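/- Fix $\tau\in\mathbb C$ with $\operatorname{Im}\tau>0$ and $\hbar\in\mathbb C^\times$ such that $\hbar\mathbb Z\cap(\mathbb Z+\mathbb Z\tau)=\{0\}$. Put $\theta(z)=-\sum_{j\in\mathbb Z}\exp\big(i\pi(j+\tfrac12)^2\tau+2i\pi(j+\tfrac12)(z+\tfrac12)\big)$, and let $\mathbb M$ be the field of meromorphic functions $g(x)$ of $x\in\mathbb C$. Let $V=\mathbb M v_+\oplus\mathbb M v_-$ and let $R(z;x)$ have the matrix $$\begin{pmatrix}1&0&0&0\\0&\frac{\theta(z)\theta(x+\hbar)\theta(x-\hbar)}{\theta(z+\hbar)\theta(x)^2}&\frac{\theta(z+x)\theta(\hbar)}{\theta(z+\hbar)\theta(x)}&0\\0&-\frac{\theta(z-x)\theta(\hbar)}{\theta(z+\hbar)\theta(x)}&\frac{\theta(z)}{\theta(z+\hbar)}&0\\0&0&0&1\end{pmatrix}$$ in the basis $v_+\otimes v_+,\,v_+\otimes v_-,\,v_-\otimes v_+,\,v_-\otimes v_-$; let $R^{ij}_{mn}(z;x)$ be the coefficient of $v_m\otimes v_n$ in $R(z;x)(v_i\otimes v_j)$.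 A representation of the elliptic quantum group $\mathcal E_{\tau,\hbar}(\mathfrak{gl}_2)$ is a $\mathbb C$-graded $\mathbb M$-vector space $X=\bigoplus_\alpha X[\alpha]$ with $\mathbb C$-linear operators $L_{ij}(z)$, $i,j\in\{\pm\}$ (signs are read as $\pm1$), whose coefficients in an $\mathbb M$-basis are meromorphic in $(z,x)$, such that $L_{ij}(z)X[\alpha]\subseteq X[\alpha+j-i]$, $L_{ij}(z)g(x)v=g(x+j\hbar)L_{ij}(z)v$, and for all $i,j,m,n$ $$\sum_{p,q}R^{pq}_{mn}(z-w;x+\hbar h)L_{pi}(z;x)L_{qj}(w;x+i\hbar)=\sum_{p,q}L_{nq}(w;x)L_{mp}(z;x+q\hbar)R^{ij}_{pq}(z-w;x),$$ where $h$ is multiplication by the weight and $L_{ij}(z;x)$ is the $\mathbb M$-linear operator with the same matrix as $L_{ij}(z)$ in a weight basis. Morphisms are the grading-preserving $\mathbb M$-linear maps that commute with all $L_{ij}(z)$. The tensor product $X\,\widetilde\otimes\,Y$ is spanned by symbols $v\,\widetilde\otimes\,w$, with $g(x)v\,\widetilde\otimes\,w=v\,\widetilde\otimes\,g(x+\beta\hbar)w$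 for $w\in Y[\beta]$ and $g(x)(v\,\widetilde\otimes\,w)=v\,\widetilde\otimes\,g(x)w$; weights add and $L_{ij}(z)=\sum_k L_{ik}(z)\,\widetilde\otimes\,L_{kj}(z)$. A representation $X$ is in the category $\mathcal O$ if its weight spaces are finite-dimensional over $\mathbb M$; its weights lie in a finite union of sets $\alpha-2\mathbb Z_{\ge0}$; $L_{--}(z)$ is invertible on each weight space for generic $z$; and, with $K_-(z)=L_{--}(z)$ and $K_+(z)=L_{++}(z)-L_{+-}(z)L_{--}(z)^{-1}L_{-+}(z)$, each weight space has a finite filtration stable under $K_\pm(z)$ whose successive quotients are isomorphic to $\mathbb M$ with $K_\pm(z)g(x)=g(x\pm\hbar)a^\pm(z)$ for non-zero meromorphic functions $a^\pm(z)$. The completed Grothendieck group $K_0(\mathcal O)$ consists of the formal sums $\sum_S n_S[S]$ over the isomorphism classes of simple objects $S$ of $\mathcal O$, with $n_S\in\mathbb Z$ and $\bigoplus_S S^{\oplus|n_S|}\in\mathcal O$. For $X\in\mathcal O$, $[X]=\sum_S m_{S,X}[S]$, where $m_{S,X}$ is the multiplicity of $S$ in $X$, that is, the largest number of subquotients isomorphic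 to $S$ in a finite chain of subrepresentations of $X$. For $\ell\in\mathbb C$ let $W^\ell=\bigoplus_{j\ge0}\mathbb M w_j$ with $w_j$ of weight $\ell-2j$ and $$L_{++}(z)w_j=\tfrac{\theta(z+(\ell-j+1)\hbar)\theta(x+(\ell-j+1)\hbar)\theta(x-j\hbar)}{\theta(x)\theta(x+(\ell-2j+1)\hbar)}w_j,\quad L_{+-}(z)w_j=\tfrac{\theta(z+x+(\ell-j)\hbar)\theta((\ell-j)\hbar)}{\theta(x+(\ell-2j-1)\hbar)}w_{j+1},$$ $$L_{-+}(z)w_j=-\tfrac{\theta(z-x+j\hbar)\theta(j\hbar)}{\theta(x)}w_{j-1}\ (j\geq 1),\quad L_{-+}(z)w_0=0,\quad L_{--}(z)w_j=\theta(z+(j+1)\hbar)w_j,$$ and let the asymptotic representation $W^{\ell,u}$ be obtained from $W^\ell$ by replacing $L_{ij}(z)$ by $L_{ij}(z+u\hbar)$. **Theorem.** For all $\ell,u\in\mathbb C$, the representation $W^{\ell,u}$ and the tensor products $W^{\ell,0}\,\widetilde\otimes\,W^{0,u}$ and $W^{\ell-u,u}\,\widetilde\otimes\,W^{u,0}$ are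 in the category $\mathcal O$; all multiplicities of simple objects of $\mathcal O$ in these two tensor products are finite, their classes lie in $K_0(\mathcal O)$, and $$[W^{\ell,0}\,\widetilde\otimes\,W^{0,u}]=[W^{\ell-u,u}\,\widetilde\otimes\,W^{u,0}]\quad\text{in }K_0(\mathcal O).$$ -/

import Mathlib

noncomputable section

namespace EllipticQG

open scoped UpperHalfPlane

universe u v

/-! ### Meromorphic functions -/

attribute [local fun_prop] analyticAt_fst analyticAt_snd

/-- The ring of entire functions on a complex vector space `E`. -/
def Entire (E : Type*) [NormedAddCommGroup E] [NormedSpace ℂ E] : Subalgebra ℂ (E → ℂ) where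
  carrier := {f | AnalyticOnNhd ℂ f Set.univ}
  mul_mem' hf hg := AnalyticOnNhd.mul hf hg
  add_mem' hf hg := AnalyticOnNhd.add hf hg
  algebraMap_mem' _ := analyticOnNhd_const

section Field

variable {E F : Type*} [NormedAddCommGroup E] [NormedSpace ℂ E]
  [NormedAddCommGroup F] [NormedSpace ℂ F]

instance : IsDomain (Entire E) :=
  have : NoZeroDivisors (Entire E) := by
    refine ⟨fun {f g} h => ?_⟩
    by_contra! hne
    obtain ⟨hf, hg⟩ := hne
    obtain ⟨x, hx⟩ : ∃ x, f.1 x ≠ 0 := by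
      by_contra! hc
      exact hf (Subtype.ext (funext hc))
    apply hg
    have hev : ∀ᶠ y in nhds x, f.1 y ≠ 0 :=
      (f.2 x (Set.mem_univ x)).continuousAt.eventually_ne hx
    have hg0 : g.1 =ᶠ[nhds x] 0 := by
      filter_upwards [hev] with y hy
      have hfg : f.1 y * g.1 y = 0 := congrFun (congrArg Subtype.val h) y
      exact (mul_eq_zero.mp hfg).resolve_left hy
    have := AnalyticOnNhd.eqOn_zero_of_preconnected_of_eventuallyEq_zero g.2
      isPreconnected_univ (Set.mem_univ x) hg0
    exact Subtype.ext (funext fun y => this (Set.mem_univ y))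
  NoZeroDivisors.to_isDomain _

/-- The field of meromorphic functions on `E`. For `E = ℂⁿ`, every meromorphic function is a
quotient of two entire functions, so that this field is the fraction field of `Entire E`. -/
abbrev Mer (E : Type*) [NormedAddCommGroup E] [NormedSpace ℂ E] : Type _ :=
  FractionRing (Entire E)

/-- Substitution `g ↦ g ∘ f` on entire functions. -/
def entirePull (f : E → F) (hf : AnalyticOnNhd ℂ f Set.univ) : Entire F →+* Entire E where
  toFun g := ⟨g.1 ∘ f, AnalyticOnNhd.comp g.2 hf (Set.mapsTo_univ _ _)⟩
  map_one' := rfl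
  map_mul' _ _ := rfl
  map_zero' := rfl
  map_add' _ _ := rfl

/-- Substitution `g ↦ g ∘ f` on meromorphic functions, for a surjective entire map `f`. -/
def merPull (f : E → F) (hf : AnalyticOnNhd ℂ f Set.univ) (hs : Function.Surjective f) :
    Mer F →+* Mer E :=
  IsFractionRing.lift (A := Entire F)
    (g := (algebraMap (Entire E) (Mer E)).comp (entirePull f hf)) <| by
      refine (IsFractionRing.injective (Entire E) (Mer E)).comp fun g₁ g₂ h => ?_
      refine Subtype.ext (funext fun y => ?_)
      obtain ⟨x, rfl⟩ := hs y
      exact congrFun (congrArg Subtype.val h) x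

end Field

/-- Meromorphic functions of `x`: the ground field. -/
abbrev M : Type := Mer ℂ

/-- Meromorphic functions of `(z, x)`. -/
abbrev M2 : Type := Mer (ℂ × ℂ)

/-- Meromorphic functions of `(z, w, x)`. -/
abbrev M3 : Type := Mer (ℂ × ℂ × ℂ)

/-- `g(x) ↦ g(x + s)`, viewed as a function of `(z, x)`. -/
def xIn (s : ℂ) : M →+* M2 :=
  merPull (fun p : ℂ × ℂ => p.2 + s) (fun _ _ => by fun_prop) fun x => ⟨(0, x - s), by simp⟩

/-- `a(x) ↦ a(z)`, viewed as a function of `(z, x)`. -/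
def zIn : M →+* M2 :=
  merPull (fun p : ℂ × ℂ => p.1) (fun _ _ => by fun_prop) fun z => ⟨(z, 0), rfl⟩

/-- `f(z; x) ↦ f(z + t; x + s)`. -/
def shift (t s : ℂ) : M2 →+* M2 :=
  merPull (fun p : ℂ × ℂ => (p.1 + t, p.2 + s)) (fun _ _ => by fun_prop)
    fun p => ⟨(p.1 - t, p.2 - s), by simp⟩

/-- `f(z; x) ↦ f(z; x + s)`, viewed as a function of `(z, w, x)`. -/
def inZ (s : ℂ) : M2 →+* M3 :=
  merPull (fun p : ℂ × ℂ × ℂ => (p.1, p.2.2 + s)) (fun _ _ => by fun_prop)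
    fun p => ⟨(p.1, 0, p.2 - s), by simp⟩

/-- `f(z; x) ↦ f(w; x + s)`, viewed as a function of `(z, w, x)`. -/
def inW (s : ℂ) : M2 →+* M3 :=
  merPull (fun p : ℂ × ℂ × ℂ => (p.2.1, p.2.2 + s)) (fun _ _ => by fun_prop)
    fun p => ⟨(0, p.1, p.2 - s), by simp⟩

/-- `f(z; x) ↦ f(z - w; x + s)`, viewed as a function of `(z, w, x)`. -/
def inZW (s : ℂ) : M2 →+* M3 :=
  merPull (fun p : ℂ × ℂ × ℂ => (p.1 - p.2.1, p.2.2 + s)) (fun _ _ => by fun_prop)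
    fun p => ⟨(p.1, 0, p.2 - s), by simp⟩

/-! ### The theta function and the R-matrix -/

/-- The Jacobi theta function
`θ(z) = - ∑_j exp(iπ (j + 1/2)² τ + 2 i π (j + 1/2) (z + 1/2))`. -/
def theta (τ : ℍ) (z : ℂ) : ℂ :=
  -∑' j : ℤ, Complex.exp (Complex.I * Real.pi * ((j : ℂ) + 1 / 2) ^ 2 * (τ : ℂ) +
    2 * Complex.I * Real.pi * ((j : ℂ) + 1 / 2) * (z + 1 / 2))

theorem theta_eq (τ : ℍ) (z : ℂ) :
    theta τ z = -(Complex.exp (Complex.I * Real.pi * (τ : ℂ) / 4 +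
      Complex.I * Real.pi * (z + 1 / 2)) * jacobiTheta₂ (z + 1 / 2 + (τ : ℂ) / 2) τ) := by
  rw [theta, jacobiTheta₂, ← tsum_mul_left]
  congr 1
  refine tsum_congr fun j => ?_
  rw [jacobiTheta₂_term, ← Complex.exp_add]
  congr 1
  ring

theorem differentiable_theta (τ : ℍ) : Differentiable ℂ (theta τ) := by
  have h : theta τ = fun z => -(Complex.exp (Complex.I * Real.pi * (τ : ℂ) / 4 +
      Complex.I * Real.pi * (z + 1 / 2)) * jacobiTheta₂ (z + 1 / 2 + (τ : ℂ) / 2) τ) :=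
    funext (theta_eq τ)
  rw [h]
  intro z
  have h1 : DifferentiableAt ℂ (fun z : ℂ => jacobiTheta₂ (z + 1 / 2 + (τ : ℂ) / 2) τ) z :=
    (differentiableAt_jacobiTheta₂_fst (z + 1 / 2 + (τ : ℂ) / 2) τ.im_pos).comp z
      (f := fun z : ℂ => z + 1 / 2 + (τ : ℂ) / 2) (by fun_prop)
  fun_prop

/-- The theta function as an element of the ring of entire functions. -/
def thetaEntire (τ : ℍ) : Entire ℂ :=
  ⟨theta τ, fun z _ => (differentiable_theta τ).analyticAt z⟩

/-- The meromorphic function `(z, x) ↦ θ(a z + b x + c)`. -/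
def th (τ : ℍ) (a b c : ℂ) : M2 :=
  algebraMap (Entire (ℂ × ℂ)) M2
    (entirePull (fun p : ℂ × ℂ => a * p.1 + b * p.2 + c) (fun _ _ => by fun_prop) (thetaEntire τ))

/-- The signs `+` (`true`) and `-` (`false`). -/
abbrev Sgn : Type := Bool

/-- The sign as the number `1` or `-1`. -/
def Sgn.val : Sgn → ℂ
  | true => 1
  | false => -1

/-- `Rcoef m n i j` is `R_{mn}^{ij}(z; x)`, the coefficient of `v_m ⊗ v_n` in
`R(z; x) (v_i ⊗ v_j)`. -/
def Rcoef (τ : ℍ) (ħ : ℂ) : Sgn → Sgn → Sgn → Sgn → M2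
  | true, true, true, true => 1
  | true, false, true, false =>
      th τ 1 0 0 * th τ 0 1 ħ * th τ 0 1 (-ħ) / (th τ 1 0 ħ * th τ 0 1 0 ^ 2)
  | true, false, false, true => th τ 1 1 0 * th τ 0 0 ħ / (th τ 1 0 ħ * th τ 0 1 0)
  | false, true, true, false => -(th τ 1 (-1) 0 * th τ 0 0 ħ / (th τ 1 0 ħ * th τ 0 1 0))
  | false, true, false, true => th τ 1 0 0 / th τ 1 0 ħ
  | false, false, false, false => 1
  | _, _, _, _ => 0

/-! ### Representations -/

/-- A `ℂ`-graded `M`-vector space `X`, given by a homogeneous basis `B` and the weights of the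
basis vectors, together with four operators `L_{ij}(z)`, given by the coordinates
`L i j b a ∈ M2` of `L_{ij}(z) b` along the basis vectors `a`. -/
structure LData where
  B : Type u
  wt : B → ℂ
  L : Sgn → Sgn → B → (B →₀ M2)

namespace LData

/-- The `M`-vector space underlying `X`. -/
abbrev V (X : LData.{u}) : Type u := X.B →₀ M

/-- `M2 ⊗_M X`: the vectors of `X` with coefficients depending meromorphically on `z`. -/
abbrev V2 (X : LData.{u}) : Type u := X.B →₀ M2

/-- The inclusion of `X` in `M2 ⊗_M X`. -/
def emb (X : LData.{u}) (v : X.V) : X.V2 := v.mapRange (xIn 0) (map_zero _)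

/-- The operator `L_{ij}(z)`, with `L_{ij}(z) (g(x) b) = g(x + j ħ) L_{ij}(z) b`. -/
def act (ħ : ℂ) (X : LData.{u}) (i j : Sgn) (v : X.V) : X.V2 :=
  v.sum fun b g => xIn (j.val * ħ) g • X.L i j b

/-- The homogeneous component of weight `α` of a vector. -/
def component (X : LData.{u}) (α : ℂ) (v : X.V) : X.V :=
  open scoped Classical in v.filter fun b => X.wt b = α

/-- The data `X` is a representation of the elliptic quantum group: `L_{ij}(z)` changes the
weight by `j - i`, and the `RLL` relations
`∑_{p,q} R_{mn}^{pq}(z-w; x+ħh) L_{pi}(z; x) L_{qj}(w; x+iħ)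
  = ∑_{p,q} L_{nq}(w; x) L_{mp}(z; x+qħ) R_{pq}^{ij}(z-w; x)` hold, where `L_{ij}(z; x)` is the
`M`-linear operator with the same matrix as `L_{ij}(z)`. -/
structure IsRep (τ : ℍ) (ħ : ℂ) (X : LData.{u}) : Prop where
  graded : ∀ (i j : Sgn) (b a : X.B), X.L i j b a ≠ 0 → X.wt a = X.wt b + (j.val - i.val)
  rll : ∀ (i j m n : Sgn) (b a : X.B),
    (∑ p : Sgn, ∑ q : Sgn, inZW (ħ * X.wt a) (Rcoef τ ħ m n p q) *
        (X.L q j b).sum fun c f => inZ 0 (X.L p i c a) * inW (i.val * ħ) f) =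
      ∑ p : Sgn, ∑ q : Sgn,
        ((X.L m p b).sum fun c f => inW 0 (X.L n q c a) * inZ (q.val * ħ) f) *
          inZW 0 (Rcoef τ ħ p q i j)

/-- The pullback of `X` by the automorphism `L_{ij}(z) ↦ L_{ij}(z + s ħ)`. -/
def spectralShift (ħ s : ℂ) (X : LData.{u}) : LData.{u} where
  B := X.B
  wt := X.wt
  L i j b := (X.L i j b).mapRange (shift (s * ħ) 0) (map_zero _)

/-- The dynamical tensor product, where `g(x) a ⊗ b = a ⊗ g(x + β ħ) b` for `b` of weight `β`
and `g(x) (a ⊗ b) = a ⊗ g(x) b`, with basis the `a ⊗ b` for `a`, `b` in the given bases, and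
with the coproduct action `L_{ij}(z) = ∑_k L_{ik}(z) ⊗ L_{kj}(z)`. -/
def tensor (ħ : ℂ) (X Y : LData.{u}) : LData.{u} where
  B := X.B × Y.B
  wt b := X.wt b.1 + Y.wt b.2
  L i j b := ∑ k : Sgn, (X.L i k b.1).sum fun a f => (Y.L k j b.2).sum fun a' g =>
    Finsupp.single (a, a') (shift 0 (ħ * Y.wt a') f * g)

/-- The direct sum of a family. -/
def directSum {ι : Type v} (X : ι → LData.{u}) : LData.{max u v} where
  B := Σ s, (X s).B
  wt b := (X b.1).wt b.2
  L i j b := ((X b.1).L i j b.2).embDomain ⟨Sigma.mk b.1, sigma_mk_injective⟩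

/-! ### Morphisms, subrepresentations -/

/-- The `M2`-linear extension of an `M`-linear map. -/
def ext {X Y : LData.{u}} (φ : X.V →ₗ[M] Y.V) : X.V2 →ₗ[M2] Y.V2 :=
  Finsupp.linearCombination M2 fun b => Y.emb (φ (Finsupp.single b 1))

/-- `X` and `Y` are isomorphic: there is an `M`-linear bijection that preserves the gradings and
commutes with the `L_{ij}(z)`. -/
def Iso (ħ : ℂ) (X Y : LData.{u}) : Prop :=
  ∃ φ : X.V ≃ₗ[M] Y.V,
    (∀ α v, φ (X.component α v) = Y.component α (φ v)) ∧
    ∀ i j v, ext φ.toLinearMap (X.act ħ i j v) = Y.act ħ i j (φ v)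

/-- A subrepresentation: a graded `M`-subspace stable under the `L_{ij}(z)`. -/
structure Subrep (ħ : ℂ) (X : LData.{u}) where
  space : Submodule M X.V
  graded : ∀ α, ∀ v ∈ space, X.component α v ∈ space
  stable : ∀ i j, ∀ v ∈ space, X.act ħ i j v ∈ Submodule.span M2 (X.emb '' space)

/-- `X` is simple: it is non-zero and has no subrepresentation other than `0` and `X`. -/
def IsSimple (ħ : ℂ) (X : LData.{u}) : Prop :=
  Nonempty X.B ∧ ∀ W : Subrep ħ X, W.space = ⊥ ∨ W.space = ⊤

/-- For subrepresentations `U ⊆ W` of `X`, the quotient `W / U` is isomorphic to `S`: there is an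
`M`-linear map `φ` such that its restriction to `W` is onto `S` with kernel `U`, preserves the
gradings and commutes with the `L_{ij}(z)`. (A linear map on `W` always extends to `X`; only its
restriction to `W` matters.) -/
def QuotientIso (ħ : ℂ) {X : LData.{u}} (U W : Subrep ħ X) (S : LData.{u}) : Prop :=
  ∃ φ : X.V →ₗ[M] S.V,
    W.space.map φ = ⊤ ∧ W.space ⊓ LinearMap.ker φ = U.space ∧
    (∀ α, ∀ v ∈ W.space, φ (X.component α v) = S.component α (φ v)) ∧
    ∀ i j, ∀ v ∈ W.space, ext φ (X.act ħ i j v) = S.act ħ i j (φ v)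

/-- The multiplicity of the simple representation `S` in `X`: the largest number of subquotients
isomorphic to `S` in a finite chain of subrepresentations of `X`. -/
def multiplicity (ħ : ℂ) (S X : LData.{u}) : ℕ∞ :=
  ⨆ (n : ℕ) (F : Fin (n + 1) → Subrep ħ X) (_ : Monotone fun k => (F k).space),
    {k : Fin n | QuotientIso ħ (F k.castSucc) (F k.succ) S}.encard

end LData

/-! ### Meromorphic eigenvalues -/

section Eigenvalues

variable {ι : Type*} [Fintype ι]

/-- The difference operator `∑_j g_j(x) v_j ↦ ∑_{i,j} A_{ij}(z; x) g_j(x + s) v_i`. -/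
def diffOp (s : ℂ) (A : Matrix ι ι M2) (v : ι → M) : ι → M2 :=
  A.mulVec fun b => xIn s (v b)

/-- `W` is stable under the difference operator. -/
def DiffStable (s : ℂ) (A : Matrix ι ι M2) (W : Submodule M (ι → M)) : Prop :=
  ∀ v ∈ W, diffOp s A v ∈ Submodule.span M2 ((fun v b => xIn 0 (v b)) '' (W : Set (ι → M)))

/-- The `M2`-linear extension of an `M`-linear form. -/
def formExt (φ : (ι → M) →ₗ[M] M) (w : ι → M2) : M2 :=
  open scoped Classical in ∑ b, w b * xIn 0 (φ (Pi.single b 1))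

/-- The vector space `⊕_{b ∈ ι} M b` with the difference operators `K_±(z)` of matrices `Kp`, `Km`
and shifts `±ħ` has a finite filtration by stable subspaces whose successive quotients are
isomorphic to one-dimensional objects `M[a⁺(z), a⁻(z)]`, where `K_±(z)` acts on `M` as
`g(x) ↦ g(x ± ħ) a^±(z)`, with non-zero meromorphic functions `a^±(z)`. -/
def HasMeromorphicEigenvalues (ħ : ℂ) (Kp Km : Matrix ι ι M2) : Prop :=
  ∃ (n : ℕ) (F : Fin (n + 1) → Submodule M (ι → M)),
    Monotone F ∧ F 0 = ⊥ ∧ F (Fin.last n) = ⊤ ∧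
    (∀ k, DiffStable ħ Kp (F k) ∧ DiffStable (-ħ) Km (F k)) ∧
    ∀ k : Fin n, ∃ (ap am : M) (φ : (ι → M) →ₗ[M] M), ap ≠ 0 ∧ am ≠ 0 ∧
      (F k.succ).map φ = ⊤ ∧ F k.succ ⊓ LinearMap.ker φ = F k.castSucc ∧
      ∀ v ∈ F k.succ, formExt φ (diffOp ħ Kp v) = xIn ħ (φ v) * zIn ap ∧
        formExt φ (diffOp (-ħ) Km v) = xIn (-ħ) (φ v) * zIn am

end Eigenvalues

/-! ### The category O -/

namespace LData

/-- The basis of the weight space of weight `α`. -/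
abbrev Fiber (X : LData.{u}) (α : ℂ) : Type u := {b : X.B // X.wt b = α}

/-- The matrix of `L_{ij}(z)` from weight `α` to weight `β`. -/
def block (X : LData.{u}) (i j : Sgn) (α β : ℂ) : Matrix (X.Fiber β) (X.Fiber α) M2 :=
  Matrix.of fun a b => X.L i j b a

/-- The matrix of `K_-(z) = L_{--}(z)` on the weight space of weight `α`. -/
def Kminus (X : LData.{u}) (α : ℂ) : Matrix (X.Fiber α) (X.Fiber α) M2 :=
  X.block false false α α

/-- The matrix of `K_+(z) = L_{++}(z) - L_{+-}(z) L_{--}(z)⁻¹ L_{-+}(z)` on the weight space of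
weight `α`; the shifts of `x` by `L_{+-}(z)` and by `L_{--}(z)⁻¹` cancel. -/
def Kplus (X : LData.{u}) [∀ α, Fintype (X.Fiber α)] (α : ℂ) :
    Matrix (X.Fiber α) (X.Fiber α) M2 :=
  open scoped Classical in
  X.block true true α α -
    X.block true false (α + 2) α * (X.Kminus (α + 2))⁻¹ * X.block false true α (α + 2)

/-- `X` is a representation in the category `O`: the weight spaces are finite-dimensional, the
weights lie in a finite union of sets `α - 2 ℕ`, the operator `L_{--}(z)` is invertible for generic
`z`, and `K_±(z)` have meromorphic eigenvalues on all weight spaces. -/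
def InO (τ : ℍ) (ħ : ℂ) (X : LData.{u}) : Prop :=
  X.IsRep τ ħ ∧
  ∃ _ : ∀ α, Fintype (X.Fiber α),
    (∃ A : Finset ℂ, ∀ b, ∃ α ∈ A, ∃ n : ℕ, X.wt b = α - 2 * n) ∧
    (∀ α, open scoped Classical in (X.Kminus α).det ≠ 0) ∧
    ∀ α, HasMeromorphicEigenvalues ħ (X.Kplus α) (X.Kminus α)

end LData

/-! ### The completed Grothendieck group -/

/-- The simple objects of the category `O`. -/
abbrev SimpleObj (τ : ℍ) (ħ : ℂ) : Type 1 :=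
  {S : LData.{0} // S.InO τ ħ ∧ S.IsSimple ħ}

/-- The isomorphism classes of simple objects of the category `O`. -/
def SimpleClass (τ : ℍ) (ħ : ℂ) : Type 1 :=
  Quot fun S T : SimpleObj τ ħ => LData.Iso ħ S.1 T.1

/-- A fixed representative of an isomorphism class of simple objects. -/
def SimpleClass.rep {τ : ℍ} {ħ : ℂ} (c : SimpleClass τ ħ) : LData.{0} := (Quot.out c).1

/-- The completed Grothendieck group `K₀(O)`: the formal sums `∑_S n_S [S]` over the isomorphism
classes of simple objects, with `n_S ∈ ℤ`, such that `⊕_S S^{⊕ |n_S|}` is in the category `O`. -/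
def K0 (τ : ℍ) (ħ : ℂ) : Set (SimpleClass τ ħ → ℤ) :=
  {n | (LData.directSum fun s : Σ c : SimpleClass τ ħ, Fin (n c).natAbs => s.1.rep).InO τ ħ}

/-- `[X] = ∑_S m_{S,X} [S]`, where `m_{S,X}` is the multiplicity of `S` in `X`. -/
def classOf (τ : ℍ) (ħ : ℂ) (X : LData.{0}) : SimpleClass τ ħ → ℤ :=
  fun c => ((LData.multiplicity ħ c.rep X).toNat : ℤ)

/-! ### Asymptotic representations -/

/-- The representation `W^ℓ` with basis `w_j`, `j ∈ ℕ`, of weights `ℓ - 2 j`. -/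
def asymptotic (τ : ℍ) (ħ ℓ : ℂ) : LData.{0} where
  B := ℕ
  wt j := ℓ - 2 * j
  L
    | true, true, j => Finsupp.single j
        (th τ 1 0 ((ℓ - j + 1) * ħ) * th τ 0 1 ((ℓ - j + 1) * ħ) * th τ 0 1 (-(j * ħ)) /
          (th τ 0 1 0 * th τ 0 1 ((ℓ - 2 * j + 1) * ħ)))
    | true, false, j => Finsupp.single (j + 1)
        (th τ 1 1 ((ℓ - j) * ħ) * th τ 0 0 ((ℓ - j) * ħ) / th τ 0 1 ((ℓ - 2 * j - 1) * ħ))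
    | false, true, 0 => 0
    | false, true, j + 1 => Finsupp.single j
        (-(th τ 1 (-1) ((j + 1) * ħ) * th τ 0 0 ((j + 1) * ħ) / th τ 0 1 0))
    | false, false, j => Finsupp.single j (th τ 1 0 ((j + 1) * ħ))

/-- The asymptotic representation `W^{ℓ,s}` with spin parameter `ℓ` and spectral parameter `s`. -/
def asymptoticRep (τ : ℍ) (ħ ℓ s : ℂ) : LData.{0} := (asymptotic τ ħ ℓ).spectralShift ħ s

end EllipticQG

end

/-! Describe W^{ℓ,s} by the two numbers a = ℓ + s and b = s. The first tensor product X then has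
parameters (a₁, b₁; a₂, b₂) = (ℓ, 0; s, s) and the second one, Y, has (ℓ, s; s, 0): they differ only
by the exchange of b₁ and b₂. The equality of classes comes from morphisms φ : X → Y and χ : Y → X
with ker φ = im χ and ker χ = im φ. Given these, [X] = [ker φ] + [im φ] = [im χ] + [ker χ] = [Y],
whatever the simple constituents are; on chains of subrepresentations this is `HasChain.of_hom`.

To find φ and χ, the basis of a tensor product is rescaled (`gaugeRep`) until the action is nearly
symmetric in b₁ and b₂. The ansatz `homMap` sends the basis vector (j, k) to a combination of the
vectors (j + i, m) with i + m = k. Its coefficients do not depend on j: each is a complex constant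
c(i, m) divided by an explicit product of theta functions of x. Commutation with the L_{ij}(z)
becomes a set of conditions on c(i + 1, m), c(i, m) and c(i, m + 1) (`Intertwining`). The theta
identities behind this reduction hold because products θ(z + a)θ(z + b) with a + b fixed are
controlled by two values of z (`ThetaMap.four_term`), a form of the three-term addition formula.
Where no denominator vanishes, the conditions are a recursion solved by theta analogues of binomial
coefficients. Where one does vanish, degenerate solutions take over; one of them needs that
translation by a zero of θ multiplies θ by an exponential (`theta_eq_zero`).

Both operators are triangular in k with diagonal entries c(0, k), and they are chosen so that for
every k exactly one of the two diagonal entries vanishes (`exists_intertwining`). Their composites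
are therefore strictly triangular morphisms. Such morphisms are zero, because a vector killed by
L_{-+}(z) is determined by its coefficients at j = 0 (`eq_zero_of_isHomOn`). Zero composites
together with complementary diagonals give exactness (`Triangular.ker_eq_range`).

Membership in the category O rests on the quantum determinant: K_+(z) K_-(z - ħ) is a scalar
depending on z only, so K_+ is triangular in any basis in which K_- is (`LData.inO_of_hasDet`).
Membership of the classes in K₀(O) and finiteness of multiplicities follow from a count of
dimensions weight by weight (`LData.sum_card_fiber_le`). The hypothesis on ħ enters through θ(nħ) ≠
0 for integers n ≠ 0 and through the uniqueness of an integer n with θ(ħ(s - n)) = 0. -/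

noncomputable section

namespace EllipticQG

open scoped UpperHalfPlane

/-! ### Instances, for faster elaboration -/

section

variable (E : Type*) [NormedAddCommGroup E] [NormedSpace ℂ E] (ι : Type*)

instance : CommRing (Entire E) := inferInstance
instance : Semiring (Entire E) := inferInstance
instance : AddCommMonoid (Entire E) := inferInstance
instance : AddZeroClass (Entire E) := inferInstance
instance : SMulZeroClass (Entire E) (Entire E) := inferInstance
instance : DistribMulAction (Entire E) (Entire E) := inferInstance
instance : Module (Entire E) (Entire E) := inferInstance
instance : Field (Mer E) := inferInstance
instance : CommRing (Mer E) := inferInstance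
instance : CommSemiring (Mer E) := inferInstance
instance : Semiring (Mer E) := inferInstance
instance : AddCommGroup (Mer E) := inferInstance
instance : AddGroup (Mer E) := inferInstance
instance : AddCommMonoid (Mer E) := inferInstance
instance : AddMonoid (Mer E) := inferInstance
instance : AddZeroClass (Mer E) := inferInstance
instance : SMulZeroClass (Mer E) (Mer E) := inferInstance
instance : DistribMulAction (Mer E) (Mer E) := inferInstance
instance : MulAction (Mer E) (Mer E) := inferInstance
instance : Module (Mer E) (Mer E) := inferInstance
instance : AddCommGroup (ι →₀ Mer E) := inferInstance
instance : AddGroup (ι →₀ Mer E) := inferInstance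
instance : AddCommMonoid (ι →₀ Mer E) := inferInstance
instance : AddMonoid (ι →₀ Mer E) := inferInstance
instance : AddZeroClass (ι →₀ Mer E) := inferInstance
instance : Add (ι →₀ Mer E) := inferInstance
instance : Module (Mer E) (ι →₀ Mer E) := inferInstance
instance : DistribMulAction (Mer E) (ι →₀ Mer E) := inferInstance
instance : MulAction (Mer E) (ι →₀ Mer E) := inferInstance
instance : SMulZeroClass (Mer E) (ι →₀ Mer E) := inferInstance
instance : SMul (Mer E) (ι →₀ Mer E) := inferInstance

end

/-! ### The theta function: addition formula and zeros -/

section Theta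

variable (τ : ℍ)

/-- The summands of the series `theta`. -/
def thetaTerm (j : ℤ) (z : ℂ) : ℂ :=
  Complex.exp (Complex.I * Real.pi * ((j : ℂ) + 1 / 2) ^ 2 * (τ : ℂ) +
    2 * Complex.I * Real.pi * ((j : ℂ) + 1 / 2) * (z + 1 / 2))

/-- The exponentials whose sums over even and odd `s` express products of theta functions. -/
def pairTerm (s : ℤ) (z : ℂ) : ℂ :=
  Complex.exp (Complex.I * Real.pi * (s : ℂ) ^ 2 * (τ : ℂ) / 2 +
    2 * Complex.I * Real.pi * (s : ℂ) * z)

/-- These are theta functions in 2z with modular parameter 2τ. All products θ(x + y)θ(x - y) are 2 ×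
2 minors of the vectors (`evenTheta`, `oddTheta`) at x and y (`theta_mul`), which reduces the
addition formula to algebra. -/
def evenTheta (z : ℂ) : ℂ := ∑' n : ℤ, pairTerm τ (2 * n) z

def oddTheta (z : ℂ) : ℂ := ∑' n : ℤ, pairTerm τ (2 * n + 1) z

theorem summable_thetaTerm (z : ℂ) : Summable fun j => thetaTerm τ j z := by
  have h := ((summable_jacobiTheta₂_term_iff (z + 1 / 2 + (τ : ℂ) / 2) τ).2 τ.im_pos).mul_left
    (Complex.exp (Complex.I * Real.pi * (τ : ℂ) / 4 + Complex.I * Real.pi * (z + 1 / 2)))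
  refine h.congr fun j => ?_
  rw [jacobiTheta₂_term, thetaTerm, ← Complex.exp_add]
  congr 1
  ring

theorem im_two_mul_pos : 0 < (2 * (τ : ℂ)).im := by
  simpa using τ.im_pos

theorem summable_pairTerm_even (z : ℂ) : Summable fun n : ℤ => pairTerm τ (2 * n) z := by
  refine ((summable_jacobiTheta₂_term_iff (2 * z) (2 * τ)).2 (im_two_mul_pos τ)).congr
    fun j => ?_
  rw [jacobiTheta₂_term, pairTerm]
  congr 1
  push_cast
  ring

theorem summable_pairTerm_odd (z : ℂ) : Summable fun n : ℤ => pairTerm τ (2 * n + 1) z := by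
  have h := ((summable_jacobiTheta₂_term_iff (2 * z + τ) (2 * τ)).2 (im_two_mul_pos τ)).mul_left
    (Complex.exp (Complex.I * Real.pi * (τ : ℂ) / 2 + 2 * Complex.I * Real.pi * z))
  refine h.congr fun j => ?_
  rw [jacobiTheta₂_term, pairTerm, ← Complex.exp_add]
  congr 1
  push_cast
  ring

/-- Pairs of integers, according to the parity of their difference. -/
def parityEquiv : (ℤ × ℤ) ⊕ (ℤ × ℤ) ≃ ℤ × ℤ where
  toFun := Sum.elim (fun p => (p.1 + p.2, p.1 - p.2 - 1)) (fun p => (p.1 + p.2, p.1 - p.2))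
  invFun q := if (q.1 - q.2) % 2 = 0 then Sum.inr ((q.1 + q.2) / 2, (q.1 - q.2) / 2)
    else Sum.inl ((q.1 + q.2 + 1) / 2, (q.1 - q.2 - 1) / 2)
  left_inv := by
    rintro (⟨n, m⟩ | ⟨n, m⟩)
    · have : ¬ (n + m - (n - m - 1)) % 2 = 0 := by omega
      dsimp only [Sum.elim_inl]
      rw [if_neg this, Sum.inl.injEq, Prod.mk.injEq]
      omega
    · have : (n + m - (n - m)) % 2 = 0 := by omega
      dsimp only [Sum.elim_inr]
      rw [if_pos this, Sum.inr.injEq, Prod.mk.injEq]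
      omega
  right_inv := by
    rintro ⟨a, b⟩
    dsimp only
    split_ifs with h
    · simp only [Sum.elim_inr, Prod.mk.injEq]
      omega
    · simp only [Sum.elim_inl, Prod.mk.injEq]
      omega

/-- The half-integers attached to the two indices have sum 2n and difference 2m + 1, and passing to
sum and difference separates x from y in the exponent. The summand 1/2 in z + 1/2 contributes
exp(2πi n) = 1 here and exp(πi(2n + 1)) = -1 in the other parity class, which is the sign in
`thetaTerm_mul_inr`. -/
theorem thetaTerm_mul_inl (n m : ℤ) (x y : ℂ) :
    thetaTerm τ (n + m) (x + y) * thetaTerm τ (n - m - 1) (x - y) =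
      pairTerm τ (2 * n) x * pairTerm τ (2 * m + 1) y := by
  rw [thetaTerm, thetaTerm, pairTerm, pairTerm, ← Complex.exp_add, ← Complex.exp_add,
    Complex.exp_eq_exp_iff_exists_int]
  refine ⟨n, ?_⟩
  push_cast
  ring

theorem thetaTerm_mul_inr (n m : ℤ) (x y : ℂ) :
    thetaTerm τ (n + m) (x + y) * thetaTerm τ (n - m) (x - y) =
      -(pairTerm τ (2 * n + 1) x * pairTerm τ (2 * m) y) := by
  rw [thetaTerm, thetaTerm, pairTerm, pairTerm, ← Complex.exp_add, ← Complex.exp_add,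
    ← neg_one_mul, ← Complex.exp_pi_mul_I, ← Complex.exp_add, Complex.exp_eq_exp_iff_exists_int]
  refine ⟨n, ?_⟩
  push_cast
  ring

theorem tsum_parity (F G : ℤ → ℂ) (hF : Summable F) (hG : Summable G) :
    (∑' j, F j) * ∑' j, G j = (∑' p : ℤ × ℤ, F (p.1 + p.2) * G (p.1 - p.2 - 1)) +
      ∑' p : ℤ × ℤ, F (p.1 + p.2) * G (p.1 - p.2) := by
  have hs : Summable fun q : ℤ × ℤ => F q.1 * G q.2 :=
    summable_mul_of_summable_norm hF.norm hG.norm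
  have hs' : Summable fun q => F (parityEquiv q).1 * G (parityEquiv q).2 :=
    parityEquiv.summable_iff.2 hs
  rw [tsum_mul_tsum_of_summable_norm hF.norm hG.norm, ← parityEquiv.tsum_eq]
  exact Summable.tsum_sum (hs'.comp_injective Sum.inl_injective)
    (hs'.comp_injective Sum.inr_injective)

theorem theta_mul (x y : ℂ) : theta τ (x + y) * theta τ (x - y) =
    evenTheta τ x * oddTheta τ y - oddTheta τ x * evenTheta τ y := by
  have h1 : ∀ z, theta τ z = -∑' j, thetaTerm τ j z := fun z => rfl
  rw [h1, h1, neg_mul_neg, tsum_parity _ _ (summable_thetaTerm τ _) (summable_thetaTerm τ _),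
    evenTheta, evenTheta, oddTheta, oddTheta,
    tsum_mul_tsum_of_summable_norm (summable_pairTerm_even τ x).norm
      (summable_pairTerm_odd τ y).norm,
    tsum_mul_tsum_of_summable_norm (summable_pairTerm_odd τ x).norm
      (summable_pairTerm_even τ y).norm, sub_eq_add_neg (∑' _, _), ← tsum_neg]
  congr 1
  · exact tsum_congr fun p => thetaTerm_mul_inl τ p.1 p.2 x y
  · exact tsum_congr fun p => thetaTerm_mul_inr τ p.1 p.2 x y

/-- The three-term addition formula. -/
theorem theta_three_term (x y u v : ℂ) :
    theta τ (x + u) * theta τ (x - u) * (theta τ (y + v) * theta τ (y - v)) -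
      theta τ (x + v) * theta τ (x - v) * (theta τ (y + u) * theta τ (y - u)) =
    theta τ (x + y) * theta τ (x - y) * (theta τ (u + v) * theta τ (u - v)) := by
  -- Every pair of factors is now a 2 × 2 minor, and the identity is the Plücker relation for four
  -- vectors in a plane.
  simp only [theta_mul]
  ring

theorem theta_neg (z : ℂ) : theta τ (-z) = -theta τ z := by
  rw [theta, theta, neg_neg, ← (Equiv.subLeft (-1 : ℤ)).tsum_eq, ← tsum_neg]
  refine tsum_congr fun j => ?_
  rw [Equiv.subLeft_apply, ← neg_one_mul, ← Complex.exp_pi_mul_I, ← Complex.exp_add,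
    Complex.exp_eq_exp_iff_exists_int]
  refine ⟨-j, ?_⟩
  push_cast
  ring

theorem theta_add_one (z : ℂ) : theta τ (z + 1) = -theta τ z := by
  rw [theta_eq, theta_eq, show z + 1 + 1 / 2 + (τ : ℂ) / 2 = z + 1 / 2 + (τ : ℂ) / 2 + 1 by ring,
    jacobiTheta₂_add_left, show Complex.I * Real.pi * (τ : ℂ) / 4 +
      Complex.I * Real.pi * (z + 1 + 1 / 2) = Complex.I * Real.pi * (τ : ℂ) / 4 +
      Complex.I * Real.pi * (z + 1 / 2) + Real.pi * Complex.I by ring, Complex.exp_add _ (_ * _),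
      Complex.exp_pi_mul_I]
  ring

theorem theta_add_tau (z : ℂ) : theta τ (z + τ) =
    -Complex.exp (-(Real.pi * Complex.I * (τ + 2 * z))) * theta τ z := by
  rw [theta_eq, theta_eq, show z + τ + 1 / 2 + (τ : ℂ) / 2 = z + 1 / 2 + (τ : ℂ) / 2 + τ by ring,
    jacobiTheta₂_add_left', ← neg_one_mul (Complex.exp (-_)), ← Complex.exp_pi_mul_I]
  have : Complex.exp (Complex.I * Real.pi * (τ : ℂ) / 4 +
      Complex.I * Real.pi * (z + τ + 1 / 2)) * Complex.exp (-Real.pi * Complex.I *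
        (τ + 2 * (z + 1 / 2 + (τ : ℂ) / 2))) = Complex.exp (Real.pi * Complex.I) *
     Complex.exp (-(Real.pi * Complex.I * (τ + 2 * z))) *
      Complex.exp (Complex.I * Real.pi * (τ : ℂ) / 4 +
      Complex.I * Real.pi * (z + 1 / 2)) := by
    rw [← Complex.exp_add, ← Complex.exp_add, ← Complex.exp_add]
    rw [Complex.exp_eq_exp_iff_exists_int]
    exact ⟨-1, by push_cast; ring⟩
  linear_combination (-jacobiTheta₂ (z + 1 / 2 + (τ : ℂ) / 2) τ) * this

theorem integral_jacobiTheta₂_term (n : ℤ) :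
    ∫ t in (0 : ℝ)..1, jacobiTheta₂_term n t τ = if n = 0 then 1 else 0 := by
  split_ifs with h
  · simp [h, jacobiTheta₂_term]
  · have hn : (2 * Real.pi * Complex.I * n : ℂ) ≠ 0 := by
      simp [h, Real.pi_ne_zero]
    simp_rw [jacobiTheta₂_term, Complex.exp_add]
    rw [intervalIntegral.integral_mul_const, integral_exp_mul_complex hn]
    simp [mul_comm _ (n : ℂ), Complex.exp_int_mul_two_pi_mul_I]

theorem integral_jacobiTheta₂ : ∫ t in (0 : ℝ)..1, jacobiTheta₂ t τ = 1 := by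
  have hc : ∀ n : ℤ, Continuous fun t : ℝ => jacobiTheta₂_term n t τ := fun n => by
    unfold jacobiTheta₂_term
    fun_prop
  have h := intervalIntegral.tsum_intervalIntegral_eq_of_summable_norm (a := 0) (b := 1)
    (f := fun n : ℤ => ⟨fun t : ℝ => jacobiTheta₂_term n t τ, hc n⟩) ?_
  · simp only [ContinuousMap.coe_mk, integral_jacobiTheta₂_term, tsum_ite_eq] at h
    exact h.symm
  · refine ((summable_jacobiTheta₂_term_iff 0 τ).2 τ.im_pos).norm.of_nonneg_of_le
      (fun _ => norm_nonneg _) fun n => ?_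
    rw [ContinuousMap.norm_le _ (norm_nonneg _)]
    rintro ⟨t, ht⟩
    simp [norm_jacobiTheta₂_term]

/-- The constant Fourier coefficient of `jacobiTheta₂` over a real period is 1, so the series cannot
vanish identically. -/
theorem exists_theta_ne_zero : ∃ z, theta τ z ≠ 0 := by
  by_contra! h
  have h0 : ∀ t : ℂ, jacobiTheta₂ t τ = 0 := by
    intro t
    have := h (t - 1 / 2 - (τ : ℂ) / 2)
    rw [theta_eq, neg_eq_zero, mul_eq_zero, or_iff_right (Complex.exp_ne_zero _)] at this
    convert this using 2
    ring
  have := integral_jacobiTheta₂ τ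
  simp [h0] at this

end Theta

end EllipticQG

end

/-! ### Zeros and quasi-periods of the theta function. -/

noncomputable section

namespace EllipticQG

open scoped UpperHalfPlane Topology

section ThetaZeros

variable (τ : ℍ)

theorem theta_analyticAt (z : ℂ) : AnalyticAt ℂ (theta τ) z :=
  (differentiable_theta τ).analyticAt z

theorem analyticOrderAt_theta_ne_top (z : ℂ) : analyticOrderAt (theta τ) z ≠ ⊤ := by
  rw [Ne, AnalyticOnNhd.analyticOrderAt_eq_top_iff_eq_zero z (theta_analyticAt τ)]
  intro h
  obtain ⟨w, hw⟩ := exists_theta_ne_zero τ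
  exact hw (congrFun h w)

/-- Entire functions form a domain, so θ can be cancelled without regard to its zeros. -/
theorem eq_of_mul_theta_eq {f g : ℂ → ℂ} (hf : Differentiable ℂ f) (hg : Differentiable ℂ g)
    (h : ∀ z, f z * theta τ z = g z * theta τ z) : f = g := by
  let f' : Entire ℂ := ⟨f, fun z _ => hf.analyticAt z⟩
  let g' : Entire ℂ := ⟨g, fun z _ => hg.analyticAt z⟩
  have h0 : thetaEntire τ ≠ 0 := fun h0 => by
    obtain ⟨w, hw⟩ := exists_theta_ne_zero τ
    exact hw (congrFun (congrArg Subtype.val h0) w)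
  have : f' * thetaEntire τ = g' * thetaEntire τ := Subtype.ext (funext h)
  exact congrArg Subtype.val (mul_right_cancel₀ h0 this)

/-- A nonnegative integer sequence with vanishing second differences is constant. -/
theorem eq_of_second_difference (u : ℤ → ℕ) (h : ∀ n, u (n + 1) + u (n - 1) = 2 * u n) :
    u 1 = u 0 := by
  have hn : ∀ n : ℕ, (u n : ℤ) = u 0 + n * (u 1 - u 0) ∧
      (u (n + 1) : ℤ) = u 0 + (n + 1) * (u 1 - u 0) := by
    intro n
    induction n with
    | zero => simp
    | succ k ih =>
      refine ⟨by push_cast; exact ih.2, ?_⟩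
      have := h (k + 1)
      rw [add_sub_cancel_right] at this
      push_cast
      have h2 : (u (k + 1 + 1) : ℤ) + u k = 2 * u (k + 1) := by exact_mod_cast this
      rw [ih.1, ih.2] at h2
      linarith
  have hm : ∀ n : ℕ, (u (-n) : ℤ) = u 0 - n * (u 1 - u 0) ∧
      (u (-n - 1) : ℤ) = u 0 - (n + 1) * (u 1 - u 0) := by
    intro n
    induction n with
    | zero =>
      have := h 0
      simp only [zero_add, zero_sub] at this
      have h2 : (u 1 : ℤ) + u (-1) = 2 * u 0 := by exact_mod_cast this
      refine ⟨by simp, ?_⟩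
      simp only [CharP.cast_eq_zero, neg_zero, zero_sub]
      linarith
    | succ k ih =>
      have e : (-((k + 1 : ℕ) : ℤ)) = -k - 1 := by push_cast; ring
      rw [e]
      refine ⟨by rw [ih.2]; push_cast; ring, ?_⟩
      have := h (-k - 1)
      rw [sub_add_cancel] at this
      have h2 : (u (-k) : ℤ) + u (-k - 1 - 1) = 2 * u (-k - 1) := by exact_mod_cast this
      rw [ih.1, ih.2] at h2
      push_cast
      linarith
  -- The sequence is affine with slope u 1 - u 0. A non-zero integral slope would make one of the
  -- values at ±(u 0 + 1) negative.
  have h1 := (hn (u 0 + 1)).1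
  have h2 := (hm (u 0 + 1)).1
  have p1 : (0 : ℤ) ≤ u ((u 0 + 1 : ℕ) : ℤ) := by positivity
  have p2 : (0 : ℤ) ≤ u (-((u 0 + 1 : ℕ) : ℤ)) := by positivity
  rw [h1] at p1
  rw [h2] at p2
  push_cast at p1 p2
  by_contra hne
  rcases lt_or_gt_of_ne hne with hlt | hlt
  · have : (u 1 : ℤ) - u 0 ≤ -1 := by omega
    nlinarith [Int.natCast_nonneg (u 0)]
  · have : (1 : ℤ) ≤ (u 1 : ℤ) - u 0 := by omega
    nlinarith [Int.natCast_nonneg (u 0)]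

/-- At a zero c the vector (`evenTheta`, `oddTheta`) is proportional to its value at 0, since θ(c)²
is the minor of the two. The minors of x with c and of x with 0 are then proportional as well. If κ
were 0, then θ(x + 2c)θ(x) would vanish identically. -/
theorem theta_translate_mul {c : ℂ} (hc : theta τ c = 0) :
    ∃ κ : ℂ, κ ≠ 0 ∧ ∀ x, theta τ (x + c) * theta τ (x - c) = κ * theta τ x ^ 2 := by
  have h0 : ∀ x, theta τ x ^ 2 = evenTheta τ x * oddTheta τ 0 - oddTheta τ x * evenTheta τ 0 :=
    fun x => by rw [← theta_mul, add_zero, sub_zero, sq]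
  obtain ⟨w, hw⟩ := exists_theta_ne_zero τ
  have hc0 := h0 c
  rw [hc] at hc0
  have key : ∀ x, theta τ (x + c) * theta τ (x - c) * theta τ w ^ 2 =
      theta τ (w + c) * theta τ (w - c) * theta τ x ^ 2 := fun x => by
    rw [theta_mul, theta_mul, h0, h0]
    linear_combination (oddTheta τ x * evenTheta τ w - evenTheta τ x * oddTheta τ w) * hc0
  refine ⟨theta τ (w + c) * theta τ (w - c) / theta τ w ^ 2, ?_, fun x => ?_⟩
  · intro hk
    rw [div_eq_zero_iff, or_iff_left (pow_ne_zero 2 hw)] at hk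
    have hz : ∀ x, theta τ (x + c) * theta τ (x - c) = 0 := fun x => by
      have := key x
      rw [hk, zero_mul, mul_eq_zero, or_iff_left (pow_ne_zero 2 hw)] at this
      exact this
    have h1 := eq_of_mul_theta_eq τ (f := fun x => theta τ (x + 2 * c)) (g := fun _ => 0)
      ((differentiable_theta τ).comp (by fun_prop)) (by fun_prop) fun x => by
        rw [zero_mul, ← hz (x + c)]
        congr 2 <;> ring
    have := congrFun h1 (w - 2 * c)
    exact hw (by simpa using this)
  · have hw2 := pow_ne_zero 2 hw
    field_simp
    exact key x

theorem analyticOrderAt_comp_add (f : ℂ → ℂ) (c z : ℂ) :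
    analyticOrderAt (fun x => f (x + c)) z = analyticOrderAt f (z + c) := by
  have h := analyticOrderAt_comp_of_deriv_ne_zero (f := f) (g := fun x : ℂ => x + c) (z₀ := z)
    (by fun_prop) (by simp)
  exact h

/-- Taking orders of vanishing in `theta_translate_mul` shows that the orders along x + ℤc have
vanishing second differences. As they are natural numbers, they are constant. -/
theorem analyticOrderAt_theta_translate {c : ℂ} (hc : theta τ c = 0) (x : ℂ) :
    analyticOrderAt (theta τ) (x + c) = analyticOrderAt (theta τ) x := by
  obtain ⟨κ, hκ, h⟩ := theta_translate_mul τ hc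
  have hd := differentiable_theta τ
  have key : ∀ y, analyticOrderAt (theta τ) (y + c) + analyticOrderAt (theta τ) (y - c) =
      2 * analyticOrderAt (theta τ) y := fun y => by
    have e : (fun x => theta τ (x + c)) * (fun x => theta τ (x - c)) =
        (fun _ => κ) * (theta τ) ^ 2 := funext h
    have := congrArg (fun f => analyticOrderAt f y) e
    rw [analyticOrderAt_mul, analyticOrderAt_mul, analyticOrderAt_pow,
      analyticOrderAt_comp_add] at this
    simp only [sub_eq_add_neg] at this ⊢
    rw [analyticOrderAt_comp_add, (analyticAt_const.analyticOrderAt_eq_zero).2 hκ] at this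
    · simpa using this
    all_goals first | exact theta_analyticAt τ y | exact analyticAt_const | skip
    · exact (theta_analyticAt τ y).pow 2
    · exact (hd.comp (by fun_prop : Differentiable ℂ (· + c))).analyticAt y
    · exact (hd.comp (by fun_prop : Differentiable ℂ (· - c))).analyticAt y
  have hN : ∀ y, ((analyticOrderAt (theta τ) y).toNat : ℕ∞) = analyticOrderAt (theta τ) y :=
    fun y => ENat.natCast_toNat (analyticOrderAt_theta_ne_top τ y)
  have := eq_of_second_difference (fun n => (analyticOrderAt (theta τ) (x + n * c)).toNat)
    fun n => by
      have := key (x + n * c)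
      rw [← hN, ← hN (_ - _), ← hN (x + n * c)] at this
      have h3 := (by exact_mod_cast this : (analyticOrderAt (theta τ) (x + n * c + c)).toNat +
        (analyticOrderAt (theta τ) (x + n * c - c)).toNat =
        2 * (analyticOrderAt (theta τ) (x + n * c)).toNat)
      rw [← h3]
      congr 3 <;> push_cast <;> ring
  rw [← hN, ← hN x]
  simpa using this

/-- If `c` is a zero of the theta function, then `θ(x + c) / θ(x)` is entire without zeros. -/
theorem exists_theta_quotient {c : ℂ} (hc : theta τ c = 0) :
    ∃ G : ℂ → ℂ, Differentiable ℂ G ∧ (∀ x, G x ≠ 0) ∧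
      ∀ x, theta τ (x + c) = G x * theta τ x := by
  have hd := differentiable_theta τ
  have hd' : Differentiable ℂ fun x => theta τ (x + c) := hd.comp (by fun_prop)
  set g : ℂ → ℂ := (fun x => theta τ (x + c)) / theta τ with hg
  have hm : MeromorphicOn g Set.univ := fun x _ =>
    (hd'.analyticAt x).meromorphicAt.div (hd.analyticAt x).meromorphicAt
  have ho : ∀ x, meromorphicOrderAt g x = 0 := fun x => by
    rw [hg, meromorphicOrderAt_div (hd'.analyticAt x).meromorphicAt
      (hd.analyticAt x).meromorphicAt, (hd'.analyticAt x).meromorphicOrderAt_eq,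
      (hd.analyticAt x).meromorphicOrderAt_eq, analyticOrderAt_comp_add,
      analyticOrderAt_theta_translate τ hc]
    have := analyticOrderAt_theta_ne_top τ x
    generalize analyticOrderAt (theta τ) x = n at this
    lift n to ℕ using this
    simp
  -- The quotient has order 0 at every point, so its normal form, which fills in the removable
  -- singularities, is entire and without zeros.
  have hnf := meromorphicNFOn_toMeromorphicNFOn g Set.univ
  set G := toMeromorphicNFOn g Set.univ
  have hoG : ∀ x, meromorphicOrderAt G x = 0 := fun x => by
    rw [meromorphicOrderAt_toMeromorphicNFOn hm (Set.mem_univ x), ho]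
  have hGd : Differentiable ℂ G := fun x =>
    ((hnf (Set.mem_univ x)).meromorphicOrderAt_nonneg_iff_analyticAt.1
      (hoG x).ge).differentiableAt
  refine ⟨G, hGd, fun x => (hnf (Set.mem_univ x)).meromorphicOrderAt_eq_zero_iff.1 (hoG x),
    fun x => ?_⟩
  have h1 : (fun x => theta τ (x + c)) =ᶠ[𝓝[≠] x] fun x => G x * theta τ x := by
    have hnz : ∀ᶠ y in 𝓝[≠] x, theta τ y ≠ 0 := by
      rcases (hd.analyticAt x).eventually_eq_zero_or_eventually_ne_zero with h | h
      · exact absurd (analyticOrderAt_eq_top.2 h) (analyticOrderAt_theta_ne_top τ x)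
      · exact h
    filter_upwards [hm.toMeromorphicNFOn_eq_self_on_nhdsNE (Set.mem_univ x), hnz] with y hy hy'
    change _ = toMeromorphicNFOn g Set.univ y * _
    rw [hy, hg]
    simp [hy']
  exact ((hd'.continuous.continuousAt).eventuallyEq_nhds_iff_eventuallyEq_nhdsNE
    ((hGd.mul hd).continuous.continuousAt)).1 h1 |>.eq_of_nhds

theorem exists_lattice_reduction (x : ℂ) : ∃ (a b : ℤ) (u v : ℝ), u ∈ Set.Icc (0 : ℝ) 1 ∧
    v ∈ Set.Icc (0 : ℝ) 1 ∧ x = (u + v * τ) + a + b * τ := by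
  set v := x.im / (τ : ℂ).im
  set u := x.re - v * (τ : ℂ).re
  refine ⟨⌊u⌋, ⌊v⌋, Int.fract u, Int.fract v, ⟨Int.fract_nonneg _, (Int.fract_lt_one _).le⟩,
    ⟨Int.fract_nonneg _, (Int.fract_lt_one _).le⟩, ?_⟩
  have hx : x = u + v * τ := by
    have h0 : (τ : ℂ).im ≠ 0 := τ.im_pos.ne'
    apply Complex.ext
    · simp [u]
    · simp only [Complex.add_im, Complex.ofReal_im, Complex.mul_im, Complex.ofReal_re, v]
      field_simp
      ring
  have h1 : (u : ℂ) = Int.fract u + ⌊u⌋ := by exact_mod_cast (Int.fract_add_floor u).symm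
  have h2 : (v : ℂ) = Int.fract v + ⌊v⌋ := by exact_mod_cast (Int.fract_add_floor v).symm
  rw [hx]
  linear_combination h1 + (τ : ℂ) * h2

/-- A doubly periodic entire function is constant. -/
theorem eq_const_of_doubly_periodic {f : ℂ → ℂ} (hf : Differentiable ℂ f)
    (h1 : ∀ x, f (x + 1) = f x) (h2 : ∀ x, f (x + τ) = f x) (x y : ℂ) : f x = f y := by
  have p1 : Function.Periodic f 1 := h1
  have p2 : Function.Periodic f τ := h2
  refine hf.apply_eq_apply_of_bounded ?_ x y
  have hcomp : IsCompact ((fun p : ℝ × ℝ => f (p.1 + p.2 * τ)) ''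
      (Set.Icc (0 : ℝ) 1 ×ˢ Set.Icc (0 : ℝ) 1)) := by
    refine (isCompact_Icc.prod isCompact_Icc).image ?_
    have := hf.continuous
    fun_prop
  refine hcomp.isBounded.subset ?_
  rintro _ ⟨z, rfl⟩
  obtain ⟨a, b, u, v, hu, hv, rfl⟩ := exists_lattice_reduction τ z
  refine ⟨(u, v), ⟨hu, hv⟩, ?_⟩
  dsimp only
  have e1 := (p1.int_mul a) (u + v * τ)
  have e2 := (p2.int_mul b) (u + v * τ + a)
  rw [mul_one] at e1
  rw [e2, e1]

/-- Translation by a zero of the theta function multiplies it by an exponential function, and the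
zeros are the points of the lattice `ℤ + ℤ τ`. -/
theorem theta_eq_zero {c : ℂ} (hc : theta τ c = 0) :
    (∃ K ν : ℂ, K ≠ 0 ∧ ∀ x, theta τ (x + c) = K * Complex.exp (ν * x) * theta τ x) ∧
      ∃ a b : ℤ, c = a + b * τ := by
  obtain ⟨G, hG, hG0, h⟩ := exists_theta_quotient τ hc
  have g1 : ∀ x, G (x + 1) = G x := by
    refine congrFun (eq_of_mul_theta_eq τ (hG.comp (by fun_prop)) hG fun x => ?_)
    have := h (x + 1)
    rw [theta_add_one, add_right_comm, theta_add_one, h x] at this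
    linear_combination this
  have g2 : ∀ x, G (x + τ) = Complex.exp (-(2 * Real.pi * Complex.I * c)) * G x := by
    refine congrFun (eq_of_mul_theta_eq τ (hG.comp (by fun_prop))
      (hG.const_mul _) fun x => ?_)
    have := h (x + τ)
    rw [theta_add_tau, add_right_comm, theta_add_tau, h x] at this
    have e : Complex.exp (-(Real.pi * Complex.I * (τ + 2 * (x + c)))) =
        Complex.exp (-(2 * Real.pi * Complex.I * c)) *
          Complex.exp (-(Real.pi * Complex.I * (τ + 2 * x))) := by
      rw [← Complex.exp_add]
      congr 1
      ring
    rw [e] at this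
    refine mul_left_cancel₀ (Complex.exp_ne_zero (-(Real.pi * Complex.I * (τ + 2 * x)))) ?_
    linear_combination this
  -- G has constant multipliers under translation by 1 and by τ, so G'/G is entire and doubly
  -- periodic. Hence it is constant and G is an exponential.
  have hdG : Differentiable ℂ (deriv G) := fun x => ((hG.analyticAt x).deriv).differentiableAt
  have d1 : ∀ x, deriv G (x + 1) = deriv G x := fun x => by
    rw [← deriv_comp_add_const, funext g1]
  have d2 : ∀ x, deriv G (x + τ) = Complex.exp (-(2 * Real.pi * Complex.I * c)) * deriv G x :=
    fun x => by
      rw [← deriv_comp_add_const, funext g2, deriv_const_mul _ (hG x)]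
  set ν := deriv G 0 / G 0 with hν
  have hconst : ∀ x, deriv G x = ν * G x := fun x => by
    have := eq_const_of_doubly_periodic τ (f := fun x => deriv G x / G x)
      (hdG.div hG hG0) (fun x => by rw [d1, g1])
      (fun x => by rw [d2, g2, mul_div_mul_left _ _ (Complex.exp_ne_zero _)]) x 0
    rw [← hν, div_eq_iff (hG0 x)] at this
    exact this
  have hexp : ∀ x, G x = G 0 * Complex.exp (ν * x) := fun x => by
    have hd : Differentiable ℂ fun x => G x * Complex.exp (-(ν * x)) := by fun_prop
    have := is_const_of_deriv_eq_zero hd (fun x => by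
      have h1 : HasDerivAt (fun x => Complex.exp (-(ν * x)))
          (Complex.exp (-(ν * x)) * -(ν * 1)) x := (((hasDerivAt_id x).const_mul ν).neg).cexp
      rw [((hG x).hasDerivAt.fun_mul h1).deriv, hconst]
      ring) x 0
    simp only [mul_zero, neg_zero, Complex.exp_zero, mul_one] at this
    rw [← this, mul_assoc, ← Complex.exp_add, neg_add_cancel, Complex.exp_zero, mul_one]
  refine ⟨⟨G 0, ν, hG0 0, fun x => by rw [h, hexp]⟩, ?_⟩
  -- The multipliers of K exp(νx) at 1 and τ must be 1 and exp(-2πi c). This gives ν = 2πi k and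
  -- then c = m - kτ.
  have q1 := g1 0
  have q2 := g2 0
  rw [hexp (0 + 1), zero_add, mul_one] at q1
  rw [hexp (0 + τ), zero_add, mul_comm _ (G 0)] at q2
  have q1' : Complex.exp ν = 1 := mul_left_cancel₀ (hG0 0) (by rw [q1, mul_one])
  have q2' := mul_left_cancel₀ (hG0 0) q2
  obtain ⟨k, hk⟩ := Complex.exp_eq_one_iff.1 q1'
  obtain ⟨m, hm⟩ := Complex.exp_eq_exp_iff_exists_int.1 q2'
  refine ⟨m, -k, ?_⟩
  have hpi : (2 * Real.pi * Complex.I : ℂ) ≠ 0 := by simp [Real.pi_ne_zero]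
  refine mul_left_cancel₀ hpi ?_
  rw [hk] at hm
  push_cast
  linear_combination hm

end ThetaZeros

end EllipticQG

end

noncomputable section

namespace EllipticQG

open scoped UpperHalfPlane

/-! ### Abstract theta identities -/

/-- An odd map from a commutative ring to a field that satisfies the three-term identity. -/
structure ThetaMap {G F : Type*} [CommRing G] [Field F] (T : G → F) : Prop where
  odd : ∀ x, T (-x) = -T x
  fay : ∀ p q j y, T p * T j * T (y - q) * T (y + p + q - j) -
    T (p + q) * T y * T (j - q) * T (y + p - j) +
    T q * T (y + p) * T (y - j) * T (j - p - q) = 0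

namespace ThetaMap

variable {G F : Type*} [CommRing G] [Field F] {T : G → F} (hT : ThetaMap T)
include hT

theorem neg_of {a b : G} (h : a = -b) : T a = -T b := by
  rw [h, hT.odd]

theorem sub_comm (a b : G) : T (a - b) = -T (b - a) := hT.neg_of (by ring)

/-- With a + b fixed, the functions T(z + a) T(z + b) of z behave like a two-dimensional space. The
coefficients in the linear relation among three of them are the values at z = -a0 and z = -a1. -/
theorem interpolation (z a0 b0 a1 b1 a2 b2 : G) (h1 : a1 + b1 = a0 + b0)
    (h2 : a2 + b2 = a0 + b0) :
    T (a1 - a0) * T (b1 - a0) * (T (z + a2) * T (z + b2)) =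
      T (a2 - a0) * T (b2 - a0) * (T (z + a1) * T (z + b1)) -
      T (a2 - a1) * T (b2 - a1) * (T (z + a0) * T (z + b0)) := by
  have h := hT.fay (a1 - a0) (a2 - a1) (z + a2) (z + (a0 + b0 - a1))
  obtain rfl : b1 = a0 + b0 - a1 := by rw [← h1]; ring
  obtain rfl : b2 = a0 + b0 - a2 := by rw [← h2]; ring
  ring_nf at h ⊢
  linear_combination h

/-- Hypotheses `e0` and `e1` say that the combination vanishes at z = -a0 and z = -a1. By
`interpolation` this suffices, provided that the first two products are independent, which is the
content of `n1` and `n2`. -/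
theorem four_term {z a0 b0 a1 b1 a2 b2 a3 b3 : G} (h1 : a1 + b1 = a0 + b0)
    (h2 : a2 + b2 = a0 + b0) (h3 : a3 + b3 = a0 + b0) (n1 : T (a1 - a0) ≠ 0)
    (n2 : T (b1 - a0) ≠ 0) {c0 c1 c2 c3 : F}
    (e0 : c1 * T (a1 - a0) * T (b1 - a0) + c2 * T (a2 - a0) * T (b2 - a0) +
      c3 * T (a3 - a0) * T (b3 - a0) = 0)
    (e1 : c0 * T (a0 - a1) * T (b0 - a1) + c2 * T (a2 - a1) * T (b2 - a1) +
      c3 * T (a3 - a1) * T (b3 - a1) = 0) :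
    c0 * (T (z + a0) * T (z + b0)) + c1 * (T (z + a1) * T (z + b1)) +
      c2 * (T (z + a2) * T (z + b2)) + c3 * (T (z + a3) * T (z + b3)) = 0 := by
  have i2 := hT.interpolation z a0 b0 a1 b1 a2 b2 h1 h2
  have i3 := hT.interpolation z a0 b0 a1 b1 a3 b3 h1 h3
  rw [show b0 - a1 = b1 - a0 by linear_combination -h1, hT.sub_comm a0 a1] at e1
  refine mul_left_cancel₀ (mul_ne_zero n1 n2) ?_
  linear_combination c2 * i2 + c3 * i3 + T (z + a1) * T (z + b1) * e0 -
    T (z + a0) * T (z + b0) * e1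

/-! #### Identities for the intertwining operators -/

/-- The linear relation on the triples `(v1, v2, v3)` of coefficients of intertwining operators. -/
def Admissible (T : G → F) (i p q : G) (v1 v2 v3 : F) : Prop :=
  ∀ y j, v1 * T i * T j * T (y - q) * T (y + p + q - j) - v2 * T y * T (j - q) * T (y + p - j) +
    v3 * T (y + p) * T (y - j) * T (j - p - q) = 0

/-- All four products in z have the same sum q + j - y - p of shifts. At the two test points z = i -
q and z = -q the claim becomes the relation `hv` at (y, j + i) and at (y - i, j). This is where the
form of `Admissible` comes from. -/
theorem admissible_raising {i p q : G} {v1 v2 v3 : F} (hv : Admissible T i p q v1 v2 v3)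
    (z y j : G) (ni : T i ≠ 0) (n : T (y + p + q - i - j) ≠ 0) :
    v1 * (T (z - y - p + i + j) * T (z + q - i) * T j * T (y - q - i) * T (y + p) * T y) +
      v2 * (T (z + j) * T (z - y - p + q) * T (y + p - i - j) * T (y - i) * T y) =
    v1 * (T (z - y - p + j) * T (z + q) * T (j + i) * T (y - q) * T (y - i) * T (y + p - i)) +
      v3 * (T (z - p + j) * T (z - y + q) * T (y - j - i) * T (y + p - i) * T (y + p)) := by
  have := hT.four_term (z := z) (a0 := q - i) (b0 := j + i - y - p) (a1 := q) (b1 := j - y - p)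
    (a2 := j) (b2 := q - y - p) (a3 := j - p) (b3 := q - y)
    (c0 := v1 * T j * T (y - q - i) * T (y + p) * T y)
    (c1 := -(v1 * T (j + i) * T (y - q) * T (y - i) * T (y + p - i)))
    (c2 := v2 * T (y + p - i - j) * T (y - i) * T y)
    (c3 := -(v3 * T (y - j - i) * T (y + p - i) * T (y + p)))
    (by ring) (by ring) (by ring) (by ring_nf; exact ni) ?_ ?_ ?_
  · ring_nf at this ⊢
    linear_combination this
  · rw [hT.neg_of (show j - y - p - (q - i) = -(y + p + q - i - j) by ring)]
    exact neg_ne_zero.2 n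
  · have h := congrArg (fun t => T (y - i) * T (y + p - i) * t) (hv y (j + i))
    rw [hT.neg_of (show j - y - p - (q - i) = -(y + p + q - j - i) by ring),
      hT.neg_of (show q - y - p - (q - i) = -(y + p - i) by ring),
      hT.neg_of (show q - y - (q - i) = -(y - i) by ring)]
    ring_nf at h ⊢
    linear_combination h
  · have h := congrArg (fun t => T y * T (y + p) * t) (hv (y - i) j)
    rw [hT.neg_of (show q - i - q = -i by ring),
      hT.neg_of (show j + i - y - p - q = -(y + p + q - i - j) by ring),
      hT.neg_of (show q - y - p - q = -(y + p) by ring),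
      hT.neg_of (show q - y - q = -y by ring)]
    ring_nf at h ⊢
    linear_combination h

theorem fay_symm (A B s m : G) : T (B + m - s) * T (A - s) * T (A + m) * T B -
    T (A + m - s) * T (B - s) * T (B + m) * T A - T (A + B + m - s) * T s * T m * T (A - B) = 0 := by
  have h := hT.fay A m (B + m) (B + m - s)
  rw [hT.neg_of (show B + m - s - (B + m) = -s by ring),
    hT.neg_of (show B + m - A - m = -(A - B) by ring)] at h
  ring_nf at h ⊢
  linear_combination -h

/-- The same two-point test applies. Here both values vanish by `fay_symm` alone, so that no
condition on coefficients of an operator is involved. -/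
theorem lowering (z y j i m β : G) (ni : T (i + 1) ≠ 0)
    (n : T (2 * y + 2 * i - β + m - j - 1) ≠ 0) :
    T (z + β + j) * T (z + i + m) * T (y - j - 1) * T (y + i + m) * T (y + 2 * i - β) *
        T (y + i - β - 1) * T (i + 1) -
      T (z - y + β + j + 1) * T (z + y + i + m - 1) * T j * T (y + i) * T (y + 2 * i - β) *
        T (i + m + 1) * T (β - i) =
    T (z + j + i) * T (z + β + m) * T (y + i - β - j - 1) * T (y + 2 * i - β + m) * T (y + i) *
        T (y - 1) * T (i + 1) -
      T (z - y - i + β + j) * T (z + y + 2 * i + m) * T (j + i + 1) * T (y - 1) *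
        T (y + i - β - 1) * T m * T (β - i) := by
  have := hT.four_term (z := z) (a0 := β + j + 1 - y) (b0 := y + i + m - 1)
    (a1 := j - i + β - y) (b1 := y + 2 * i + m) (a2 := β + j) (b2 := i + m)
    (a3 := j + i) (b3 := β + m)
    (c0 := -(T j * T (y + i) * T (y + 2 * i - β) * T (i + m + 1) * T (β - i)))
    (c1 := T (j + i + 1) * T (y - 1) * T (y + i - β - 1) * T m * T (β - i))
    (c2 := T (y - j - 1) * T (y + i + m) * T (y + 2 * i - β) * T (y + i - β - 1) * T (i + 1))
    (c3 := -(T (y + i - β - j - 1) * T (y + 2 * i - β + m) * T (y + i) * T (y - 1) * T (i + 1)))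
    (by ring) (by ring) (by ring) ?_ ?_ ?_ ?_
  · ring_nf at this ⊢
    linear_combination this
  · rw [hT.neg_of (show j - i + β - y - (β + j + 1 - y) = -(i + 1) by ring)]
    exact neg_ne_zero.2 ni
  · convert n using 2; ring
  · have h := congrArg (fun t => T (y - 1) * T (y + i - β - 1) * T (i + 1) * t)
      (hT.fay_symm (y + i) (y + 2 * i - β) (j + i + 1) m)
    rw [hT.neg_of (show j - i + β - y - (β + j + 1 - y) = -(i + 1) by ring)]
    ring_nf at h ⊢
    linear_combination h
  · have h := congrArg (fun t => T (y + i) * T (y + 2 * i - β) * T (i + 1) * t)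
      (hT.fay_symm (y - 1) (y + i - β - 1) j (i + m + 1))
    ring_nf at h ⊢
    linear_combination h

theorem admissible_generic (i p q : G) : Admissible T i p q (T p) (T i * T (p + q)) (T i * T q) :=
  fun y j => by linear_combination T i * hT.fay p q j y

omit hT in
theorem Admissible.mul {i p q : G} {v1 v2 v3 : F} (h : Admissible T i p q v1 v2 v3) (t : F) :
    Admissible T i p q (t * v1) (t * v2) (t * v3) :=
  fun y j => by linear_combination t * h y j

-- For q = 0 and for p + q = 0 the triple of `admissible_generic` has the common factor T p, which
-- may vanish. This triple and the next one are what remains when the factor is removed.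
omit hT in
theorem admissible_of_q_eq_zero (i p : G) : Admissible T i p 0 1 (T i) 0 :=
  fun y j => by simp only [sub_zero, add_zero]; ring

omit hT in
theorem admissible_of_add_eq_zero (i p q : G) (h : p + q = 0) :
    Admissible T i p q 1 0 (-T i) := fun y j => by
  obtain rfl : p = -q := by linear_combination h
  ring_nf

/-- When q = 0 and p is a quasi-period, the generic triple is zero. A non-zero one exists because
translation by p turns the theta factors of the first term into those of the third, up to a
constant: the character e contributes the same e(y) e(-j) to both. -/
theorem admissible_of_quasiperiod (i p : G) {K : F} {e : G → F}
    (he : ∀ a b, e (a + b) = e a * e b) (hK : ∀ w, T (w + p) = K * e w * T w) :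
    Admissible T i p 0 K 0 (-T i) := fun y j => by
  have h1 : T (j - p) = K * e (-j) * T j := by
    rw [hT.neg_of (show j - p = -(-j + p) by ring), hK, hT.odd]; ring
  have h2 : T (y + p + 0 - j) = K * (e y * e (-j)) * T (y - j) := by
    rw [show y + p + 0 - j = y - j + p by ring, hK, sub_eq_add_neg y j, he]
  rw [sub_zero (j - p), h1, h2, hK y, sub_zero]
  ring

end ThetaMap

end EllipticQG
end

noncomputable section

namespace EllipticQG

/-! ### Theta identities for the asymptotic representations -/

namespace ThetaMap

variable {G F : Type*} [CommRing G] [Field F] {T : G → F} (hT : ThetaMap T)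
include hT

/-- In the names `rll_mn_ij`, the two pairs of letters are the signs (m, n) and (i, j) of the RLL
relation in question. Each identity becomes a combination of instances of `fay` after denominators
are cleared; most need only one. -/
theorem rll_pp_pm (z w x a b n : G) (h1 : T x ≠ 0) (h2 : T (x + a - b - 2 * n - 1) ≠ 0) (h3 : T (x
  + a - b - 2 * n) ≠ 0) (h4 : T (x - 1) ≠ 0) (h5 : T (z - w + 1) ≠ 0) :
    T (z + a - n) * T (x + a - b - n) * T (x - n - 1) * T (w + x + a - n + 1) * T (a - b - n) / (T
      x * T (x + a - b - 2 * n - 1) * T (x + a - b - 2 * n)) =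
      T (w + x + a - n) * T (a - b - n) * T (z + a - n + 1) * T (x + a - b - n) * T (x - n - 1) * T
        (z - w) * T (x + 1) * T (x - 1) / (T (x + a - b - 2 * n - 1) * T (x - 1) * T (x + a - b - 2
        * n) * T (z - w + 1) * T x * T x) - T (w + a - n) * T (x + a - b - n) * T (x - n - 1) * T
        (z + x + a - n + 1) * T (a - b - n) * T (z - w - x) * T 1 / (T x * T (x + a - b - 2 * n -
        1) * T (x + a - b - 2 * n) * T (z - w + 1) * T x) := by
  have hf : T x * T (w + x + a - n + 1) * T (z - w + 1) * T (z + a - n) - T (x + 1) * T (w + x + a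
    - n) * T (z - w) * T (z + a - n + 1) + T 1 * T (w + a - n) * T (z - w - x) * T (z + x + a - n +
    1) = 0 := by
    have h := hT.fay x 1 (w + x + a - n + 1) (-z + w)
    rw [hT.neg_of (show (-z + w) - 1 = -(z - w + 1) by ring), hT.neg_of (show (-z + w) + x + 1 - (w
      + x + a - n + 1) = -(z + a - n) by ring), hT.neg_of (show -z + w = -(z - w) by ring),
      hT.neg_of (show (-z + w) + x - (w + x + a - n + 1) = -(z + a - n + 1) by ring), hT.neg_of
      (show (-z + w) + x = -(z - w - x) by ring), hT.neg_of (show (-z + w) - (w + x + a - n + 1) =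
      -(z + x + a - n + 1) by ring)] at h
    ring_nf at h ⊢
    linear_combination h
  linear_combination (norm := (field_simp; ring)) T (a - b - n) * T (x - n - 1) * T (x + a - b - n)
    / (T x * T x * T (x + a - b - 2 * n - 1) * T (x + a - b - 2 * n) * T (z - w + 1)) * hf

theorem rll_pp_mp (z w x a b n : G) (h1 : T (x + a - b - 2 * n - 1) ≠ 0) (h2 : T (x - 1) ≠ 0) (h3 :
  T (x + a - b - 2 * n) ≠ 0) (h4 : T (z - w + 1) ≠ 0) (h5 : T x ≠ 0) :
    T (z + x + a - n) * T (a - b - n) * T (w + a - n + 1) * T (x + a - b - n) * T (x - n - 1) / (T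
      (x + a - b - 2 * n - 1) * T (x - 1) * T (x + a - b - 2 * n)) =
      T (w + x + a - n) * T (a - b - n) * T (z + a - n + 1) * T (x + a - b - n) * T (x - n - 1) * T
        (z - w + x) * T 1 / (T (x + a - b - 2 * n - 1) * T (x - 1) * T (x + a - b - 2 * n) * T (z -
        w + 1) * T x) + T (w + a - n) * T (x + a - b - n) * T (x - n - 1) * T (z + x + a - n + 1) *
        T (a - b - n) * T (z - w) / (T x * T (x + a - b - 2 * n - 1) * T (x + a - b - 2 * n) * T (z
        - w + 1)) := by
  have hf : T x * T (w + a - n + 1) * T (z - w + 1) * T (z + x + a - n) - T 1 * T (w + x + a - n) *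
    T (z - w + x) * T (z + a - n + 1) - T (x - 1) * T (w + a - n) * T (z - w) * T (z + x + a - n +
    1) = 0 := by
    have h := hT.fay x (-x + 1) (w + a - n + 1) (-z + w - x)
    rw [hT.neg_of (show (-z + w - x) - (-x + 1) = -(z - w + 1) by ring), hT.neg_of (show (-z + w -
      x) + x + (-x + 1) - (w + a - n + 1) = -(z + x + a - n) by ring), hT.neg_of (show -z + w - x =
      -(z - w + x) by ring), hT.neg_of (show (-z + w - x) + x - (w + a - n + 1) = -(z + a - n + 1)
      by ring), hT.neg_of (show -x + 1 = -(x - 1) by ring), hT.neg_of (show (-z + w - x) + x = -(z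
      - w) by ring), hT.neg_of (show (-z + w - x) - (w + a - n + 1) = -(z + x + a - n + 1) by
      ring)] at h
    ring_nf at h ⊢
    linear_combination h
  linear_combination (norm := (field_simp; ring)) T (a - b - n) * T (x - n - 1) * T (x + a - b - n)
    / (T (x - 1) * T x * T (x + a - b - 2 * n - 1) * T (x + a - b - 2 * n) * T (z - w + 1)) * hf

theorem rll_pm_pp (z w x a b n : G) (h1 : T (z - w + 1) ≠ 0) (h2 : T (x + a - b - 2 * n + 2) ≠ 0)
  (h3 : T x ≠ 0) (h4 : T (x + a - b - 2 * n + 3) ≠ 0) (h5 : T (x + 1) ≠ 0) :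
    -(T (z - w) * T (x + a - b - 2 * n + 3) * T (x + a - b - 2 * n + 1) * T (z + a - n + 2) * T (x
      + a - b - n + 2) * T (x - n + 1) * T (w - x + b + n - 1) * T n / (T (z - w + 1) * T (x + a -
      b - 2 * n + 2) * T (x + a - b - 2 * n + 2) * T x * T (x + a - b - 2 * n + 3) * T (x + 1))) -
      T (z - w + x + a - b - 2 * n + 2) * T 1 * T (z - x + b + n) * T n * T (w + a - n + 1) * T (x
      + a - b - n + 2) * T (x - n + 1) / (T (z - w + 1) * T (x + a - b - 2 * n + 2) * T x * T (x +
      1) * T (x + a - b - 2 * n + 2)) =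
      -(T (w - x + b + n) * T n * T (z + a - n + 1) * T (x + a - b - n + 2) * T (x - n + 1) / (T x
        * T (x + 1) * T (x + a - b - 2 * n + 2))) := by
  have hf : -(T (x + a - b - 2 * n + 1) * T (w - x + b + n - 1) * T (z - w) * T (z + a - n + 2)) -
    T 1 * T (w + a - n + 1) * T (z - w + x + a - b - 2 * n + 2) * T (z - x + b + n) + T (x + a - b
    - 2 * n + 2) * T (w - x + b + n) * T (z - w + 1) * T (z + a - n + 1) = 0 := by
    have h := hT.fay (x + a - b - 2 * n + 1) (-x - a + b + 2 * n - 2) (w - x + b + n - 1) (-z + w -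
      x - a + b + 2 * n - 2)
    rw [hT.neg_of (show (-z + w - x - a + b + 2 * n - 2) - (-x - a + b + 2 * n - 2) = -(z - w) by
      ring), hT.neg_of (show (-z + w - x - a + b + 2 * n - 2) + (x + a - b - 2 * n + 1) + (-x - a +
      b + 2 * n - 2) - (w - x + b + n - 1) = -(z + a - n + 2) by ring), hT.neg_of (show (x + a - b
      - 2 * n + 1) + (-x - a + b + 2 * n - 2) = -(1) by ring), hT.neg_of (show -z + w - x - a + b +
      2 * n - 2 = -(z - w + x + a - b - 2 * n + 2) by ring), hT.neg_of (show (-z + w - x - a + b +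
      2 * n - 2) + (x + a - b - 2 * n + 1) - (w - x + b + n - 1) = -(z - x + b + n) by ring),
      hT.neg_of (show -x - a + b + 2 * n - 2 = -(x + a - b - 2 * n + 2) by ring), hT.neg_of (show
      (-z + w - x - a + b + 2 * n - 2) + (x + a - b - 2 * n + 1) = -(z - w + 1) by ring), hT.neg_of
      (show (-z + w - x - a + b + 2 * n - 2) - (w - x + b + n - 1) = -(z + a - n + 1) by ring)]
      at h
    ring_nf at h ⊢
    linear_combination -h
  linear_combination (norm := (field_simp; ring)) T n * T (x - n + 1) * T (x + a - b - n + 2) / (T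
    x * T (x + 1) * T (x + a - b - 2 * n + 2) * T (x + a - b - 2 * n + 2) * T (z - w + 1)) * hf

theorem rll_pm_pm (z w x a b n : G) (h1 : T (z - w + 1) ≠ 0) (h2 : T (x + a - b - 2 * n) ≠ 0) (h3 :
  T x ≠ 0) (h4 : T (x + a - b - 2 * n + 1) ≠ 0) (h5 : T (x - 1) ≠ 0)
    (hn1 : T (2 * x + a - b - 2 * n) ≠ 0) (hn2 : T (w + b + n + 1) ≠ 0) :
    T (z - w) * T (x + a - b - 2 * n + 1) * T (x + a - b - 2 * n - 1) * T (z + a - n + 1) * T (x +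
      a - b - n + 1) * T (x - n) * T (w + b + n + 1) / (T (z - w + 1) * T (x + a - b - 2 * n) * T
      (x + a - b - 2 * n) * T x * T (x + a - b - 2 * n + 1)) - T (z - w + x + a - b - 2 * n) * T 1
      * T (z - x + b + n + 1) * T (n + 1) * T (w + x + a - n + 1) * T (a - b - n) / (T (z - w + 1)
      * T (x + a - b - 2 * n) * T x * T (x + a - b - 2 * n)) =
      T (w + b + n + 1) * T (z + a - n + 1) * T (x + a - b - n) * T (x - n - 1) * T (z - w) * T (x
        + 1) * T (x - 1) / (T (x - 1) * T (x + a - b - 2 * n) * T (z - w + 1) * T x * T x) + T (w -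
        x + b + n + 1) * T (n + 1) * T (z + x + a - n + 1) * T (a - b - n) * T (z - w - x) * T 1 /
        (T x * T (x + a - b - 2 * n) * T (z - w + 1) * T x) := by
  have i0 : -(T (2 * x + a - b - 2 * n) * T (w + b + n + 1) * T (z - w) * T (z + a - n + 1)) + T (x
    + a - b - 2 * n) * T (w - x + b + n + 1) * T (z - w - x) * T (z + x + a - n + 1) + T x * T (w +
    x + a - n + 1) * T (z - w + x + a - b - 2 * n) * T (z - x + b + n + 1) = 0 := by
    have h := hT.fay (2 * x + a - b - 2 * n) (-x) (-w - b - n - 1) (z - w - x)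
    rw [hT.neg_of (show -w - b - n - 1 = -(w + b + n + 1) by ring), hT.neg_of (show (-w - b - n -
      1) - (-x) = -(w - x + b + n + 1) by ring), hT.neg_of (show -x = -(x) by ring), hT.neg_of
      (show (-w - b - n - 1) - (2 * x + a - b - 2 * n) - (-x) = -(w + x + a - n + 1) by ring)] at h
    ring_nf at h ⊢
    linear_combination h
  have i1 : -(T (2 * x + a - b - 2 * n) * T (w + b + n + 1) * T (z - w) * T (z + a - n + 1)) + T (x
    + a - b - 2 * n) * T (w - x + b + n + 1) * T (z - w - x) * T (z + x + a - n + 1) + T x * T (w +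
    x + a - n + 1) * T (z - w + x + a - b - 2 * n) * T (z - x + b + n + 1) = 0 := by
    have h := hT.fay (2 * x + a - b - 2 * n) (-x) (-w - b - n - 1) (z - w - x)
    rw [hT.neg_of (show -w - b - n - 1 = -(w + b + n + 1) by ring), hT.neg_of (show (-w - b - n -
      1) - (-x) = -(w - x + b + n + 1) by ring), hT.neg_of (show -x = -(x) by ring), hT.neg_of
      (show (-w - b - n - 1) - (2 * x + a - b - 2 * n) - (-x) = -(w + x + a - n + 1) by ring)] at h
    ring_nf at h ⊢
    linear_combination h
  have e0 : -(T (x - n) * T x * T (x + a - b - 2 * n - 1) * T (x + a - b - n + 1)) + T (x - n - 1)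
    * T (x + 1) * T (x + a - b - 2 * n) * T (x + a - b - n) + T 1 * T (n + 1) * T (a - b - n) * T
    (2 * x + a - b - 2 * n) = 0 := by
    have h := hT.fay (x - n) (-1) x (-x - a + b + 2 * n)
    rw [hT.neg_of (show (-x - a + b + 2 * n) - (-1) = -(x + a - b - 2 * n - 1) by ring), hT.neg_of
      (show (-x - a + b + 2 * n) + (x - n) + (-1) - x = -(x + a - b - n + 1) by ring), hT.neg_of
      (show -x - a + b + 2 * n = -(x + a - b - 2 * n) by ring), hT.neg_of (show (-x - a + b + 2 *
      n) + (x - n) - x = -(x + a - b - n) by ring), hT.neg_of (show -1 = -(1) by ring), hT.neg_of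
      (show (-x - a + b + 2 * n) + (x - n) = -(a - b - n) by ring), hT.neg_of (show (-x - a + b + 2
      * n) - x = -(2 * x + a - b - 2 * n) by ring)] at h
    ring_nf at h ⊢
    linear_combination -h
  have e1 : T (x - n) * T x * T (x + a - b - 2 * n - 1) * T (x + a - b - n + 1) - T 1 * T (n + 1) *
    T (a - b - n) * T (2 * x + a - b - 2 * n) - T (x - n - 1) * T (x + 1) * T (x + a - b - 2 * n) *
    T (x + a - b - n) = 0 := by
    have h := hT.fay (x - n) (-x + n + 1) (-x) (a - b - n)
    rw [hT.neg_of (show -x = -(x) by ring), hT.neg_of (show (-x) - (-x + n + 1) = -(n + 1) by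
      ring), hT.neg_of (show -x + n + 1 = -(x - n - 1) by ring), hT.neg_of (show (-x) - (x - n) -
      (-x + n + 1) = -(x + 1) by ring)] at h
    ring_nf at h ⊢
    linear_combination -h
  have hf : T (x - n) * T x * T (x + a - b - 2 * n - 1) * T (x + a - b - n + 1) * T (w + b + n + 1)
    * T (z - w) * T (z + a - n + 1) - T 1 * T (n + 1) * T (a - b - n) * T x * T (w + x + a - n + 1)
    * T (z - w + x + a - b - 2 * n) * T (z - x + b + n + 1) - T (x - n - 1) * T (x + 1) * T (x + a
    - b - 2 * n) * T (x + a - b - n) * T (w + b + n + 1) * T (z - w) * T (z + a - n + 1) - T 1 * T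
    (n + 1) * T (a - b - n) * T (x + a - b - 2 * n) * T (w - x + b + n + 1) * T (z - w - x) * T (z
    + x + a - n + 1) = 0 := by
    -- The factor with 2x occurs in all four relations above but in no term of the claim.
    -- Multiplying by it and by T (w + b + n + 1) makes the claim a combination of these relations.
    refine mul_left_cancel₀ (mul_ne_zero hn1 hn2) ?_
    linear_combination -T (x - n) * T x * T (x + a - b - 2 * n - 1) * T (x + a - b - n + 1) * T (w
      + b + n + 1) * i0 + T (x - n - 1) * T (x + 1) * T (x + a - b - 2 * n) * T (x + a - b - n) * T
      (w + b + n + 1) * i1 - T (x + a - b - 2 * n) * T (w - x + b + n + 1) * T (w + b + n + 1) * T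
      (z - w - x) * T (z + x + a - n + 1) * e0 + T x * T (w + b + n + 1) * T (w + x + a - n + 1) *
      T (z - w + x + a - b - 2 * n) * T (z - x + b + n + 1) * e1
  linear_combination (norm := (field_simp; ring)) 1 / (T x * T x * T (x + a - b - 2 * n) * T (x + a
    - b - 2 * n) * T (z - w + 1)) * hf

theorem rll_pm_mp (z w x a b n : G) (h1 : T (z - w + 1) ≠ 0) (h2 : T (x + a - b - 2 * n) ≠ 0) (h3 :
  T (x + a - b - 2 * n + 1) ≠ 0) (h4 : T (x - 1) ≠ 0) (h5 : T x ≠ 0) :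
    -(T (z - w) * T (x + a - b - 2 * n + 1) * T (x + a - b - 2 * n - 1) * T (z + x + a - n + 1) * T
      (a - b - n + 1) * T (w - x + b + n + 1) * T n / (T (z - w + 1) * T (x + a - b - 2 * n) * T (x
      + a - b - 2 * n) * T (x + a - b - 2 * n + 1) * T (x - 1))) + T (z - w + x + a - b - 2 * n) *
      T 1 * T (z + b + n + 1) * T (w + a - n + 1) * T (x + a - b - n) * T (x - n - 1) / (T (z - w +
      1) * T (x + a - b - 2 * n) * T (x - 1) * T (x + a - b - 2 * n)) =
      T (w + b + n + 1) * T (z + a - n + 1) * T (x + a - b - n) * T (x - n - 1) * T (z - w + x) * T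
        1 / (T (x - 1) * T (x + a - b - 2 * n) * T (z - w + 1) * T x) - T (w - x + b + n + 1) * T
        (n + 1) * T (z + x + a - n + 1) * T (a - b - n) * T (z - w) / (T x * T (x + a - b - 2 * n)
        * T (z - w + 1)) := by
  have hg : -(T n * T (a - b - n + 1) * T x * T (x + a - b - 2 * n - 1)) + T (n + 1) * T (a - b -
    n) * T (x - 1) * T (x + a - b - 2 * n) - T 1 * T (x + a - b - n) * T (x - n - 1) * T (a - b - 2
    * n) = 0 := by
    have h := hT.fay n 1 (a - b - n + 1) (x + a - b - 2 * n)
    ring_nf at h ⊢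
    linear_combination -h
  have hf : T (a - b - 2 * n) * T (w - x + b + n + 1) * T (z - w) * T (z + x + a - n + 1) + T x * T
    (w + a - n + 1) * T (z - w + x + a - b - 2 * n) * T (z + b + n + 1) - T (x + a - b - 2 * n) * T
    (w + b + n + 1) * T (z - w + x) * T (z + a - n + 1) = 0 := by
    have h := hT.fay (a - b - 2 * n) (-x - a + b + 2 * n) (w - x + b + n + 1) (-z + w - x - a + b +
      2 * n)
    rw [hT.neg_of (show (-z + w - x - a + b + 2 * n) - (-x - a + b + 2 * n) = -(z - w) by ring),
      hT.neg_of (show (-z + w - x - a + b + 2 * n) + (a - b - 2 * n) + (-x - a + b + 2 * n) - (w -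
      x + b + n + 1) = -(z + x + a - n + 1) by ring), hT.neg_of (show (a - b - 2 * n) + (-x - a + b
      + 2 * n) = -(x) by ring), hT.neg_of (show -z + w - x - a + b + 2 * n = -(z - w + x + a - b -
      2 * n) by ring), hT.neg_of (show (-z + w - x - a + b + 2 * n) + (a - b - 2 * n) - (w - x + b
      + n + 1) = -(z + b + n + 1) by ring), hT.neg_of (show -x - a + b + 2 * n = -(x + a - b - 2 *
      n) by ring), hT.neg_of (show (-z + w - x - a + b + 2 * n) + (a - b - 2 * n) = -(z - w + x) by
      ring), hT.neg_of (show (-z + w - x - a + b + 2 * n) - (w - x + b + n + 1) = -(z + a - n + 1)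
      by ring)] at h
    ring_nf at h ⊢
    linear_combination h
  have h : -(T n * T (a - b - n + 1) * T x * T (x + a - b - 2 * n - 1) * T (w - x + b + n + 1) * T
    (z - w) * T (z + x + a - n + 1)) + T 1 * T (x - n - 1) * T x * T (x + a - b - n) * T (w + a - n
    + 1) * T (z - w + x + a - b - 2 * n) * T (z + b + n + 1) - T 1 * T (x - n - 1) * T (x + a - b -
    2 * n) * T (x + a - b - n) * T (w + b + n + 1) * T (z - w + x) * T (z + a - n + 1) + T (n + 1)
    * T (a - b - n) * T (x - 1) * T (x + a - b - 2 * n) * T (w - x + b + n + 1) * T (z - w) * T (z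
    + x + a - n + 1) = 0 := by
    linear_combination T (w - x + b + n + 1) * T (z - w) * T (z + x + a - n + 1) * hg + T (x - n -
      1) * T 1 * T (x + a - b - n) * hf
  linear_combination (norm := (field_simp; ring)) 1 / (T (x - 1) * T x * T (x + a - b - 2 * n) * T
    (x + a - b - 2 * n) * T (z - w + 1)) * h

theorem rll_pm_mm (z w x a b n : G) (h1 : T (z - w + 1) ≠ 0) (h2 : T (x + a - b - 2 * n - 2) ≠ 0)
  (h3 : T (x + a - b - 2 * n - 1) ≠ 0) :
    T (z - w) * T (x + a - b - 2 * n - 1) * T (x + a - b - 2 * n - 3) * T (z + x + a - n) * T (a -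
      b - n) * T (w + b + n + 1) / (T (z - w + 1) * T (x + a - b - 2 * n - 2) * T (x + a - b - 2 *
      n - 2) * T (x + a - b - 2 * n - 1)) + T (z - w + x + a - b - 2 * n - 2) * T 1 * T (z + b + n
      + 2) * T (w + x + a - n - 1) * T (a - b - n) / (T (z - w + 1) * T (x + a - b - 2 * n - 2) * T
      (x + a - b - 2 * n - 2)) =
      T (w + b + n + 2) * T (z + x + a - n - 1) * T (a - b - n) / (T (x + a - b - 2 * n - 2)) := by
  have hf : T (x + a - b - 2 * n - 3) * T (w + b + n + 1) * T (z - w) * T (z + x + a - n) + T 1 * T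
    (w + x + a - n - 1) * T (z - w + x + a - b - 2 * n - 2) * T (z + b + n + 2) - T (x + a - b - 2
    * n - 2) * T (w + b + n + 2) * T (z - w + 1) * T (z + x + a - n - 1) = 0 := by
    have h := hT.fay (x + a - b - 2 * n - 3) (-x - a + b + 2 * n + 2) (w + b + n + 1) (-z + w - x -
      a + b + 2 * n + 2)
    rw [hT.neg_of (show (-z + w - x - a + b + 2 * n + 2) - (-x - a + b + 2 * n + 2) = -(z - w) by
      ring), hT.neg_of (show (-z + w - x - a + b + 2 * n + 2) + (x + a - b - 2 * n - 3) + (-x - a +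
      b + 2 * n + 2) - (w + b + n + 1) = -(z + x + a - n) by ring), hT.neg_of (show (x + a - b - 2
      * n - 3) + (-x - a + b + 2 * n + 2) = -(1) by ring), hT.neg_of (show -z + w - x - a + b + 2 *
      n + 2 = -(z - w + x + a - b - 2 * n - 2) by ring), hT.neg_of (show (-z + w - x - a + b + 2 *
      n + 2) + (x + a - b - 2 * n - 3) - (w + b + n + 1) = -(z + b + n + 2) by ring), hT.neg_of
      (show -x - a + b + 2 * n + 2 = -(x + a - b - 2 * n - 2) by ring), hT.neg_of (show (-z + w - x
      - a + b + 2 * n + 2) + (x + a - b - 2 * n - 3) = -(z - w + 1) by ring), hT.neg_of (show (-z +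
      w - x - a + b + 2 * n + 2) - (w + b + n + 1) = -(z + x + a - n - 1) by ring)] at h
    ring_nf at h ⊢
    linear_combination h
  linear_combination (norm := (field_simp; ring)) T (a - b - n) / (T (x + a - b - 2 * n - 2) * T (x
    + a - b - 2 * n - 2) * T (z - w + 1)) * hf

theorem rll_mp_pp (z w x a b n : G) (h1 : T (z - w + 1) ≠ 0) (h2 : T (x + a - b - 2 * n + 2) ≠ 0)
  (h3 : T x ≠ 0) (h4 : T (x + a - b - 2 * n + 3) ≠ 0) (h5 : T (x + 1) ≠ 0) :
    T (z - w - x - a + b + 2 * n - 2) * T 1 * T (z + a - n + 2) * T (x + a - b - n + 2) * T (x - n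
      + 1) * T (w - x + b + n - 1) * T n / (T (z - w + 1) * T (x + a - b - 2 * n + 2) * T x * T (x
      + a - b - 2 * n + 3) * T (x + 1)) - T (z - w) * T (z - x + b + n) * T n * T (w + a - n + 1) *
      T (x + a - b - n + 2) * T (x - n + 1) / (T (z - w + 1) * T x * T (x + 1) * T (x + a - b - 2 *
      n + 2)) =
      -(T (w + a - n + 2) * T (x + a - b - n + 2) * T (x - n + 1) * T (z - x + b + n - 1) * T n /
        (T x * T (x + a - b - 2 * n + 3) * T (x + 1))) := by
  have hf : T 1 * T (w - x + b + n - 1) * T (z - w - x - a + b + 2 * n - 2) * T (z + a - n + 2) - T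
    (x + a - b - 2 * n + 3) * T (w + a - n + 1) * T (z - w) * T (z - x + b + n) + T (x + a - b - 2
    * n + 2) * T (w + a - n + 2) * T (z - w + 1) * T (z - x + b + n - 1) = 0 := by
    have h := hT.fay 1 (x + a - b - 2 * n + 2) (-w + x - b - n + 1) (z - w)
    rw [hT.neg_of (show -w + x - b - n + 1 = -(w - x + b + n - 1) by ring), hT.neg_of (show (-w + x
      - b - n + 1) - (x + a - b - 2 * n + 2) = -(w + a - n + 1) by ring), hT.neg_of (show (-w + x -
      b - n + 1) - 1 - (x + a - b - 2 * n + 2) = -(w + a - n + 2) by ring)] at h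
    ring_nf at h ⊢
    linear_combination -h
  linear_combination (norm := (field_simp; ring)) T n * T (x - n + 1) * T (x + a - b - n + 2) / (T
    x * T (x + 1) * T (x + a - b - 2 * n + 2) * T (x + a - b - 2 * n + 3) * T (z - w + 1)) * hf

theorem rll_mp_pm (z w x a b n : G) (h1 : T (z - w + 1) ≠ 0) (h2 : T (x + a - b - 2 * n) ≠ 0) (h3 :
  T x ≠ 0) (h4 : T (x + a - b - 2 * n + 1) ≠ 0) (h5 : T (x - 1) ≠ 0) :
    -(T (z - w - x - a + b + 2 * n) * T 1 * T (z + a - n + 1) * T (x + a - b - n + 1) * T (x - n) *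
      T (w + b + n + 1) / (T (z - w + 1) * T (x + a - b - 2 * n) * T x * T (x + a - b - 2 * n +
      1))) - T (z - w) * T (z - x + b + n + 1) * T (n + 1) * T (w + x + a - n + 1) * T (a - b - n)
      / (T (z - w + 1) * T x * T (x + a - b - 2 * n)) =
      -(T (w + x + a - n + 1) * T (a - b - n + 1) * T (z - x + b + n + 1) * T n * T (z - w) * T (x
        + 1) * T (x - 1) / (T (x + a - b - 2 * n + 1) * T (x - 1) * T (z - w + 1) * T x * T x)) - T
        (w + a - n + 1) * T (x + a - b - n + 1) * T (x - n) * T (z + b + n + 1) * T (z - w - x) * T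
        1 / (T x * T (x + a - b - 2 * n + 1) * T (z - w + 1) * T x) := by
  have hg : -(T x * T (w + b + n + 1) * T (z - w - x - a + b + 2 * n) * T (z + a - n + 1)) + T (x +
    a - b - 2 * n) * T (w + a - n + 1) * T (z - w - x) * T (z + b + n + 1) - T (a - b - 2 * n) * T
    (w + x + a - n + 1) * T (z - w) * T (z - x + b + n + 1) = 0 := by
    have h := hT.fay x (a - b - 2 * n) (z + a - n + 1) (w + a - n + 1)
    rw [hT.neg_of (show (w + a - n + 1) + x + (a - b - 2 * n) - (z + a - n + 1) = -(z - w - x - a +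
      b + 2 * n) by ring), hT.neg_of (show (w + a - n + 1) + x - (z + a - n + 1) = -(z - w - x) by
      ring), hT.neg_of (show (w + a - n + 1) - (z + a - n + 1) = -(z - w) by ring)] at h
    ring_nf at h ⊢
    linear_combination h
  have hf : T 1 * T (a - b - 2 * n) * T (x - n) * T (x + a - b - n + 1) - T (n + 1) * T (a - b - n)
    * T x * T (x + a - b - 2 * n + 1) + T n * T (a - b - n + 1) * T (x + 1) * T (x + a - b - 2 * n)
    = 0 := by
    have h := hT.fay 1 n (-a + b + 2 * n) x
    rw [hT.neg_of (show -a + b + 2 * n = -(a - b - 2 * n) by ring), hT.neg_of (show (-a + b + 2 *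
      n) - n = -(a - b - n) by ring), hT.neg_of (show (-a + b + 2 * n) - 1 - n = -(a - b - n + 1)
      by ring)] at h
    ring_nf at h ⊢
    linear_combination -h
  have h : -(T 1 * T (x - n) * T x * T (x + a - b - n + 1) * T (w + b + n + 1) * T (z - w - x - a +
    b + 2 * n) * T (z + a - n + 1)) - T (n + 1) * T (a - b - n) * T x * T (x + a - b - 2 * n + 1) *
    T (w + x + a - n + 1) * T (z - w) * T (z - x + b + n + 1) + T n * T (a - b - n + 1) * T (x + 1)
    * T (x + a - b - 2 * n) * T (w + x + a - n + 1) * T (z - w) * T (z - x + b + n + 1) + T 1 * T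
    (x - n) * T (x + a - b - 2 * n) * T (x + a - b - n + 1) * T (w + a - n + 1) * T (z - w - x) * T
    (z + b + n + 1) = 0 := by
    linear_combination T 1 * T (x - n) * T (x + a - b - n + 1) * hg + T (w + x + a - n + 1) * T (z
      - w) * T (z - x + b + n + 1) * hf
  linear_combination (norm := (field_simp; ring)) 1 / (T x * T x * T (x + a - b - 2 * n) * T (x + a
    - b - 2 * n + 1) * T (z - w + 1)) * h

theorem rll_mp_mp (z w x a b n : G) (h1 : T (z - w + 1) ≠ 0) (h2 : T (x + a - b - 2 * n) ≠ 0) (h3 :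
  T (x + a - b - 2 * n + 1) ≠ 0) (h4 : T (x - 1) ≠ 0) (h5 : T x ≠ 0)
    (hn1 : T (2 * x + a - b - 2 * n) ≠ 0) (hn2 : T (w + a - n + 1) ≠ 0) :
    T (z - w - x - a + b + 2 * n) * T 1 * T (z + x + a - n + 1) * T (a - b - n + 1) * T (w - x + b
      + n + 1) * T n / (T (z - w + 1) * T (x + a - b - 2 * n) * T (x + a - b - 2 * n + 1) * T (x -
      1)) + T (z - w) * T (z + b + n + 1) * T (w + a - n + 1) * T (x + a - b - n) * T (x - n - 1) /
      (T (z - w + 1) * T (x - 1) * T (x + a - b - 2 * n)) =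
      -(T (w + x + a - n + 1) * T (a - b - n + 1) * T (z - x + b + n + 1) * T n * T (z - w + x) * T
        1 / (T (x + a - b - 2 * n + 1) * T (x - 1) * T (z - w + 1) * T x)) + T (w + a - n + 1) * T
        (x + a - b - n + 1) * T (x - n) * T (z + b + n + 1) * T (z - w) / (T x * T (x + a - b - 2 *
        n + 1) * T (z - w + 1)) := by
  have i0 : T (2 * x + a - b - 2 * n) * T (w + a - n + 1) * T (z - w) * T (z + b + n + 1) - T (x +
    a - b - 2 * n) * T (w + x + a - n + 1) * T (z - w + x) * T (z - x + b + n + 1) - T x * T (w - x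
    + b + n + 1) * T (z - w - x - a + b + 2 * n) * T (z + x + a - n + 1) = 0 := by
    have h := hT.fay (2 * x + a - b - 2 * n) (-x) (w + a - n + 1) (-z + w - x)
    rw [hT.neg_of (show (-z + w - x) - (-x) = -(z - w) by ring), hT.neg_of (show (-z + w - x) + (2
      * x + a - b - 2 * n) + (-x) - (w + a - n + 1) = -(z + b + n + 1) by ring), hT.neg_of (show -z
      + w - x = -(z - w + x) by ring), hT.neg_of (show (-z + w - x) + (2 * x + a - b - 2 * n) - (w
      + a - n + 1) = -(z - x + b + n + 1) by ring), hT.neg_of (show -x = -(x) by ring), hT.neg_of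
      (show (-z + w - x) + (2 * x + a - b - 2 * n) = -(z - w - x - a + b + 2 * n) by ring),
      hT.neg_of (show (-z + w - x) - (w + a - n + 1) = -(z + x + a - n + 1) by ring)] at h
    ring_nf at h ⊢
    linear_combination h
  have i1 : T (2 * x + a - b - 2 * n) * T (w + a - n + 1) * T (z - w) * T (z + b + n + 1) - T (x +
    a - b - 2 * n) * T (w + x + a - n + 1) * T (z - w + x) * T (z - x + b + n + 1) - T x * T (w - x
    + b + n + 1) * T (z - w - x - a + b + 2 * n) * T (z + x + a - n + 1) = 0 := by
    have h := hT.fay (2 * x + a - b - 2 * n) (-x) (w + a - n + 1) (-z + w - x)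
    rw [hT.neg_of (show (-z + w - x) - (-x) = -(z - w) by ring), hT.neg_of (show (-z + w - x) + (2
      * x + a - b - 2 * n) + (-x) - (w + a - n + 1) = -(z + b + n + 1) by ring), hT.neg_of (show -z
      + w - x = -(z - w + x) by ring), hT.neg_of (show (-z + w - x) + (2 * x + a - b - 2 * n) - (w
      + a - n + 1) = -(z - x + b + n + 1) by ring), hT.neg_of (show -x = -(x) by ring), hT.neg_of
      (show (-z + w - x) + (2 * x + a - b - 2 * n) = -(z - w - x - a + b + 2 * n) by ring),
      hT.neg_of (show (-z + w - x) - (w + a - n + 1) = -(z + x + a - n + 1) by ring)] at h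
    ring_nf at h ⊢
    linear_combination h
  have e0 : T (x - n - 1) * T x * T (x + a - b - 2 * n + 1) * T (x + a - b - n) + T 1 * T n * T (a
    - b - n + 1) * T (2 * x + a - b - 2 * n) - T (x - n) * T (x - 1) * T (x + a - b - 2 * n) * T (x
    + a - b - n + 1) = 0 := by
    have h := hT.fay (x - n - 1) (-x + n) (-x) (a - b - n + 1)
    rw [hT.neg_of (show -x = -(x) by ring), hT.neg_of (show (x - n - 1) + (-x + n) = -(1) by ring),
      hT.neg_of (show (-x) - (-x + n) = -(n) by ring), hT.neg_of (show -x + n = -(x - n) by ring),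
      hT.neg_of (show (-x) - (x - n - 1) - (-x + n) = -(x - 1) by ring)] at h
    ring_nf at h ⊢
    linear_combination -h
  have e1 : -(T 1 * T n * T (a - b - n + 1) * T (2 * x + a - b - 2 * n)) - T (x - n - 1) * T x * T
    (x + a - b - 2 * n + 1) * T (x + a - b - n) + T (x - n) * T (x - 1) * T (x + a - b - 2 * n) * T
    (x + a - b - n + 1) = 0 := by
    have h := hT.fay 1 (-x + n) n (-x - a + b + 2 * n - 1)
    rw [hT.neg_of (show (-x - a + b + 2 * n - 1) - (-x + n) = -(a - b - n + 1) by ring), hT.neg_of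
      (show (-x - a + b + 2 * n - 1) + 1 + (-x + n) - n = -(2 * x + a - b - 2 * n) by ring),
      hT.neg_of (show 1 + (-x + n) = -(x - n - 1) by ring), hT.neg_of (show -x - a + b + 2 * n - 1
      = -(x + a - b - 2 * n + 1) by ring), hT.neg_of (show (-x - a + b + 2 * n - 1) + 1 - n = -(x +
      a - b - n) by ring), hT.neg_of (show -x + n = -(x - n) by ring), hT.neg_of (show (-x - a + b
      + 2 * n - 1) + 1 = -(x + a - b - 2 * n) by ring), hT.neg_of (show (-x - a + b + 2 * n - 1) -
      n = -(x + a - b - n + 1) by ring)] at h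
    ring_nf at h ⊢
    linear_combination -h
  have hf : T 1 * T n * T (a - b - n + 1) * T x * T (w - x + b + n + 1) * T (z - w - x - a + b + 2
    * n) * T (z + x + a - n + 1) + T (x - n - 1) * T x * T (x + a - b - 2 * n + 1) * T (x + a - b -
    n) * T (w + a - n + 1) * T (z - w) * T (z + b + n + 1) + T 1 * T n * T (a - b - n + 1) * T (x +
    a - b - 2 * n) * T (w + x + a - n + 1) * T (z - w + x) * T (z - x + b + n + 1) - T (x - n) * T
    (x - 1) * T (x + a - b - 2 * n) * T (x + a - b - n + 1) * T (w + a - n + 1) * T (z - w) * T (z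
    + b + n + 1) = 0 := by
    -- As in `rll_pm_pm`, the factor with 2x links the claim to the four relations.
    refine mul_left_cancel₀ (mul_ne_zero hn1 hn2) ?_
    linear_combination T (x - n - 1) * T x * T (x + a - b - 2 * n + 1) * T (x + a - b - n) * T (w +
      a - n + 1) * i0 - T (x - n) * T (x - 1) * T (x + a - b - 2 * n) * T (x + a - b - n + 1) * T
      (w + a - n + 1) * i1 + T (x + a - b - 2 * n) * T (w + a - n + 1) * T (w + x + a - n + 1) * T
      (z - w + x) * T (z - x + b + n + 1) * e0 - T x * T (w - x + b + n + 1) * T (w + a - n + 1) *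
      T (z - w - x - a + b + 2 * n) * T (z + x + a - n + 1) * e1
  linear_combination (norm := (field_simp; ring)) 1 / (T (x - 1) * T x * T (x + a - b - 2 * n) * T
    (x + a - b - 2 * n + 1) * T (z - w + 1)) * hf

theorem rll_mp_mm (z w x a b n : G) (h1 : T (z - w + 1) ≠ 0) (h2 : T (x + a - b - 2 * n - 2) ≠ 0)
  (h3 : T (x + a - b - 2 * n - 1) ≠ 0) :
    -(T (z - w - x - a + b + 2 * n + 2) * T 1 * T (z + x + a - n) * T (a - b - n) * T (w + b + n +
      1) / (T (z - w + 1) * T (x + a - b - 2 * n - 2) * T (x + a - b - 2 * n - 1))) + T (z - w) * T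
      (z + b + n + 2) * T (w + x + a - n - 1) * T (a - b - n) / (T (z - w + 1) * T (x + a - b - 2 *
      n - 2)) =
      T (w + x + a - n) * T (a - b - n) * T (z + b + n + 1) / (T (x + a - b - 2 * n - 1)) := by
  have hf : -(T 1 * T (w + b + n + 1) * T (z - w - x - a + b + 2 * n + 2) * T (z + x + a - n)) + T
    (x + a - b - 2 * n - 1) * T (w + x + a - n - 1) * T (z - w) * T (z + b + n + 2) - T (x + a - b
    - 2 * n - 2) * T (w + x + a - n) * T (z - w + 1) * T (z + b + n + 1) = 0 := by
    have h := hT.fay 1 (x + a - b - 2 * n - 2) (-w - b - n - 1) (z - w)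
    rw [hT.neg_of (show -w - b - n - 1 = -(w + b + n + 1) by ring), hT.neg_of (show (-w - b - n -
      1) - (x + a - b - 2 * n - 2) = -(w + x + a - n - 1) by ring), hT.neg_of (show (-w - b - n -
      1) - 1 - (x + a - b - 2 * n - 2) = -(w + x + a - n) by ring)] at h
    ring_nf at h ⊢
    linear_combination h
  linear_combination (norm := (field_simp; ring)) T (a - b - n) / (T (x + a - b - 2 * n - 2) * T (x
    + a - b - 2 * n - 1) * T (z - w + 1)) * hf

theorem rll_mm_pm (z w x b n : G) (h1 : T x ≠ 0) (h2 : T (x - 1) ≠ 0) (h3 : T (z - w + 1) ≠ 0) :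
    -(T (z - x + b + n) * T n * T (w + b + n + 1) / (T x)) =
      -(T (w + b + n) * T (z - x + b + n + 1) * T n * T (z - w) * T (x + 1) * T (x - 1) / (T (x -
        1) * T (z - w + 1) * T x * T x)) + T (w - x + b + n) * T n * T (z + b + n + 1) * T (z - w -
        x) * T 1 / (T x * T (z - w + 1) * T x) := by
  have hf : -(T x * T (w + b + n + 1) * T (z - w + 1) * T (z - x + b + n)) + T (x + 1) * T (w + b +
    n) * T (z - w) * T (z - x + b + n + 1) - T 1 * T (w - x + b + n) * T (z - w - x) * T (z + b + n
    + 1) = 0 := by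
    have h := hT.fay x 1 (w + b + n + 1) (-z + w)
    rw [hT.neg_of (show (-z + w) - 1 = -(z - w + 1) by ring), hT.neg_of (show (-z + w) + x + 1 - (w
      + b + n + 1) = -(z - x + b + n) by ring), hT.neg_of (show -z + w = -(z - w) by ring),
      hT.neg_of (show (-z + w) + x - (w + b + n + 1) = -(z - x + b + n + 1) by ring), hT.neg_of
      (show (-z + w) + x = -(z - w - x) by ring), hT.neg_of (show (-z + w) - (w + b + n + 1) = -(z
      + b + n + 1) by ring)] at h
    ring_nf at h ⊢
    linear_combination -h
  linear_combination (norm := (field_simp; ring)) T n / (T x * T x * T (z - w + 1)) * hf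

theorem rll_mm_mp (z w x b n : G) (h1 : T (x - 1) ≠ 0) (h2 : T (z - w + 1) ≠ 0) (h3 : T x ≠ 0) :
    -(T (z + b + n) * T (w - x + b + n + 1) * T n / (T (x - 1))) =
      -(T (w + b + n) * T (z - x + b + n + 1) * T n * T (z - w + x) * T 1 / (T (x - 1) * T (z - w +
        1) * T x)) - T (w - x + b + n) * T n * T (z + b + n + 1) * T (z - w) / (T x * T (z - w +
        1)) := by
  have hf : -(T x * T (w - x + b + n + 1) * T (z - w + 1) * T (z + b + n)) + T 1 * T (w + b + n) *
    T (z - w + x) * T (z - x + b + n + 1) + T (x - 1) * T (w - x + b + n) * T (z - w) * T (z + b +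
    n + 1) = 0 := by
    have h := hT.fay x (-x + 1) (w - x + b + n + 1) (-z + w - x)
    rw [hT.neg_of (show (-z + w - x) - (-x + 1) = -(z - w + 1) by ring), hT.neg_of (show (-z + w -
      x) + x + (-x + 1) - (w - x + b + n + 1) = -(z + b + n) by ring), hT.neg_of (show -z + w - x =
      -(z - w + x) by ring), hT.neg_of (show (-z + w - x) + x - (w - x + b + n + 1) = -(z - x + b +
      n + 1) by ring), hT.neg_of (show -x + 1 = -(x - 1) by ring), hT.neg_of (show (-z + w - x) + x
      = -(z - w) by ring), hT.neg_of (show (-z + w - x) - (w - x + b + n + 1) = -(z + b + n + 1) by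
      ring)] at h
    ring_nf at h ⊢
    linear_combination -h
  linear_combination (norm := (field_simp; ring)) T n / (T (x - 1) * T x * T (z - w + 1)) * hf

/-- The quantum determinant T (z + b) T (z + a + 1) depends neither on x nor on the index n of the
basis vector. This makes K_+ computable from K_-. -/
theorem qdet_pp_mm (z x a b n : G) (h1 : T x ≠ 0) (h2 : T (x + a - b - 2 * n + 1) ≠ 0) (h3 : T (x -
  1) ≠ 0) :
    T (z + a - n + 1) * T (x + a - b - n + 1) * T (x - n) * T (z + b + n) / (T x * T (x + a - b - 2
      * n + 1)) =
      T (z + b) * T (z + a + 1) - T (x - 1) * T (z + x + a - n + 1) * T (a - b - n + 1) * T (z - x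
        + b + n) * T n / (T x * T (x + a - b - 2 * n + 1) * T (x - 1)) := by
  have hf : T (x - n) * T (x + a - b - n + 1) * T (z + b + n) * T (z + a - n + 1) - T x * T (x + a
    - b - 2 * n + 1) * T (z + b) * T (z + a + 1) + T n * T (a - b - n + 1) * T (z - x + b + n) * T
    (z + x + a - n + 1) = 0 := by
    have h := hT.fay (x - n) n (x + a - b - n + 1) (-z - b)
    rw [hT.neg_of (show (-z - b) - n = -(z + b + n) by ring), hT.neg_of (show (-z - b) + (x - n) +
      n - (x + a - b - n + 1) = -(z + a - n + 1) by ring), hT.neg_of (show -z - b = -(z + b) by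
      ring), hT.neg_of (show (-z - b) + (x - n) - (x + a - b - n + 1) = -(z + a + 1) by ring),
      hT.neg_of (show (-z - b) + (x - n) = -(z - x + b + n) by ring), hT.neg_of (show (-z - b) - (x
      + a - b - n + 1) = -(z + x + a - n + 1) by ring)] at h
    ring_nf at h ⊢
    linear_combination h
  linear_combination (norm := (field_simp; ring)) 1 / (T x * T (x + a - b - 2 * n + 1)) * hf

theorem qdet_mm_pp (z x a b n : G) (h1 : T (x - 1) ≠ 0) (h2 : T (x + a - b - 2 * n) ≠ 0) (h3 : T x
  ≠ 0) :
    T (z + b + n + 1) * T (z + a - n) * T (x + a - b - n) * T (x - n - 1) / (T (x - 1) * T (x + a -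
      b - 2 * n)) =
      T x * T (x + a - b - 2 * n - 1) * T (z + b) * T (z + a + 1) / (T (x - 1) * T (x + a - b - 2 *
        n)) - T x * T (z - x + b + n + 1) * T (n + 1) * T (z + x + a - n) * T (a - b - n) / (T (x -
        1) * T x * T (x + a - b - 2 * n)) := by
  have hf : T (x - n - 1) * T (x + a - b - n) * T (z + b + n + 1) * T (z + a - n) - T x * T (x + a
    - b - 2 * n - 1) * T (z + b) * T (z + a + 1) + T (n + 1) * T (a - b - n) * T (z - x + b + n +
    1) * T (z + x + a - n) = 0 := by
    have h := hT.fay (x - n - 1) (n + 1) (x + a - b - n) (-z - b)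
    rw [hT.neg_of (show (-z - b) - (n + 1) = -(z + b + n + 1) by ring), hT.neg_of (show (-z - b) +
      (x - n - 1) + (n + 1) - (x + a - b - n) = -(z + a - n) by ring), hT.neg_of (show -z - b = -(z
      + b) by ring), hT.neg_of (show (-z - b) + (x - n - 1) - (x + a - b - n) = -(z + a + 1) by
      ring), hT.neg_of (show (-z - b) + (x - n - 1) = -(z - x + b + n + 1) by ring), hT.neg_of
      (show (-z - b) - (x + a - b - n) = -(z + x + a - n) by ring)] at h
    ring_nf at h ⊢
    linear_combination h
  linear_combination (norm := (field_simp; ring)) 1 / (T (x - 1) * T (x + a - b - 2 * n)) * hf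


end ThetaMap

end EllipticQG

end

noncomputable section

namespace EllipticQG

open scoped UpperHalfPlane

/-! ### Theta functions of entire functions -/

section

variable {E F : Type*} [NormedAddCommGroup E] [NormedSpace ℂ E]
  [NormedAddCommGroup F] [NormedSpace ℂ F] (τ : ℍ) (ħ : ℂ)

/-- The function `θ(ħ f)`, for an entire function `f`. -/
def thetaFn (f : Entire E) : Mer E :=
  algebraMap (Entire E) (Mer E) ⟨fun p => theta τ (ħ * f.1 p),
    fun p _ => (theta_analyticAt τ _).comp (f := fun p => ħ * f.1 p)
      (analyticAt_const.mul (f.2 p trivial))⟩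

theorem thetaMap_theta : ThetaMap fun u : ℂ => theta τ (ħ * u) where
  odd x := by rw [mul_neg, theta_neg]
  fay p q j y := by
    -- The half-sums and half-differences are chosen so that x ± u, y ± v and the other combinations
    -- become the arguments in `fay`; for example x + u is ħp.
    have h := theta_three_term τ (ħ * ((p + j) / 2)) (ħ * (y + (p - j) / 2))
      (ħ * ((p - j) / 2)) (ħ * (q + (p - j) / 2))
    rw [show ħ * ((p + j) / 2) - ħ * (y + (p - j) / 2) = -(ħ * (y - j)) by ring,
      show ħ * ((p - j) / 2) - ħ * (q + (p - j) / 2) = -(ħ * q) by ring,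
      show ħ * ((p - j) / 2) + ħ * (q + (p - j) / 2) = -(ħ * (j - p - q)) by ring,
      theta_neg, theta_neg, theta_neg] at h
    ring_nf at h ⊢
    linear_combination h

theorem thetaMap_thetaFn : ThetaMap (thetaFn (E := E) τ ħ) where
  odd f := by
    rw [thetaFn, thetaFn, ← map_neg]
    exact congrArg _ (Subtype.ext (funext fun p => (thetaMap_theta τ ħ).odd (f.1 p)))
  fay p q j y := by
    simp only [thetaFn, ← map_mul, ← map_sub, ← map_add]
    rw [← map_zero (algebraMap (Entire E) (Mer E))]
    exact congrArg _ (Subtype.ext (funext fun v =>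
      (thetaMap_theta τ ħ).fay (p.1 v) (q.1 v) (j.1 v) (y.1 v)))

theorem thetaFn_ne_zero {f : Entire E} {p : E} (h : theta τ (ħ * f.1 p) ≠ 0) :
    thetaFn τ ħ f ≠ 0 := fun h0 => by
  have := (IsFractionRing.injective (Entire E) (Mer E)) (h0.trans (map_zero _).symm)
  exact h (congrFun (congrArg Subtype.val this) p)

theorem thetaFn_ne_zero_of_surjective (hħ : ħ ≠ 0) {f : Entire E}
    (hf : Function.Surjective f.1) : thetaFn τ ħ f ≠ 0 := by
  obtain ⟨u, hu⟩ := exists_theta_ne_zero τ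
  obtain ⟨p, hp⟩ := hf (u / ħ)
  exact thetaFn_ne_zero τ ħ (p := p) (by rwa [hp, mul_div_cancel₀ _ hħ])

theorem merPull_algebraMap (f : E → F) (hf : AnalyticOnNhd ℂ f Set.univ)
    (hs : Function.Surjective f) (g : Entire F) :
    merPull f hf hs (algebraMap (Entire F) (Mer F) g) =
      algebraMap (Entire E) (Mer E) (entirePull f hf g) := by
  rw [merPull, IsFractionRing.lift_algebraMap]; rfl

theorem merPull_thetaFn (f : E → F) (hf : AnalyticOnNhd ℂ f Set.univ)
    (hs : Function.Surjective f) (g : Entire F) :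
    merPull f hf hs (thetaFn τ ħ g) = thetaFn τ ħ (entirePull f hf g) :=
  merPull_algebraMap ..

theorem ringHom_ext_mer {K : Type*} [Field K] {φ ψ : Mer E →+* K}
    (h : ∀ f : Entire E, φ (algebraMap _ _ f) = ψ (algebraMap _ _ f)) : φ = ψ :=
  IsLocalization.ringHom_ext (nonZeroDivisors (Entire E)) (RingHom.ext h)

variable {τ ħ} in
theorem merPull_comp {H : Type*} [NormedAddCommGroup H] [NormedSpace ℂ H] {f : E → F} {g : F → H}
    {k : E → H} {hf : AnalyticOnNhd ℂ f Set.univ} {hg : AnalyticOnNhd ℂ g Set.univ}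
    {hk : AnalyticOnNhd ℂ k Set.univ} {hfs : Function.Surjective f}
    {hgs : Function.Surjective g} {hks : Function.Surjective k} (h : ∀ p, g (f p) = k p)
    (m : Mer H) : merPull f hf hfs (merPull g hg hgs m) = merPull k hk hks m := by
  suffices (merPull f hf hfs).comp (merPull g hg hgs) = merPull k hk hks from
    RingHom.congr_fun this m
  refine ringHom_ext_mer fun u => ?_
  rw [RingHom.comp_apply, merPull_algebraMap, merPull_algebraMap, merPull_algebraMap]
  exact congrArg _ (Subtype.ext (funext fun p => congrArg u.1 (h p)))

theorem merPull_id {f : E → E} {hf : AnalyticOnNhd ℂ f Set.univ} {hfs : Function.Surjective f}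
    (h : ∀ p, f p = p) (m : Mer E) : merPull f hf hfs m = m := by
  suffices merPull f hf hfs = RingHom.id _ from RingHom.congr_fun this m
  refine ringHom_ext_mer fun u => ?_
  rw [merPull_algebraMap]
  exact congrArg _ (Subtype.ext (funext fun p => congrArg u.1 (h p)))

/-- Constants as entire functions. -/
abbrev cst : ℂ →+* Entire E := algebraMap ℂ (Entire E)

/-- A continuous linear form, divided by `ħ`, as an entire function. -/
def coord (L : E →L[ℂ] ℂ) : Entire E := ⟨fun p => L p / ħ, fun p _ => (L.analyticAt p).div_const⟩

end

/-- The function `x / ħ` of `x`. -/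
def x₁ (ħ : ℂ) : Entire ℂ := coord ħ (ContinuousLinearMap.id ℂ ℂ)

/-- The function `z / ħ` of `(z, x)`. -/
def z₂ (ħ : ℂ) : Entire (ℂ × ℂ) := coord ħ (ContinuousLinearMap.fst ℂ ℂ ℂ)

/-- The function `x / ħ` of `(z, x)`. -/
def x₂ (ħ : ℂ) : Entire (ℂ × ℂ) := coord ħ (ContinuousLinearMap.snd ℂ ℂ ℂ)

/-- The function `z / ħ` of `(z, w, x)`. -/
def z₃ (ħ : ℂ) : Entire (ℂ × ℂ × ℂ) := coord ħ (ContinuousLinearMap.fst ℂ ℂ (ℂ × ℂ))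

/-- The function `w / ħ` of `(z, w, x)`. -/
def w₃ (ħ : ℂ) : Entire (ℂ × ℂ × ℂ) :=
  coord ħ ((ContinuousLinearMap.fst ℂ ℂ ℂ).comp (ContinuousLinearMap.snd ℂ ℂ (ℂ × ℂ)))

/-- The function `x / ħ` of `(z, w, x)`. -/
def x₃ (ħ : ℂ) : Entire (ℂ × ℂ × ℂ) :=
  coord ħ ((ContinuousLinearMap.snd ℂ ℂ ℂ).comp (ContinuousLinearMap.snd ℂ ℂ (ℂ × ℂ)))

section

variable {τ : ℍ} {ħ : ℂ} (hħ : ħ ≠ 0)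
include hħ

/-- Arguments are measured in units of ħ, so that shifts by ħ become additions of 1 and the abstract
identities apply with integral shifts. -/
theorem th_eq (a b c : ℂ) :
    th τ a b c = thetaFn τ ħ (cst a * z₂ ħ + cst b * x₂ ħ + cst (c / ħ)) := by
  rw [th, thetaFn]
  congr 1
  refine Subtype.ext (funext fun p => ?_)
  change theta τ (a * p.1 + b * p.2 + c) = theta τ _
  congr 1
  change a * p.1 + b * p.2 + c = ħ * (a * (p.1 / ħ) + b * (p.2 / ħ) + c / ħ)
  field_simp

theorem thetaFn_x₁_ne_zero (c : ℂ) : thetaFn τ ħ (x₁ ħ + cst c) ≠ 0 :=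
  thetaFn_ne_zero_of_surjective τ ħ hħ fun u => ⟨(u - c) * ħ, by
    change (u - c) * ħ / ħ + c = u; field_simp; ring⟩

theorem thetaFn_x₂_ne_zero (c : ℂ) : thetaFn τ ħ (x₂ ħ + cst c) ≠ 0 :=
  thetaFn_ne_zero_of_surjective τ ħ hħ fun u => ⟨(0, (u - c) * ħ), by
    change (u - c) * ħ / ħ + c = u; field_simp; ring⟩

theorem thetaFn_z₂_ne_zero (c : ℂ) : thetaFn τ ħ (z₂ ħ + cst c) ≠ 0 :=
  thetaFn_ne_zero_of_surjective τ ħ hħ fun u => ⟨((u - c) * ħ, 0), by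
    change (u - c) * ħ / ħ + c = u; field_simp; ring⟩

theorem thetaFn_two_mul_x₂_ne_zero (c : ℂ) : thetaFn τ ħ (2 * x₂ ħ + cst c) ≠ 0 :=
  thetaFn_ne_zero_of_surjective τ ħ hħ fun u => ⟨(0, (u - c) * ħ / 2), by
    change 2 * ((u - c) * ħ / 2 / ħ) + c = u; field_simp; ring⟩

theorem thetaFn_x₃_ne_zero (c : ℂ) : thetaFn τ ħ (x₃ ħ + cst c) ≠ 0 :=
  thetaFn_ne_zero_of_surjective τ ħ hħ fun u => ⟨(0, 0, (u - c) * ħ), by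
    change (u - c) * ħ / ħ + c = u; field_simp; ring⟩

theorem thetaFn_w₃_ne_zero (c : ℂ) : thetaFn τ ħ (w₃ ħ + cst c) ≠ 0 :=
  thetaFn_ne_zero_of_surjective τ ħ hħ fun u => ⟨(0, (u - c) * ħ, 0), by
    change (u - c) * ħ / ħ + c = u; field_simp; ring⟩

theorem thetaFn_z₃_sub_w₃_ne_zero (c : ℂ) : thetaFn τ ħ (z₃ ħ - w₃ ħ + cst c) ≠ 0 :=
  thetaFn_ne_zero_of_surjective τ ħ hħ fun u => ⟨((u - c) * ħ, 0, 0), by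
    change (u - c) * ħ / ħ - 0 / ħ + c = u; field_simp; ring⟩

theorem thetaFn_two_mul_x₃_ne_zero (c : ℂ) : thetaFn τ ħ (2 * x₃ ħ + cst c) ≠ 0 :=
  thetaFn_ne_zero_of_surjective τ ħ hħ fun u => ⟨(0, 0, (u - c) * ħ / 2), by
    change 2 * ((u - c) * ħ / 2 / ħ) + c = u; field_simp; ring⟩

end

end EllipticQG

end

noncomputable section

namespace EllipticQG

open scoped UpperHalfPlane

/-! ### The RLL relations of the asymptotic representations -/

/-- The sign as the number `1` or `0`. -/
def Sgn.ind : Sgn → ℤ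
  | true => 1
  | false => 0

theorem Sgn.val_eq (i : Sgn) : i.val = 2 * (i.ind : ℂ) - 1 := by
  cases i <;> simp [Sgn.val, Sgn.ind]; norm_num

/-- The entries of the R-matrix in terms of an abstract theta function. -/
def rcoef {G F : Type*} [CommRing G] [Field F] (T : G → F) (z x : G) :
    Sgn → Sgn → Sgn → Sgn → F
  | true, true, true, true => 1
  | true, false, true, false => T z * T (x + 1) * T (x - 1) / (T (z + 1) * T x ^ 2)
  | true, false, false, true => T (z + x) * T 1 / (T (z + 1) * T x)
  | false, true, true, false => -(T (z - x) * T 1 / (T (z + 1) * T x))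
  | false, true, false, true => T z / T (z + 1)
  | false, false, false, false => 1
  | _, _, _, _ => 0

/-- The entries of the operators `L_{ij}(z)` of the asymptotic representations in terms of an
abstract theta function. -/
def wcoef {G F : Type*} [CommRing G] [Field F] (T : G → F) (z x a b n : G) : Sgn → Sgn → F
  | true, true => T (z + a - n + 1) * T (x + a - b - n + 1) * T (x - n) /
      (T x * T (x + a - b - 2 * n + 1))
  | true, false => T (z + x + a - n) * T (a - b - n) / T (x + a - b - 2 * n - 1)
  | false, true => -(T (z - x + b + n) * T n / T x)
  | false, false => T (z + b + n + 1)

theorem rcoef_of_ne {G F : Type*} [CommRing G] [Field F] (T : G → F) (z x : G) {m n p q : Sgn}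
    (h : p.ind + q.ind ≠ m.ind + n.ind) : rcoef T z x m n p q = 0 := by
  cases m <;> cases n <;> cases p <;> cases q <;> first | rfl | exact absurd rfl h

section Generic

variable {G F : Type*} [CommRing G] [Algebra ℂ G] [Field F]

/-- `T` vanishes at no translate of `u` by a constant. -/
def Generic (T : G → F) (u : G) : Prop := ∀ c : ℂ, T (u + algebraMap ℂ G c) ≠ 0

variable {T : G → F} {u : G}

theorem Generic.ne_zero (h : Generic T u) : ¬ T u = 0 := by simpa using h 0

theorem generic_add_algebraMap (c : ℂ) : Generic T (u + algebraMap ℂ G c) ↔ Generic T u := by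
  refine ⟨fun h d => ?_, fun h d => ?_⟩
  · have := h (d - c)
    rwa [map_sub, add_assoc, add_sub_cancel] at this
  · have := h (c + d)
    rwa [map_add, ← add_assoc] at this

theorem generic_sub_algebraMap (c : ℂ) : Generic T (u - algebraMap ℂ G c) ↔ Generic T u := by
  rw [sub_eq_add_neg, ← map_neg, generic_add_algebraMap]

theorem generic_add_intCast (c : ℤ) : Generic T (u + c) ↔ Generic T u := by
  simpa using generic_add_algebraMap (T := T) (u := u) (c : ℂ)

theorem generic_sub_intCast (c : ℤ) : Generic T (u - c) ↔ Generic T u := by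
  simpa using generic_sub_algebraMap (T := T) (u := u) (c : ℂ)

theorem generic_sub_two_mul_intCast (c : ℤ) : Generic T (u - 2 * c) ↔ Generic T u := by
  simpa only [map_mul, map_ofNat, map_intCast] using
    generic_sub_algebraMap (T := T) (u := u) (2 * c : ℂ)

theorem generic_add_one : Generic T (u + 1) ↔ Generic T u := by
  simpa using generic_add_algebraMap (T := T) (u := u) 1

theorem generic_sub_one : Generic T (u - 1) ↔ Generic T u := by
  simpa using generic_sub_algebraMap (T := T) (u := u) 1

theorem generic_add_ofNat (n : ℕ) [n.AtLeastTwo] :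
    Generic T (u + (ofNat(n) : G)) ↔ Generic T u := by
  simpa only [map_ofNat] using generic_add_algebraMap (T := T) (u := u) (OfNat.ofNat n)

theorem generic_sub_ofNat (n : ℕ) [n.AtLeastTwo] :
    Generic T (u - (ofNat(n) : G)) ↔ Generic T u := by
  simpa only [map_ofNat] using generic_sub_algebraMap (T := T) (u := u) (OfNat.ofNat n)

end Generic

namespace ThetaMap

section

variable {G F : Type*} [CommRing G] [Field F] {T : G → F} (hT : ThetaMap T)
include hT

theorem map_zero : T 0 = 0 := by
  have h := hT.fay 0 0 0 0
  simp only [add_zero, sub_zero] at h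
  by_contra h0
  apply h0
  have : T 0 * T 0 * T 0 * T 0 = 0 := by linear_combination h
  simpa using this

theorem wcoef_zero (z x a b : G) : wcoef T z x a b 0 false true = 0 := by
  simp [wcoef, hT.map_zero]

end

variable {G F : Type*} [CommRing G] [Algebra ℂ G] [Field F] {T : G → F} (hT : ThetaMap T)
include hT

-- Of the sixteen relations, the four with m = n and i = j reduce to commutativity. The genericity
-- of 2x and of w is needed only for `rll_pm_pm` and `rll_mp_mp`.
set_option linter.unusedSimpArgs false in
set_option maxHeartbeats 1000000 in
theorem rll_wcoef {z w x : G} (hx : Generic T x) (hx2 : Generic T (2 * x)) (hw : Generic T w)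
    (hzw : Generic T (z - w)) (a b : ℂ) (k : ℤ) (i j m n : Sgn) :
    (∑ p : Sgn, ∑ q : Sgn, rcoef T (z - w)
        (x + algebraMap ℂ G a - algebraMap ℂ G b - 2 * ((k + m.ind + n.ind - i.ind - j.ind : ℤ) : G))
          m n p q *
        (wcoef T z x (algebraMap ℂ G a) (algebraMap ℂ G b) ((k + q.ind - j.ind : ℤ) : G) p i *
          wcoef T w (x + ((2 * i.ind - 1 : ℤ) : G)) (algebraMap ℂ G a) (algebraMap ℂ G b) k q j)) =
      ∑ p : Sgn, ∑ q : Sgn,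
        wcoef T w x (algebraMap ℂ G a) (algebraMap ℂ G b) ((k + m.ind - p.ind : ℤ) : G) n q *
          wcoef T z (x + ((2 * q.ind - 1 : ℤ) : G)) (algebraMap ℂ G a) (algebraMap ℂ G b) k m p *
          rcoef T (z - w) x p q i j := by
  cases m <;> cases n <;> cases i <;> cases j <;>
    simp only [Fintype.sum_bool, rcoef, wcoef, Sgn.ind, zero_mul, mul_zero, add_zero, zero_add,
      Int.cast_add, Int.cast_sub, Int.cast_mul, Int.cast_one, Int.cast_zero, Int.cast_ofNat]
  on_goal 2 => have h := hT.rll_mm_mp z w x (algebraMap ℂ G b) k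
  on_goal 3 => have h := hT.rll_mm_pm z w x (algebraMap ℂ G b) k
  on_goal 5 => have h := hT.rll_mp_mm z w x (algebraMap ℂ G a) (algebraMap ℂ G b) k
  on_goal 6 => have h := hT.rll_mp_mp z w x (algebraMap ℂ G a) (algebraMap ℂ G b) k
  on_goal 7 => have h := hT.rll_mp_pm z w x (algebraMap ℂ G a) (algebraMap ℂ G b) k
  on_goal 8 => have h := hT.rll_mp_pp z w x (algebraMap ℂ G a) (algebraMap ℂ G b) k
  on_goal 9 => have h := hT.rll_pm_mm z w x (algebraMap ℂ G a) (algebraMap ℂ G b) k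
  on_goal 10 => have h := hT.rll_pm_mp z w x (algebraMap ℂ G a) (algebraMap ℂ G b) k
  on_goal 11 => have h := hT.rll_pm_pm z w x (algebraMap ℂ G a) (algebraMap ℂ G b) k
  on_goal 12 => have h := hT.rll_pm_pp z w x (algebraMap ℂ G a) (algebraMap ℂ G b) k
  on_goal 14 => have h := hT.rll_pp_mp z w x (algebraMap ℂ G a) (algebraMap ℂ G b) k
  on_goal 15 => have h := hT.rll_pp_pm z w x (algebraMap ℂ G a) (algebraMap ℂ G b) k
  all_goals first
    | ring_nf; done
    | simp only [ne_eq, Generic.ne_zero, generic_add_algebraMap, generic_sub_algebraMap,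
        generic_add_intCast, generic_sub_intCast, generic_sub_two_mul_intCast, generic_add_one, generic_sub_one,
        generic_add_ofNat, generic_sub_ofNat, hx, hx2, hw, hzw, not_false_eq_true,
        forall_const] at h
      ring_nf at h ⊢
      linear_combination h

end ThetaMap

end EllipticQG

end

noncomputable section

namespace EllipticQG

open scoped UpperHalfPlane

theorem map_rcoef {G F G' F' : Type*} [CommRing G] [Field F] [CommRing G'] [Field F'] {T : G → F}
    {T' : G' → F'} {ρ : F →+* F'} {π : G →+* G'} (h : ∀ f, ρ (T f) = T' (π f)) (z x : G)
    (m n i j : Sgn) : ρ (rcoef T z x m n i j) = rcoef T' (π z) (π x) m n i j := by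
  cases m <;> cases n <;> cases i <;> cases j <;> simp [rcoef, h]

theorem map_wcoef {G F G' F' : Type*} [CommRing G] [Field F] [CommRing G'] [Field F'] {T : G → F}
    {T' : G' → F'} {ρ : F →+* F'} {π : G →+* G'} (h : ∀ f, ρ (T f) = T' (π f)) (z x a b n : G)
    (i j : Sgn) :
    ρ (wcoef T z x a b n i j) = wcoef T' (π z) (π x) (π a) (π b) (π n) i j := by
  cases i <;> cases j <;> simp [wcoef, h, map_ofNat]

section

variable {τ : ℍ} {ħ : ℂ} (hħ : ħ ≠ 0)

include hħ

theorem Rcoef_eq (m n i j : Sgn) :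
    Rcoef τ ħ m n i j = rcoef (thetaFn τ ħ) (z₂ ħ) (x₂ ħ) m n i j := by
  have e1 : ħ / ħ = 1 := div_self hħ
  have e2 : -ħ / ħ = -1 := by rw [neg_div, e1]
  cases m <;> cases n <;> cases i <;> cases j <;>
    simp [Rcoef, rcoef, th_eq hħ, e1, e2, ← sub_eq_add_neg]

omit hħ in
theorem shift_th (a b c t u : ℂ) : shift t u (th τ a b c) = th τ a b (c + a * t + b * u) := by
  refine (merPull_algebraMap ..).trans ?_
  rw [th]
  congr 1
  refine Subtype.ext (funext fun p => congrArg (theta τ) ?_)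
  change a * (p.1 + t) + b * (p.2 + u) + c = _
  ring

theorem shift_th_mul (a b e s : ℂ) : shift (s * ħ) 0 (th τ a b (e * ħ)) =
    thetaFn τ ħ (cst a * z₂ ħ + cst b * x₂ ħ + cst (e + a * s)) := by
  rw [shift_th, th_eq hħ]
  congr 3
  field_simp
  ring

/-- All four operators take one uniform shape in the parameters a = ℓ + s and b = s. The index is
truncated at 0 only for L_{-+} on the first basis vector, where the coefficient T 0 vanishes. -/
theorem asymptoticRep_L (ℓ s : ℂ) (i j : Sgn) (b : ℕ) :
    (asymptoticRep τ ħ ℓ s).L i j b = Finsupp.single ((b : ℤ) + i.ind - j.ind).toNat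
      (wcoef (thetaFn τ ħ) (z₂ ħ) (x₂ ħ) (cst (ℓ + s)) (cst s) ((b : ℤ) : Entire (ℂ × ℂ)) i j) := by
  have key := @shift_th_mul τ ħ hħ
  have k0 := fun a b => key a b 0 s
  have k1 := fun a b e => key a b (-e) s
  simp only [zero_mul, neg_mul] at k0 k1
  have c2 : (cst 2 : Entire (ℂ × ℂ)) = 2 := map_ofNat _ 2
  have w0 := (thetaMap_thetaFn (E := ℂ × ℂ) τ ħ).wcoef_zero
  rcases i with _ | _ <;> rcases j with _ | _
  · simp [asymptoticRep, LData.spectralShift, asymptotic, wcoef, Sgn.ind, key]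
    congr 2; ring
  · rcases b with _ | b
    · simp [asymptoticRep, LData.spectralShift, asymptotic, Sgn.ind, w0]
    · simp [asymptoticRep, LData.spectralShift, asymptotic, wcoef, Sgn.ind, key, k0,
        -Finsupp.single_neg]
      ring_nf
  · simp [asymptoticRep, LData.spectralShift, asymptotic, wcoef, Sgn.ind, c2, key]
    ring_nf
  · simp [asymptoticRep, LData.spectralShift, asymptotic, wcoef, Sgn.ind, c2, key, k0, k1]
    ring_nf

omit hħ in
theorem asymptoticRep_wt (ℓ s : ℂ) (b : ℕ) : (asymptoticRep τ ħ ℓ s).wt b = ℓ - 2 * b := rfl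

omit hħ in
/-- The coefficients of products of two operators `L_{ij}`. -/
theorem sum_mul_of_eq_wcoef {α β : ℂ} {L : Sgn → Sgn → ℕ → (ℕ →₀ M2)}
    (hL : ∀ i j (b : ℕ), L i j b = Finsupp.single ((b : ℤ) + i.ind - j.ind).toNat
      (wcoef (thetaFn τ ħ) (z₂ ħ) (x₂ ħ) (cst α) (cst β) ((b : ℤ) : Entire (ℂ × ℂ)) i j))
    {G K : Type*} [CommRing G] [Algebra ℂ G] [Field K]
    {T : G → K} (hT : ThetaMap T) {ρ σ : M2 →+* K} {π ϖ : Entire (ℂ × ℂ) →ₐ[ℂ] G}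
    (hρ : ∀ f, ρ (thetaFn τ ħ f) = T (π f)) (hσ : ∀ f, σ (thetaFn τ ħ f) = T (ϖ f))
    (p i q j : Sgn) (b a : ℕ) :
    ((L q j b).sum fun c f => ρ (L p i c a) * σ f) =
      if (a : ℤ) = b + q.ind - j.ind + p.ind - i.ind then
        wcoef T (π (z₂ ħ)) (π (x₂ ħ)) (algebraMap ℂ G α) (algebraMap ℂ G β)
            ((b + q.ind - j.ind : ℤ) : G) p i *
          wcoef T (ϖ (z₂ ħ)) (ϖ (x₂ ħ)) (algebraMap ℂ G α) (algebraMap ℂ G β)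
            ((b : ℤ) : G) q j
      else 0 := by
  have hρ' : ∀ f, ρ (thetaFn τ ħ f) = T ((π : Entire (ℂ × ℂ) →+* G) f) := hρ
  have hσ' : ∀ f, σ (thetaFn τ ħ f) = T ((ϖ : Entire (ℂ × ℂ) →+* G) f) := hσ
  simp only [hL]
  rw [Finsupp.sum_single_index (by simp), map_wcoef hσ']
  -- A negative target index occurs only for L_{-+} at k = 0, with coefficient zero. The truncation
  -- by `toNat` is therefore harmless and the indices can be compared in ℤ.
  have w0 : ∀ (y x a b : G) (k : ℤ) (r t : Sgn), 0 ≤ k → k + r.ind - t.ind < 0 →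
      wcoef T y x a b (k : G) r t = 0 := by
    intro y x a b k r t h0 h1
    obtain ⟨rfl, rfl, rfl⟩ : k = 0 ∧ r = false ∧ t = true := by
      cases r <;> cases t <;> simp [Sgn.ind] at * <;> omega
    simpa using hT.wcoef_zero y x a b
  simp only [map_intCast, AlgHom.coe_toRingHom, AlgHom.commutes]
  rcases lt_or_ge ((b : ℤ) + q.ind - j.ind) 0 with hb | hb
  · rw [w0 _ _ _ _ b q j (by positivity) hb]
    simp
  · rw [Int.toNat_of_nonneg hb, Finsupp.single_apply, apply_ite ρ, map_wcoef hρ']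
    simp only [map_intCast, AlgHom.coe_toRingHom, AlgHom.commutes, map_zero]
    rcases lt_or_ge ((b : ℤ) + q.ind - j.ind + p.ind - i.ind) 0 with ha | ha
    · rw [w0 _ _ _ _ (b + q.ind - j.ind) p i hb ha]
      simp
    · rw [ite_mul, zero_mul]
      congr 1
      rw [eq_iff_iff]
      omega

end

end EllipticQG

end

noncomputable section

namespace EllipticQG

open scoped UpperHalfPlane

universe u v

/-! ### Products of operators and tensor products -/

theorem shift_zero_apply (f : M2) : shift 0 0 f = f := merPull_id (fun p => by simp) f

theorem shift_shift (s t s' t' : ℂ) (f : M2) :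
    shift s t (shift s' t' f) = shift (s + s') (t + t') f :=
  merPull_comp (fun p => by ext <;> simp <;> ring) f

theorem shift_zIn (u : ℂ) (g : M) : shift 0 u (zIn g) = zIn g :=
  merPull_comp (fun p => by simp) g

section Products

variable {R K : Type*} [CommRing R] [CommRing K]

/-- Homomorphisms from a ring with translations to a ring that express the arguments of two
operators, with all shifts of the dynamical variable. -/
structure DynamicalPair (sh : ℂ → R →+* R) (K : Type*) [CommRing K] where
  left : ℂ → R →+* K
  right : ℂ → R →+* K
  translate : ℂ → K →+* K
  left_shift : ∀ s f, left 0 (sh s f) = left s f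
  right_shift : ∀ s t f, right s (sh t f) = right (s + t) f
  translate_left : ∀ s f, translate s (left 0 f) = left s f
  translate_right : ∀ s t f, translate s (right t f) = right (s + t) f

variable {sh : ℂ → R →+* R} {A B : Type*}

/-- The coefficients of the product of `L_{pi}` and `L_{qj}`, with arguments given by `P`. -/
def prodCoef (ħ : ℂ) (P : DynamicalPair sh K) (L : Sgn → Sgn → A → (A →₀ R))
    (p i q j : Sgn) (b a : A) : K :=
  (L q j b).sum fun c f => P.left 0 (L p i c a) * P.right (i.val * ħ) f

/-- The coproduct action. -/
def tensorOp (sh : ℂ → R →+* R) (ħ : ℂ) (wt : B → ℂ) (L : Sgn → Sgn → A → (A →₀ R))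
    (L' : Sgn → Sgn → B → (B →₀ R)) (i j : Sgn) (b : A × B) : A × B →₀ R :=
  ∑ k : Sgn, (L i k b.1).sum fun a f => (L' k j b.2).sum fun a' g =>
    Finsupp.single (a, a') (sh (ħ * wt a') f * g)

theorem sum_single_apply (φ : B → R →+* R) (f : A →₀ R) (g : B →₀ R)
    (x : A) (y : B) :
    (f.sum fun a r => g.sum fun b s => Finsupp.single (a, b) (φ b r * s)) (x, y) =
      φ y (f x) * g y := by
  classical
  simp only [Finsupp.sum, Finsupp.finsetSum_apply, Finsupp.single_apply, Prod.mk.injEq]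
  rw [Finset.sum_eq_single x, Finset.sum_eq_single y]
  · simp
  · intro b _ hb; simp [hb]
  · intro h; simp [Finsupp.notMem_support_iff.1 h]
  · intro b _ hb; simp [hb]
  · intro h; simp [Finsupp.notMem_support_iff.1 h]

variable {ħ : ℂ} {wt : B → ℂ} {L : Sgn → Sgn → A → (A →₀ R)} {L' : Sgn → Sgn → B → (B →₀ R)}

theorem tensorOp_apply (i j : Sgn) (b a : A × B) : tensorOp sh ħ wt L L' i j b a =
    ∑ k : Sgn, sh (ħ * wt a.2) (L i k b.1 a.1) * L' k j b.2 a.2 := by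
  rw [tensorOp, Finsupp.finsetSum_apply]
  exact Finset.sum_congr rfl fun k _ =>
    sum_single_apply (fun y => sh (ħ * wt y)) _ _ a.1 a.2

theorem tensorOp_sum {N : Type*} [AddCommMonoid N] (i j : Sgn) (b : A × B)
    (h : A × B → R → N) (h0 : ∀ c, h c 0 = 0) (hadd : ∀ c r s, h c (r + s) = h c r + h c s) :
    (tensorOp sh ħ wt L L' i j b).sum h = ∑ k : Sgn, (L i k b.1).sum fun c f =>
      (L' k j b.2).sum fun c' g => h (c, c') (sh (ħ * wt c') f * g) := by
  rw [tensorOp, ← Finsupp.sum_finsetSum_index h0 hadd]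
  refine Finset.sum_congr rfl fun k _ => ?_
  rw [Finsupp.sum_sum_index h0 hadd]
  refine Finsupp.sum_congr fun c _ => ?_
  rw [Finsupp.sum_sum_index h0 hadd]
  exact Finsupp.sum_congr fun c' _ => Finsupp.sum_single_index (h0 _)

/-- Products on a tensor product factor into products on the two factors. The shifts agree because
the weights of c' and of a.2 differ by i - s, which turns iħ + ħ wt(c') into ħ wt(a.2) + sħ. The
abstract pair of arguments lets this computation serve the RLL relations, with (z, w) and (w, z),
and the quantum determinant, with (z, z - ħ). -/
theorem prodCoef_tensorOp (P : DynamicalPair sh K)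
    (hwt : ∀ i j b a, L' i j b a ≠ 0 → wt a = wt b + (j.val - i.val))
    (p i q j : Sgn) (b a : A × B) :
    prodCoef ħ P (tensorOp sh ħ wt L L') p i q j b a = ∑ t : Sgn, ∑ s : Sgn,
      P.translate (ħ * wt a.2) (prodCoef ħ P L p s q t b.1 a.1) *
        prodCoef ħ P L' s i t j b.2 a.2 := by
  rw [prodCoef, tensorOp_sum q j b _ (by simp) (fun c r s => by rw [map_add, mul_add])]
  refine Finset.sum_congr rfl fun t _ => ?_
  have key : ∀ (s : Sgn) (c : A) (c' : B) (f g : R),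
      P.left 0 (sh (ħ * wt a.2) (L p s c a.1) * L' s i c' a.2) *
        P.right (i.val * ħ) (sh (ħ * wt c') f * g) =
      (P.left (ħ * wt a.2) (L p s c a.1) * P.right (ħ * wt a.2 + s.val * ħ) f) *
        (P.left 0 (L' s i c' a.2) * P.right (i.val * ħ) g) := by
    intro s c c' f g
    by_cases h : L' s i c' a.2 = 0
    · simp [h]
    · rw [map_mul, map_mul, P.left_shift, P.right_shift, hwt _ _ _ _ h,
        show i.val * ħ + ħ * wt c' = ħ * (wt c' + (i.val - s.val)) + s.val * ħ by ring]
      ring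
  simp only [tensorOp_apply, map_sum, Finset.sum_mul, key]
  simp only [Finsupp.sum, prodCoef, map_sum, map_mul, P.translate_left, P.translate_right]
  simp only [Finset.sum_mul_sum]
  symm
  rw [Finset.sum_comm]
  exact Finset.sum_congr rfl fun c _ => Finset.sum_comm

/-- The `RLL` relations, for coefficients of the R-matrix with shifted dynamical variable. -/
theorem tensorOp_rll (P Q : DynamicalPair sh K) (hPQ : P.translate = Q.translate)
    (hwt : ∀ i j b a, L' i j b a ≠ 0 → wt a = wt b + (j.val - i.val)) {wt' : A → ℂ}
    {ϱ : ℂ → Sgn → Sgn → Sgn → Sgn → K}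
    (hϱ : ∀ s t m n i j, P.translate s (ϱ t m n i j) = ϱ (s + t) m n i j)
    (h : ∀ i j m n b a, ∑ p : Sgn, ∑ q : Sgn, ϱ (ħ * wt' a) m n p q * prodCoef ħ P L p i q j b a =
      ∑ p : Sgn, ∑ q : Sgn, prodCoef ħ Q L n q m p b a * ϱ 0 p q i j)
    (h' : ∀ i j m n b a, ∑ p : Sgn, ∑ q : Sgn, ϱ (ħ * wt a) m n p q * prodCoef ħ P L' p i q j b a =
      ∑ p : Sgn, ∑ q : Sgn, prodCoef ħ Q L' n q m p b a * ϱ 0 p q i j)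
    (i j m n : Sgn) (b a : A × B) :
    ∑ p : Sgn, ∑ q : Sgn, ϱ (ħ * (wt' a.1 + wt a.2)) m n p q *
        prodCoef ħ P (tensorOp sh ħ wt L L') p i q j b a =
      ∑ p : Sgn, ∑ q : Sgn, prodCoef ħ Q (tensorOp sh ħ wt L L') n q m p b a * ϱ 0 p q i j := by
  have e := fun s t => congrArg (P.translate (ħ * wt a.2)) (h s t m n b.1 a.1)
  have e' := fun p q => h' i j p q b.2 a.2
  simp only [prodCoef_tensorOp P hwt, prodCoef_tensorOp Q hwt, ← hPQ]
  simp only [Fintype.sum_bool, map_add, map_mul, hϱ, add_zero, mul_add] at e e' ⊢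
  simp only [add_comm (ħ * wt a.2)] at e
  -- The first four terms carry the R-matrix past the operators on the first factor, and the last
  -- four carry it past those on the second.
  linear_combination
    prodCoef ħ P L' true i true j b.2 a.2 * e true true +
    prodCoef ħ P L' true i false j b.2 a.2 * e true false +
    prodCoef ħ P L' false i true j b.2 a.2 * e false true +
    prodCoef ħ P L' false i false j b.2 a.2 * e false false +
    P.translate (ħ * wt a.2) (prodCoef ħ Q L n true m true b.1 a.1) * e' true true +
    P.translate (ħ * wt a.2) (prodCoef ħ Q L n false m true b.1 a.1) * e' true false +
    P.translate (ħ * wt a.2) (prodCoef ħ Q L n true m false b.1 a.1) * e' false true +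
    P.translate (ħ * wt a.2) (prodCoef ħ Q L n false m false b.1 a.1) * e' false false

end Products

/-- Translations of `x` in functions of `(z, w, x)`. -/
def shift₃ (u : ℂ) : M3 →+* M3 :=
  merPull (fun p : ℂ × ℂ × ℂ => (p.1, p.2.1, p.2.2 + u))
    (fun _ _ => by
      refine analyticAt_fst.prod (AnalyticAt.prod ?_ ?_)
      · exact analyticAt_fst.comp (analyticAt_snd)
      · exact (analyticAt_snd.comp (analyticAt_snd)).add analyticAt_const)
    fun p => ⟨(p.1, p.2.1, p.2.2 - u), by simp⟩

theorem shift₃_inZW (s t : ℂ) (f : M2) : shift₃ s (inZW t f) = inZW (s + t) f :=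
  merPull_comp (fun p => by ext <;> simp; ring) f

/-- Operators with arguments `z`, `w`. -/
def pairZW : DynamicalPair (shift 0) M3 where
  left := inZ
  right := inW
  translate := shift₃
  left_shift s f := merPull_comp (fun p => by ext <;> simp) f
  right_shift s t f := merPull_comp (fun p => by ext <;> simp; ring) f
  translate_left s f := merPull_comp (fun p => by ext <;> simp) f
  translate_right s t f := merPull_comp (fun p => by ext <;> simp; ring) f

/-- Operators with arguments `w`, `z`. -/
def pairWZ : DynamicalPair (shift 0) M3 where
  left := inW
  right := inZ
  translate := shift₃
  left_shift s f := merPull_comp (fun p => by ext <;> simp) f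
  right_shift s t f := merPull_comp (fun p => by ext <;> simp; ring) f
  translate_left s f := merPull_comp (fun p => by ext <;> simp) f
  translate_right s t f := merPull_comp (fun p => by ext <;> simp; ring) f

/-- Operators with arguments `z`, `z - ħ`. -/
def pairDet (ħ : ℂ) : DynamicalPair (shift 0) M2 where
  left := shift 0
  right := shift (-ħ)
  translate := shift 0
  left_shift s f := by rw [shift_shift]; simp
  right_shift s t f := by rw [shift_shift]; simp
  translate_left s f := by rw [shift_shift]; simp
  translate_right s t f := by rw [shift_shift]; simp

namespace LData

variable {ħ : ℂ} {X Y : LData.{u}}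

theorem tensor_isRep {τ : ℍ} (hX : X.IsRep τ ħ) (hY : Y.IsRep τ ħ) :
    (X.tensor ħ Y).IsRep τ ħ where
  graded i j b a h := by
    replace h := ne_of_eq_of_ne (tensorOp_apply i j b a).symm h
    obtain ⟨k, -, hk⟩ := Finset.exists_ne_zero_of_sum_ne_zero h
    have h1 := hX.graded i k b.1 a.1 fun h0 => hk (by rw [h0, map_zero, zero_mul])
    have h2 := hY.graded k j b.2 a.2 fun h0 => hk (by rw [h0, mul_zero])
    change X.wt a.1 + Y.wt a.2 = X.wt b.1 + Y.wt b.2 + _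
    rw [h1, h2]; ring
  rll := tensorOp_rll pairZW pairWZ rfl hY.graded
    (ϱ := fun s m n i j => inZW s (Rcoef τ ħ m n i j))
    (fun s t m n i j => shift₃_inZW s t _) hX.rll hY.rll

end LData

end EllipticQG

end

noncomputable section

namespace EllipticQG

open scoped UpperHalfPlane

universe u v

/-! ### Quantum determinants -/

section Determinant

variable {R K : Type*} [CommRing R] [Field K] {sh : ℂ → R →+* R} {A B : Type*} {ħ : ℂ}

/-- The part of the quantum determinant relations that determines `K_+(z)`. -/
structure HasDet (ħ : ℂ) (P : DynamicalPair sh K) (f D : K) (L : Sgn → Sgn → A → (A →₀ R)) :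
    Prop where
  minus : ∀ b a, prodCoef ħ P L false true false false b a =
    f * prodCoef ħ P L false false false true b a
  det : ∀ b a, prodCoef ħ P L true true false false b a -
    f * prodCoef ħ P L true false false true b a = open scoped Classical in if b = a then D else 0

/-- The quantum determinant relations. -/
structure HasFullDet (ħ : ℂ) (P : DynamicalPair sh K) (f D : K) (wt : A → ℂ)
    (L : Sgn → Sgn → A → (A →₀ R)) : Prop extends HasDet ħ P f D L where
  plus : ∀ b a, prodCoef ħ P L true true true false b a =
    f * prodCoef ħ P L true false true true b a
  det' : ∀ b a, f * prodCoef ħ P L false false true true b a -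
    prodCoef ħ P L false true true false b a =
      open scoped Classical in if b = a then D * P.translate (ħ * wt a) f else 0

/-- In the sum over the inner signs of the coproduct, `plus` and `minus` of the second factor cancel
the terms with equal inner signs. The relations `det` and `det'` turn the others into D' times the
determinant expression of the first factor, with the shift of f that it requires. Only the second
factor needs the full set of relations. -/
theorem HasDet.tensorOp {P : DynamicalPair sh K} {f D D' : K} {wt : B → ℂ}
    {L : Sgn → Sgn → A → (A →₀ R)} {L' : Sgn → Sgn → B → (B →₀ R)}
    (hwt : ∀ i j b a, L' i j b a ≠ 0 → wt a = wt b + (j.val - i.val))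
    (h : HasDet ħ P f D L) (h' : HasFullDet ħ P f D' wt L') (hD : ∀ s, P.translate s D = D) :
    HasDet ħ P f (D * D') (tensorOp sh ħ wt L L') := by
  have key : ∀ r : Sgn, ∀ b a,
      prodCoef ħ P (EllipticQG.tensorOp sh ħ wt L L') r true false false b a -
        f * prodCoef ħ P (EllipticQG.tensorOp sh ħ wt L L') r false false true b a =
      open scoped Classical in if b.2 = a.2 then D' * P.translate (ħ * wt a.2)
        (prodCoef ħ P L r true false false b.1 a.1 -
          f * prodCoef ħ P L r false false true b.1 a.1) else 0 := by
    intro r b a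
    have e1 := h'.plus b.2 a.2
    have e2 := h'.minus b.2 a.2
    have e3 := h'.det b.2 a.2
    have e4 := h'.det' b.2 a.2
    rw [prodCoef_tensorOp P hwt, prodCoef_tensorOp P hwt]
    simp only [Fintype.sum_bool, map_sub, map_mul]
    split_ifs at e3 e4 ⊢ with hb <;>
      linear_combination
        P.translate (ħ * wt a.2) (prodCoef ħ P L r true false true b.1 a.1) * e1 +
        P.translate (ħ * wt a.2) (prodCoef ħ P L r false false false b.1 a.1) * e2 +
        P.translate (ħ * wt a.2) (prodCoef ħ P L r true false false b.1 a.1) * e3 -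
        P.translate (ħ * wt a.2) (prodCoef ħ P L r false false true b.1 a.1) * e4
  constructor
  · intro b a
    have e := key false b a
    rw [h.minus, sub_self, map_zero, mul_zero, ite_self] at e
    exact sub_eq_zero.1 e
  · intro b a
    rw [key true b a, h.det]
    by_cases h1 : b.1 = a.1 <;> by_cases h2 : b.2 = a.2 <;>
      simp [h1, h2, Prod.ext_iff, hD, mul_comm]

end Determinant

namespace ThetaMap

section

variable {G F : Type*} [CommRing G] [Field F] {T : G → F}

theorem wcoef_plus {x : G} (hx : T x ≠ 0) (hx2 : T (x - 1) ≠ 0) (z a b k : G)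
    (n0 : T (x + a - b - 2 * k - 1) ≠ 0) (n1 : T (x + a - b - 2 * k) ≠ 0) :
    wcoef T z x a b (k + 1) true true * wcoef T (z - 1) (x + 1) a b k true false =
      T (x - 1) / T x * (wcoef T z x a b k true false * wcoef T (z - 1) (x - 1) a b k true true) := by
  simp only [wcoef]
  ring_nf at *
  field_simp

theorem wcoef_minus {x : G} (hx : T x ≠ 0) (hx2 : T (x - 1) ≠ 0)
    (z a b k : G) :
    wcoef T z x a b k false true * wcoef T (z - 1) (x + 1) a b k false false =
      T (x - 1) / T x *
        (wcoef T z x a b (k - 1) false false * wcoef T (z - 1) (x - 1) a b k false true) := by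
  simp only [wcoef]
  ring_nf at *
  field_simp

end

variable {G F : Type*} [CommRing G] [Field F] {T : G → F} (hT : ThetaMap T)
include hT

theorem wcoef_det {x : G} (hx : T x ≠ 0) (hx2 : T (x - 1) ≠ 0) (z a b k : G)
    (n0 : T (x + a - b - 2 * k + 1) ≠ 0) :
    wcoef T z x a b k true true * wcoef T (z - 1) (x + 1) a b k false false -
      T (x - 1) / T x *
        (wcoef T z x a b (k - 1) true false * wcoef T (z - 1) (x - 1) a b k false true) =
    T (z + b) * T (z + a + 1) := by
  have h := hT.qdet_pp_mm z x a b k hx n0 hx2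
  simp only [wcoef]
  ring_nf at h ⊢
  linear_combination h

theorem wcoef_det' {x : G} (hx : T x ≠ 0) (hx2 : T (x - 1) ≠ 0) (z a b k : G)
    (n1 : T (x + a - b - 2 * k) ≠ 0) :
    T (x - 1) / T x *
        (wcoef T z x a b k false false * wcoef T (z - 1) (x - 1) a b k true true) -
      wcoef T z x a b (k + 1) false true * wcoef T (z - 1) (x + 1) a b k true false =
    T (z + b) * T (z + a + 1) * (T (x + a - b - 2 * k - 1) / T (x + a - b - 2 * k)) := by
  have h := congrArg (fun t => T (x - 1) / T x * t) (hT.qdet_mm_pp z x a b k hx2 n1 hx)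
  simp only [wcoef]
  ring_nf at *
  field_simp at h ⊢
  linear_combination h

end ThetaMap

end EllipticQG

end

/-! ### From abstract theta identities to meromorphic functions of (z, w, x). -/

noncomputable section

namespace EllipticQG

open scoped UpperHalfPlane

universe u v

theorem cst_val {E : Type*} [NormedAddCommGroup E] [NormedSpace ℂ E] (i : Sgn) :
    (cst i.val : Entire E) = ((2 * i.ind - 1 : ℤ) : Entire E) := by
  rw [Sgn.val_eq, ← map_intCast (cst : ℂ →+* Entire E)]
  push_cast
  rfl

/-- Substitution in entire functions, as an algebra homomorphism. -/
def entirePullₐ {E F : Type*} [NormedAddCommGroup E] [NormedSpace ℂ E]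
    [NormedAddCommGroup F] [NormedSpace ℂ F] (f : E → F) (hf : AnalyticOnNhd ℂ f Set.univ) :
    Entire F →ₐ[ℂ] Entire E :=
  { entirePull f hf with commutes' := fun _ => rfl }

section

variable {τ : ℍ} {ħ : ℂ}

theorem exists_merPull_thetaFn {E F : Type*} [NormedAddCommGroup E] [NormedSpace ℂ E]
    [NormedAddCommGroup F] [NormedSpace ℂ F] {f : E → F} {hf : AnalyticOnNhd ℂ f Set.univ}
    {hs : Function.Surjective f} {ρ : Mer F →+* Mer E} (hρ : ρ = merPull f hf hs) :
    ∃ π : Entire F →ₐ[ℂ] Entire E,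
      (∀ g, ρ (thetaFn τ ħ g) = thetaFn τ ħ (π g)) ∧ ∀ g p, (π g).1 p = g.1 (f p) :=
  ⟨entirePullₐ f hf, fun g => by rw [hρ]; exact merPull_thetaFn τ ħ f hf hs g, fun _ _ => rfl⟩

theorem inZ_thetaFn (hħ : ħ ≠ 0) (s : ℂ) : ∃ π : Entire (ℂ × ℂ) →ₐ[ℂ] Entire (ℂ × ℂ × ℂ),
    (∀ f, inZ (s * ħ) (thetaFn τ ħ f) = thetaFn τ ħ (π f)) ∧
      π (z₂ ħ) = z₃ ħ ∧ π (x₂ ħ) = x₃ ħ + cst s := by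
  obtain ⟨π, h, hp⟩ := exists_merPull_thetaFn (τ := τ) (ħ := ħ) (ρ := inZ (s * ħ)) rfl
  refine ⟨π, h, Subtype.ext (funext fun p => hp _ p), Subtype.ext (funext fun p => ?_)⟩
  refine (hp _ p).trans ?_
  change (p.2.2 + s * ħ) / ħ = p.2.2 / ħ + s
  field_simp

theorem inW_thetaFn (hħ : ħ ≠ 0) (s : ℂ) : ∃ π : Entire (ℂ × ℂ) →ₐ[ℂ] Entire (ℂ × ℂ × ℂ),
    (∀ f, inW (s * ħ) (thetaFn τ ħ f) = thetaFn τ ħ (π f)) ∧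
      π (z₂ ħ) = w₃ ħ ∧ π (x₂ ħ) = x₃ ħ + cst s := by
  obtain ⟨π, h, hp⟩ := exists_merPull_thetaFn (τ := τ) (ħ := ħ) (ρ := inW (s * ħ)) rfl
  refine ⟨π, h, Subtype.ext (funext fun p => hp _ p), Subtype.ext (funext fun p => ?_)⟩
  refine (hp _ p).trans ?_
  change (p.2.2 + s * ħ) / ħ = p.2.2 / ħ + s
  field_simp

theorem inZW_thetaFn (hħ : ħ ≠ 0) (s : ℂ) : ∃ π : Entire (ℂ × ℂ) →ₐ[ℂ] Entire (ℂ × ℂ × ℂ),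
    (∀ f, inZW (s * ħ) (thetaFn τ ħ f) = thetaFn τ ħ (π f)) ∧
      π (z₂ ħ) = z₃ ħ - w₃ ħ ∧ π (x₂ ħ) = x₃ ħ + cst s := by
  obtain ⟨π, h, hp⟩ := exists_merPull_thetaFn (τ := τ) (ħ := ħ) (ρ := inZW (s * ħ)) rfl
  refine ⟨π, h, Subtype.ext (funext fun p => ?_), Subtype.ext (funext fun p => ?_)⟩
  · refine (hp _ p).trans ?_
    change (p.1 - p.2.1) / ħ = p.1 / ħ - p.2.1 / ħ
    ring
  · refine (hp _ p).trans ?_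
    change (p.2.2 + s * ħ) / ħ = p.2.2 / ħ + s
    field_simp

theorem shift_thetaFn (hħ : ħ ≠ 0) (t s : ℂ) : ∃ π : Entire (ℂ × ℂ) →ₐ[ℂ] Entire (ℂ × ℂ),
    (∀ f, shift (t * ħ) (s * ħ) (thetaFn τ ħ f) = thetaFn τ ħ (π f)) ∧
      π (z₂ ħ) = z₂ ħ + cst t ∧ π (x₂ ħ) = x₂ ħ + cst s := by
  obtain ⟨π, h, hp⟩ := exists_merPull_thetaFn (τ := τ) (ħ := ħ) (ρ := shift (t * ħ) (s * ħ)) rfl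
  refine ⟨π, h, Subtype.ext (funext fun p => ?_), Subtype.ext (funext fun p => ?_)⟩
  · refine (hp _ p).trans ?_
    change (p.1 + t * ħ) / ħ = p.1 / ħ + t
    field_simp
  · refine (hp _ p).trans ?_
    change (p.2 + s * ħ) / ħ = p.2 / ħ + s
    field_simp

theorem xIn_thetaFn (hħ : ħ ≠ 0) (s : ℂ) : ∃ π : Entire ℂ →ₐ[ℂ] Entire (ℂ × ℂ),
    (∀ f, xIn (s * ħ) (thetaFn τ ħ f) = thetaFn τ ħ (π f)) ∧ π (x₁ ħ) = x₂ ħ + cst s := by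
  obtain ⟨π, h, hp⟩ := exists_merPull_thetaFn (τ := τ) (ħ := ħ) (ρ := xIn (s * ħ)) rfl
  refine ⟨π, h, Subtype.ext (funext fun p => (hp _ p).trans ?_)⟩
  change (p.2 + s * ħ) / ħ = p.2 / ħ + s
  field_simp

theorem zIn_thetaFn : ∃ π : Entire ℂ →ₐ[ℂ] Entire (ℂ × ℂ),
    (∀ f, zIn (thetaFn τ ħ f) = thetaFn τ ħ (π f)) ∧ π (x₁ ħ) = z₂ ħ := by
  obtain ⟨π, h, hp⟩ := exists_merPull_thetaFn (τ := τ) (ħ := ħ) (ρ := zIn) rfl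
  exact ⟨π, h, Subtype.ext (funext fun p => hp _ p)⟩

variable (hħ : ħ ≠ 0)
include hħ

theorem wcoef_isRep {α β : ℂ} {L : Sgn → Sgn → ℕ → (ℕ →₀ M2)}
    (hL : ∀ i j (b : ℕ), L i j b = Finsupp.single ((b : ℤ) + i.ind - j.ind).toNat
      (wcoef (thetaFn τ ħ) (z₂ ħ) (x₂ ħ) (cst α) (cst β) ((b : ℤ) : Entire (ℂ × ℂ)) i j))
    (i j m n : Sgn) (b a : ℕ) :
    (∑ p : Sgn, ∑ q : Sgn, inZW (ħ * (α - β - 2 * a)) (Rcoef τ ħ m n p q) *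
        (L q j b).sum fun c f => inZ 0 (L p i c a) * inW (i.val * ħ) f) =
      ∑ p : Sgn, ∑ q : Sgn, ((L m p b).sum fun c f => inW 0 (L n q c a) * inZ (q.val * ħ) f) *
          inZW 0 (Rcoef τ ħ p q i j) := by
  have hT := thetaMap_thetaFn (E := ℂ × ℂ × ℂ) τ ħ
  have e0 : (0 : ℂ) = 0 * ħ := (zero_mul ħ).symm
  obtain ⟨πz, hπz, z1, z2⟩ := inZ_thetaFn (τ := τ) hħ 0
  obtain ⟨πw, hπw, w1, w2⟩ := inW_thetaFn (τ := τ) hħ 0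
  obtain ⟨πr, hπr, r1, r2⟩ := inZW_thetaFn (τ := τ) hħ 0
  obtain ⟨πs, hπs, s1, s2⟩ := inZW_thetaFn (τ := τ) hħ (α - β - 2 * a)
  have zw : ∀ p q, ((L q j b).sum fun c f => inZ 0 (L p i c a) * inW (i.val * ħ) f) =
      if (a : ℤ) = b + q.ind - j.ind + p.ind - i.ind then
        wcoef (thetaFn τ ħ) (z₃ ħ) (x₃ ħ) (cst α) (cst β) ((b + q.ind - j.ind : ℤ) : Entire _) p i *
        wcoef (thetaFn τ ħ) (w₃ ħ) (x₃ ħ + ((2 * i.ind - 1 : ℤ) : Entire _)) (cst α) (cst β)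
          ((b : ℤ) : Entire _) q j else 0 := fun p q => by
    obtain ⟨π, hπ, h1, h2⟩ := inW_thetaFn (τ := τ) hħ i.val
    rw [e0, sum_mul_of_eq_wcoef hL hT hπz hπ, h1, h2, z1, z2, cst_val, map_zero,
      add_zero]
  have wz : ∀ p q, ((L m p b).sum fun c f => inW 0 (L n q c a) * inZ (q.val * ħ) f) =
      if (a : ℤ) = b + m.ind - p.ind + n.ind - q.ind then
        wcoef (thetaFn τ ħ) (w₃ ħ) (x₃ ħ) (cst α) (cst β) ((b + m.ind - p.ind : ℤ) : Entire _) n q *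
        wcoef (thetaFn τ ħ) (z₃ ħ) (x₃ ħ + ((2 * q.ind - 1 : ℤ) : Entire _)) (cst α) (cst β)
          ((b : ℤ) : Entire _) m p else 0 := fun p q => by
    obtain ⟨π, hπ, h1, h2⟩ := inZ_thetaFn (τ := τ) hħ q.val
    rw [e0, sum_mul_of_eq_wcoef hL hT hπw hπ, h1, h2, w1, w2, cst_val, map_zero,
      add_zero]
  have hπr' : ∀ f, inZW 0 (thetaFn τ ħ f) = thetaFn τ ħ ((πr : _ →+* Entire (ℂ × ℂ × ℂ)) f) :=
    fun f => (congrArg (fun s => inZW s (thetaFn τ ħ f)) e0).trans (hπr f)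
  have hπs' : ∀ f, inZW ((α - β - 2 * a) * ħ) (thetaFn τ ħ f) =
    thetaFn τ ħ ((πs : _ →+* Entire (ℂ × ℂ × ℂ)) f) := hπs
  simp only [Rcoef_eq hħ, mul_comm ħ, zw, wz, map_rcoef hπr', map_rcoef hπs',
    AlgHom.coe_toRingHom, r1, r2, s1, s2, map_zero, add_zero]
  -- A non-zero entry of the R-matrix preserves the total sign. Hence the conditions on the target
  -- index a in the various terms can all be replaced by a single one.
  have hl : ∀ (p q : Sgn) (t u : M3), rcoef (thetaFn τ ħ) (z₃ ħ - w₃ ħ)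
        (x₃ ħ + cst (α - β - 2 * a)) m n p q *
        (if (a : ℤ) = b + q.ind - j.ind + p.ind - i.ind then t else u) =
      rcoef (thetaFn τ ħ) (z₃ ħ - w₃ ħ) (x₃ ħ + cst (α - β - 2 * a)) m n p q *
        (if (a : ℤ) = b + m.ind + n.ind - i.ind - j.ind then t else u) := fun p q t u => by
    by_cases h : p.ind + q.ind = m.ind + n.ind
    · congr 2; rw [eq_iff_iff]; omega
    · rw [rcoef_of_ne _ _ _ h, zero_mul, zero_mul]
  have hr : ∀ (p q : Sgn) (t u : M3),
      (if (a : ℤ) = b + m.ind - p.ind + n.ind - q.ind then t else u) *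
        rcoef (thetaFn τ ħ) (z₃ ħ - w₃ ħ) (x₃ ħ) p q i j =
      (if (a : ℤ) = b + m.ind + n.ind - i.ind - j.ind then t else u) *
        rcoef (thetaFn τ ħ) (z₃ ħ - w₃ ħ) (x₃ ħ) p q i j := fun p q t u => by
    by_cases h : i.ind + j.ind = p.ind + q.ind
    · congr 2; rw [eq_iff_iff]; omega
    · rw [rcoef_of_ne _ _ _ h, mul_zero, mul_zero]
  simp only [hl, hr]
  by_cases ha : (a : ℤ) = b + m.ind + n.ind - i.ind - j.ind
  · have := hT.rll_wcoef (z := z₃ ħ) (w := w₃ ħ) (x := x₃ ħ) (thetaFn_x₃_ne_zero hħ)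
      (thetaFn_two_mul_x₃_ne_zero hħ) (thetaFn_w₃_ne_zero hħ) (thetaFn_z₃_sub_w₃_ne_zero hħ)
      α β b i j m n
    rw [← ha] at this
    simp only [if_pos ha]
    convert this using 7
    simp only [map_sub, map_mul, map_natCast, map_ofNat, Int.cast_natCast]
    ring
  · simp only [if_neg ha, mul_zero, zero_mul]

end

end EllipticQG

end

/-! ### RLL relations and quantum determinant of the asymptotic representations. -/

noncomputable section

namespace EllipticQG

open scoped UpperHalfPlane

universe u v

section

variable {τ : ℍ} {ħ : ℂ} (hħ : ħ ≠ 0)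
include hħ

omit hħ in
theorem wcoef_graded {α β : ℂ} {L : Sgn → Sgn → ℕ → (ℕ →₀ M2)}
    (hL : ∀ i j (b : ℕ), L i j b = Finsupp.single ((b : ℤ) + i.ind - j.ind).toNat
      (wcoef (thetaFn τ ħ) (z₂ ħ) (x₂ ħ) (cst α) (cst β) ((b : ℤ) : Entire (ℂ × ℂ)) i j))
    {i j : Sgn} {b a : ℕ} (h : L i j b a ≠ 0) : (a : ℤ) = b + i.ind - j.ind := by
  have hT := thetaMap_thetaFn (E := ℂ × ℂ) τ ħ
  rw [hL] at h
  have h2 : ((b : ℤ) + i.ind - j.ind).toNat = a := by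
    by_contra h0; exact h (Finsupp.single_eq_of_ne' h0)
  have h3 : 0 ≤ (b : ℤ) + i.ind - j.ind := by
    by_contra! h0
    obtain ⟨hb, rfl, rfl⟩ : b = 0 ∧ i = false ∧ j = true := by
      revert h0
      cases i <;> cases j <;> simp [Sgn.ind]; omega
    apply h
    rw [hb, Nat.cast_zero, Int.cast_zero, hT.wcoef_zero, Finsupp.single_zero]
    rfl
  omega

theorem asymptoticRep_isRep (ℓ s : ℂ) : (asymptoticRep τ ħ ℓ s).IsRep τ ħ where
  graded i j := fun (b a : ℕ) h => by
    have h := wcoef_graded (asymptoticRep_L (τ := τ) hħ ℓ s) h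
    have h4 : (a : ℂ) = b + i.ind - j.ind := mod_cast congrArg (Int.cast : ℤ → ℂ) h
    change ℓ - 2 * (a : ℂ) = ℓ - 2 * (b : ℂ) + _
    rw [h4, Sgn.val_eq, Sgn.val_eq]
    ring
  rll i j m n b a := by
    have := wcoef_isRep hħ (asymptoticRep_L (τ := τ) hħ ℓ s) i j m n b a
    rw [add_sub_cancel_right] at this
    exact this

/-- The function `θ(x - ħ) / θ(x)` of `(z, x)`. -/
def detRatio (τ : ℍ) (ħ : ℂ) : M2 := thetaFn τ ħ (x₂ ħ - 1) / thetaFn τ ħ (x₂ ħ)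

/-- The quantum determinant of an asymptotic representation. -/
def qdet (τ : ℍ) (ħ α β : ℂ) : M := thetaFn τ ħ (x₁ ħ + cst β) * thetaFn τ ħ (x₁ ħ + cst (α + 1))

omit hħ in
theorem zIn_qdet (α β : ℂ) : zIn (qdet τ ħ α β) =
    thetaFn τ ħ (z₂ ħ + cst β) * thetaFn τ ħ (z₂ ħ + cst α + 1) := by
  obtain ⟨π, hπ, h1⟩ := zIn_thetaFn (τ := τ) (ħ := ħ)
  rw [qdet, map_mul, hπ, hπ, map_add, map_add, h1, AlgHom.commutes, AlgHom.commutes, map_add,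
    map_one, add_assoc]

theorem qdet_ne_zero (α β : ℂ) : qdet τ ħ α β ≠ 0 :=
  mul_ne_zero (thetaFn_x₁_ne_zero hħ _) (thetaFn_x₁_ne_zero hħ _)

theorem wcoef_hasFullDet {α β : ℂ} {L : Sgn → Sgn → ℕ → (ℕ →₀ M2)}
    (hL : ∀ i j (b : ℕ), L i j b = Finsupp.single ((b : ℤ) + i.ind - j.ind).toNat
      (wcoef (thetaFn τ ħ) (z₂ ħ) (x₂ ħ) (cst α) (cst β) ((b : ℤ) : Entire (ℂ × ℂ)) i j)) :
    HasFullDet ħ (pairDet ħ) (detRatio τ ħ) (zIn (qdet τ ħ α β)) (fun b : ℕ => α - β - 2 * b) L := by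
  have hT := thetaMap_thetaFn (E := ℂ × ℂ) τ ħ
  have hx : Generic (thetaFn τ ħ) (x₂ ħ) := thetaFn_x₂_ne_zero hħ
  have e : ∀ (p i q j : Sgn) (b a : ℕ), prodCoef ħ (pairDet ħ) L p i q j b a =
      if (a : ℤ) = b + q.ind - j.ind + p.ind - i.ind then
        wcoef (thetaFn τ ħ) (z₂ ħ) (x₂ ħ) (cst α) (cst β) ((b + q.ind - j.ind : ℤ) : Entire _) p i *
        wcoef (thetaFn τ ħ) (z₂ ħ - 1) (x₂ ħ + ((2 * i.ind - 1 : ℤ) : Entire _)) (cst α) (cst β)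
          ((b : ℤ) : Entire _) q j else 0 := fun p i q j b a => by
    obtain ⟨π, hπ, h1, h2⟩ := shift_thetaFn (τ := τ) hħ 0 0
    obtain ⟨ϖ, hϖ, k1, k2⟩ := shift_thetaFn (τ := τ) hħ (-1) i.val
    rw [zero_mul] at hπ
    rw [neg_one_mul] at hϖ
    refine (sum_mul_of_eq_wcoef hL hT hπ hϖ p i q j b a).trans ?_
    rw [h1, h2, k1, k2, cst_val, map_zero, add_zero, add_zero, map_neg, map_one, ← sub_eq_add_neg]
  have n0 : ∀ k : ℤ, Generic (thetaFn τ ħ) (x₂ ħ + cst α - cst β - 2 * (k : Entire _)) := fun k => by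
    rw [generic_sub_two_mul_intCast, generic_sub_algebraMap, generic_add_algebraMap]
    exact hx
  have n1 : ∀ k : ℤ, thetaFn τ ħ (x₂ ħ + cst α - cst β - 2 * (k : Entire _)) ≠ 0 :=
    fun k => (n0 k).ne_zero
  have hx2 : thetaFn τ ħ (x₂ ħ - 1) ≠ 0 := ((generic_sub_one).2 hx).ne_zero
  have htr : ∀ a : ℕ, (pairDet ħ).translate (ħ * (α - β - 2 * a)) (detRatio τ ħ) =
      thetaFn τ ħ (x₂ ħ + cst α - cst β - 2 * ((a : ℤ) : Entire _) - 1) /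
        thetaFn τ ħ (x₂ ħ + cst α - cst β - 2 * ((a : ℤ) : Entire _)) := fun a => by
    obtain ⟨π, hπ, h1, h2⟩ := shift_thetaFn (τ := τ) hħ 0 (α - β - 2 * a)
    rw [zero_mul] at hπ
    change shift 0 _ _ = _
    rw [mul_comm, detRatio, map_div₀, hπ, hπ, map_sub, h2, map_one]
    simp only [map_sub, map_mul, map_natCast, map_ofNat, Int.cast_natCast]
    congr 2 <;> ring
  have v : 2 * Sgn.ind true - 1 = 1 ∧ 2 * Sgn.ind false - 1 = -1 ∧
      (∀ b : ℤ, b + Sgn.ind true - Sgn.ind true = b) ∧ (∀ b : ℤ, b + Sgn.ind false - Sgn.ind false = b) ∧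
      (∀ b : ℤ, b + Sgn.ind true - Sgn.ind false = b + 1) ∧
      (∀ b : ℤ, b + Sgn.ind false - Sgn.ind true = b - 1) := by simp [Sgn.ind]
  refine ⟨⟨fun b a => ?_, fun b a => ?_⟩, fun b a => ?_, fun b a => ?_⟩ <;> rw [e, e]
  · by_cases ha : (a : ℤ) = b - 1
    · have := ThetaMap.wcoef_minus (T := thetaFn τ ħ) hx.ne_zero hx2 (z₂ ħ) (cst α) (cst β)
        (b : ℤ)
      rw [if_pos (by simp [Sgn.ind]; omega), if_pos (by simp [Sgn.ind]; omega)]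
      simpa only [v, detRatio, Int.cast_add, Int.cast_sub, Int.cast_one, Int.cast_neg,
        ← sub_eq_add_neg] using this
    · rw [if_neg (by simp [Sgn.ind]; omega), if_neg (by simp [Sgn.ind]; omega), mul_zero]
  · by_cases ha : b = a
    · have := hT.wcoef_det hx.ne_zero hx2 (z₂ ħ) (cst α) (cst β) (b : ℤ)
        ((generic_add_one).2 (n0 b)).ne_zero
      rw [if_pos (by simp [Sgn.ind]; omega), if_pos (by simp [Sgn.ind]; omega), if_pos ha,
        zIn_qdet]
      simpa only [v, detRatio, Int.cast_add, Int.cast_sub, Int.cast_one, Int.cast_neg,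
        ← sub_eq_add_neg] using this
    · rw [if_neg (by simp [Sgn.ind]; omega), if_neg (by simp [Sgn.ind]; omega), if_neg ha,
        mul_zero, sub_zero]
  · by_cases ha : (a : ℤ) = b + 1
    · have := ThetaMap.wcoef_plus (T := thetaFn τ ħ) hx.ne_zero hx2 (z₂ ħ) (cst α) (cst β)
        (b : ℤ) ((generic_sub_one).2 (n0 b)).ne_zero (n1 b)
      rw [if_pos (by simp [Sgn.ind]; omega), if_pos (by simp [Sgn.ind]; omega)]
      simpa only [v, detRatio, Int.cast_add, Int.cast_sub, Int.cast_one, Int.cast_neg,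
        ← sub_eq_add_neg] using this
    · rw [if_neg (by simp [Sgn.ind]; omega), if_neg (by simp [Sgn.ind]; omega), mul_zero]
  · by_cases ha : b = a
    · have := hT.wcoef_det' hx.ne_zero hx2 (z₂ ħ) (cst α) (cst β) (b : ℤ) (n1 b)
      rw [if_pos (by simp [Sgn.ind]; omega), if_pos (by simp [Sgn.ind]; omega), if_pos ha,
        zIn_qdet, htr, ← ha]
      simpa only [v, detRatio, Int.cast_add, Int.cast_sub, Int.cast_one, Int.cast_neg,
        ← sub_eq_add_neg] using this
    · rw [if_neg (by simp [Sgn.ind]; omega), if_neg (by simp [Sgn.ind]; omega), if_neg ha,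
        mul_zero, sub_zero]

end

end EllipticQG

end

noncomputable section

namespace EllipticQG

/-! ### Triangular bases and flags of difference operators -/

section Flags

variable {ι k K : Type*} [Fintype ι] [Field k] [Field K]

/-- The semilinear operator with matrix `A`. -/
def semiOp (σ : k →+* K) (A : Matrix ι ι K) (v : ι → k) : ι → K := A.mulVec fun b => σ (v b)

/-- The inclusion of `k^ι` in `K^ι`. -/
def mapFun (σ : k →+* K) (v : ι → k) : ι → K := fun b => σ (v b)

/-- The extension of a linear form. -/
def mapForm (σ : k →+* K) (φ : (ι → k) →ₗ[k] k) (w : ι → K) : K :=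
  open scoped Classical in ∑ b, w b * σ (φ (Pi.single b 1))

/-- Two semilinear operators have a common flag with eigenvalues in the image of `ζ`. -/
def HasFlag (σ₀ σp σm ζ : k →+* K) (Kp Km : Matrix ι ι K) : Prop :=
  ∃ (n : ℕ) (F : Fin (n + 1) → Submodule k (ι → k)),
    Monotone F ∧ F 0 = ⊥ ∧ F (Fin.last n) = ⊤ ∧
    (∀ i, (∀ v ∈ F i, semiOp σp Kp v ∈ Submodule.span K (mapFun σ₀ '' (F i : Set (ι → k)))) ∧
      ∀ v ∈ F i, semiOp σm Km v ∈ Submodule.span K (mapFun σ₀ '' (F i : Set (ι → k)))) ∧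
    ∀ i : Fin n, ∃ (ap am : k) (φ : (ι → k) →ₗ[k] k), ap ≠ 0 ∧ am ≠ 0 ∧
      (F i.succ).map φ = ⊤ ∧ F i.succ ⊓ LinearMap.ker φ = F i.castSucc ∧
      ∀ v ∈ F i.succ, mapForm σ₀ φ (semiOp σp Kp v) = σp (φ v) * ζ ap ∧
        mapForm σ₀ φ (semiOp σm Km v) = σm (φ v) * ζ am

/-- A basis in which a semilinear operator is triangular, with diagonal `a`. -/
def IsTriangular {κ : Type*} (σ₀ σ ζ : k →+* K) (A : Matrix ι ι K) (r : κ → ℕ) (e : κ → ι → k)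
    (a : κ → k) : Prop :=
  ∀ i, semiOp σ A (e i) - ζ (a i) • mapFun σ₀ (e i) ∈
    Submodule.span K (mapFun σ₀ '' (e '' {j | r j < r i}))

variable {σ₀ σ ζ : k →+* K} {A : Matrix ι ι K}

theorem semiOp_add (v w : ι → k) : semiOp σ A (v + w) = semiOp σ A v + semiOp σ A w := by
  rw [semiOp, semiOp, semiOp, ← Matrix.mulVec_add]
  congr 1; ext b; simp

theorem semiOp_smul (g : k) (v : ι → k) : semiOp σ A (g • v) = σ g • semiOp σ A v := by
  rw [semiOp, semiOp, ← Matrix.mulVec_smul]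
  congr 1; ext b; simp

theorem semiOp_zero : semiOp σ A 0 = 0 := by simpa using semiOp_smul (σ := σ) (A := A) 0 0

omit [Fintype ι] in
theorem mapFun_add (v w : ι → k) : mapFun σ (v + w) = mapFun σ v + mapFun σ w := by
  ext b; simp [mapFun]

omit [Fintype ι] in
theorem mapFun_smul (g : k) (v : ι → k) : mapFun σ (g • v) = σ g • mapFun σ v := by
  ext b; simp [mapFun]

variable {φ : (ι → k) →ₗ[k] k}

theorem mapForm_add (v w : ι → K) : mapForm σ φ (v + w) = mapForm σ φ v + mapForm σ φ w := by
  simp [mapForm, add_mul, Finset.sum_add_distrib]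

theorem mapForm_smul (g : K) (v : ι → K) : mapForm σ φ (g • v) = g * mapForm σ φ v := by
  simp [mapForm, Finset.mul_sum, mul_assoc]

theorem mapForm_mapFun (v : ι → k) : mapForm σ φ (mapFun σ v) = σ (φ v) := by
  classical
  have : v = ∑ b, v b • Pi.single b (1 : k) := by
    ext c; simp [Finset.sum_apply, Pi.single_apply]
  conv_rhs => rw [this]
  simp only [map_sum, map_smul, mapForm, mapFun, smul_eq_mul, map_mul]

theorem mapForm_eq_zero {S : Set (ι → k)} (hS : ∀ v ∈ S, φ v = 0) {w : ι → K}
    (hw : w ∈ Submodule.span K (mapFun σ '' S)) : mapForm σ φ w = 0 := by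
  induction hw using Submodule.span_induction with
  | mem x hx =>
    obtain ⟨v, hv, rfl⟩ := hx
    rw [mapForm_mapFun, hS v hv, map_zero]
  | zero => simp [mapForm]
  | add x y _ _ hx hy => rw [mapForm_add, hx, hy, add_zero]
  | smul g x _ hx => rw [mapForm_smul, hx, mul_zero]

theorem IsTriangular.comp_equiv {κ κ' : Type*} {r : κ → ℕ} {e : κ → ι → k} {a : κ → k}
    (h : IsTriangular σ₀ σ ζ A r e a) (f : κ' ≃ κ) {r' : κ' → ℕ}
    (hr : ∀ i j, r (f j) < r (f i) → r' j < r' i) :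
    IsTriangular σ₀ σ ζ A r' (e ∘ f) (a ∘ f) := fun i => by
  refine Submodule.span_mono (Set.image_mono ?_) (h (f i))
  rintro _ ⟨j, hj, rfl⟩
  exact ⟨f.symm j, hr _ _ (by simpa using hj), by simp⟩

theorem exists_sorting_equiv {κ : Type*} [Fintype κ] (r : κ → ℕ) :
    ∃ f : Fin (Fintype.card κ) ≃ κ, ∀ i j, r (f j) < r (f i) → j.val < i.val := by
  let e := (Fintype.equivFin κ).symm
  refine ⟨(Tuple.sort (r ∘ e)).trans e, fun i j h => ?_⟩
  by_contra! hij
  exact absurd (Tuple.monotone_sort (r ∘ e) (Fin.le_def.2 hij)) (not_le.2 h)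

theorem IsTriangular.stable {n : ℕ} {e : Fin n → ι → k} {a : Fin n → k}
    (h : IsTriangular σ₀ σ ζ A Fin.val e a) (m : ℕ) {v : ι → k}
    (hv : v ∈ Submodule.span k (e '' {j | j.val < m})) : semiOp σ A v ∈
      Submodule.span K (mapFun σ₀ '' (Submodule.span k (e '' {j | j.val < m}) : Set (ι → k))) := by
  induction hv using Submodule.span_induction with
  | mem x hx =>
    obtain ⟨i, hi, rfl⟩ := hx
    rw [← sub_add_cancel (semiOp σ A (e i)) (ζ (a i) • mapFun σ₀ (e i))]
    refine Submodule.add_mem _ (Submodule.span_mono ?_ (h i)) (Submodule.smul_mem _ _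
      (Submodule.subset_span ⟨_, Submodule.subset_span ⟨i, hi, rfl⟩, rfl⟩))
    refine Set.image_mono (subset_trans (Set.image_mono fun j hj => ?_) Submodule.subset_span)
    exact lt_trans (show j.val < i.val from hj) hi
  | zero => rw [semiOp_zero]; exact Submodule.zero_mem _
  | add x y _ _ hx hy => rw [semiOp_add]; exact Submodule.add_mem _ hx hy
  | smul g x _ hx => rw [semiOp_smul]; exact Submodule.smul_mem _ _ hx

theorem IsTriangular.mapForm_coord {n : ℕ} (e : Module.Basis (Fin n) k (ι → k)) {a : Fin n → k}
    (h : IsTriangular σ₀ σ ζ A Fin.val e a) (i : Fin n) {v : ι → k}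
    (hv : v ∈ Submodule.span k (e '' {j | j.val < i.val + 1})) :
    mapForm σ₀ (e.coord i) (semiOp σ A v) = σ (e.coord i v) * ζ (a i) := by
  induction hv using Submodule.span_induction with
  | mem x hx =>
    obtain ⟨l, hl, rfl⟩ := hx
    have h0 := mapForm_eq_zero (φ := e.coord i) (S := e '' {j | j.val < l.val}) (σ := σ₀) (by
      rintro _ ⟨j, hj, rfl⟩
      rw [Module.Basis.coord_apply, e.repr_self, Finsupp.single_apply, if_neg]
      rintro rfl
      simp only [Set.mem_ofPred_eq] at hl hj
      omega) (h l)
    rw [sub_eq_add_neg, ← neg_smul, mapForm_add, mapForm_smul, mapForm_mapFun] at h0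
    rw [eq_neg_of_add_eq_zero_left h0, Module.Basis.coord_apply, e.repr_self, Finsupp.single_apply]
    split_ifs with hli
    · rw [hli]; simp
    · simp
  | zero => rw [semiOp_zero]; simp [mapForm]
  | add x y _ _ hx hy => rw [semiOp_add, mapForm_add, hx, hy]; simp [add_mul]
  | smul g x _ hx => rw [semiOp_smul, mapForm_smul, hx]; simp [mul_assoc]

variable {σp σm : k →+* K} {Kp Km : Matrix ι ι K}

/-- The flag consists of the spans of initial segments once the basis is sorted by r. The dual
coordinates identify its successive quotients with one-dimensional objects. -/
theorem hasFlag_of_triangular {κ : Type*} [Fintype κ] (r : κ → ℕ)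
    (e : Module.Basis κ k (ι → k)) {ap am : κ → k} (hap : ∀ i, ap i ≠ 0) (ham : ∀ i, am i ≠ 0)
    (hp : IsTriangular σ₀ σp ζ Kp r e ap) (hm : IsTriangular σ₀ σm ζ Km r e am) :
    HasFlag σ₀ σp σm ζ Kp Km := by
  obtain ⟨f, hf⟩ := exists_sorting_equiv r
  have hp' := hp.comp_equiv f hf
  have hm' := hm.comp_equiv f hf
  set e' := e.reindex f.symm with he
  have hcoe : e ∘ f = e' := by ext i; simp [he]
  rw [hcoe] at hp' hm'
  refine ⟨Fintype.card κ, fun i : Fin (Fintype.card κ + 1) => Submodule.span k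
    (e' '' {j : Fin (Fintype.card κ) | j.val < i.val}), ?_, ?_, ?_, ?_, fun i => ?_⟩
  · exact fun i j hij => Submodule.span_mono (Set.image_mono fun l hl =>
      lt_of_lt_of_le (show l.val < i.val from hl) (Fin.le_def.1 hij))
  · simp
  · simp only [Fin.val_last, Fin.is_lt, Set.ofPred_true, Set.image_univ]
    exact e'.span_eq
  · exact fun i => ⟨fun v hv => hp'.stable i.val hv, fun v hv => hm'.stable i.val hv⟩
  · refine ⟨_, _, e'.coord i, hap (f i), ham (f i), ?_, ?_, fun v hv =>
      ⟨hp'.mapForm_coord e' i hv, hm'.mapForm_coord e' i hv⟩⟩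
    · refine eq_top_iff.2 fun c _ => ⟨c • e' i, ?_, by simp⟩
      exact Submodule.smul_mem _ _ (Submodule.subset_span ⟨i, by simp, rfl⟩)
    · ext v
      simp only [Submodule.mem_inf, LinearMap.mem_ker, Module.Basis.mem_span_image,
        Module.Basis.coord_apply]
      constructor
      · rintro ⟨h1, h2⟩ j hj
        have := h1 hj
        have hij : j ≠ i := by rintro rfl; simp [h2] at hj
        simp only [Fin.val_succ, Set.mem_ofPred_eq, Fin.val_castSucc] at this ⊢
        have : j.val ≠ i.val := fun h => hij (Fin.ext h)
        omega
      · intro h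
        refine ⟨fun j hj => ?_, ?_⟩
        · have := h hj
          simp only [Fin.val_succ, Set.mem_ofPred_eq, Fin.val_castSucc] at this ⊢
          omega
        · by_contra h0
          have := h (Finsupp.mem_support_iff.2 h0)
          simp at this

/-- A vector with φ = 1 is picked in each step of the flag. This converse of `hasFlag_of_triangular`
is needed for direct sums: triangular bases of the summands can be united, whereas flags would have
to be interleaved. -/
theorem HasFlag.exists_triangular (h : HasFlag σ₀ σp σm ζ Kp Km) :
    ∃ (n : ℕ) (e : Module.Basis (Fin n) k (ι → k)) (ap am : Fin n → k), (∀ i, ap i ≠ 0) ∧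
      (∀ i, am i ≠ 0) ∧ IsTriangular σ₀ σp ζ Kp Fin.val e ap ∧
      IsTriangular σ₀ σm ζ Km Fin.val e am := by
  obtain ⟨n, F, hF, h0, h1, hst, h⟩ := h
  choose ap am φ hap ham hmap hker hφ using h
  have : ∀ i : Fin n, ∃ v ∈ F i.succ, φ i v = 1 := fun i => by
    have : (1 : k) ∈ (F i.succ).map (φ i) := by rw [hmap]; trivial
    exact this
  choose v hv hv1 using this
  have hle : ∀ i : Fin n, ∀ w ∈ F i.castSucc, φ i w = 0 := fun i w hw => by
    rw [← hker] at hw; exact hw.2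
  have hspan : ∀ i : Fin (n + 1), F i = Submodule.span k (v '' {j | j.val < i.val}) := by
    intro i
    induction i using Fin.induction with
    | zero => simp [h0]
    | succ i ih =>
      refine le_antisymm (fun w hw => ?_) (Submodule.span_le.2 ?_)
      · have h2 : w - φ i w • v i ∈ F i.castSucc := by
          rw [← hker]
          exact ⟨Submodule.sub_mem _ hw (Submodule.smul_mem _ _ (hv i)), by simp [hv1]⟩
        rw [← sub_add_cancel w (φ i w • v i)]
        refine Submodule.add_mem _ ?_ (Submodule.smul_mem _ _ (Submodule.subset_span
          ⟨i, by simp, rfl⟩))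
        rw [ih] at h2
        refine Submodule.span_mono (Set.image_mono fun j hj => ?_) h2
        simp only [Fin.val_succ, Set.mem_ofPred_eq, Fin.val_castSucc] at hj ⊢
        omega
      · rintro _ ⟨j, hj, rfl⟩
        exact hF (Fin.le_def.2 (by simp only [Fin.val_succ, Set.mem_ofPred_eq] at hj ⊢; omega)) (hv j)
  have hz : ∀ i j : Fin n, j.val < i.val → φ i (v j) = 0 := fun i j hij => hle i _ (by
    rw [hspan]; exact Submodule.subset_span ⟨j, hij, rfl⟩)
  have hli : LinearIndependent k v := by
    rw [Fintype.linearIndependent_iff]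
    intro g hg
    classical
    by_contra! hne
    -- With i the largest index of a non-zero coefficient, φ i kills all other terms of the
    -- relation.
    obtain ⟨i, hi, hmax⟩ := (Finset.univ.filter fun i => g i ≠ 0).exists_max_image Fin.val
      (by obtain ⟨i, hi⟩ := hne; exact ⟨i, by simpa using hi⟩)
    have := congrArg (φ i) hg
    rw [map_sum, map_zero, Finset.sum_eq_single i] at this
    · simp only [map_smul, hv1, smul_eq_mul, mul_one] at this
      exact (Finset.mem_filter.1 hi).2 this
    · intro j _ hj
      by_cases hgj : g j = 0
      · simp [hgj]
      · have := hmax j (by simpa using hgj)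
        rw [map_smul, hz i j (lt_of_le_of_ne this fun h => hj (Fin.ext h)), smul_zero]
    · simp
  have htop : ⊤ ≤ Submodule.span k (Set.range v) := by
    rw [← h1, hspan]
    exact Submodule.span_mono (Set.image_subset_range _ _)
  have key : ∀ (σ : k →+* K) (A : Matrix ι ι K) (a : Fin n → k),
      (∀ i, ∀ w ∈ F i, semiOp σ A w ∈ Submodule.span K (mapFun σ₀ '' (F i : Set (ι → k)))) →
      (∀ i, mapForm σ₀ (φ i) (semiOp σ A (v i)) = σ (φ i (v i)) * ζ (a i)) →
      IsTriangular σ₀ σ ζ A Fin.val v a := by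
    intro σ A a hA hφA i
    have hw := Submodule.sub_mem _ (hA i.succ _ (hv i))
      (Submodule.smul_mem _ (ζ (a i)) (Submodule.subset_span ⟨_, hv i, rfl⟩))
    have hf : mapForm σ₀ (φ i) (semiOp σ A (v i) - ζ (a i) • mapFun σ₀ (v i)) = 0 := by
      rw [sub_eq_add_neg, ← neg_smul, mapForm_add, mapForm_smul, mapForm_mapFun, hφA, hv1]
      simp
    have hdec : ∀ w ∈ Submodule.span K (mapFun σ₀ '' (F i.succ : Set (ι → k))),
        w - mapForm σ₀ (φ i) w • mapFun σ₀ (v i) ∈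
          Submodule.span K (mapFun σ₀ '' (v '' {j | j.val < i.val})) := by
      intro w hw
      induction hw using Submodule.span_induction with
      | mem x hx =>
        obtain ⟨y, hy, rfl⟩ := hx
        have : y - φ i y • v i ∈ Submodule.span k (v '' {j | j.val < i.val}) := by
          have := hspan i.castSucc
          rw [Fin.val_castSucc] at this
          rw [← this, ← hker]
          exact ⟨Submodule.sub_mem _ hy (Submodule.smul_mem _ _ (hv i)), by simp [hv1]⟩
        rw [mapForm_mapFun, ← mapFun_smul]
        have e : mapFun σ₀ y - mapFun σ₀ (φ i y • v i) = mapFun σ₀ (y - φ i y • v i) := by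
          ext b; simp [mapFun]
        rw [e]
        clear e
        generalize y - φ i y • v i = u at this
        induction this using Submodule.span_induction with
        | mem x hx => exact Submodule.subset_span ⟨x, hx, rfl⟩
        | zero => convert Submodule.zero_mem _; ext b; simp [mapFun]
        | add x y _ _ hx hy => rw [mapFun_add]; exact Submodule.add_mem _ hx hy
        | smul g x _ hx => rw [mapFun_smul]; exact Submodule.smul_mem _ _ hx
      | zero => simp [mapForm]
      | add x y _ _ hx hy =>
        rw [mapForm_add, add_smul, add_sub_add_comm]
        exact Submodule.add_mem _ hx hy
      | smul g x _ hx =>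
        rw [mapForm_smul, mul_smul, ← smul_sub]
        exact Submodule.smul_mem _ _ hx
    have := hdec _ hw
    rwa [hf, zero_smul, sub_zero] at this
  refine ⟨n, Module.Basis.mk hli htop, ap, am, hap, ham, ?_, ?_⟩ <;> rw [Module.Basis.coe_mk]
  · exact key _ _ _ (fun i => (hst i).1) fun i => (hφ i _ (hv i)).1
  · exact key _ _ _ (fun i => (hst i).2) fun i => (hφ i _ (hv i)).2

theorem hasMeromorphicEigenvalues_iff {ħ : ℂ} {Kp Km : Matrix ι ι M2} :
    HasMeromorphicEigenvalues ħ Kp Km ↔ HasFlag (xIn 0) (xIn ħ) (xIn (-ħ)) zIn Kp Km := Iff.rfl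

end Flags

end EllipticQG

end

noncomputable section

namespace EllipticQG

open scoped UpperHalfPlane

universe u v

/-! ### Representations with triangular `K_-` -/

section Triangular

variable {ι k K : Type*} [Fintype ι] [Field k] [Field K] {σ₀ σ ζ : k →+* K} {A : Matrix ι ι K}

theorem isTriangular_single [DecidableEq ι] {r : ι → ℕ} {a : ι → k}
    (h : ∀ c b, A c b ≠ 0 → c = b ∨ r c < r b) (ha : ∀ b, A b b = ζ (a b)) :
    IsTriangular σ₀ σ ζ A r (Pi.basisFun k ι) a := fun b => by
  have e : semiOp σ A (Pi.basisFun k ι b) - ζ (a b) • mapFun σ₀ (Pi.basisFun k ι b) =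
      ∑ c, (if c = b then 0 else A c b) • mapFun σ₀ (Pi.basisFun k ι c) := by
    ext c
    simp only [semiOp, mapFun, Pi.basisFun_apply, Pi.single_apply, Pi.sub_apply, Pi.smul_apply,
      Finset.sum_apply, smul_eq_mul, Matrix.mulVec, dotProduct, 
      mul_ite, mul_one, mul_zero, Finset.sum_ite_eq, Finset.sum_ite_eq', Finset.mem_univ, if_true,
      apply_ite σ, apply_ite σ₀, map_one, map_zero]
    split_ifs with hc
    · rw [hc, ha, sub_self]
    · rw [sub_zero]
  rw [e]
  refine Submodule.sum_mem _ fun c _ => ?_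
  split_ifs with hc
  · rw [zero_smul]; exact Submodule.zero_mem _
  · by_cases h0 : A c b = 0
    · rw [h0, zero_smul]; exact Submodule.zero_mem _
    · exact Submodule.smul_mem _ _ (Submodule.subset_span ⟨_, ⟨c, (h c b h0).resolve_left hc, rfl⟩,
        rfl⟩)

theorem det_ne_zero_of_triangular [DecidableEq ι] {r : ι → ℕ} (hr : Function.Injective r)
    (h : A.BlockTriangular r) (ha : ∀ b, A b b ≠ 0) : A.det ≠ 0 := by
  let : LinearOrder ι := LinearOrder.lift' r hr
  have h2 : A.BlockTriangular id := fun i j hij => h hij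
  have := Matrix.det_of_isUpperTriangular h2
  rw [show A.det = ∏ i, A i i by convert this]
  exact Finset.prod_ne_zero_iff.2 fun b _ => ha b

theorem inv_diag_of_triangular [DecidableEq ι] {r : ι → ℕ} (hr : Function.Injective r)
    (h : A.BlockTriangular r) (ha : ∀ b, A b b ≠ 0) :
    A⁻¹.BlockTriangular r ∧ ∀ b, A⁻¹ b b = (A b b)⁻¹ := by
  have hd := (det_ne_zero_of_triangular hr h ha).isUnit
  have := A.invertibleOfIsUnitDet hd
  have hi : A⁻¹.BlockTriangular r := Matrix.blockTriangular_inv_of_blockTriangular h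
  refine ⟨hi, fun b => eq_inv_of_mul_eq_one_left ?_⟩
  have := congrFun (congrFun (A.nonsing_inv_mul hd) b) b
  rw [Matrix.mul_apply, Finset.sum_eq_single b, Matrix.one_apply_eq] at this
  · exact this
  · intro c _ hc
    rcases lt_trichotomy (r c) (r b) with h1 | h1 | h1
    · rw [hi h1, zero_mul]
    · exact absurd (hr h1) hc
    · rw [h h1, mul_zero]
  · simp

end Triangular

namespace LData

variable {ħ : ℂ} {τ : ℍ} {X : LData.{u}}

theorem sum_eq_sum_fiber {N R : Type*} [AddCommMonoid N] [Zero R] {γ : ℂ} [Fintype (X.Fiber γ)]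
    {f : X.B →₀ R} (hf : ∀ c, f c ≠ 0 → X.wt c = γ) (g : X.B → R → N) (h0 : ∀ c, g c 0 = 0) :
    f.sum g = ∑ c : X.Fiber γ, g c (f c) := by
  classical
  rw [Finsupp.sum]
  refine Eq.trans ?_ (Finset.sum_map Finset.univ (Function.Embedding.subtype fun b => X.wt b = γ)
    fun c => g c (f c))
  refine Finset.sum_subset (fun c hc => ?_) fun c _ hc => ?_
  · exact Finset.mem_map.2 ⟨⟨c, hf c (Finsupp.mem_support_iff.1 hc)⟩, Finset.mem_univ _, rfl⟩
  · rw [Finsupp.notMem_support_iff.1 hc, h0]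

theorem prodCoef_eq_block (hX : X.IsRep τ ħ) {α β γ : ℂ} [Fintype (X.Fiber β)] {p i q j : Sgn}
    (hβ : β = α + (j.val - q.val)) (b : X.Fiber α) (a : X.Fiber γ) :
    prodCoef ħ (pairDet ħ) X.L p i q j b a =
      (X.block p i β γ * (X.block q j α β).map (shift (-ħ) (i.val * ħ))) a b := by
  rw [prodCoef, sum_eq_sum_fiber (γ := β), Matrix.mul_apply]
  · refine Finset.sum_congr rfl fun c _ => ?_
    change shift 0 0 _ * shift (-ħ) _ _ = _
    rw [shift_zero_apply]
    rfl
  · intro c hc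
    rw [hX.graded q j b c hc, b.2, hβ]
  · intro c
    rw [map_zero, mul_zero]

/-- This is K_+(z) K_-(z - ħ) = D. The relation `minus` moves K_- past L_{-+}, which cancels the
inverse of K_- in the correction term, and `det` evaluates what is left. -/
theorem Kplus_mul (hX : X.IsRep τ ħ) [∀ α, Fintype (X.Fiber α)] {f D : M2}
    (h : HasDet ħ (pairDet ħ) f D X.L) (α : ℂ)
    (hdet : open scoped Classical in (X.Kminus (α + 2)).det ≠ 0) :
    open scoped Classical in
    X.Kplus α * (X.Kminus α).map (shift (-ħ) (Sgn.val true * ħ)) = Matrix.diagonal fun _ => D := by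
  classical
  have e1 : X.block false true α (α + 2) * (X.Kminus α).map (shift (-ħ) (Sgn.val true * ħ)) =
      f • (X.Kminus (α + 2) *
        (X.block false true α (α + 2)).map (shift (-ħ) (Sgn.val false * ħ))) := by
    ext a b
    have := h.minus b a
    rw [prodCoef_eq_block hX (β := α) (by simp), prodCoef_eq_block hX (β := α + 2)
      (by simp [Sgn.val]; norm_num)] at this
    exact this
  have e2 : X.block true true α α * (X.Kminus α).map (shift (-ħ) (Sgn.val true * ħ)) -
      f • (X.block true false (α + 2) α *
        (X.block false true α (α + 2)).map (shift (-ħ) (Sgn.val false * ħ))) =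
      Matrix.diagonal fun _ => D := by
    ext a b
    have := h.det b a
    rw [prodCoef_eq_block hX (β := α) (by simp), prodCoef_eq_block hX (β := α + 2)
      (by simp [Sgn.val]; norm_num)] at this
    refine Eq.trans this ?_
    rw [Matrix.diagonal_apply]
    by_cases hab : a = b
    · rw [if_pos hab, if_pos (by rw [hab])]
    · rw [if_neg hab, if_neg fun h => hab (Subtype.ext h.symm)]
  rw [Kplus, sub_mul, Matrix.mul_assoc, Matrix.mul_assoc, e1, Matrix.mul_smul, ← Matrix.mul_assoc
    (X.Kminus (α + 2))⁻¹, Matrix.mul_smul]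
  rw [← e2, Matrix.nonsing_inv_mul _ hdet.isUnit, Matrix.one_mul]

theorem exists_shift_zIn (s t : ℂ) (g : M) : ∃ g', shift s t (zIn g) = zIn g' := by
  have h1 : AnalyticOnNhd ℂ (fun p : ℂ × ℂ => p.1 + s) Set.univ := fun _ _ =>
    analyticAt_fst.add analyticAt_const
  have h2 : Function.Surjective (fun p : ℂ × ℂ => p.1 + s) := fun z => ⟨(z - s, 0), by simp⟩
  have h3 : AnalyticOnNhd ℂ (fun z : ℂ => z + s) Set.univ := fun _ _ =>
    analyticAt_id.add analyticAt_const
  have h4 : Function.Surjective (fun z : ℂ => z + s) := fun z => ⟨z - s, by simp⟩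
  have e1 : shift s t (zIn g) = merPull _ h1 h2 g := merPull_comp (fun p => rfl) g
  have e2 : zIn (merPull _ h3 h4 g) = merPull _ h1 h2 g := merPull_comp (fun p => rfl) g
  exact ⟨_, e1.trans e2.symm⟩

/-- The function r orders the basis of each weight space so that K_- is triangular with a diagonal
depending on z only. By `Kplus_mul`, K_+ is D times the inverse of a shift of K_-. The same basis is
therefore triangular for K_+, with diagonal D divided by the shifted one. -/
theorem inO_of_hasDet (hX : X.IsRep τ ħ) (hfin : ∀ α, Finite (X.Fiber α)) (A : Finset ℂ)
    (hA : ∀ b, ∃ α ∈ A, ∃ n : ℕ, X.wt b = α - 2 * n) {f : M2} {D : M} (hD : D ≠ 0)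
    (h : HasDet ħ (pairDet ħ) f (zIn D) X.L) (r : X.B → ℕ)
    (hr : ∀ b b', X.wt b = X.wt b' → r b = r b' → b = b') (κ : X.B → M) (hκ : ∀ b, κ b ≠ 0)
    (hdiag : ∀ b, X.L false false b b = zIn (κ b))
    (htri : ∀ b a, X.L false false b a ≠ 0 → r a ≤ r b) : X.InO τ ħ := by
  classical
  let := fun α => Fintype.ofFinite (X.Fiber α)
  have hinj : ∀ α, Function.Injective fun b : X.Fiber α => r b :=
    fun α b b' hb => Subtype.ext (hr _ _ (b.2.trans b'.2.symm) hb)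
  have hK : ∀ α, (X.Kminus α).BlockTriangular fun b => r b := fun α a b hab => by
    by_contra h0
    exact absurd (htri b a h0) (not_le.2 hab)
  have hz : ∀ {g : M}, g ≠ 0 → zIn g ≠ 0 := fun hg => (map_ne_zero _).2 hg
  have hKd : ∀ α (b : X.Fiber α), X.Kminus α b b = zIn (κ b) := fun α b => hdiag b
  have hdet : ∀ α, (X.Kminus α).det ≠ 0 := fun α =>
    det_ne_zero_of_triangular (hinj α) (hK α) fun b => by rw [hKd]; exact hz (hκ b)
  refine ⟨hX, inferInstance, ⟨A, hA⟩, fun α => by convert hdet α, fun α => ?_⟩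
  rw [hasMeromorphicEigenvalues_iff]
  set S := (X.Kminus α).map (shift (-ħ) (Sgn.val true * ħ)) with hS
  choose κ' hκ' using fun b => exists_shift_zIn (-ħ) (Sgn.val true * ħ) (κ b)
  have hSt : S.BlockTriangular fun b => r b := fun a b hab => by
    rw [hS, Matrix.map_apply, hK α hab, map_zero]
  have hSd : ∀ b : X.Fiber α, S b b = zIn (κ' b) := fun b => by
    rw [hS, Matrix.map_apply, hKd, hκ']
  have hκ0 : ∀ b, κ' b ≠ 0 := fun b h0 => by
    have := hκ' b
    rw [h0, map_zero, map_eq_zero, map_eq_zero] at this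
    exact hκ b this
  have hS0 : ∀ b, S b b ≠ 0 := fun b => by rw [hSd]; exact hz (hκ0 b)
  obtain ⟨hi, hid⟩ := inv_diag_of_triangular (hinj α) hSt hS0
  have hKp : X.Kplus α = zIn D • S⁻¹ := by
    have e : X.Kplus α * S = Matrix.diagonal fun _ => zIn D := by
      convert Kplus_mul hX h α (by convert hdet (α + 2))
    rw [← Matrix.mul_nonsing_inv_cancel_right S (X.Kplus α)
      ((det_ne_zero_of_triangular (hinj α) hSt hS0).isUnit), e]
    ext a b
    rw [Matrix.diagonal_mul, Matrix.smul_apply, smul_eq_mul]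
  have tri : ∀ {B : Matrix (X.Fiber α) (X.Fiber α) M2}, B.BlockTriangular (fun b => r b) →
      ∀ c b, B c b ≠ 0 → c = b ∨ r c < r b := fun hB c b h0 => by
    by_contra! hc
    rcases hc.2.lt_or_eq with h1 | h1
    · exact h0 (hB h1)
    · exact hc.1 (hinj α h1.symm)
  refine hasFlag_of_triangular (fun b : X.Fiber α => r b) (Pi.basisFun M _)
    (ap := fun b => D / κ' b) (am := fun b => κ b) (fun b => div_ne_zero hD (hκ0 b))
    (fun b => hκ b) ?_ ?_
  · rw [hKp]
    refine isTriangular_single (fun c b h0 => tri hi c b fun h1 => h0 ?_) fun b => ?_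
    · rw [Matrix.smul_apply, h1, smul_zero]
    · rw [Matrix.smul_apply, hid, hSd, smul_eq_mul, map_div₀, div_eq_mul_inv]
  · exact isTriangular_single (tri (hK α)) (hKd α)

end LData

end EllipticQG

end

noncomputable section

namespace EllipticQG

open scoped UpperHalfPlane

universe u v

/-! ### The asymptotic representations and their tensor products are in the category `O` -/

section

variable {τ : ℍ} {ħ : ℂ} (hħ : ħ ≠ 0)
include hħ

theorem asymptoticRep_hasFullDet (ℓ s : ℂ) :
    HasFullDet ħ (pairDet ħ) (detRatio τ ħ) (zIn (qdet τ ħ (ℓ + s) s))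
      (asymptoticRep τ ħ ℓ s).wt (asymptoticRep τ ħ ℓ s).L := by
  have := wcoef_hasFullDet hħ (asymptoticRep_L (τ := τ) hħ ℓ s)
  rw [add_sub_cancel_right] at this
  exact this

theorem asymptoticRep_minus (ℓ s : ℂ) (b a : ℕ) :
    (asymptoticRep τ ħ ℓ s).L false false b a =
      if b = a then zIn (thetaFn τ ħ (x₁ ħ + cst (s + b + 1))) else 0 := by
  obtain ⟨π, hπ, h1⟩ := zIn_thetaFn (τ := τ) (ħ := ħ)
  have h2 : π (x₁ ħ + cst (s + b + 1)) = z₂ ħ + cst s + ((b : ℤ) : Entire (ℂ × ℂ)) + 1 := by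
    rw [map_add, h1, AlgHom.commutes, map_add, map_add, map_one, map_natCast, Int.cast_natCast]
    ring
  rw [hπ, h2]
  have h := asymptoticRep_L (τ := τ) hħ ℓ s false false b
  have h3 : ((b : ℤ) + Sgn.ind false - Sgn.ind false).toNat = b := by simp
  rw [h3] at h
  rw [h]
  exact Finsupp.single_apply (a := b) (a' := a)

theorem asymptoticRep_inO (ℓ s : ℂ) : (asymptoticRep τ ħ ℓ s).InO τ ħ := by
  have hinj : ∀ b b' : ℕ, ℓ - 2 * (b : ℂ) = ℓ - 2 * b' → b = b' := fun b b' h => by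
    have : (b : ℂ) = b' := by linear_combination -h / 2
    exact_mod_cast this
  refine LData.inO_of_hasDet (asymptoticRep_isRep hħ ℓ s) (fun α => ?_) {ℓ}
    (fun b => ⟨ℓ, by simp, b, rfl⟩) (qdet_ne_zero hħ _ _) (asymptoticRep_hasFullDet hħ ℓ s).toHasDet
    (fun b : ℕ => b) (fun b b' h _ => hinj b b' h)
    (fun b : ℕ => thetaFn τ ħ (x₁ ħ + cst (s + b + 1))) (fun b => thetaFn_x₁_ne_zero hħ _)
    (fun b => (asymptoticRep_minus hħ ℓ s b b).trans (if_pos rfl)) fun (b a : ℕ) h => ?_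
  · have : Subsingleton ((asymptoticRep τ ħ ℓ s).Fiber α) :=
      ⟨fun b b' => Subtype.ext (hinj _ _ (b.2.trans b'.2.symm))⟩
    infer_instance
  · rw [asymptoticRep_minus hħ, ite_ne_right_iff] at h
    exact h.1.symm.le

/-- On the tensor product, L_{--} is L_{-+} ⊗ L_{+-} + L_{--} ⊗ L_{--}. The first term lowers the
first index and the second is diagonal, so that ordering by the first index makes K_- triangular;
its diagonal is the product of the two diagonals. -/
theorem tensor_asymptoticRep_inO (ℓ s ℓ' s' : ℂ) :
    ((asymptoticRep τ ħ ℓ s).tensor ħ (asymptoticRep τ ħ ℓ' s')).InO τ ħ := by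
  have hX := asymptoticRep_isRep (τ := τ) hħ ℓ s
  have hY := asymptoticRep_isRep (τ := τ) hħ ℓ' s'
  have hwt : ∀ b : ℕ × ℕ, ((asymptoticRep τ ħ ℓ s).tensor ħ (asymptoticRep τ ħ ℓ' s')).wt b =
      ℓ + ℓ' - 2 * ((b.1 + b.2 : ℕ) : ℂ) := fun b => by
    change ℓ - 2 * (b.1 : ℂ) + (ℓ' - 2 * (b.2 : ℂ)) = _
    push_cast; ring
  have hinj : ∀ b b' : ℕ × ℕ, ((asymptoticRep τ ħ ℓ s).tensor ħ (asymptoticRep τ ħ ℓ' s')).wt b =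
      ((asymptoticRep τ ħ ℓ s).tensor ħ (asymptoticRep τ ħ ℓ' s')).wt b' →
      b.1 + b.2 = b'.1 + b'.2 := fun b b' h => by
    rw [hwt, hwt] at h
    have : ((b.1 + b.2 : ℕ) : ℂ) = (b'.1 + b'.2 : ℕ) := by linear_combination -h / 2
    exact_mod_cast this
  have hdet := HasDet.tensorOp hY.graded (asymptoticRep_hasFullDet (τ := τ) hħ ℓ s).toHasDet
    (asymptoticRep_hasFullDet (τ := τ) hħ ℓ' s') fun u => shift_zIn u _
  rw [← map_mul] at hdet
  have hmm : ∀ b a : ℕ × ℕ,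
      ((asymptoticRep τ ħ ℓ s).tensor ħ (asymptoticRep τ ħ ℓ' s')).L false false b a =
      shift 0 (ħ * (asymptoticRep τ ħ ℓ' s').wt a.2)
          ((asymptoticRep τ ħ ℓ s).L false true b.1 a.1) *
        (asymptoticRep τ ħ ℓ' s').L true false b.2 a.2 +
      shift 0 (ħ * (asymptoticRep τ ħ ℓ' s').wt a.2)
          ((asymptoticRep τ ħ ℓ s).L false false b.1 a.1) *
        (asymptoticRep τ ħ ℓ' s').L false false b.2 a.2 := fun b a =>
    (tensorOp_apply false false b a).trans (Fintype.sum_bool _)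
  have hup : ∀ b a : ℕ, (asymptoticRep τ ħ ℓ s).L false true b a ≠ 0 → a + 1 = b := fun b a h => by
    have := wcoef_graded (asymptoticRep_L (τ := τ) hħ ℓ s) h
    simp only [Sgn.ind] at this
    omega
  have hdg : ∀ (l s : ℂ) (b : ℕ), (asymptoticRep τ ħ l s).L false false b b =
      zIn (thetaFn τ ħ (x₁ ħ + cst (s + b + 1))) := fun l s b =>
    (asymptoticRep_minus hħ l s b b).trans (if_pos rfl)
  have hz : ∀ u c : ℂ, shift 0 u (zIn (thetaFn τ ħ (x₁ ħ + cst c))) =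
      zIn (thetaFn τ ħ (x₁ ħ + cst c)) := fun u c => shift_zIn u _
  refine LData.inO_of_hasDet (LData.tensor_isRep hX hY) (fun α => ?_) {ℓ + ℓ'}
    (fun b => ⟨ℓ + ℓ', by simp, _, hwt b⟩) (mul_ne_zero (qdet_ne_zero hħ _ _) (qdet_ne_zero hħ _ _))
    hdet (fun b : ℕ × ℕ => b.1)
    (fun (b b' : ℕ × ℕ) h (h1 : b.1 = b'.1) => Prod.ext h1 (by have := hinj b b' h; omega))
    (fun b : ℕ × ℕ => thetaFn τ ħ (x₁ ħ + cst (s + b.1 + 1)) *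
      thetaFn τ ħ (x₁ ħ + cst (s' + b.2 + 1)))
    (fun b => mul_ne_zero (thetaFn_x₁_ne_zero hħ _) (thetaFn_x₁_ne_zero hħ _))
    (fun b : ℕ × ℕ => ?_) fun (b a : ℕ × ℕ) h => ?_
  · rcases isEmpty_or_nonempty
      (((asymptoticRep τ ħ ℓ s).tensor ħ (asymptoticRep τ ħ ℓ' s')).Fiber α) with h | ⟨⟨b, hb⟩⟩
    · infer_instance
    · obtain ⟨j, k⟩ : ℕ × ℕ := b
      refine Set.Finite.subset (Finset.finite_toSet (Finset.HasAntidiagonal.antidiagonal (j + k)))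
        fun (c : ℕ × ℕ) hc => ?_
      exact Finset.mem_coe.2 (Finset.HasAntidiagonal.mem_antidiagonal.2
        (hinj c (j, k) (Eq.trans hc hb.symm)))
  · have h0 : (asymptoticRep τ ħ ℓ s).L false true b.1 b.1 = 0 := by
      by_contra h; exact absurd (hup _ _ h) (by simp)
    rw [hmm b b, h0, hdg, hdg, map_zero, zero_mul, zero_add, hz, map_mul]
  · by_contra! hlt
    have hlt : b.1 < a.1 := hlt
    apply h
    have h0 : (asymptoticRep τ ħ ℓ s).L false true b.1 a.1 = 0 := by
      by_contra h1
      have := hup _ _ h1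
      omega
    have h1 := (asymptoticRep_minus (τ := τ) hħ ℓ s b.1 a.1).trans (if_neg (by omega))
    rw [hmm b a, h0, h1, map_zero, zero_mul, zero_mul, zero_add]

end

/-! ### Direct sums in the category `O` -/

namespace LData

variable {ι : Type v} {X : ι → LData.{u}} {τ : ℍ} {ħ : ℂ}

theorem directSum_L_apply (i j : Sgn) (s : ι) (b a : (X s).B) :
    (directSum X).L i j ⟨s, b⟩ ⟨s, a⟩ = (X s).L i j b a := by
  let f : (X s).B ↪ Σ s, (X s).B :=
    ⟨@Sigma.mk ι (fun s => (X s).B) s, sigma_mk_injective (β := fun s => (X s).B)⟩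
  exact Finsupp.embDomain_apply_self f _ a

theorem directSum_L_apply_of_ne (i j : Sgn) {s t : ι} (h : s ≠ t) (b : (X s).B) (a : (X t).B) :
    (directSum X).L i j ⟨s, b⟩ ⟨t, a⟩ = 0 := by
  refine Finsupp.embDomain_of_notMem_range _ _ _ ?_
  rintro ⟨c, hc⟩
  exact h (congrArg Sigma.fst hc)

theorem directSum_L_sum {N : Type*} [AddCommMonoid N] (i j : Sgn) (s : ι) (b : (X s).B)
    (g : (directSum X).B → M2 → N) :
    ((directSum X).L i j ⟨s, b⟩).sum g = ((X s).L i j b).sum fun c f => g ⟨s, c⟩ f :=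
  Finsupp.sum_embDomain ..

theorem directSum_isRep (h : ∀ s, (X s).IsRep τ ħ) : (directSum X).IsRep τ ħ where
  graded := by
    rintro i j ⟨s, b⟩ ⟨t, a⟩ hL
    by_cases hst : s = t
    · subst hst
      rw [directSum_L_apply] at hL
      exact (h s).graded i j b a hL
    · exact absurd (directSum_L_apply_of_ne i j hst b a) hL
  rll := by
    rintro i j m n ⟨s, b⟩ ⟨t, a⟩
    simp only [directSum_L_sum]
    by_cases hst : s = t
    · subst hst
      simp only [directSum_L_apply]
      exact (h s).rll i j m n b a
    · simp only [directSum_L_apply_of_ne _ _ hst, map_zero, zero_mul, Finsupp.sum, Finset.sum_const_zero,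
        mul_zero]

/-- The inclusion of the weight spaces of a summand. -/
def fiberIncl (X : ι → LData.{u}) (α : ℂ) (s : ι) : (X s).Fiber α → (directSum X).Fiber α :=
  fun b => ⟨⟨s, b.1⟩, b.2⟩

theorem fiberIncl_injective (α : ℂ) (s : ι) : Function.Injective (fiberIncl X α s) := fun _ _ h =>
  Subtype.ext (sigma_mk_injective (β := fun s => (X s).B) (congrArg Subtype.val h))

theorem extend_comp_map {A B R S : Type*} [Zero R] [Zero S] {f : A → B} (hf : Function.Injective f)
    (σ : R → S) (h0 : σ 0 = 0) (w : A → R) :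
    (fun b => σ (Function.extend f w 0 b)) = Function.extend f (fun a => σ (w a)) 0 := by
  ext b
  by_cases h : ∃ a, f a = b
  · obtain ⟨a, rfl⟩ := h
    rw [hf.extend_apply, hf.extend_apply]
  · rw [Function.extend_apply' _ _ _ h, Function.extend_apply' _ _ _ h]
    exact h0

theorem block_mulVec_extend {i j : Sgn} {α β : ℂ} {s : ι} [Fintype ((X s).Fiber α)]
    [Fintype ((directSum X).Fiber α)] (w : (X s).Fiber α → M2) :
    ((directSum X).block i j α β).mulVec (Function.extend (fiberIncl X α s) w 0) =
      Function.extend (fiberIncl X β s) (((X s).block i j α β).mulVec w) 0 := by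
  classical
  have hinj := fiberIncl_injective (X := X) α s
  have e : ∀ c, ((directSum X).block i j α β).mulVec (Function.extend (fiberIncl X α s) w 0) c =
      ∑ a, (directSum X).block i j α β c (fiberIncl X α s a) * w a := fun c => by
    rw [Matrix.mulVec, dotProduct]
    have := Finset.sum_map Finset.univ ⟨_, hinj⟩ fun b =>
      (directSum X).block i j α β c b * Function.extend (fiberIncl X α s) w 0 b
    simp only [Function.Embedding.coeFn_mk, hinj.extend_apply] at this
    rw [← this]
    refine (Finset.sum_subset (Finset.subset_univ _) fun b _ hb => ?_).symm
    rw [Function.extend_apply', Pi.zero_apply, mul_zero]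
    simpa using hb
  ext c
  rw [e]
  obtain ⟨⟨t, c⟩, hc⟩ := c
  by_cases hst : s = t
  · subst hst
    have := (fiberIncl_injective (X := X) β s).extend_apply
      (((X s).block i j α β).mulVec w) 0 ⟨c, hc⟩
    refine Eq.trans ?_ this.symm
    exact Finset.sum_congr rfl fun a _ => congrArg (· * w a) (directSum_L_apply i j s a.1 c)
  · rw [Function.extend_apply']
    · refine Finset.sum_eq_zero fun a _ => ?_
      refine mul_eq_zero_of_left ?_ _
      exact directSum_L_apply_of_ne i j hst a.1 c
    · rintro ⟨a, ha⟩
      exact hst (congrArg (fun b => b.1.1) ha)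

variable [∀ α, Fintype ((directSum X).Fiber α)]

omit [∀ α, Fintype ((directSum X).Fiber α)] in
theorem single_eq_extend {R : Type*} [Zero R] [DecidableEq ι] {α : ℂ} {s : ι}
    [DecidableEq ((X s).Fiber α)] [DecidableEq ((directSum X).Fiber α)]
    (b : (X s).Fiber α) (g : R) :
    Pi.single (fiberIncl X α s b) g = Function.extend (fiberIncl X α s) (Pi.single b g) 0 := by
  have hinj := fiberIncl_injective (X := X) α s
  ext c
  by_cases h : ∃ a, fiberIncl X α s a = c
  · obtain ⟨a, rfl⟩ := h
    rw [hinj.extend_apply, Pi.single_apply, Pi.single_apply]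
    simp only [hinj.eq_iff]
  · rw [Function.extend_apply' _ _ _ h, Pi.single_apply, if_neg fun h' => h ⟨b, h'.symm⟩]
    rfl

/-- K_- preserves the summands, so each basis vector already has a preimage in its own summand.
Surjectivity then replaces a computation of the determinant. -/
theorem det_Kminus_directSum (α : ℂ) (hf : ∀ s, Fintype ((X s).Fiber α))
    (h : ∀ s, open scoped Classical in ((X s).Kminus α).det ≠ 0) :
    open scoped Classical in ((directSum X).Kminus α).det ≠ 0 := by
  classical
  rw [← isUnit_iff_ne_zero, ← Matrix.isUnit_iff_isUnit_det, ← Matrix.mulVec_surjective_iff_isUnit]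
  have hs : ∀ b, (Pi.single b (1 : M2) : (directSum X).Fiber α → M2) ∈ LinearMap.range ((directSum X).Kminus α).mulVecLin := by
    rintro ⟨⟨s, b⟩, hb⟩
    have e := single_eq_extend (X := X) (s := s) (α := α) ⟨b, hb⟩ (1 : M2)
    refine ⟨Function.extend (fiberIncl X α s)
      (((X s).Kminus α)⁻¹.mulVec (Pi.single ⟨b, hb⟩ 1)) 0, ?_⟩
    rw [Matrix.mulVecLin_apply, Kminus, block_mulVec_extend]
    refine Eq.trans ?_ e.symm
    rw [Matrix.mulVec_mulVec]
    change Function.extend _ ((((X s).Kminus α) * ((X s).Kminus α)⁻¹).mulVec _) _ = _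
    rw [Matrix.mul_nonsing_inv _ (h s).isUnit, Matrix.one_mulVec]
  intro w
  have hw : w ∈ LinearMap.range ((directSum X).Kminus α).mulVecLin := by
    rw [← Finset.univ_sum_single w]
    refine Submodule.sum_mem _ fun b _ => ?_
    have := Submodule.smul_mem _ (w b) (hs b)
    rwa [← Pi.single_smul, smul_eq_mul, mul_one] at this
  exact hw

theorem Kplus_mulVec_extend (hf : ∀ s α, Fintype ((X s).Fiber α))
    (h : ∀ s α, open scoped Classical in ((X s).Kminus α).det ≠ 0) {α : ℂ} (s : ι)
    (w : (X s).Fiber α → M2) :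
    ((directSum X).Kplus α).mulVec (Function.extend (fiberIncl X α s) w 0) =
      Function.extend (fiberIncl X α s) (((X s).Kplus α).mulVec w) 0 := by
  classical
  have hinv : ∀ u : (X s).Fiber (α + 2) → M2,
      ((directSum X).Kminus (α + 2))⁻¹.mulVec (Function.extend (fiberIncl X (α + 2) s) u 0) =
        Function.extend (fiberIncl X (α + 2) s) (((X s).Kminus (α + 2))⁻¹.mulVec u) 0 := fun u => by
    have e := block_mulVec_extend (X := X) (i := false) (j := false) (β := α + 2)
      (((X s).Kminus (α + 2))⁻¹.mulVec u)
    change ((directSum X).Kminus (α + 2)).mulVec _ =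
      Function.extend _ (((X s).Kminus (α + 2)).mulVec _) (0 : (directSum X).Fiber (α + 2) → M2) at e
    rw [Matrix.mulVec_mulVec, Matrix.mul_nonsing_inv _ (h s (α + 2)).isUnit,
      Matrix.one_mulVec] at e
    rw [← e, Matrix.mulVec_mulVec, Matrix.nonsing_inv_mul _
      (det_Kminus_directSum (α + 2) (fun s => hf s _) fun s => h s _).isUnit, Matrix.one_mulVec]
  rw [Kplus, Kplus, Matrix.sub_mulVec, Matrix.sub_mulVec, ← Matrix.mulVec_mulVec,
    ← Matrix.mulVec_mulVec, ← Matrix.mulVec_mulVec, ← Matrix.mulVec_mulVec, block_mulVec_extend,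
    block_mulVec_extend, hinv, block_mulVec_extend]
  exact (map_sub (Function.ExtendByZero.linearMap M2 (fiberIncl X α s)) _ _).symm

omit [∀ α, Fintype ((directSum X).Fiber α)] in
theorem isTriangular_directSum {α : ℂ} [Fintype ((directSum X).Fiber α)]
    [∀ s, Fintype ((X s).Fiber α)] {σ₀ σ ζ : M →+* M2}
    {A : Matrix ((directSum X).Fiber α) ((directSum X).Fiber α) M2}
    {A' : ∀ s, Matrix ((X s).Fiber α) ((X s).Fiber α) M2}
    (hA : ∀ s w, A.mulVec (Function.extend (fiberIncl X α s) w 0) =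
      Function.extend (fiberIncl X α s) ((A' s).mulVec w) 0)
    {r : ∀ s, (X s).Fiber α → ℕ} {e : ∀ s, (X s).Fiber α → (X s).Fiber α → M}
    {a : ∀ s, (X s).Fiber α → M} (h : ∀ s, IsTriangular σ₀ σ ζ (A' s) (r s) (e s) (a s)) :
    IsTriangular σ₀ σ ζ A (fun b : (directSum X).Fiber α => r b.1.1 ⟨b.1.2, b.2⟩)
      (fun b : (directSum X).Fiber α =>
        Function.extend (fiberIncl X α b.1.1) (e b.1.1 ⟨b.1.2, b.2⟩) (0 : (directSum X).Fiber α → M))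
      (fun b : (directSum X).Fiber α => a b.1.1 ⟨b.1.2, b.2⟩) := by
  rintro ⟨⟨s, b⟩, hb⟩
  have hm : ∀ w : (X s).Fiber α → M, mapFun σ₀ (Function.extend (fiberIncl X α s) w 0) =
      Function.ExtendByZero.linearMap M2 (fiberIncl X α s) (mapFun σ₀ w) :=
    fun w => extend_comp_map (fiberIncl_injective α s) _ (map_zero σ₀) w
  have hs : ∀ w : (X s).Fiber α → M, semiOp σ A (Function.extend (fiberIncl X α s) w 0) =
      Function.ExtendByZero.linearMap M2 (fiberIncl X α s) (semiOp σ (A' s) w) := fun w => by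
    rw [semiOp, extend_comp_map (fiberIncl_injective α s) _ (map_zero σ), hA]
    rfl
  have h1 := Submodule.mem_map_of_mem (f := Function.ExtendByZero.linearMap M2 (fiberIncl X α s))
    (h s ⟨b, hb⟩)
  rw [map_sub, map_smul, ← hm, ← hs, Submodule.map_span] at h1
  refine Submodule.span_mono ?_ h1
  rintro _ ⟨_, ⟨_, ⟨c, hc, rfl⟩, rfl⟩, rfl⟩
  exact ⟨_, ⟨fiberIncl X α s c, hc, rfl⟩, hm _⟩

/-- Triangular bases of the summands, extended by zero, together form a triangular basis of each
weight space. Only the finiteness of the weight spaces and the bound on the weights have to be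
assumed. -/
theorem directSum_inO (h : ∀ s, (X s).InO τ ħ) (A : Finset ℂ)
    (hA : ∀ b, ∃ α ∈ A, ∃ n : ℕ, (directSum X).wt b = α - 2 * n) : (directSum X).InO τ ħ := by
  classical
  choose hrep hf hbd hdet hflag using h
  refine ⟨directSum_isRep hrep, inferInstance, ⟨A, hA⟩, fun α => by
    convert det_Kminus_directSum α (fun s => hf s α) (fun s => hdet s α), fun α => ?_⟩
  rw [hasMeromorphicEigenvalues_iff]
  choose n e ap am hap ham hp hm using fun s => HasFlag.exists_triangular (hflag s α)
  -- Reindexing each triangular basis by the standard basis of its fiber makes the united family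
  -- indexed by the fiber of the direct sum, so its size is right and spanning suffices.
  let f : ∀ s, (X s).Fiber α ≃ Fin (n s) := fun s => ((e s).indexEquiv (Pi.basisFun M _)).symm
  have hp' := isTriangular_directSum (A := (directSum X).Kplus α)
    (fun s w => Kplus_mulVec_extend hf hdet s w)
    (fun s => (hp s).comp_equiv (f s) (r' := fun b => (f s b).val) fun i j h => h)
  have hm' := isTriangular_directSum (A := (directSum X).Kminus α)
    (A' := fun s => (X s).Kminus α) (fun s w => block_mulVec_extend w)
    (fun s => (hm s).comp_equiv (f s) (r' := fun b => (f s b).val) fun i j h => h)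
  set E : (directSum X).Fiber α → (directSum X).Fiber α → M := fun b =>
    Function.extend (fiberIncl X α b.1.1) ((e b.1.1 ∘ f b.1.1) ⟨b.1.2, b.2⟩) (0 : (directSum X).Fiber α → M) with hE
  have hspan : ⊤ ≤ Submodule.span M (Set.range E) := by
    have h1 : ∀ b, (Pi.single b (1 : M) : (directSum X).Fiber α → M) ∈ Submodule.span M (Set.range E) := by
      rintro ⟨⟨s, b⟩, hb⟩
      have h2 := Submodule.mem_map_of_mem
        (f := Function.ExtendByZero.linearMap M (fiberIncl X α s))
        ((e s).mem_span (Pi.single (⟨b, hb⟩ : (X s).Fiber α) (1 : M)))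
      have h3 : Function.ExtendByZero.linearMap M (fiberIncl X α s)
          (Pi.single (⟨b, hb⟩ : (X s).Fiber α) (1 : M)) =
          Pi.single (⟨⟨s, b⟩, hb⟩ : (directSum X).Fiber α) 1 :=
        (single_eq_extend (X := X) (s := s) (α := α) ⟨b, hb⟩ (1 : M)).symm
      rw [h3, Submodule.map_span] at h2
      refine Submodule.span_mono ?_ h2
      rintro _ ⟨_, ⟨c, rfl⟩, rfl⟩
      refine ⟨fiberIncl X α s ((f s).symm c), ?_⟩
      change Function.extend _ (e s (f s ((f s).symm c))) (0 : (directSum X).Fiber α → M) = _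
      rw [Equiv.apply_symm_apply]
      rfl
    intro w _
    rw [← Finset.univ_sum_single w]
    refine Submodule.sum_mem _ fun b _ => ?_
    have := Submodule.smul_mem _ (w b) (h1 b)
    rwa [← Pi.single_smul, smul_eq_mul, mul_one] at this
  have hb := coe_basisOfTopLeSpanOfCardEqFinrank E hspan (by rw [Module.finrank_fintype_fun_eq_card])
  rw [← hb] at hp' hm'
  exact hasFlag_of_triangular _ _ (fun b => hap _ _) (fun b => ham _ _) hp' hm'

end LData

end EllipticQG

end

noncomputable section

namespace EllipticQG

open scoped UpperHalfPlane

universe u v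

/-! ### Extension of scalars and subrepresentations -/

/-- A generalized inverse turns kernels and quotients into conditions on linear maps, and these pass
to M2 through `ext`. In this way it replaces appeals to the flatness of M2 over M. -/
theorem exists_pseudoinverse {k V W : Type*} [Field k] [AddCommGroup V] [Module k V]
    [AddCommGroup W] [Module k W] (f : V →ₗ[k] W) : ∃ g : W →ₗ[k] V, ∀ v, f (g (f v)) = f v := by
  obtain ⟨g, hg⟩ := f.rangeRestrict.exists_rightInverse_of_surjective f.range_rangeRestrict
  obtain ⟨g', hg'⟩ := LinearMap.exists_extend g
  refine ⟨g', fun v => ?_⟩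
  have h1 : g' (f v) = g (f.rangeRestrict v) := LinearMap.congr_fun hg' (f.rangeRestrict v)
  have h2 : f.rangeRestrict (g (f.rangeRestrict v)) = f.rangeRestrict v := LinearMap.congr_fun hg _
  rw [h1]
  exact congrArg Subtype.val h2

namespace LData

section Extension

variable {X Y Z : LData.{u}}

theorem emb_add (v w : X.V) : X.emb (v + w) = X.emb v + X.emb w :=
  Finsupp.mapRange_add (RingHom.map_add (xIn 0)) v w

theorem emb_smul (g : M) (v : X.V) : X.emb (g • v) = xIn 0 g • X.emb v :=
  Finsupp.mapRange_smul' g (xIn 0 g) v fun x => by rw [smul_eq_mul, map_mul, smul_eq_mul]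

theorem emb_single (b : X.B) (g : M) : X.emb (Finsupp.single b g) = Finsupp.single b (xIn 0 g) :=
  Finsupp.mapRange_single

theorem ext_emb (φ : X.V →ₗ[M] Y.V) (v : X.V) : ext φ (X.emb v) = Y.emb (φ v) := by
  induction v using Finsupp.induction_linear with
  | zero => rw [map_zero, emb, emb, Finsupp.mapRange_zero, Finsupp.mapRange_zero, map_zero]
  | add v w hv hw => rw [emb_add, map_add, map_add, emb_add, hv, hw]
  | single b g =>
    rw [emb_single, ext, Finsupp.linearCombination_single, ← emb_smul, ← map_smul,
      Finsupp.smul_single, smul_eq_mul, mul_one]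

theorem ext_single (φ : X.V →ₗ[M] Y.V) (b : X.B) (f : M2) :
    ext φ (Finsupp.single b f) = f • Y.emb (φ (Finsupp.single b 1)) :=
  Finsupp.linearCombination_single ..

theorem ext_comp (ψ : Y.V →ₗ[M] Z.V) (φ : X.V →ₗ[M] Y.V) (w : X.V2) :
    ext (ψ ∘ₗ φ) w = ext ψ (ext φ w) := by
  have : ext (ψ ∘ₗ φ) = ext ψ ∘ₗ ext φ := Finsupp.lhom_ext fun b f => by
    rw [LinearMap.comp_apply, ext_single, ext_single, map_smul, ext_emb]
    rfl
  exact LinearMap.congr_fun this w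

theorem ext_add (ψ φ : X.V →ₗ[M] Y.V) (w : X.V2) : ext (ψ + φ) w = ext ψ w + ext φ w := by
  have : ext (ψ + φ) = ext ψ + ext φ := Finsupp.lhom_ext fun b f => by
    rw [LinearMap.add_apply, ext_single, ext_single, ext_single, LinearMap.add_apply, emb_add,
      smul_add]
  exact LinearMap.congr_fun this w

theorem ext_id (w : X.V2) : ext (LinearMap.id : X.V →ₗ[M] X.V) w = w := by
  have : ext (LinearMap.id : X.V →ₗ[M] X.V) = LinearMap.id := Finsupp.lhom_ext fun b f => by
    rw [ext_single, LinearMap.id_apply, LinearMap.id_apply, emb_single, map_one,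
      Finsupp.smul_single, smul_eq_mul, mul_one]
  exact LinearMap.congr_fun this w

/-- The extension of scalars of a subspace. -/
def extSpan (U : Submodule M X.V) : Submodule M2 X.V2 := Submodule.span M2 (X.emb '' U)

theorem extSpan_mono {U V : Submodule M X.V} (h : U ≤ V) : extSpan U ≤ extSpan V :=
  Submodule.span_mono (Set.image_mono h)

theorem emb_mem_extSpan {U : Submodule M X.V} {v : X.V} (h : v ∈ U) : X.emb v ∈ extSpan U :=
  Submodule.subset_span ⟨v, h, rfl⟩

theorem mem_extSpan_top (w : X.V2) : w ∈ extSpan (⊤ : Submodule M X.V) := by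
  induction w using Finsupp.induction_linear with
  | zero => exact Submodule.zero_mem _
  | add v w hv hw => exact Submodule.add_mem _ hv hw
  | single b f =>
    rw [← mul_one f, ← smul_eq_mul, ← Finsupp.smul_single, ← map_one (xIn 0), ← emb_single]
    exact Submodule.smul_mem _ _ (emb_mem_extSpan trivial)

theorem ext_mem_extSpan (φ : X.V →ₗ[M] Y.V) {U : Submodule M X.V} {V : Submodule M Y.V}
    (h : ∀ v ∈ U, φ v ∈ V) {w : X.V2} (hw : w ∈ extSpan U) : ext φ w ∈ extSpan V := by
  have : extSpan U ≤ (extSpan V).comap (ext φ) := Submodule.span_le.2 (by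
    rintro _ ⟨v, hv, rfl⟩
    change ext φ (X.emb v) ∈ extSpan V
    rw [ext_emb]
    exact emb_mem_extSpan (h v hv))
  exact this hw

theorem ext_eq_of_eqOn {φ ψ : X.V →ₗ[M] Y.V} {U : Submodule M X.V} (h : ∀ v ∈ U, φ v = ψ v)
    {w : X.V2} (hw : w ∈ extSpan U) : ext φ w = ext ψ w := by
  have : extSpan U ≤ LinearMap.eqLocus (ext φ) (ext ψ) := Submodule.span_le.2 (by
    rintro _ ⟨v, hv, rfl⟩
    change ext φ (X.emb v) = ext ψ (X.emb v)
    rw [ext_emb, ext_emb, h v hv])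
  exact this hw

theorem ext_zero_apply (w : X.V2) : ext (0 : X.V →ₗ[M] Y.V) w = 0 := by
  have := ext_add (0 : X.V →ₗ[M] Y.V) 0 w
  rw [add_zero] at this
  exact left_eq_add.1 this

/-- The map 1 - gφ, with g a generalized inverse of φ, projects onto the kernel. After extension of
scalars it still fixes every vector killed by the extension of φ, so that kernels commute with the
extension (`mem_extSpan_ker`). -/
theorem exists_projection_ker (φ : X.V →ₗ[M] Y.V) : ∃ p : X.V →ₗ[M] X.V,
    (∀ v, φ (p v) = 0) ∧ ∀ w, ext φ w = 0 → ext p w = w := by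
  obtain ⟨g, hg⟩ := exists_pseudoinverse φ
  refine ⟨LinearMap.id - g ∘ₗ φ, fun v => ?_, fun w hw => ?_⟩
  · rw [LinearMap.sub_apply, map_sub, LinearMap.comp_apply, hg, LinearMap.id_apply, sub_self]
  · have h1 := ext_add (LinearMap.id - g ∘ₗ φ) (g ∘ₗ φ) w
    have h2 : LinearMap.id - g ∘ₗ φ + g ∘ₗ φ = (LinearMap.id : X.V →ₗ[M] X.V) :=
      LinearMap.ext fun v => sub_add_cancel v (g (φ v))
    rw [h2, ext_id, ext_comp, hw, map_zero, add_zero] at h1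
    exact h1.symm

theorem mem_extSpan_ker {φ : X.V →ₗ[M] Y.V} {w : X.V2} (h : ext φ w = 0) :
    w ∈ extSpan (LinearMap.ker φ) := by
  obtain ⟨p, hp, hw⟩ := exists_projection_ker φ
  rw [← hw w h]
  exact ext_mem_extSpan p (fun v _ => hp v) (mem_extSpan_top w)

theorem exists_ker_eq (U : Submodule M X.V) : ∃ q : X.V →ₗ[M] X.V, LinearMap.ker q = U := by
  obtain ⟨g, hg⟩ := exists_pseudoinverse U.mkQ
  refine ⟨g ∘ₗ U.mkQ, le_antisymm (fun v hv => ?_) fun v hv => ?_⟩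
  · have h := hg v
    rw [show g (U.mkQ v) = 0 from hv, map_zero] at h
    exact (Submodule.Quotient.mk_eq_zero U).1 h.symm
  · change g (U.mkQ v) = 0
    rw [show U.mkQ v = 0 from (Submodule.Quotient.mk_eq_zero U).2 hv, map_zero]

theorem mem_extSpan_comap {φ : X.V →ₗ[M] Y.V} {U : Submodule M Y.V} {w : X.V2}
    (h : ext φ w ∈ extSpan U) : w ∈ extSpan (U.comap φ) := by
  obtain ⟨q, hq⟩ := exists_ker_eq U
  have h0 : ext (q ∘ₗ φ) w = 0 := by
    rw [ext_comp, ext_eq_of_eqOn (ψ := 0) (fun v hv => ?_) h, ext_zero_apply]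
    rw [← hq] at hv
    exact hv
  have := mem_extSpan_ker h0
  rwa [LinearMap.ker_comp, hq] at this

theorem mem_extSpan_inf {U V : Submodule M X.V} {w : X.V2} (hU : w ∈ extSpan U)
    (hV : w ∈ extSpan V) : w ∈ extSpan (U ⊓ V) := by
  obtain ⟨q, rfl⟩ := exists_ker_eq V
  obtain ⟨p, hp, hw⟩ := exists_projection_ker q
  have e : ext p w = w := by
    refine hw w ?_
    rw [ext_eq_of_eqOn (ψ := 0) (fun v hv => hv) hV, ext_zero_apply]
  have h := mem_extSpan_comap (φ := p) (U := U) (e.symm ▸ hU)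
  rw [← e]
  exact ext_mem_extSpan p (V := U ⊓ LinearMap.ker q)
    (fun v hv => Submodule.mem_inf.2 ⟨hv, LinearMap.mem_ker.2 (hp v)⟩) h

variable {ħ : ℂ} {i j : Sgn}

theorem act_add (v w : X.V) : X.act ħ i j (v + w) = X.act ħ i j v + X.act ħ i j w :=
  Finsupp.sum_add_index' (fun b => by rw [map_zero, zero_smul])
    fun b f g => by rw [RingHom.map_add, add_smul]

theorem act_single (b : X.B) (g : M) :
    X.act ħ i j (Finsupp.single b g) = xIn (j.val * ħ) g • X.L i j b :=
  Finsupp.sum_single_index (by rw [map_zero, zero_smul])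

theorem act_smul (g : M) (v : X.V) : X.act ħ i j (g • v) = xIn (j.val * ħ) g • X.act ħ i j v := by
  induction v using Finsupp.induction_linear with
  | zero => rw [smul_zero]; simp [act]
  | add v w hv hw => rw [smul_add, act_add, act_add, smul_add, hv, hw]
  | single b f => rw [Finsupp.smul_single, act_single, act_single, smul_smul, smul_eq_mul, map_mul]

theorem component_add (α : ℂ) (v w : X.V) :
    X.component α (v + w) = X.component α v + X.component α w := Finsupp.filter_add

theorem component_smul (α : ℂ) (g : M) (v : X.V) :
    X.component α (g • v) = g • X.component α v := Finsupp.filter_smul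

end Extension

section Subreps

variable {ħ : ℂ} {X Y : LData.{u}}

/-- The restriction of a linear map to a subspace preserves the gradings and commutes with the
`L_{ij}(z)`. -/
structure IsHomOn (ħ : ℂ) (W : Submodule M X.V) (φ : X.V →ₗ[M] Y.V) : Prop where
  graded : ∀ α, ∀ v ∈ W, φ (X.component α v) = Y.component α (φ v)
  comm : ∀ i j, ∀ v ∈ W, ext φ (X.act ħ i j v) = Y.act ħ i j (φ v)

theorem IsHomOn.mono {W W' : Submodule M X.V} {φ : X.V →ₗ[M] Y.V} (h : IsHomOn ħ W φ)
    (hW : W' ≤ W) : IsHomOn ħ W' φ :=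
  ⟨fun α v hv => h.graded α v (hW hv), fun i j v hv => h.comm i j v (hW hv)⟩

instance : Min (Subrep ħ X) := ⟨fun U V =>
  { space := U.space ⊓ V.space
    graded := fun α v hv => ⟨U.graded α v hv.1, V.graded α v hv.2⟩
    stable := fun i j v hv => mem_extSpan_inf (U.stable i j v hv.1) (V.stable i j v hv.2) }⟩

instance : Max (Subrep ħ X) := ⟨fun U V =>
  { space := U.space ⊔ V.space
    graded := fun α v hv => by
      obtain ⟨u, hu, w, hw, rfl⟩ := Submodule.mem_sup.1 hv
      rw [component_add]
      exact Submodule.add_mem_sup (U.graded α u hu) (V.graded α w hw)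
    stable := fun i j v hv => by
      obtain ⟨u, hu, w, hw, rfl⟩ := Submodule.mem_sup.1 hv
      rw [act_add]
      exact Submodule.add_mem _ (extSpan_mono le_sup_left (U.stable i j u hu))
        (extSpan_mono le_sup_right (V.stable i j w hw)) }⟩

instance : Bot (Subrep ħ X) := ⟨
  { space := ⊥
    graded := fun α v hv => by
      rw [(Submodule.mem_bot M).1 hv]
      exact (Submodule.mem_bot M).2 (Finsupp.filter_zero _)
    stable := fun i j v hv => by
      rw [(Submodule.mem_bot M).1 hv, act, Finsupp.sum_zero_index]
      exact Submodule.zero_mem _ }⟩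

instance : Top (Subrep ħ X) := ⟨
  { space := ⊤
    graded := fun _ _ _ => trivial
    stable := fun _ _ _ _ => mem_extSpan_top _ }⟩

theorem Subrep.inf_space (U V : Subrep ħ X) : (U ⊓ V).space = U.space ⊓ V.space := rfl

/-- The image of a subrepresentation. -/
def Subrep.map (U : Subrep ħ X) (φ : X.V →ₗ[M] Y.V) (h : IsHomOn ħ U.space φ) : Subrep ħ Y where
  space := U.space.map φ
  graded := by
    rintro α _ ⟨v, hv, rfl⟩
    exact ⟨_, U.graded α v hv, h.graded α v hv⟩
  stable := by
    rintro i j _ ⟨v, hv, rfl⟩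
    rw [← h.comm i j v hv]
    exact ext_mem_extSpan φ (V := U.space.map φ) (fun w hw => Submodule.mem_map_of_mem hw)
      (U.stable i j v hv)

/-- The preimage of a subrepresentation. -/
def Subrep.comap (U : Subrep ħ Y) (φ : X.V →ₗ[M] Y.V) (h : IsHomOn ħ ⊤ φ) : Subrep ħ X where
  space := U.space.comap φ
  graded α v hv := by
    change φ _ ∈ U.space
    rw [h.graded α v trivial]
    exact U.graded α _ hv
  stable i j v hv := by
    refine mem_extSpan_comap ?_
    rw [h.comm i j v trivial]
    exact U.stable i j _ hv

theorem quotientIso_iff {U W : Subrep ħ X} {S : LData.{u}} : QuotientIso ħ U W S ↔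
    ∃ φ : X.V →ₗ[M] S.V, W.space.map φ = ⊤ ∧ W.space ⊓ LinearMap.ker φ = U.space ∧
      IsHomOn ħ W.space φ :=
  ⟨fun ⟨φ, h1, h2, h3, h4⟩ => ⟨φ, h1, h2, h3, h4⟩, fun ⟨φ, h1, h2, h⟩ => ⟨φ, h1, h2, h.1, h.2⟩⟩

theorem QuotientIso.le {U W : Subrep ħ X} {S : LData.{u}} (h : QuotientIso ħ U W S) :
    U.space ≤ W.space := by
  obtain ⟨φ, -, h2, -⟩ := h
  exact h2 ▸ inf_le_left

theorem QuotientIso.congr {U W U' W' : Subrep ħ X} {S : LData.{u}} (h : QuotientIso ħ U W S)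
    (hU : U.space = U'.space) (hW : W.space = W'.space) : QuotientIso ħ U' W' S := by
  obtain ⟨φ, h⟩ := h
  rw [hU, hW] at h
  exact ⟨φ, h⟩

/-- Isomorphisms of subquotients are represented by linear maps on all of X. This one represents a
map on B + C that is f on B and 0 on C. -/
theorem exists_glue {k V W : Type*} [Field k] [AddCommGroup V] [Module k V]
    [AddCommGroup W] [Module k W] (f : V →ₗ[k] W) (B C : Submodule k V)
    (h : ∀ v ∈ B ⊓ C, f v = 0) :
    ∃ g : V →ₗ[k] W, (∀ v ∈ B, g v = f v) ∧ ∀ v ∈ C, g v = 0 := by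
  obtain ⟨s, hs⟩ := exists_pseudoinverse (C.mkQ ∘ₗ B.subtype)
  refine ⟨f ∘ₗ B.subtype ∘ₗ s ∘ₗ C.mkQ, fun v hv => ?_, fun v hv => ?_⟩
  · have h1 := hs ⟨v, hv⟩
    have h2 : (s (C.mkQ v) : V) - v ∈ C := (Submodule.Quotient.eq C).1 h1
    have h3 := h _ ⟨Submodule.sub_mem _ (s (C.mkQ v)).2 hv, h2⟩
    rw [map_sub, sub_eq_zero] at h3
    exact h3
  · change f (s (C.mkQ v)) = 0
    rw [show C.mkQ v = 0 from (Submodule.Quotient.mk_eq_zero C).2 hv, map_zero]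
    exact map_zero f

/-- A simple subquotient lies either in a subrepresentation or in the quotient by it. -/
theorem QuotientIso.cut {A B : Subrep ħ X} {S : LData.{u}} (hS : S.IsSimple ħ)
    (h : QuotientIso ħ A B S) (C : Subrep ħ X) :
    QuotientIso ħ (A ⊓ C) (B ⊓ C) S ∨ QuotientIso ħ (A ⊔ C) (B ⊔ C) S := by
  have hAB := h.le
  rw [quotientIso_iff] at h
  obtain ⟨φ, h1, h2, h3⟩ := h
  have hker : ∀ v ∈ B.space, φ v = 0 → v ∈ A.space := fun v hv h0 => by
    rw [← h2]; exact ⟨hv, h0⟩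
  have hA : ∀ v ∈ A.space, φ v = 0 := fun v hv => by rw [← h2] at hv; exact hv.2
  have h3' : IsHomOn ħ (B ⊓ C).space φ := h3.mono inf_le_left
  -- The image of B ∩ C in the simple S is 0 or S. If it is 0, extending φ by zero on C identifies
  -- (B + C)/(A + C) with S; otherwise φ itself identifies (B ∩ C)/(A ∩ C) with S.
  rcases hS.2 ((B ⊓ C).map φ h3') with h4 | h4
  · right
    have h5 : ∀ v ∈ B.space ⊓ C.space, φ v = 0 := fun v hv => by
      have : φ v ∈ ((B ⊓ C).map φ h3').space := ⟨v, hv, rfl⟩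
      rw [h4] at this
      exact (Submodule.mem_bot M).1 this
    obtain ⟨g, hg, hgC⟩ := exists_glue φ B.space C.space h5
    refine quotientIso_iff.2 ⟨g, ?_, ?_, ?_, ?_⟩
    · rw [← top_le_iff, ← h1]
      rintro _ ⟨v, hv, rfl⟩
      exact ⟨v, Submodule.mem_sup_left hv, hg v hv⟩
    · ext v
      constructor
      · rintro ⟨hv, h0⟩
        obtain ⟨b, hb, c, hc, rfl⟩ := Submodule.mem_sup.1 hv
        have h0 : g (b + c) = 0 := h0
        rw [map_add, hgC c hc, add_zero, hg b hb] at h0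
        exact Submodule.add_mem_sup (hker b hb h0) hc
      · intro hv
        obtain ⟨b, hb, c, hc, rfl⟩ := Submodule.mem_sup.1 hv
        refine ⟨Submodule.add_mem_sup (hAB hb) hc, ?_⟩
        change g (b + c) = 0
        rw [map_add, hgC c hc, add_zero, hg b (hAB hb), hA b hb]
    · intro α v hv
      obtain ⟨b, hb, c, hc, rfl⟩ := Submodule.mem_sup.1 hv
      rw [component_add, map_add, map_add, hg _ (B.graded α b hb), hgC _ (C.graded α c hc),
        hgC c hc, hg b hb, add_zero, add_zero, h3.graded α b hb]
    · intro i j v hv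
      obtain ⟨b, hb, c, hc, rfl⟩ := Submodule.mem_sup.1 hv
      rw [act_add, map_add, map_add, ext_eq_of_eqOn hg (B.stable i j b hb),
        ext_eq_of_eqOn (ψ := 0) hgC (C.stable i j c hc), ext_zero_apply,
        hgC c hc, hg b hb, add_zero, add_zero, h3.comm i j b hb]
  · left
    refine quotientIso_iff.2 ⟨φ, h4, ?_, h3'⟩
    rw [Subrep.inf_space, Subrep.inf_space, inf_right_comm, h2]

theorem QuotientIso.map {A B : Subrep ħ X} {S : LData.{u}} (h : QuotientIso ħ A B S)
    {φ : X.V →ₗ[M] Y.V} (hφ : IsHomOn ħ ⊤ φ) (hK : LinearMap.ker φ ≤ A.space) :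
    QuotientIso ħ (A.map φ (hφ.mono le_top)) (B.map φ (hφ.mono le_top)) S := by
  have hAB := h.le
  rw [quotientIso_iff] at h
  obtain ⟨f, h1, h2, h3⟩ := h
  obtain ⟨s, hs⟩ := exists_pseudoinverse φ
  have hA : ∀ v ∈ A.space, f v = 0 := fun v hv => by rw [← h2] at hv; exact hv.2
  have key : ∀ v ∈ B.space, (f ∘ₗ s ∘ₗ φ) v = f v := fun v _ => by
    have : s (φ v) - v ∈ A.space := hK (by rw [LinearMap.mem_ker, map_sub, hs, sub_self])
    have := hA _ this
    rw [map_sub, sub_eq_zero] at this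
    exact this
  have key' : ∀ v ∈ B.space, (f ∘ₗ s) (φ v) = f v := key
  refine quotientIso_iff.2 ⟨f ∘ₗ s, ?_, ?_, ?_, ?_⟩
  · rw [← top_le_iff, ← h1]
    rintro _ ⟨v, hv, rfl⟩
    exact ⟨φ v, ⟨v, hv, rfl⟩, key v hv⟩
  · ext w
    constructor
    · rintro ⟨⟨v, hv, rfl⟩, h0⟩
      have h0 : (f ∘ₗ s) (φ v) = 0 := h0
      rw [key' v hv] at h0
      refine ⟨v, ?_, rfl⟩
      change v ∈ A.space
      rw [← h2]
      exact ⟨hv, h0⟩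
    · rintro ⟨v, hv, rfl⟩
      refine ⟨⟨v, hAB hv, rfl⟩, ?_⟩
      change (f ∘ₗ s) (φ v) = 0
      rw [key' v (hAB hv), hA v hv]
  · rintro α _ ⟨v, hv, rfl⟩
    rw [← hφ.graded α v trivial, key' _ (B.graded α v hv), key' v hv, h3.graded α v hv]
  · rintro i j _ ⟨v, hv, rfl⟩
    rw [← hφ.comm i j v trivial, ← ext_comp, LinearMap.comp_assoc,
      ext_eq_of_eqOn key (B.stable i j v hv), key' v hv, h3.comm i j v hv]

theorem QuotientIso.comap {A B : Subrep ħ Y} {S : LData.{u}} (h : QuotientIso ħ A B S)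
    {φ : X.V →ₗ[M] Y.V} (hφ : IsHomOn ħ ⊤ φ) (hI : B.space ≤ LinearMap.range φ) :
    QuotientIso ħ (A.comap φ hφ) (B.comap φ hφ) S := by
  rw [quotientIso_iff] at h
  obtain ⟨f, h1, h2, h3⟩ := h
  refine quotientIso_iff.2 ⟨f ∘ₗ φ, ?_, ?_, ?_, ?_⟩
  · rw [← top_le_iff, ← h1]
    rintro _ ⟨w, hw, rfl⟩
    obtain ⟨v, rfl⟩ := hI hw
    exact ⟨v, hw, rfl⟩
  · change B.space.comap φ ⊓ _ = A.space.comap φ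
    rw [LinearMap.ker_comp, ← Submodule.comap_inf, h2]
  · intro α v hv
    rw [LinearMap.comp_apply, LinearMap.comp_apply, hφ.graded α v trivial, h3.graded α _ hv]
  · intro i j v hv
    rw [ext_comp, hφ.comm i j v trivial, h3.comm i j _ hv, LinearMap.comp_apply]

theorem QuotientIso.iso {A B : Subrep ħ X} {S T : LData.{u}} (hS : QuotientIso ħ A B S)
    (hT : QuotientIso ħ A B T) : Iso ħ S T := by
  rw [quotientIso_iff] at hS hT
  obtain ⟨f, f1, f2, f3⟩ := hS
  obtain ⟨g, g1, g2, g3⟩ := hT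
  have hex : ∀ {S : LData.{u}} (f : X.V →ₗ[M] S.V), B.space.map f = ⊤ →
      ∃ s : S.V →ₗ[M] X.V, ∀ v, s v ∈ B.space ∧ f (s v) = v := fun {S} f hf => by
    obtain ⟨s, hs⟩ := (f ∘ₗ B.space.subtype).exists_rightInverse_of_surjective (by
      rw [LinearMap.range_comp, Submodule.range_subtype, hf])
    exact ⟨B.space.subtype ∘ₗ s, fun v => ⟨(s v).2, LinearMap.congr_fun hs v⟩⟩
  have hex' : ∀ {S T : LData.{u}} (f : X.V →ₗ[M] S.V) (g : X.V →ₗ[M] T.V) (s : S.V →ₗ[M] X.V),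
      B.space ⊓ LinearMap.ker f = A.space → B.space ⊓ LinearMap.ker g = A.space →
      (∀ v, s v ∈ B.space ∧ f (s v) = v) → ∀ v ∈ B.space, g (s (f v)) = g v :=
    fun f g s hf hg hs v hv => by
      have h : s (f v) - v ∈ A.space := by
        rw [← hf]
        exact ⟨Submodule.sub_mem _ (hs _).1 hv, by
          change f (s (f v) - v) = 0
          rw [map_sub, (hs _).2, sub_self]⟩
      rw [← hg] at h
      have h2 : g (s (f v) - v) = 0 := h.2
      rwa [map_sub, sub_eq_zero] at h2
  obtain ⟨s, hs⟩ := hex f f1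
  obtain ⟨t, ht⟩ := hex g g1
  have k1 := hex' f g s f2 g2 hs
  have k2 := hex' g f t g2 f2 ht
  refine ⟨LinearEquiv.ofLinearMap (g ∘ₗ s) (f ∘ₗ t) (LinearMap.ext fun v => ?_)
    (LinearMap.ext fun v => ?_), fun α v => ?_, fun i j v => ?_⟩
  · exact (k1 _ (ht v).1).trans (ht v).2
  · exact (k2 _ (hs v).1).trans (hs v).2
  · change g (s (S.component α v)) = T.component α (g (s v))
    rw [← g3.graded α _ (hs v).1, ← k1 _ (B.graded α _ (hs v).1), f3.graded α _ (hs v).1, (hs v).2]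
  · change ext (g ∘ₗ s) (S.act ħ i j v) = T.act ħ i j (g (s v))
    rw [← g3.comm i j _ (hs v).1]
    nth_rewrite 1 [← (hs v).2]
    rw [← f3.comm i j _ (hs v).1, ← ext_comp]
    exact ext_eq_of_eqOn k1 (B.stable i j _ (hs v).1)

end Subreps

end LData

end EllipticQG

end

noncomputable section

namespace EllipticQG

open scoped UpperHalfPlane

universe u v

/-! ### Multiplicities -/

namespace LData

variable {ħ : ℂ} {X Y S T : LData.{u}}

/-- There is a chain of subrepresentations between `U` and `V` with `n` subquotients isomorphic
to `S`. -/
def HasChain (S : LData.{u}) : ℕ → Subrep ħ X → Subrep ħ X → Prop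
  | 0, U, V => U.space ≤ V.space
  | n + 1, U, V => ∃ A B, HasChain S n U A ∧ QuotientIso ħ A B S ∧ B.space ≤ V.space

theorem HasChain.le {n : ℕ} {U V : Subrep ħ X} (h : HasChain S n U V) : U.space ≤ V.space := by
  induction n generalizing V with
  | zero => exact h
  | succ n ih =>
    obtain ⟨A, B, h1, h2, h3⟩ := h
    exact (ih h1).trans (h2.le.trans h3)

theorem HasChain.mono_right {n : ℕ} {U V V' : Subrep ħ X} (h : HasChain S n U V)
    (hV : V.space ≤ V'.space) : HasChain S n U V' := by
  cases n with
  | zero => exact le_trans h hV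
  | succ n =>
    obtain ⟨A, B, h1, h2, h3⟩ := h
    exact ⟨A, B, h1, h2, h3.trans hV⟩

theorem HasChain.mono_left {n : ℕ} {U U' V : Subrep ħ X} (h : HasChain S n U V)
    (hU : U'.space ≤ U.space) : HasChain S n U' V := by
  induction n generalizing V with
  | zero => exact hU.trans h
  | succ n ih =>
    obtain ⟨A, B, h1, h2, h3⟩ := h
    exact ⟨A, B, ih h1, h2, h3⟩

theorem HasChain.of_succ {n : ℕ} {U V : Subrep ħ X} (h : HasChain S (n + 1) U V) :
    HasChain S n U V := by
  obtain ⟨A, B, h1, h2, h3⟩ := h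
  exact h1.mono_right (h2.le.trans h3)

theorem HasChain.of_le {n m : ℕ} {U V : Subrep ħ X} (h : HasChain S n U V) (hm : m ≤ n) :
    HasChain S m U V := by
  induction hm with
  | refl => exact h
  | step _ ih => exact ih h.of_succ

theorem HasChain.trans {m n : ℕ} {U V W : Subrep ħ X} (h : HasChain S m U V)
    (h' : HasChain S n V W) : HasChain S (m + n) U W := by
  induction n generalizing W with
  | zero => exact h.mono_right h'
  | succ n ih =>
    obtain ⟨A, B, h1, h2, h3⟩ := h'
    exact ⟨A, B, ih h1, h2, h3⟩

/-- By `QuotientIso.cut` every counted factor survives on at least one side of C, so the counts on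
the two sides can be made to add up to n. -/
theorem HasChain.cut (hS : S.IsSimple ħ) {n : ℕ} {U V : Subrep ħ X} (h : HasChain S n U V)
    (C : Subrep ħ X) :
    ∃ p q, p + q = n ∧ HasChain S p (U ⊓ C) (V ⊓ C) ∧ HasChain S q (U ⊔ C) (V ⊔ C) := by
  induction n generalizing V with
  | zero => exact ⟨0, 0, rfl, inf_le_inf_right _ h, sup_le_sup_right h _⟩
  | succ n ih =>
    obtain ⟨A, B, h1, h2, h3⟩ := h
    obtain ⟨p, q, hpq, hp, hq⟩ := ih h1
    rcases h2.cut hS C with h4 | h4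
    · exact ⟨p + 1, q, by omega, ⟨_, _, hp, h4, inf_le_inf_right _ h3⟩,
        hq.mono_right (sup_le_sup_right (h2.le.trans h3) _)⟩
    · exact ⟨p, q + 1, by omega, hp.mono_right (inf_le_inf_right _ (h2.le.trans h3)),
        ⟨_, _, hq, h4, sup_le_sup_right h3 _⟩⟩

theorem HasChain.split (hS : S.IsSimple ħ) {n : ℕ} {U C V : Subrep ħ X} (h : HasChain S n U V)
    (hU : U.space ≤ C.space) (hV : C.space ≤ V.space) :
    ∃ p q, p + q = n ∧ HasChain S p U C ∧ HasChain S q C V := by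
  obtain ⟨p, q, hpq, hp, hq⟩ := h.cut hS C
  exact ⟨p, q, hpq, (hp.mono_left (le_inf le_rfl hU)).mono_right inf_le_right,
    (hq.mono_left le_sup_right).mono_right (sup_le le_rfl hV)⟩

theorem HasChain.map {n : ℕ} {U V : Subrep ħ X} (h : HasChain S n U V)
    {φ : X.V →ₗ[M] Y.V} (hφ : IsHomOn ħ ⊤ φ) (hK : LinearMap.ker φ ≤ U.space) :
    HasChain S n (U.map φ (hφ.mono le_top)) (V.map φ (hφ.mono le_top)) := by
  induction n generalizing V with
  | zero => exact Submodule.map_mono h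
  | succ n ih =>
    obtain ⟨A, B, h1, h2, h3⟩ := h
    exact ⟨_, _, ih h1, h2.map hφ (hK.trans h1.le), Submodule.map_mono h3⟩

theorem HasChain.comap {n : ℕ} {U V : Subrep ħ Y} (h : HasChain S n U V)
    {φ : X.V →ₗ[M] Y.V} (hφ : IsHomOn ħ ⊤ φ) (hI : V.space ≤ LinearMap.range φ) :
    HasChain S n (U.comap φ hφ) (V.comap φ hφ) := by
  induction n generalizing V with
  | zero => exact Submodule.comap_mono h
  | succ n ih =>
    obtain ⟨A, B, h1, h2, h3⟩ := h
    exact ⟨_, _, ih h1 (h2.le.trans (h3.trans hI)), h2.comap hφ (h3.trans hI), Submodule.comap_mono h3⟩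

/-- A chain of X is cut at K = ker φ = im χ. The part above K is mapped by φ to a chain from 0 to im
φ; the part below K is pulled back along χ to a chain that starts at ker χ = im φ. Placed one above
the other, they give a chain of Y with as many factors isomorphic to S. -/
theorem HasChain.of_hom (hS : S.IsSimple ħ) {φ : X.V →ₗ[M] Y.V} {χ : Y.V →ₗ[M] X.V}
    (hφ : IsHomOn ħ ⊤ φ) (hχ : IsHomOn ħ ⊤ χ) (h1 : LinearMap.ker φ = LinearMap.range χ)
    (h2 : LinearMap.ker χ = LinearMap.range φ) {n : ℕ}
    (h : HasChain S n (⊥ : Subrep ħ X) ⊤) : HasChain S n (⊥ : Subrep ħ Y) ⊤ := by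
  let K : Subrep ħ X := (⊥ : Subrep ħ Y).comap φ hφ
  have hK : K.space = LinearMap.ker φ := rfl
  obtain ⟨p, q, rfl, hp, hq⟩ := h.split hS (C := K) bot_le le_top
  have e1 := hq.map hφ (le_of_eq hK.symm)
  have e2 := hp.comap hχ (le_of_eq (hK.trans h1))
  rw [add_comm]
  refine (e1.mono_left bot_le).trans ((e2.mono_left ?_).mono_right le_top)
  change Submodule.map φ ⊤ ≤ LinearMap.ker χ
  rw [h2, LinearMap.range_eq_map]

/-! ### Chains and multiplicities -/

theorem exists_chain_of_hasChain {n : ℕ} {U V : Subrep ħ X} (h : HasChain S n U V) :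
    ∃ (m : ℕ) (F : Fin (m + 1) → Subrep ħ X), (Monotone fun k => (F k).space) ∧
      (F (Fin.last m)).space ≤ V.space ∧
      (n : ℕ∞) ≤ {k : Fin m | QuotientIso ħ (F k.castSucc) (F k.succ) S}.encard := by
  induction n generalizing V with
  | zero => exact ⟨0, fun _ => U, fun _ _ _ => le_rfl, h, by simp⟩
  | succ n ih =>
    obtain ⟨A, B, h1, h2, h3⟩ := h
    obtain ⟨m, F, hF, hl, hn⟩ := ih h1
    -- Appending A and then B adds two steps. The new factor S is the last one; the step from the
    -- old end to A is not counted.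
    let F1 : Fin (m + 2) → Subrep ħ X := Fin.snoc F A
    let F2 : Fin (m + 3) → Subrep ħ X := Fin.snoc F1 B
    have mono : ∀ {m : ℕ} {F : Fin (m + 1) → Subrep ħ X} {C : Subrep ħ X},
        (Monotone fun k => (F k).space) → (F (Fin.last m)).space ≤ C.space →
        Monotone fun k : Fin (m + 2) => ((Fin.snoc F C : Fin (m + 2) → Subrep ħ X) k).space := by
      intro m F C hF hC
      refine Fin.monotone_iff_le_succ.2 fun i => ?_
      induction i using Fin.lastCases with
      | last => rw [Fin.succ_last, Fin.snoc_last, Fin.snoc_castSucc]; exact hC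
      | cast i =>
        rw [← Fin.castSucc_succ, Fin.snoc_castSucc, Fin.snoc_castSucc]
        exact hF (Fin.castSucc_lt_succ).le
    have hF1 := mono hF hl
    have hA : F1 (Fin.last (m + 1)) = A := Fin.snoc_last ..
    have hF2 := mono (F := F1) (C := B) hF1 (hA ▸ h2.le)
    refine ⟨m + 2, F2, hF2, ?_, ?_⟩
    · rw [show F2 (Fin.last (m + 2)) = B from Fin.snoc_last ..]
      exact h3
    · set s := {k : Fin m | QuotientIso ħ (F k.castSucc) (F k.succ) S}
      have hlast : Fin.last (m + 1) ∉ (fun k : Fin m => k.castSucc.castSucc) '' s := by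
        rintro ⟨k, -, hk⟩
        exact absurd hk (Fin.castSucc_lt_last _).ne
      have hinj : Function.Injective fun k : Fin m => k.castSucc.castSucc :=
        (Fin.castSucc_injective _).comp (Fin.castSucc_injective _)
      calc ((n + 1 : ℕ) : ℕ∞) ≤ s.encard + 1 := by push_cast; gcongr
        _ = (insert (Fin.last (m + 1)) ((fun k : Fin m => k.castSucc.castSucc) '' s)).encard := by
          rw [Set.encard_insert_of_notMem hlast, hinj.encard_image]
        _ ≤ _ := Set.encard_le_encard (Set.insert_subset ?_ ?_)
      · change QuotientIso ħ (F2 _) (F2 _) S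
        rw [Fin.succ_last, show F2 (Fin.last (m + 2)) = B from Fin.snoc_last ..,
          show F2 (Fin.last (m + 1)).castSucc = F1 (Fin.last (m + 1)) from Fin.snoc_castSucc .., hA]
        exact h2
      · rintro _ ⟨k, hk, rfl⟩
        change QuotientIso ħ (F2 _) (F2 _) S
        rw [← Fin.castSucc_succ, ← Fin.castSucc_succ,
          show F2 k.castSucc.castSucc.castSucc = F1 _ from Fin.snoc_castSucc ..,
          show F2 k.succ.castSucc.castSucc = F1 _ from Fin.snoc_castSucc ..,
          show F1 k.castSucc.castSucc = F _ from Fin.snoc_castSucc ..,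
          show F1 k.succ.castSucc = F _ from Fin.snoc_castSucc ..]
        exact hk

theorem hasChain_of_chain {m : ℕ} {F : Fin (m + 1) → Subrep ħ X}
    (hF : Monotone fun k => (F k).space) (j : Fin (m + 1)) :
    HasChain S {k : Fin m | k.castSucc < j ∧ QuotientIso ħ (F k.castSucc) (F k.succ) S}.ncard
      (F 0) (F j) := by
  induction j using Fin.induction with
  | zero => simp [HasChain]
  | succ j ih =>
    by_cases hj : QuotientIso ħ (F j.castSucc) (F j.succ) S
    · have e : {k : Fin m | k.castSucc < j.succ ∧ QuotientIso ħ (F k.castSucc) (F k.succ) S} =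
          insert j {k : Fin m | k.castSucc < j.castSucc ∧
            QuotientIso ħ (F k.castSucc) (F k.succ) S} := by
        ext k
        simp only [Set.mem_ofPred_eq, Set.mem_insert_iff, Fin.castSucc_lt_succ_iff,
          Fin.castSucc_lt_castSucc_iff, le_iff_eq_or_lt]
        constructor
        · rintro ⟨h1 | h1, h2⟩
          · exact Or.inl h1
          · exact Or.inr ⟨h1, h2⟩
        · rintro (h1 | ⟨h1, h2⟩)
          · exact ⟨Or.inl h1, h1 ▸ hj⟩
          · exact ⟨Or.inr h1, h2⟩
      rw [e, Set.ncard_insert_of_notMem (by simp)]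
      exact ⟨_, _, ih, hj, le_rfl⟩
    · have e : {k : Fin m | k.castSucc < j.succ ∧ QuotientIso ħ (F k.castSucc) (F k.succ) S} =
          {k : Fin m | k.castSucc < j.castSucc ∧
            QuotientIso ħ (F k.castSucc) (F k.succ) S} := by
        ext k
        simp only [Set.mem_ofPred_eq, Fin.castSucc_lt_succ_iff,
          Fin.castSucc_lt_castSucc_iff, le_iff_eq_or_lt]
        constructor
        · rintro ⟨h1 | h1, h2⟩
          · exact absurd (h1 ▸ h2) hj
          · exact ⟨h1, h2⟩
        · rintro ⟨h1, h2⟩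
          exact ⟨Or.inr h1, h2⟩
      rw [e]
      exact ih.mono_right (hF (Fin.castSucc_lt_succ).le)

theorem le_multiplicity_iff {n : ℕ} :
    (n : ℕ∞) ≤ multiplicity ħ S X ↔ HasChain S n (⊥ : Subrep ħ X) ⊤ := by
  constructor
  · intro h
    cases n with
    | zero => exact bot_le
    | succ n =>
      -- A strict inequality against the supremum is witnessed by a single chain, with at least n +
      -- 1 factors.
      have h1 : (n : ℕ∞) < multiplicity ħ S X := lt_of_lt_of_le (by exact_mod_cast n.lt_succ_self) h
      obtain ⟨m, h2⟩ := lt_iSup_iff.1 h1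
      obtain ⟨F, h2⟩ := lt_iSup_iff.1 h2
      obtain ⟨hF, h2⟩ := lt_iSup_iff.1 h2
      have h3 := hasChain_of_chain (S := S) hF (Fin.last m)
      simp only [Fin.castSucc_lt_last, true_and] at h3
      rw [← (Set.toFinite _).cast_ncard_eq] at h2
      exact ((h3.of_le (by exact_mod_cast h2)).mono_left bot_le).mono_right le_top
  · intro h
    obtain ⟨m, F, hF, -, hn⟩ := exists_chain_of_hasChain h
    exact hn.trans (le_iSup_of_le m (le_iSup_of_le F (le_iSup_of_le hF le_rfl)))

theorem multiplicity_le_of_hom (hS : S.IsSimple ħ) {φ : X.V →ₗ[M] Y.V} {χ : Y.V →ₗ[M] X.V}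
    (hφ : IsHomOn ħ ⊤ φ) (hχ : IsHomOn ħ ⊤ χ) (h1 : LinearMap.ker φ = LinearMap.range χ)
    (h2 : LinearMap.ker χ = LinearMap.range φ) : multiplicity ħ S X ≤ multiplicity ħ S Y :=
  ENat.forall_natCast_le_iff_le.1 fun _ hn =>
    le_multiplicity_iff.2 (HasChain.of_hom hS hφ hχ h1 h2 (le_multiplicity_iff.1 hn))

theorem multiplicity_eq_of_hom (hS : S.IsSimple ħ) {φ : X.V →ₗ[M] Y.V} {χ : Y.V →ₗ[M] X.V}
    (hφ : IsHomOn ħ ⊤ φ) (hχ : IsHomOn ħ ⊤ χ) (h1 : LinearMap.ker φ = LinearMap.range χ)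
    (h2 : LinearMap.ker χ = LinearMap.range φ) : multiplicity ħ S X = multiplicity ħ S Y :=
  le_antisymm (multiplicity_le_of_hom hS hφ hχ h1 h2) (multiplicity_le_of_hom hS hχ hφ h2 h1)

/-! ### Dimensions of weight spaces -/

/-- The part of weight `α` of a subspace. -/
def weightPart (α : ℂ) (U : Submodule M X.V) : Submodule M X.V :=
  U ⊓ Finsupp.supported M M {b | X.wt b = α}

theorem component_eq_self_iff {α : ℂ} {v : X.V} :
    X.component α v = v ↔ v ∈ Finsupp.supported M M {b | X.wt b = α} := by
  classical
  rw [component, Finsupp.filter_eq_self_iff, Finsupp.mem_supported']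
  exact forall_congr' fun b => not_imp_comm

theorem component_mem_supported (α : ℂ) (v : X.V) :
    X.component α v ∈ Finsupp.supported M M {b | X.wt b = α} := by
  classical
  rw [Finsupp.mem_supported', component]
  exact fun b hb => Finsupp.filter_apply_neg _ _ hb

theorem finrank_supported (α : ℂ) [Finite (X.Fiber α)] :
    Module.Finite M (Finsupp.supported M M {b | X.wt b = α}) ∧
    Module.finrank M (Finsupp.supported M M {b | X.wt b = α}) = Nat.card (X.Fiber α) := by
  have := Fintype.ofFinite (X.Fiber α)
  let e : Finsupp.supported M M {b | X.wt b = α} ≃ₗ[M] (X.Fiber α →₀ M) :=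
    Finsupp.supportedEquivFinsupp _
  refine ⟨Module.Finite.equiv e.symm, ?_⟩
  rw [e.finrank_eq, Module.finrank_finsupp_self, Nat.card_eq_fintype_card]

theorem finrank_map_add_finrank_inf_ker {k V W : Type*} [Field k] [AddCommGroup V] [Module k V]
    [AddCommGroup W] [Module k W] (U : Submodule k V) [Module.Finite k U] (φ : V →ₗ[k] W) :
    Module.finrank k (U.map φ) + Module.finrank k (U ⊓ LinearMap.ker φ : Submodule k V) =
      Module.finrank k U := by
  have h := LinearMap.finrank_range_add_finrank_ker (φ.domRestrict U)
  rw [LinearMap.range_domRestrict, LinearMap.ker_domRestrict] at h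
  rw [← h, ← Submodule.map_comap_subtype, LinearEquiv.finrank_eq
    (Submodule.equivMapOfInjective _ (Submodule.injective_subtype U) _)]

theorem weightPart_mono {α : ℂ} {U V : Submodule M X.V} (h : U ≤ V) :
    weightPart α U ≤ weightPart α V := inf_le_inf_right _ h

theorem finite_weightPart (α : ℂ) [Finite (X.Fiber α)] (U : Submodule M X.V) :
    Module.Finite M (weightPart α U) := by
  have := (finrank_supported (X := X) α).1
  exact Submodule.finiteDimensional_of_le (K := M) (inf_le_right : weightPart α U ≤ _)

theorem finrank_weightPart_mono (α : ℂ) [Finite (X.Fiber α)] {U V : Submodule M X.V} (h : U ≤ V) :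
    Module.finrank M (weightPart α U) ≤ Module.finrank M (weightPart α V) := by
  have := finite_weightPart α V
  exact Submodule.finrank_mono (weightPart_mono h)

/-- The map to S commutes with the projections to weight α, so the weight part of B maps onto that
of S with kernel the weight part of A; then rank-nullity applies. -/
theorem QuotientIso.finrank (α : ℂ) [Finite (X.Fiber α)] {A B : Subrep ħ X}
    (h : QuotientIso ħ A B S) :
    Finite (S.Fiber α) ∧ Module.finrank M (weightPart α B.space) =
      Module.finrank M (weightPart α A.space) + Nat.card (S.Fiber α) := by
  have hAB := h.le
  rw [quotientIso_iff] at h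
  obtain ⟨φ, h1, h2, h3⟩ := h
  have hfin := finite_weightPart α B.space
  have hr : (weightPart α B.space).map φ = Finsupp.supported M M {b | S.wt b = α} := by
    refine le_antisymm ?_ fun w hw => ?_
    · rintro _ ⟨v, hv, rfl⟩
      rw [← component_eq_self_iff, ← h3.graded α v hv.1, component_eq_self_iff.2 hv.2]
    · obtain ⟨v, hv, rfl⟩ : w ∈ B.space.map φ := by rw [h1]; trivial
      refine ⟨X.component α v, ⟨B.graded α v hv, component_mem_supported α v⟩, ?_⟩
      rw [h3.graded α v hv, component_eq_self_iff.2 hw]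
  have hk : weightPart α B.space ⊓ LinearMap.ker φ = weightPart α A.space := by
    rw [weightPart, inf_right_comm, h2]
    rfl
  have hrn := finrank_map_add_finrank_inf_ker (k := M) (weightPart α B.space) φ
  have hSf : Module.Finite M (Finsupp.supported M M {b | S.wt b = α}) := by
    rw [← hr]
    exact Module.Finite.map _ _
  have hS : Finite (S.Fiber α) := by
    let e : Finsupp.supported M M {b | S.wt b = α} ≃ₗ[M] (S.Fiber α →₀ M) :=
      Finsupp.supportedEquivFinsupp _
    have := Module.Finite.equiv e
    exact Module.Finite.finite_basis (Finsupp.basisSingleOne (R := M) (ι := S.Fiber α))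
  refine ⟨hS, ?_⟩
  rw [← hrn, hr, hk, (finrank_supported (X := S) α).2, add_comm]

theorem QuotientIso.ne {A B : Subrep ħ X} (hS : S.IsSimple ħ) (h : QuotientIso ħ A B S) :
    A.space ≠ B.space := by
  intro hAB
  obtain ⟨φ, h1, h2, -⟩ := h
  obtain ⟨b⟩ := hS.1
  obtain ⟨v, hv, hb⟩ : Finsupp.single b (1 : M) ∈ B.space.map φ := by rw [h1]; trivial
  rw [← hAB, ← h2] at hv
  have h0 : φ v = 0 := hv.2
  rw [hb, Finsupp.single_eq_zero] at h0
  exact one_ne_zero h0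

/-- A simple quotient has no proper intermediate subrepresentations. -/
theorem QuotientIso.eq_or_eq {A B C : Subrep ħ X} (hS : S.IsSimple ħ) (h : QuotientIso ħ A B S)
    (hA : A.space ≤ C.space) (hB : C.space ≤ B.space) : C.space = A.space ∨ C.space = B.space := by
  rw [quotientIso_iff] at h
  obtain ⟨φ, h1, h2, h3⟩ := h
  rcases hS.2 (C.map φ (h3.mono hB)) with h4 | h4
  · refine Or.inl (le_antisymm (fun v hv => ?_) hA)
    have h5 : φ v ∈ (C.map φ (h3.mono hB)).space := ⟨v, hv, rfl⟩
    rw [h4] at h5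
    rw [← h2]
    exact ⟨hB hv, (Submodule.mem_bot M).1 h5⟩
  · refine Or.inr (le_antisymm hB fun v hv => ?_)
    obtain ⟨c, hc, h5⟩ : φ v ∈ (C.map φ (h3.mono hB)).space := by rw [h4]; trivial
    have h6 : v - c ∈ A.space := by
      rw [← h2]
      refine ⟨Submodule.sub_mem _ hv (hB hc), ?_⟩
      change φ (v - c) = 0
      rw [map_sub, h5, sub_self]
    have := Submodule.add_mem _ (hA h6) hc
    rwa [sub_add_cancel] at this

/-- Nothing lies strictly between A and B, so a simple factor of a chain there must be the whole of
B/A, and a second factor has no room. -/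
theorem HasChain.quotientIso_of_simple {A B : Subrep ħ X} (hS : S.IsSimple ħ) (hT : T.IsSimple ħ)
    (h : QuotientIso ħ A B S) {n : ℕ} (hn : HasChain T n A B) :
    n = 0 ∨ n = 1 ∧ QuotientIso ħ A B T := by
  cases n with
  | zero => exact Or.inl rfl
  | succ n =>
    right
    obtain ⟨A', B', h1, h2, h3⟩ := hn
    have hA' : A'.space = A.space :=
      (h.eq_or_eq hS h1.le (h2.le.trans h3)).resolve_right fun h4 =>
        h2.ne hT (le_antisymm h2.le (h4 ▸ h3))
    have hB' : B'.space = B.space :=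
      (h.eq_or_eq hS (h1.le.trans h2.le) h3).resolve_left fun h4 => h2.ne hT (hA'.trans h4.symm)
    refine ⟨?_, h2.congr hA' hB'⟩
    cases n with
    | zero => rfl
    | succ n =>
      obtain ⟨A'', B'', k1, k2, k3⟩ := h1
      exact absurd (le_antisymm k2.le (k3.trans (hA'.le.trans k1.le))) (k2.ne hT)

/-- The dimensions of the simple subquotients of a representation add up to at most the dimension
of the representation. -/
theorem sum_card_fiber_le {ι : Type*} (s : Finset ι) (S : ι → LData.{u})
    (hS : ∀ i ∈ s, (S i).IsSimple ħ) (hne : ∀ i ∈ s, ∀ j ∈ s, i ≠ j → ¬ Iso ħ (S i) (S j)) (α : ℂ)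
    [Finite (X.Fiber α)] (d : ℕ) (n : ι → ℕ) (U V : Subrep ħ X) (hUV : U.space ≤ V.space)
    (hd : Module.finrank M (weightPart α V.space) ≤ Module.finrank M (weightPart α U.space) + d)
    (h : ∀ i ∈ s, HasChain (S i) (n i) U V) :
    ∑ i ∈ s, n i * Nat.card ((S i).Fiber α) + Module.finrank M (weightPart α U.space) ≤
      Module.finrank M (weightPart α V.space) := by
  induction d using Nat.strong_induction_on generalizing n U V with
  | _ d ih =>
  by_cases h0 : ∀ i ∈ s, n i * Nat.card ((S i).Fiber α) = 0
  · rw [Finset.sum_eq_zero h0, zero_add]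
    exact finrank_weightPart_mono α hUV
  push Not at h0
  obtain ⟨i, hi, hi0⟩ := h0
  obtain ⟨m, hm⟩ := Nat.exists_eq_succ_of_ne_zero (left_ne_zero_of_mul hi0)
  have hi1 := right_ne_zero_of_mul hi0
  -- One factor B/A isomorphic to S i, with non-zero weight space at α, is singled out, and all the
  -- other chains are cut at A and B. The dimension gaps from U to A and from B to V are both
  -- smaller than d, so the induction hypothesis applies to these two pieces.
  obtain ⟨A, B, h1, h2, h3⟩ := hm ▸ h i hi
  have hUA := h1.le
  have hdim := (h2.finrank α).2
  have hUA' := finrank_weightPart_mono α hUA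
  have hBV' := finrank_weightPart_mono α h3
  have hsplit : ∀ j : s, ∃ p r q, p + r + q = n j ∧ HasChain (S j) p U A ∧ HasChain (S j) r A B ∧
      HasChain (S j) q B V := fun j => by
    obtain ⟨p, q, hpq, hp, hq⟩ := (h j j.2).split (hS j j.2) (hUA.trans h2.le) h3
    obtain ⟨p, r, hpr, hp, hr⟩ := hp.split (hS j j.2) hUA h2.le
    exact ⟨p, r, q, by omega, hp, hr, hq⟩
  choose p r q hn hp hr hq using hsplit
  classical
  let p' : ι → ℕ := fun j => if hj : j ∈ s then p ⟨j, hj⟩ else 0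
  let q' : ι → ℕ := fun j => if hj : j ∈ s then q ⟨j, hj⟩ else 0
  have hp' : ∀ j (hj : j ∈ s), p' j = p ⟨j, hj⟩ := fun j hj => dif_pos hj
  have hq' : ∀ j (hj : j ∈ s), q' j = q ⟨j, hj⟩ := fun j hj => dif_pos hj
  have e1 := ih (Module.finrank M (weightPart α A.space) - Module.finrank M (weightPart α U.space))
    (by omega) p' U A hUA (by omega) fun j hj => by rw [hp' j hj]; exact hp ⟨j, hj⟩
  have e2 := ih (Module.finrank M (weightPart α V.space) - Module.finrank M (weightPart α B.space))
    (by omega) q' B V h3 (by omega) fun j hj => by rw [hq' j hj]; exact hq ⟨j, hj⟩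
  have e3 : ∑ j ∈ s, n j * Nat.card ((S j).Fiber α) ≤
      ∑ j ∈ s, (p' j * Nat.card ((S j).Fiber α) + q' j * Nat.card ((S j).Fiber α) +
        if j = i then Nat.card ((S i).Fiber α) else 0) := by
    refine Finset.sum_le_sum fun j hj => ?_
    have hnj := hn ⟨j, hj⟩
    rw [hp' j hj, hq' j hj, ← add_mul, ← hnj]
    -- Between A and B the chain for S j is empty, or has one factor and then S j is isomorphic to S
    -- i. As the S j are pairwise non-isomorphic, the second case forces j = i.
    rcases (hr ⟨j, hj⟩).quotientIso_of_simple (hS i hi) (hS j hj) h2 with h4 | ⟨h4, h5⟩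
    · rw [h4, add_zero]
      exact Nat.le_add_right _ _
    · have hji : j = i := by
        by_contra hji
        exact hne j hj i hi hji (h5.iso h2)
      rw [h4, if_pos hji, ← hji]
      exact le_of_eq (by ring)
  rw [Finset.sum_add_distrib, Finset.sum_add_distrib, Finset.sum_ite_eq', if_pos hi] at e3
  omega

theorem sum_card_fiber_le_card {ι : Type*} (s : Finset ι) (S : ι → LData.{u})
    (hS : ∀ i ∈ s, (S i).IsSimple ħ) (hne : ∀ i ∈ s, ∀ j ∈ s, i ≠ j → ¬ Iso ħ (S i) (S j)) (α : ℂ)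
    [Finite (X.Fiber α)] (n : ι → ℕ) (h : ∀ i ∈ s, (n i : ℕ∞) ≤ multiplicity ħ (S i) X) :
    ∑ i ∈ s, n i * Nat.card ((S i).Fiber α) ≤ Nat.card (X.Fiber α) := by
  have e := sum_card_fiber_le (X := X) s S hS hne α _ n ⊥ ⊤ bot_le le_add_self
    fun i hi => le_multiplicity_iff.1 (h i hi)
  have e2 : weightPart α (⊤ : Subrep ħ X).space = Finsupp.supported M M {b | X.wt b = α} :=
    top_inf_eq _
  rw [e2, (finrank_supported (X := X) α).2] at e
  omega

end LData

end EllipticQG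

end

noncomputable section

namespace EllipticQG

open scoped UpperHalfPlane

universe u v

/-! ### Classes in the completed Grothendieck group -/

section

variable {τ : ℍ} {ħ : ℂ} {X Y : LData.{0}}

theorem SimpleClass.rep_inO (c : SimpleClass τ ħ) : c.rep.InO τ ħ := (Quot.out c).2.1

theorem SimpleClass.rep_isSimple (c : SimpleClass τ ħ) : c.rep.IsSimple ħ := (Quot.out c).2.2

theorem SimpleClass.not_iso {c d : SimpleClass τ ħ} (h : c ≠ d) : ¬ LData.Iso ħ c.rep d.rep :=
  fun hi => h (by rw [← Quot.out_eq c, ← Quot.out_eq d]; exact Quot.sound hi)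

theorem LData.InO.finite_fiber (hX : X.InO τ ħ) (α : ℂ) : Finite (X.Fiber α) := by
  obtain ⟨-, hf, -⟩ := hX
  infer_instance

theorem sum_multiplicity_le (hX : X.InO τ ħ) (s : Finset (SimpleClass τ ħ)) (α : ℂ)
    (n : SimpleClass τ ħ → ℕ) (h : ∀ c ∈ s, (n c : ℕ∞) ≤ LData.multiplicity ħ c.rep X) :
    ∑ c ∈ s, n c * Nat.card (c.rep.Fiber α) ≤ Nat.card (X.Fiber α) := by
  have := hX.finite_fiber α
  exact LData.sum_card_fiber_le_card s SimpleClass.rep (fun c _ => c.rep_isSimple)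
    (fun c _ d _ h => SimpleClass.not_iso h) α n h

/-- Each occurrence of a simple object uses up some dimension in one of its weights, where X has
only finitely many dimensions. -/
theorem multiplicity_ne_top (hX : X.InO τ ħ) (c : SimpleClass τ ħ) :
    LData.multiplicity ħ c.rep X ≠ ⊤ := by
  intro h
  obtain ⟨b⟩ := c.rep_isSimple.1
  have := c.rep_inO.finite_fiber (c.rep.wt b)
  have hpos : 0 < Nat.card (c.rep.Fiber (c.rep.wt b)) :=
    Nat.card_pos_iff.2 ⟨⟨⟨b, rfl⟩⟩, this⟩
  have h1 := sum_multiplicity_le hX {c} (c.rep.wt b)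
    (fun _ => Nat.card (X.Fiber (c.rep.wt b)) + 1) fun d hd => by
      rw [Finset.mem_singleton.1 hd, h]; exact le_top
  rw [Finset.sum_singleton] at h1
  nlinarith

theorem sum_classOf_le (hX : X.InO τ ħ) (s : Finset (SimpleClass τ ħ)) (α : ℂ) :
    ∑ c ∈ s, (classOf τ ħ X c).natAbs * Nat.card (c.rep.Fiber α) ≤ Nat.card (X.Fiber α) :=
  sum_multiplicity_le hX s α _ fun c _ => by
    rw [classOf, Int.natAbs_natCast, ENat.natCast_toNat (multiplicity_ne_top hX c)]

/-- The sum of the simple constituents has weight spaces no larger than those of X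
(`sum_classOf_le`). Finite dimensions and the bound on the weights are thus inherited from X, and
`LData.directSum_inO` gives the rest. -/
theorem classOf_mem_K0 (hX : X.InO τ ħ) : classOf τ ħ X ∈ K0 τ ħ := by
  have hle := fun s α => sum_classOf_le hX s α
  set n := classOf τ ħ X
  have hfin : ∀ α, Finite ((LData.directSum fun s : Σ c : SimpleClass τ ħ, Fin (n c).natAbs =>
      s.1.rep).Fiber α) := fun α => by
    -- Infinitely many classes contributing to weight α would violate the inequality on a finite set
    -- of more than dim X[α] of them.
    have hf : {c : SimpleClass τ ħ |
        (n c).natAbs * Nat.card (c.rep.Fiber α) ≠ 0}.Finite := by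
      by_contra hinf
      obtain ⟨t, ht, hcard⟩ := Set.Infinite.exists_subset_card_eq hinf (Nat.card (X.Fiber α) + 1)
      have h1 := hle t α
      have h2 : ∑ c ∈ t, 1 ≤ ∑ c ∈ t, (n c).natAbs * Nat.card (c.rep.Fiber α) :=
        Finset.sum_le_sum fun c hc => Nat.one_le_iff_ne_zero.2 (ht hc)
      rw [Finset.sum_const, hcard, smul_eq_mul, mul_one] at h2
      omega
    have := hf.to_subtype
    have := fun c : SimpleClass τ ħ => c.rep_inO.finite_fiber α
    let f : (LData.directSum fun s : Σ c : SimpleClass τ ħ, Fin (n c).natAbs =>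
      s.1.rep).Fiber α → Σ c : {c : SimpleClass τ ħ |
        (n c).natAbs * Nat.card (c.rep.Fiber α) ≠ 0}, Fin (n c.1).natAbs × c.1.rep.Fiber α :=
      fun b => ⟨⟨b.1.1.1, mul_ne_zero (Nat.ne_of_gt b.1.1.2.pos)
        (Nat.card_pos_iff.2 ⟨⟨⟨b.1.2, b.2⟩⟩, this _⟩).ne'⟩, b.1.1.2, ⟨b.1.2, b.2⟩⟩
    refine Finite.of_injective f ?_
    rintro ⟨⟨⟨c, k⟩, b⟩, hb⟩ ⟨⟨⟨c', k'⟩, b'⟩, hb'⟩ h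
    obtain ⟨h1, h2⟩ := Sigma.mk.inj_iff.1 h
    obtain rfl : c = c' := congrArg Subtype.val h1
    obtain ⟨h3, h4⟩ := Prod.mk.inj (eq_of_heq h2)
    obtain rfl : k = k' := h3
    obtain rfl : b = b' := congrArg Subtype.val h4
    rfl
  have hfin' := fun α => Fintype.ofFinite ((LData.directSum
    fun s : Σ c : SimpleClass τ ħ, Fin (n c).natAbs => s.1.rep).Fiber α)
  have hwt := hX
  obtain ⟨-, -, ⟨A, hA⟩, -⟩ := hwt
  refine LData.directSum_inO (fun s => s.1.rep_inO) A ?_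
  rintro ⟨⟨c, k⟩, b⟩
  have := c.rep_inO.finite_fiber (c.rep.wt b)
  have hpos : 0 < Nat.card (c.rep.Fiber (c.rep.wt b)) :=
    Nat.card_pos_iff.2 ⟨⟨⟨b, rfl⟩⟩, this⟩
  have h1 := hle {c} (c.rep.wt b)
  rw [Finset.sum_singleton] at h1
  have h2 : 0 < Nat.card (X.Fiber (c.rep.wt b)) := lt_of_lt_of_le (Nat.mul_pos k.pos hpos) h1
  obtain ⟨⟨⟨x, hx⟩⟩, -⟩ := Nat.card_pos_iff.1 h2
  obtain ⟨α, hα, m, hm⟩ := hA x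
  exact ⟨α, hα, m, hx.symm.trans hm⟩

theorem classOf_eq_of_hom {φ : X.V →ₗ[M] Y.V} {χ : Y.V →ₗ[M] X.V}
    (hφ : LData.IsHomOn ħ ⊤ φ) (hχ : LData.IsHomOn ħ ⊤ χ)
    (h1 : LinearMap.ker φ = LinearMap.range χ) (h2 : LinearMap.ker χ = LinearMap.range φ) :
    classOf τ ħ X = classOf τ ħ Y := funext fun c => by
  rw [classOf, classOf, LData.multiplicity_eq_of_hom c.rep_isSimple hφ hχ h1 h2]

end

end EllipticQG

end

noncomputable section

namespace EllipticQG

open scoped UpperHalfPlane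

universe u v

/-! ### Matrix coefficients of tensor products and of intertwining operators -/

section Coefficients

variable {G F : Type*} [CommRing G] [Field F] (T : G → F)

/-- The product of the `T (y - r)` for `1 ≤ r ≤ i`. -/
def lowerProd (y : G) (i : ℕ) : F := ∏ r ∈ Finset.range i, T (y - 1 - r)

/-- The product of the `T (y + r)` for `1 ≤ r ≤ i`. -/
def upperProd (y : G) (i : ℕ) : F := ∏ r ∈ Finset.range i, T (y + 1 + r)

theorem lowerProd_zero (y : G) : lowerProd T y 0 = 1 := rfl

theorem lowerProd_succ (y : G) (i : ℕ) :
    lowerProd T y (i + 1) = lowerProd T y i * T (y - i - 1) := by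
  rw [lowerProd, Finset.prod_range_succ, sub_right_comm]; rfl

theorem lowerProd_succ' (y : G) (i : ℕ) :
    lowerProd T (y + 1) (i + 1) = lowerProd T y i * T y := by
  rw [lowerProd, Finset.prod_range_succ', Nat.cast_zero, sub_zero, add_sub_cancel_right]
  refine congrArg (· * _) (Finset.prod_congr rfl fun r _ => ?_)
  rw [Nat.cast_add, Nat.cast_one]; congr 1; ring

theorem lowerProd_sub_one (y : G) (i : ℕ) :
    lowerProd T (y - 1) i * T (y - 1) = lowerProd T y i * T (y - i - 1) := by
  rw [← lowerProd_succ', sub_add_cancel, lowerProd_succ]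

theorem upperProd_zero (y : G) : upperProd T y 0 = 1 := rfl

theorem upperProd_succ (y : G) (i : ℕ) :
    upperProd T y (i + 1) = upperProd T y i * T (y + i + 1) := by
  rw [upperProd, Finset.prod_range_succ, add_right_comm]; rfl

theorem upperProd_succ' (y : G) (i : ℕ) :
    upperProd T (y - 1) (i + 1) = upperProd T y i * T y := by
  rw [upperProd, Finset.prod_range_succ', Nat.cast_zero, add_zero, sub_add_cancel]
  refine congrArg (· * _) (Finset.prod_congr rfl fun r _ => ?_)
  rw [Nat.cast_add, Nat.cast_one]; congr 1; ring

theorem upperProd_sub_one (y : G) (i : ℕ) :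
    upperProd T (y - 1) i * T (y + i) = upperProd T y i * T y := by
  rw [← upperProd_succ', upperProd_succ]; congr 2; ring

/-- The first of the two coefficients of `L_{ij}(z)` on a basis vector of a tensor product. -/
def coefA (z x a₁ b₁ a₂ b₂ j k : G) : Sgn → Sgn → F
  | true, true => T (z + a₁ - j + 1) * T (z + a₂ - k + 1) *
      T (x + a₁ - b₁ + a₂ - b₂ - j - 2 * k + 1) * T (x - k) /
      (T x * T (x + a₁ - b₁ + a₂ - b₂ - 2 * j - 2 * k + 1))
  | true, false => T (z + x + a₁ + a₂ - b₂ - j - 2 * k) * T (z + b₂ + k + 1) * T (a₁ - b₁ - j) *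
      T (x + a₂ - b₂ - k) / (T (x + a₁ - b₁ + a₂ - b₂ - 2 * j - 2 * k - 1) *
        T (x + a₂ - b₂ - 2 * k - 1) * T (x + a₂ - b₂ - 2 * k))
  | false, true => -(T (z - x - a₂ + b₂ + 2 * k + b₁ + j) * T (z + a₂ - k + 1) * T j * T (x - k) /
      T x)
  | false, false => T (z + b₁ + j + 1) * T (z + b₂ + k + 1) * T (x + a₂ - b₂ - 2 * k - j - 1) *
      T (x + a₂ - b₂ - k) / (T (x + a₂ - b₂ - 2 * k - 1) * T (x + a₂ - b₂ - 2 * k))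

/-- The second of the two coefficients of `L_{ij}(z)` on a basis vector of a tensor product. -/
def coefB (z x a₁ b₁ a₂ b₂ j k : G) : Sgn → Sgn → F
  | true, true => -(T (z + x + a₁ + a₂ - b₂ - j - 2 * k + 2) * T (z - x + b₂ + k) *
      T (a₁ - b₁ - j) * T k / (T x * T (x + a₁ - b₁ + a₂ - b₂ - 2 * j - 2 * k + 1) *
        T (x + a₂ - b₂ - 2 * k + 1) * T (x + a₂ - b₂ - 2 * k + 2)))
  | true, false => T (z + a₁ - j + 1) * T (z + x + a₂ - k) * T (a₂ - b₂ - k) *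
      T (x + a₁ - b₁ + a₂ - b₂ - j - 2 * k - 1) / T (x + a₁ - b₁ + a₂ - b₂ - 2 * j - 2 * k - 1)
  | false, true => -(T (z + b₁ + j + 1) * T (z - x + b₂ + k) * T k *
      T (x + a₂ - b₂ - 2 * k - j + 1) / (T x * T (x + a₂ - b₂ - 2 * k + 1) *
        T (x + a₂ - b₂ - 2 * k + 2)))
  | false, false => -(T (z - x - a₂ + b₂ + 2 * k + b₁ + j + 2) * T (z + x + a₂ - k) * T j *
      T (a₂ - b₂ - k))

/-- Here the rescaled basis pays off: some coefficients are symmetric in b₁ and b₂, and `coefB` with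
second sign - is symmetric up to the factor T (a₂ - b - k). The diagonal entries of an intertwining
operator have to compensate for that factor, which is the condition `lower₀` below. -/
theorem coefA_swap (z x a₁ b₁ a₂ b₂ j k : G) (i : Sgn) :
    coefA T z x a₁ b₁ a₂ b₂ j k i true = coefA T z x a₁ b₂ a₂ b₁ j k i true := by
  cases i <;> simp only [coefA] <;> ring_nf

theorem coefB_swap {a₂ b₁ b₂ k : G} {c c' : F} (h : c' * T (a₂ - b₂ - k) = c * T (a₂ - b₁ - k))
    (z x a₁ j : G) (i : Sgn) :
    coefB T z x a₁ b₁ a₂ b₂ j k i false * c' = c * coefB T z x a₁ b₂ a₂ b₁ j k i false := by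
  cases i
  · have h' := congrArg (fun t => T (z - x - a₂ + b₂ + 2 * k + b₁ + j + 2) * T (z + x + a₂ - k) *
      T j * t) h
    simp only [coefB]
    ring_nf at h' ⊢
    linear_combination -h'
  · have h' := congrArg (fun t => T (z + a₁ - j + 1) * T (z + x + a₂ - k) *
      T (x + a₁ - b₁ + a₂ - b₂ - j - 2 * k - 1) *
      (T (x + a₁ - b₁ + a₂ - b₂ - 2 * j - 2 * k - 1))⁻¹ * t) h
    simp only [coefB]
    ring_nf at h' ⊢
    linear_combination h'

end Coefficients

namespace ThetaMap

variable {G F : Type*} [CommRing G] [Field F] {T : G → F} (hT : ThetaMap T)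
include hT

omit hT in
-- The relation is specialized to y = 0, where the middle term drops out.
theorem Admissible.mul_eq {i p q : G} {v1 v2 v3 : F} (hv : Admissible T i p q v1 v2 v3)
    (hT : ThetaMap T) {j : G} (hj : T j ≠ 0) (hj' : T (p + q - j) ≠ 0) :
    v1 * T i * T q = v3 * T p := by
  have h := hv 0 j
  rw [hT.map_zero, hT.neg_of (show (0 : G) - q = -q by ring), hT.neg_of (show (0 : G) - j = -j by ring),
    hT.neg_of (show j - p - q = -(p + q - j) by ring), zero_add] at h
  refine mul_right_cancel₀ (mul_ne_zero hj hj') ?_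
  linear_combination -h

/-- The identity `admissible_raising` under other nonvanishing conditions. -/
theorem admissible_raising_of_ne {i p q : G} {v1 v2 v3 : F} (hv : Admissible T i p q v1 v2 v3)
    (z y j : G) (hj : T j ≠ 0) (hj' : T (p + q - j) ≠ 0) (n1 : T (j - q + i) ≠ 0)
    (n2 : T (y + p - i) ≠ 0) :
    v1 * (T (z - y - p + i + j) * T (z + q - i) * T j * T (y - q - i) * T (y + p) * T y) +
      v2 * (T (z + j) * T (z - y - p + q) * T (y + p - i - j) * T (y - i) * T y) =
    v1 * (T (z - y - p + j) * T (z + q) * T (j + i) * T (y - q) * T (y - i) * T (y + p - i)) +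
      v3 * (T (z - p + j) * T (z - y + q) * T (y - j - i) * T (y + p - i) * T (y + p)) := by
  have := hT.four_term (z := z) (a0 := q - i) (b0 := j + i - y - p) (a1 := j) (b1 := q - y - p)
    (a2 := q) (b2 := j - y - p) (a3 := j - p) (b3 := q - y)
    (c0 := v1 * T j * T (y - q - i) * T (y + p) * T y)
    (c1 := v2 * T (y + p - i - j) * T (y - i) * T y)
    (c2 := -(v1 * T (j + i) * T (y - q) * T (y - i) * T (y + p - i)))
    (c3 := -(v3 * T (y - j - i) * T (y + p - i) * T (y + p)))
    (by ring) (by ring) (by ring) (by convert n1 using 2; ring) ?_ ?_ ?_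
  · ring_nf at this ⊢
    linear_combination this
  · rw [hT.neg_of (show q - y - p - (q - i) = -(y + p - i) by ring)]
    exact neg_ne_zero.2 n2
  · have h := congrArg (fun t => T (y - i) * T (y + p - i) * t) (hv y (j + i))
    rw [hT.neg_of (show j - y - p - (q - i) = -(y + p + q - j - i) by ring),
      hT.neg_of (show q - y - p - (q - i) = -(y + p - i) by ring),
      hT.neg_of (show q - y - (q - i) = -(y - i) by ring)]
    ring_nf at h ⊢
    linear_combination h
  · have e := hv.mul_eq hT hj hj'
    rw [hT.neg_of (show q - i - j = -(j + i - q) by ring),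
      hT.neg_of (show j + i - y - p - j = -(y + p - i) by ring),
      hT.neg_of (show q - j = -(j - q) by ring),
      hT.neg_of (show j - y - p - j = -(y + p) by ring),
      hT.neg_of (show j - p - j = -p by ring),
      hT.neg_of (show q - y - j = -(y + j - q) by ring)]
    have f := hT.fay_symm y (j + i) i (-q)
    rw [hT.odd] at f
    have f' := congrArg (fun t => v1 * T (y + p) * T (y + p - i) * t) f
    have e' := congrArg (fun t => T (y + p) * T (y + p - i) * T (y - j - i) * T (y + j - q) * t) e
    ring_nf at f' e' ⊢
    linear_combination e' - f'

/-- The argument put in place of j contains x. With this choice x cancels from T (y + p + q - i -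
j), leaving the constant a₂ - a₁ + j - m, whose theta value may vanish. Hence
`admissible_raising_of_ne` is used, with conditions that hold for generic x. -/
theorem coef_raising_pp {z x a₁ b₁ a₂ b₂ i m j : G} {c₁ c₂ c₃ : F}
    (hv : Admissible T (i + 1) (b₁ - b₂ - i) (a₂ - b₁ - m) c₁ (c₂ * T (i + m + 1))
      (c₃ * T (m + 1)))
    (n1 : T x ≠ 0) (n2 : T (x + a₁ - b₁ + a₂ - b₂ - 2 * j - 2 * i - 2 * m - 1) ≠ 0)
    (n3 : T (x + a₂ - b₁ - 2 * m - i - 1) ≠ 0) (n4 : T (x + a₂ - b₂ - 2 * m - 2 * i - 1) ≠ 0)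
    (n5 : T (x + a₂ - b₂ - 2 * m - 2 * i) ≠ 0) (n6 : T (x + a₂ - b₁ - 2 * m) ≠ 0)
    (n7 : T (x + a₂ - b₁ - 2 * m - 1) ≠ 0)
    (k1 : T (x + a₁ - b₁ + a₂ - b₂ - j - 2 * m - 2 * i - 1) ≠ 0)
    (k2 : T (x + a₁ - b₁ - j - m - i - 1) ≠ 0)
    (k3 : T (x + a₁ - b₂ - j - m - i) ≠ 0) :
    coefA T z x a₁ b₁ a₂ b₂ j (i + m + 1) true true * (c₁ * T (x + a₂ - b₂ - 2 * m - i) /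
        (T (x + a₂ - b₁ - 2 * m - i - 1) * T (x + a₂ - b₂ - 2 * m - 2 * i - 1) *
          T (x + a₂ - b₂ - 2 * m - 2 * i))) +
      coefB T z x a₁ b₁ a₂ b₂ j (i + m + 1) true true * c₂ =
    c₁ / (T (x + a₂ - b₁ - 2 * m) * T (x + a₂ - b₂ - 2 * m - 2 * i)) *
        coefA T z x a₁ b₂ a₂ b₁ (j + i + 1) m true true +
      c₃ * T (x + a₂ - b₁ - 2 * m - 1) * T (x + a₂ - b₂ - 2 * m - i) /
        (T (x + a₂ - b₁ - 2 * m - i - 1) * T (x + a₂ - b₂ - 2 * m - 2 * i)) *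
        coefB T z x a₁ b₂ a₂ b₁ (j + i) (m + 1) true true := by
  have h := hT.admissible_raising_of_ne hv (z + b₁ + 1) (x + a₂ - b₁ - 2 * m)
    (a₁ - b₁ - j + (x + a₂ - b₁ - 2 * m) + (b₁ - b₂ - i) - (i + 1))
    (by convert k1 using 2; ring) (by rw [← neg_ne_zero, ← hT.odd]; convert k2 using 2; ring)
    (by convert k3 using 2; ring) (by convert n4 using 2; ring)
  simp only [coefA, coefB]
  ring_nf at *
  rw [hT.neg_of (show -a₁ + j + b₁ = -(a₁ - j - b₁) by ring),
    hT.neg_of (show -a₁ + j + i + b₂ = -(a₁ - j - i - b₂) by ring)] at h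
  field_simp
  linear_combination h

theorem coef_raising_mp {z x a₁ b₁ a₂ b₂ i m j : G} {c₁ c₂ c₃ : F}
    (hv : Admissible T (i + 1) (b₁ - b₂ - i) (a₂ - b₁ - m) c₁ (c₂ * T (i + m + 1))
      (c₃ * T (m + 1)))
    (n0 : T (i + 1) ≠ 0) (n1 : T x ≠ 0)
    (n3 : T (x + a₂ - b₁ - 2 * m - i - 1) ≠ 0) (n4 : T (x + a₂ - b₂ - 2 * m - 2 * i - 1) ≠ 0)
    (n5 : T (x + a₂ - b₂ - 2 * m - 2 * i) ≠ 0) (n6 : T (x + a₂ - b₁ - 2 * m) ≠ 0)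
    (n7 : T (x + a₂ - b₁ - 2 * m - 1) ≠ 0)
    (k1 : T (x + a₂ - b₁ + a₂ - b₂ - 3 * m - 2 * i - 1 - j) ≠ 0) :
    coefA T z x a₁ b₁ a₂ b₂ j (i + m + 1) false true * (c₁ * T (x + a₂ - b₂ - 2 * m - i) /
        (T (x + a₂ - b₁ - 2 * m - i - 1) * T (x + a₂ - b₂ - 2 * m - 2 * i - 1) *
          T (x + a₂ - b₂ - 2 * m - 2 * i))) +
      coefB T z x a₁ b₁ a₂ b₂ j (i + m + 1) false true * c₂ =
    c₁ / (T (x + a₂ - b₁ - 2 * m) * T (x + a₂ - b₂ - 2 * m - 2 * i)) *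
        coefA T z x a₁ b₂ a₂ b₁ (j + i + 1) m false true +
      c₃ * T (x + a₂ - b₁ - 2 * m - 1) * T (x + a₂ - b₂ - 2 * m - i) /
        (T (x + a₂ - b₁ - 2 * m - i - 1) * T (x + a₂ - b₂ - 2 * m - 2 * i)) *
        coefB T z x a₁ b₂ a₂ b₁ (j + i) (m + 1) false true := by
  have h := hT.admissible_raising hv (z + b₁ + 1) (x + a₂ - b₁ - 2 * m) j n0
    (by convert k1 using 2; ring)
  simp only [coefA, coefB]
  ring_nf at *
  field_simp
  linear_combination -h

theorem coef_lowering_mm {z x a₁ b₁ a₂ b₂ i m j : G} {c c₁ c₂ : F}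
    (h1 : c₁ * T (i + 1) * T (a₂ - b₂ - i - m) = c * T (i + m + 1) * T (b₁ - b₂ - i))
    (h2 : c₂ * T (i + 1) * T (a₂ - b₁ - m + 1) = c * T m * T (b₁ - b₂ - i))
    (n0 : T (i + 1) ≠ 0)
    (n3 : T (x + a₂ - b₁ - 2 * m - i - 1) ≠ 0) (n4 : T (x + a₂ - b₂ - 2 * m - 2 * i - 1) ≠ 0)
    (n5 : T (x + a₂ - b₂ - 2 * m - 2 * i) ≠ 0) (n6 : T (x + a₂ - b₁ - 2 * m) ≠ 0)
    (n7 : T (x + a₂ - b₁ - 2 * m - 1) ≠ 0)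
    (k1 : T (2 * x + 2 * a₂ - b₁ - b₂ - 3 * m - 2 * i - j - 1) ≠ 0) :
    coefA T z x a₁ b₁ a₂ b₂ j (i + m) false false * c +
      coefB T z x a₁ b₁ a₂ b₂ j (i + m) false false * (c₁ * T (x + a₂ - b₂ - 2 * m - i) /
        (T (x + a₂ - b₁ - 2 * m - i - 1) * T (x + a₂ - b₂ - 2 * m - 2 * i - 1) *
          T (x + a₂ - b₂ - 2 * m - 2 * i))) =
    c * T (x + a₂ - b₁ - 2 * m - 1) * T (x + a₂ - b₂ - 2 * m - i) /
        (T (x + a₂ - b₁ - 2 * m - i - 1) * T (x + a₂ - b₂ - 2 * m - 2 * i)) *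
        coefA T z x a₁ b₂ a₂ b₁ (j + i) m false false +
      c₂ / (T (x + a₂ - b₁ - 2 * m) * T (x + a₂ - b₂ - 2 * m - 2 * i)) *
        coefB T z x a₁ b₂ a₂ b₁ (j + i + 1) (m - 1) false false := by
  have h := hT.lowering (z + b₂ + 1) (x + a₂ - b₂ - 2 * m - 2 * i) j i m (b₁ - b₂) n0
    (by convert k1 using 2; ring)
  have h1' := congrArg (fun t => T (z - (x + a₂ - b₂ - 2 * m - 2 * i) + b₁ - i - m + j + i + m + 2) *
    T (z + x + a₂ - i - m) * T j * T (x + a₂ - b₂ - 2 * m - i) * T (x + a₂ - b₁ - 2 * m) * t) h1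
  have h2' := congrArg (fun t => T (z - x - a₂ + b₁ + 2 * m + b₂ + j + i + 1) *
    T (z + x + a₂ - m + 1) * T (j + i + 1) * T (x + a₂ - b₂ - 2 * m - 2 * i - 1) *
    T (x + a₂ - b₁ - 2 * m - i - 1) * t) h2
  simp only [coefA, coefB]
  ring_nf at *
  field_simp
  refine mul_right_cancel₀ n0 ?_
  linear_combination c * h - h1' + h2'

theorem coef_lowering_pm {z x a₁ b₁ a₂ b₂ i m j : G} {c c₁ c₂ : F}
    (h1 : c₁ * T (i + 1) * T (a₂ - b₂ - i - m) = c * T (i + m + 1) * T (b₁ - b₂ - i))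
    (h2 : c₂ * T (i + 1) * T (a₂ - b₁ - m + 1) = c * T m * T (b₁ - b₂ - i))
    (n0 : T (i + 1) ≠ 0) (n2 : T (x + a₁ - b₁ + a₂ - b₂ - 2 * j - 2 * i - 2 * m - 1) ≠ 0)
    (n3 : T (x + a₂ - b₁ - 2 * m - i - 1) ≠ 0) (n4 : T (x + a₂ - b₂ - 2 * m - 2 * i - 1) ≠ 0)
    (n5 : T (x + a₂ - b₂ - 2 * m - 2 * i) ≠ 0) (n6 : T (x + a₂ - b₁ - 2 * m) ≠ 0)
    (n7 : T (x + a₂ - b₁ - 2 * m - 1) ≠ 0)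
    (k1 : T (x + a₂ - a₁ + j - m) ≠ 0) :
    coefA T z x a₁ b₁ a₂ b₂ j (i + m) true false * c +
      coefB T z x a₁ b₁ a₂ b₂ j (i + m) true false * (c₁ * T (x + a₂ - b₂ - 2 * m - i) /
        (T (x + a₂ - b₁ - 2 * m - i - 1) * T (x + a₂ - b₂ - 2 * m - 2 * i - 1) *
          T (x + a₂ - b₂ - 2 * m - 2 * i))) =
    c * T (x + a₂ - b₁ - 2 * m - 1) * T (x + a₂ - b₂ - 2 * m - i) /
        (T (x + a₂ - b₁ - 2 * m - i - 1) * T (x + a₂ - b₂ - 2 * m - 2 * i)) *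
        coefA T z x a₁ b₂ a₂ b₁ (j + i) m true false +
      c₂ / (T (x + a₂ - b₁ - 2 * m) * T (x + a₂ - b₂ - 2 * m - 2 * i)) *
        coefB T z x a₁ b₂ a₂ b₁ (j + i + 1) (m - 1) true false := by
  have h := hT.lowering (z + b₂ + 1) (x + a₂ - b₂ - 2 * m - 2 * i)
    (a₁ - b₁ - j + (x + a₂ - b₂ - 2 * m - 2 * i) - 1) i m (b₁ - b₂) n0
    (by convert k1 using 2; ring)
  have h1' := congrArg (fun t => T (z + a₁ - j + 1) * T (z + x + a₂ - i - m) *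
    T (x + a₁ - b₁ + a₂ - b₂ - j - 2 * m - 2 * i - 1) * T (x + a₂ - b₂ - 2 * m - i) *
    T (x + a₂ - b₁ - 2 * m) * t) h1
  have h2' := congrArg (fun t => T (z + a₁ - j - i) * T (z + x + a₂ - m + 1) *
    T (x + a₁ - b₁ + a₂ - b₂ - j - 2 * m - i) * T (x + a₂ - b₂ - 2 * m - 2 * i - 1) *
    T (x + a₂ - b₁ - 2 * m - i - 1) * t) h2
  simp only [coefA, coefB]
  ring_nf at *
  rw [hT.neg_of (show -a₁ + j + b₁ = -(a₁ - j - b₁) by ring),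
    hT.neg_of (show -a₁ + b₂ + j + i = -(a₁ - b₂ - j - i) by ring)] at h
  field_simp
  refine mul_right_cancel₀ n0 ?_
  linear_combination -c * h + h1' - h2'

end ThetaMap

end EllipticQG

end

/-! ### Sums over antidiagonals, and the denominators of intertwining operators. -/

noncomputable section

namespace EllipticQG

open scoped UpperHalfPlane

universe u v

section Sums

variable {R N : Type*} [CommRing R] [AddCommGroup N] [Module R N]

open Finset.HasAntidiagonal (antidiagonal)

/-- The coefficients of e (i + 1) m are compared by `hs` and those of e 0 k by `h0`. The truncated
differences k - 1 and p.2 - 1 are harmless: β vanishes for k = 0 and B does for second index 0. -/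
theorem raising_sum {α β : R} {P Q A B : ℕ → ℕ → R} (e : ℕ → ℕ → N) {k : ℕ}
    (h0 : α * P 0 k = Q 0 k * A 0 k)
    (hs : ∀ i m, i + m + 1 = k →
      α * P (i + 1) m + β * P i m = Q (i + 1) m * A (i + 1) m + Q i (m + 1) * B i (m + 1))
    (hB : B k 0 = 0) (hβ : k = 0 → β = 0) :
    α • ∑ p ∈ antidiagonal k, P p.1 p.2 • e p.1 p.2 +
      β • ∑ p ∈ antidiagonal (k - 1), P p.1 p.2 • e (p.1 + 1) p.2 =
    ∑ p ∈ antidiagonal k, Q p.1 p.2 •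
      (A p.1 p.2 • e p.1 p.2 + B p.1 p.2 • e (p.1 + 1) (p.2 - 1)) := by
  simp only [smul_add, Finset.sum_add_distrib, Finset.smul_sum, smul_smul]
  cases k with
  | zero => simp [h0, hB, hβ rfl]
  | succ k =>
    rw [Finset.Nat.sum_antidiagonal_succ (n := k), Finset.Nat.sum_antidiagonal_succ (n := k),
      Finset.Nat.sum_antidiagonal_succ' (n := k), hB, mul_zero, zero_smul, zero_add,
      Nat.add_sub_cancel, h0, add_assoc, add_assoc, ← Finset.sum_add_distrib,
      ← Finset.sum_add_distrib]
    refine congrArg _ (Finset.sum_congr rfl fun p hp => ?_)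
    rw [← add_smul]
    exact (congrArg (· • e (p.1 + 1) p.2)
      (hs p.1 p.2 (by rw [Finset.HasAntidiagonal.mem_antidiagonal.1 hp]))).trans (add_smul _ _ _)

/-- The two ends of the antidiagonal, f 0 (k + 1) and f (k + 1) 0, receive fewer terms and need the
separate hypotheses `h0` and `h1`; the interior is `hs`. -/
theorem lowering_sum {α β : R} {P Q A B : ℕ → ℕ → R} (f : ℕ → ℕ → N) {k : ℕ}
    (h0 : β * P 0 (k + 1) = Q 0 k * B 0 k)
    (h1 : α * P k 0 + β * P (k + 1) 0 = Q k 0 * A k 0)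
    (hs : ∀ i m, i + m + 1 = k → α * P i (m + 1) + β * P (i + 1) (m + 1) =
      Q i (m + 1) * A i (m + 1) + Q (i + 1) m * B (i + 1) m) :
    α • ∑ p ∈ antidiagonal k, P p.1 p.2 • f (p.1 + 1) p.2 +
      β • ∑ p ∈ antidiagonal (k + 1), P p.1 p.2 • f p.1 p.2 =
    ∑ p ∈ antidiagonal k, Q p.1 p.2 •
      (A p.1 p.2 • f (p.1 + 1) p.2 + B p.1 p.2 • f p.1 (p.2 + 1)) := by
  simp only [smul_add, Finset.sum_add_distrib, Finset.smul_sum, smul_smul]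
  rw [Finset.Nat.sum_antidiagonal_succ (n := k), h0]
  cases k with
  | zero => simp [← h1, add_smul]; abel
  | succ k =>
    rw [Finset.Nat.sum_antidiagonal_succ' (n := k), Finset.Nat.sum_antidiagonal_succ' (n := k),
      Finset.Nat.sum_antidiagonal_succ' (n := k), Finset.Nat.sum_antidiagonal_succ (n := k)]
    have e : ∑ p ∈ antidiagonal k, (α * P p.1 (p.2 + 1)) • f (p.1 + 1) (p.2 + 1) +
        ∑ p ∈ antidiagonal k, (β * P (p.1 + 1) (p.2 + 1)) • f (p.1 + 1) (p.2 + 1) =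
        ∑ p ∈ antidiagonal k, (Q p.1 (p.2 + 1) * A p.1 (p.2 + 1)) • f (p.1 + 1) (p.2 + 1) +
        ∑ p ∈ antidiagonal k, (Q (p.1 + 1) p.2 * B (p.1 + 1) p.2) • f (p.1 + 1) (p.2 + 1) := by
      rw [← Finset.sum_add_distrib, ← Finset.sum_add_distrib]
      refine Finset.sum_congr rfl fun p hp => ?_
      rw [← add_smul, ← add_smul, hs p.1 p.2 (by rw [Finset.HasAntidiagonal.mem_antidiagonal.1 hp])]
    have h1' := congrArg (· • f (k + 1 + 1) 0) h1
    simp only [add_smul] at h1'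
    rw [← h1']
    linear_combination (norm := (dsimp only; abel)) e

end Sums

section Denominators

variable {G F : Type*} [CommRing G] [Field F] (T : G → F)

/-- The denominator of the coefficients of intertwining operators. -/
def denom (Y y : G) (i : ℕ) : F := lowerProd T Y i * upperProd T y i

theorem denom_succ (Y y : G) (i : ℕ) : denom T Y (y - 2) (i + 1) * T (y + i) =
    denom T Y y i * (T (Y - i - 1) * T (y - 1) * T y) := by
  have h := upperProd_sub_one T y i
  rw [denom, denom, show y - 2 = y - 1 - 1 by ring, upperProd_succ', lowerProd_succ]
  linear_combination (lowerProd T Y i * T (Y - i - 1) * T (y - 1)) * h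

theorem denom_add_one_sub_one (Y y : G) (i : ℕ) :
    denom T (Y + 1) (y - 1) (i + 1) = denom T Y y i * (T Y * T y) := by
  rw [denom, denom, upperProd_succ', lowerProd_succ']
  ring

theorem denom_sub_one (Y y : G) (i : ℕ) : denom T (Y - 1) (y - 1) i * (T (Y - 1) * T (y + i)) =
    denom T Y y i * (T (Y - i - 1) * T y) := by
  have h := upperProd_sub_one T y i
  have h' := lowerProd_sub_one T Y i
  rw [denom, denom]
  linear_combination upperProd T (y - 1) i * T (y + i) * h' +
    lowerProd T Y i * T (Y - i - 1) * h

/-- The coefficients of intertwining operators. -/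
def homCoef (x d e : G) (c : ℕ → ℕ → F) (i m : ℕ) : F :=
  c i m / denom T (x + e - 2 * m) (x + d - 2 * m - 2 * i) i

theorem homCoef_zero (x d e : G) (c : ℕ → ℕ → F) (m : ℕ) : homCoef T x d e c 0 m = c 0 m := by
  rw [homCoef, denom, lowerProd_zero, upperProd_zero, mul_one, div_one]

/-- The conditions on the coefficients of an intertwining operator. -/
structure Intertwining (a₂ b₁ b₂ : G) (c : ℕ → ℕ → F) : Prop where
  raise : ∀ i m : ℕ, ThetaMap.Admissible T (i + 1) (b₁ - b₂ - i) (a₂ - b₁ - m) (c (i + 1) m)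
    (c i m * T (i + m + 1)) (c i (m + 1) * T (m + 1))
  lower₁ : ∀ i m : ℕ, c (i + 1) m * T (i + 1) * T (a₂ - b₂ - i - m) =
    c i m * T (i + m + 1) * T (b₁ - b₂ - i)
  lower₂ : ∀ i m : ℕ, c (i + 1) m * T (i + 1) * T (a₂ - b₁ - m) =
    c i (m + 1) * T (m + 1) * T (b₁ - b₂ - i)
  lower₀ : ∀ m : ℕ, c 0 (m + 1) * T (a₂ - b₂ - m) = c 0 m * T (a₂ - b₁ - m)

variable {T} in
theorem Intertwining.add {a₂ b₁ b₂ : G} {c c' : ℕ → ℕ → F} (h : Intertwining T a₂ b₁ b₂ c)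
    (h' : Intertwining T a₂ b₁ b₂ c') : Intertwining T a₂ b₁ b₂ (c + c') where
  raise i m y j := by
    simp only [Pi.add_apply]; linear_combination h.raise i m y j + h'.raise i m y j
  lower₁ i m := by simp only [Pi.add_apply]; linear_combination h.lower₁ i m + h'.lower₁ i m
  lower₂ i m := by simp only [Pi.add_apply]; linear_combination h.lower₂ i m + h'.lower₂ i m
  lower₀ m := by simp only [Pi.add_apply]; linear_combination h.lower₀ m + h'.lower₀ m

end Denominators

section Generic

variable {G F : Type*} [CommRing G] [Algebra ℂ G] [Field F] {T : G → F} {u : G}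

theorem Generic.add_cst (h : Generic T u) (c : ℂ) : Generic T (u + algebraMap ℂ G c) :=
  (generic_add_algebraMap c).2 h

theorem Generic.sub_cst (h : Generic T u) (c : ℂ) : Generic T (u - algebraMap ℂ G c) :=
  (generic_sub_algebraMap c).2 h

theorem Generic.add_nat (h : Generic T u) (n : ℕ) : Generic T (u + n) := by
  rw [← map_natCast (algebraMap ℂ G)]; exact h.add_cst n

theorem Generic.sub_nat (h : Generic T u) (n : ℕ) : Generic T (u - n) := by
  rw [← map_natCast (algebraMap ℂ G)]; exact h.sub_cst n

theorem Generic.sub_one (h : Generic T u) : Generic T (u - 1) := generic_sub_one.2 h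

theorem Generic.sub_two_mul (h : Generic T u) (n : ℕ) : Generic T (u - 2 * n) := by
  exact_mod_cast h.sub_nat (2 * n)

theorem Generic.sub_three_mul (h : Generic T u) (n : ℕ) : Generic T (u - 3 * n) := by
  exact_mod_cast h.sub_nat (3 * n)

theorem Generic.prod_ne_zero (h : Generic T u) (i : ℕ) : lowerProd T u i ≠ 0 ∧ upperProd T u i ≠ 0 :=
  ⟨Finset.prod_ne_zero_iff.2 fun r _ => (h.sub_one.sub_nat r).ne_zero,
    Finset.prod_ne_zero_iff.2 fun r _ => ((generic_add_one.2 h).add_nat r).ne_zero⟩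

theorem denom_ne_zero {y : G} (h : Generic T u) (hy : Generic T y) (i : ℕ) : denom T u y i ≠ 0 :=
  mul_ne_zero (h.prod_ne_zero i).1 (hy.prod_ne_zero i).2

end Generic

end EllipticQG

end

/-! ### Commutation with the operators, coefficient by coefficient. -/

noncomputable section

namespace EllipticQG

open scoped UpperHalfPlane

universe u v

section

variable {G F : Type*} [CommRing G] [Algebra ℂ G] [Field F] {T : G → F} {x : G}

theorem homCoef_succ (hx : Generic T x) (d e : ℂ) (c : ℕ → ℕ → F) (i m : ℕ) :
    homCoef T x (algebraMap ℂ G d) (algebraMap ℂ G e) c (i + 1) m =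
      c (i + 1) m * T (x + algebraMap ℂ G d - 2 * m - i) /
        (T (x + algebraMap ℂ G e - 2 * m - i - 1) * T (x + algebraMap ℂ G d - 2 * m - 2 * i - 1) *
          T (x + algebraMap ℂ G d - 2 * m - 2 * i)) /
      denom T (x + algebraMap ℂ G e - 2 * m) (x + algebraMap ℂ G d - 2 * m - 2 * i) i := by
  have h := denom_succ T (x + algebraMap ℂ G e - 2 * m) (x + algebraMap ℂ G d - 2 * m - 2 * i) i
  have hY := (hx.add_cst e).sub_two_mul m
  have hy := ((hx.add_cst d).sub_two_mul m).sub_two_mul i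
  have n1 := (hY.sub_nat i).sub_one.ne_zero
  have n2 := hy.sub_one.ne_zero
  have n3 := hy.ne_zero
  have n4 := denom_ne_zero hY (hy.sub_two_mul 1) (i + 1)
  have n5 := denom_ne_zero hY hy i
  rw [Nat.cast_one, mul_one] at n4
  rw [homCoef, show x + algebraMap ℂ G d - 2 * m - 2 * ((i + 1 : ℕ) : G) =
    x + algebraMap ℂ G d - 2 * m - 2 * i - 2 by push_cast; ring]
  rw [show x + algebraMap ℂ G d - 2 * m - 2 * i + i = x + algebraMap ℂ G d - 2 * m - i by ring] at h
  field_simp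
  linear_combination -c (i + 1) m * h

theorem homCoef_add_one_succ (x : G) (d e : ℂ) (c : ℕ → ℕ → F) (i m : ℕ) :
    homCoef T (x + 1) (algebraMap ℂ G d) (algebraMap ℂ G e) c (i + 1) m =
      c (i + 1) m / (T (x + algebraMap ℂ G e - 2 * m) *
        T (x + algebraMap ℂ G d - 2 * m - 2 * i)) /
      denom T (x + algebraMap ℂ G e - 2 * m) (x + algebraMap ℂ G d - 2 * m - 2 * i) i := by
  rw [div_div, mul_comm (T _ * _), ← denom_add_one_sub_one, homCoef]
  congr 2 <;> push_cast <;> ring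

theorem homCoef_sub_one_succ (x : G) (d e : ℂ) (c : ℕ → ℕ → F) (i m : ℕ) :
    homCoef T (x - 1) (algebraMap ℂ G d) (algebraMap ℂ G e) c (i + 1) m =
      c (i + 1) m / (T (x + algebraMap ℂ G e - 2 * (m + 1 : ℕ)) *
        T (x + algebraMap ℂ G d - 2 * (m + 1 : ℕ) - 2 * i)) /
      denom T (x + algebraMap ℂ G e - 2 * (m + 1 : ℕ))
        (x + algebraMap ℂ G d - 2 * (m + 1 : ℕ) - 2 * i) i := by
  rw [div_div, mul_comm (T _ * _), ← denom_add_one_sub_one, homCoef]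
  congr 2 <;> push_cast <;> ring

theorem homCoef_sub_one (hx : Generic T x) (d e : ℂ) (c : ℕ → ℕ → F) (i m : ℕ) :
    homCoef T (x - 1) (algebraMap ℂ G d) (algebraMap ℂ G e) c i m =
      c i m * T (x + algebraMap ℂ G e - 2 * m - 1) * T (x + algebraMap ℂ G d - 2 * m - i) /
        (T (x + algebraMap ℂ G e - 2 * m - i - 1) * T (x + algebraMap ℂ G d - 2 * m - 2 * i)) /
      denom T (x + algebraMap ℂ G e - 2 * m) (x + algebraMap ℂ G d - 2 * m - 2 * i) i := by
  have h := denom_sub_one T (x + algebraMap ℂ G e - 2 * m) (x + algebraMap ℂ G d - 2 * m - 2 * i) i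
  have hY := (hx.add_cst e).sub_two_mul m
  have hy := ((hx.add_cst d).sub_two_mul m).sub_two_mul i
  have n1 := (hY.sub_nat i).sub_one.ne_zero
  have n3 := hy.ne_zero
  have n4 := denom_ne_zero hY.sub_one hy.sub_one i
  have n5 := denom_ne_zero hY hy i
  rw [homCoef, show x - 1 + algebraMap ℂ G e - 2 * (m : G) =
    x + algebraMap ℂ G e - 2 * m - 1 by ring, show x - 1 + algebraMap ℂ G d - 2 * (m : G) - 2 * i =
    x + algebraMap ℂ G d - 2 * m - 2 * i - 1 by ring]
  rw [show x + algebraMap ℂ G d - 2 * m - 2 * i + i = x + algebraMap ℂ G d - 2 * m - i by ring] at h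
  field_simp
  linear_combination -c i m * h

theorem homCoef_add_one (hx : Generic T x) (d e : ℂ) (c : ℕ → ℕ → F) (i m : ℕ) :
    homCoef T (x + 1) (algebraMap ℂ G d) (algebraMap ℂ G e) c i (m + 1) =
      c i (m + 1) * T (x + algebraMap ℂ G e - 2 * m - 1) *
        T (x + algebraMap ℂ G d - 2 * m - i) /
        (T (x + algebraMap ℂ G e - 2 * m - i - 1) * T (x + algebraMap ℂ G d - 2 * m - 2 * i)) /
      denom T (x + algebraMap ℂ G e - 2 * m) (x + algebraMap ℂ G d - 2 * m - 2 * i) i := by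
  rw [← homCoef_sub_one hx d e (fun i m => c i (m + 1)), homCoef, homCoef]
  congr 2 <;> push_cast <;> ring

variable (hT : ThetaMap T) (hx : Generic T x) (hx2 : Generic T (2 * x))
  (hn : ∀ n : ℕ, T (n + 1 : G) ≠ 0)
include hT hx hx2 hn

omit hx2 in
theorem homCoef_raising {a₁ b₁ a₂ b₂ : ℂ} {c : ℕ → ℕ → F} (hc : Intertwining T (algebraMap ℂ G a₂)
    (algebraMap ℂ G b₁) (algebraMap ℂ G b₂) c) (z : G) (σ : Sgn) (i m j : ℕ) :
    coefA T z x (algebraMap ℂ G a₁) (algebraMap ℂ G b₁) (algebraMap ℂ G a₂) (algebraMap ℂ G b₂)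
      j (i + m + 1) σ true *
        homCoef T x (algebraMap ℂ G (a₂ - b₂)) (algebraMap ℂ G (a₂ - b₁)) c (i + 1) m +
    coefB T z x (algebraMap ℂ G a₁) (algebraMap ℂ G b₁) (algebraMap ℂ G a₂) (algebraMap ℂ G b₂)
      j (i + m + 1) σ true *
        homCoef T x (algebraMap ℂ G (a₂ - b₂)) (algebraMap ℂ G (a₂ - b₁)) c i m =
    homCoef T (x + 1) (algebraMap ℂ G (a₂ - b₂)) (algebraMap ℂ G (a₂ - b₁)) c (i + 1) m *
      coefA T z x (algebraMap ℂ G a₁) (algebraMap ℂ G b₂) (algebraMap ℂ G a₂) (algebraMap ℂ G b₁)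
      (j + i + 1) m σ true +
    homCoef T (x + 1) (algebraMap ℂ G (a₂ - b₂)) (algebraMap ℂ G (a₂ - b₁)) c i (m + 1) *
      coefB T z x (algebraMap ℂ G a₁) (algebraMap ℂ G b₂) (algebraMap ℂ G a₂) (algebraMap ℂ G b₁)
      (j + i) (m + 1) σ true := by
  rw [homCoef_succ hx, homCoef_add_one_succ, homCoef_add_one hx, homCoef]
  simp only [map_sub, ← add_sub_assoc]
  set a₁' := algebraMap ℂ G a₁
  set a₂' := algebraMap ℂ G a₂
  set b₁' := algebraMap ℂ G b₁
  set b₂' := algebraMap ℂ G b₂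
  have g1 : ∀ a b : ℂ, Generic T (x + algebraMap ℂ G a - algebraMap ℂ G b) :=
    fun a b => (hx.add_cst a).sub_cst b
  have g2 : ∀ a b c d : ℂ, Generic T (x + algebraMap ℂ G a - algebraMap ℂ G b +
      algebraMap ℂ G c - algebraMap ℂ G d) := fun a b c d => ((g1 a b).add_cst c).sub_cst d
  have e := (g1 a₂ b₁).sub_two_mul m
  have d := ((g1 a₂ b₂).sub_two_mul m).sub_two_mul i
  cases σ
  · have key := congrArg (· / denom T (x + a₂' - b₁' - 2 * m) (x + a₂' - b₂' - 2 * m - 2 * i) i)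
        (hT.coef_raising_mp (z := z) (j := (j : G)) (a₁ := a₁') (hc.raise i m) (hn i) hx.ne_zero
        (e.sub_nat i).sub_one.ne_zero d.sub_one.ne_zero d.ne_zero e.ne_zero e.sub_one.ne_zero
        (((((g2 a₂ b₁ a₂ b₂).sub_three_mul m).sub_two_mul i).sub_one).sub_nat j).ne_zero)
    simp only [add_div] at key
    linear_combination key
  · have key := congrArg (· / denom T (x + a₂' - b₁' - 2 * m) (x + a₂' - b₂' - 2 * m - 2 * i) i)
        (hT.coef_raising_pp (z := z) (j := (j : G)) (a₁ := a₁') (hc.raise i m) hx.ne_zero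
        (((((g2 a₁ b₁ a₂ b₂).sub_two_mul j).sub_two_mul i).sub_two_mul m).sub_one).ne_zero
        (e.sub_nat i).sub_one.ne_zero d.sub_one.ne_zero d.ne_zero e.ne_zero e.sub_one.ne_zero
        (((((g2 a₁ b₁ a₂ b₂).sub_nat j).sub_two_mul m).sub_two_mul i).sub_one).ne_zero
        ((((g1 a₁ b₁).sub_nat j).sub_nat m).sub_nat i).sub_one.ne_zero
        ((((g1 a₁ b₂).sub_nat j).sub_nat m).sub_nat i).ne_zero)
    simp only [add_div] at key
    linear_combination key

/-- The number c₂ plays the part of c (i + 1) (m - 1). Keeping it free covers m = 0 as well, where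
it is taken to be 0. -/
theorem homCoef_lowering {a₁ b₁ a₂ b₂ : ℂ} {c : ℕ → ℕ → F} (hc : Intertwining T (algebraMap ℂ G a₂)
    (algebraMap ℂ G b₁) (algebraMap ℂ G b₂) c) (z : G) (σ : Sgn) (i m j : ℕ) (c₂ : F)
    (h2 : c₂ * T (i + 1) * T (algebraMap ℂ G a₂ - algebraMap ℂ G b₁ - m + 1) =
      c i m * T m * T (algebraMap ℂ G b₁ - algebraMap ℂ G b₂ - i)) :
    coefA T z x (algebraMap ℂ G a₁) (algebraMap ℂ G b₁) (algebraMap ℂ G a₂) (algebraMap ℂ G b₂)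
      j (i + m) σ false *
        homCoef T x (algebraMap ℂ G (a₂ - b₂)) (algebraMap ℂ G (a₂ - b₁)) c i m +
    coefB T z x (algebraMap ℂ G a₁) (algebraMap ℂ G b₁) (algebraMap ℂ G a₂) (algebraMap ℂ G b₂)
      j (i + m) σ false *
        homCoef T x (algebraMap ℂ G (a₂ - b₂)) (algebraMap ℂ G (a₂ - b₁)) c (i + 1) m =
    homCoef T (x - 1) (algebraMap ℂ G (a₂ - b₂)) (algebraMap ℂ G (a₂ - b₁)) c i m *
      coefA T z x (algebraMap ℂ G a₁) (algebraMap ℂ G b₂) (algebraMap ℂ G a₂) (algebraMap ℂ G b₁)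
      (j + i) m σ false +
    c₂ / (T (x + algebraMap ℂ G (a₂ - b₁) - 2 * m) *
        T (x + algebraMap ℂ G (a₂ - b₂) - 2 * m - 2 * i)) /
      denom T (x + algebraMap ℂ G (a₂ - b₁) - 2 * m)
        (x + algebraMap ℂ G (a₂ - b₂) - 2 * m - 2 * i) i *
      coefB T z x (algebraMap ℂ G a₁) (algebraMap ℂ G b₂) (algebraMap ℂ G a₂) (algebraMap ℂ G b₁)
      (j + i + 1) (m - 1) σ false := by
  rw [homCoef_succ hx, homCoef_sub_one hx, homCoef]
  have k0 := ((((hx2.add_cst (2 * a₂ - b₁ - b₂)).sub_three_mul m).sub_two_mul i).sub_nat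
    j).sub_one.ne_zero
  simp only [map_sub, map_mul, map_ofNat, ← add_sub_assoc] at k0 ⊢
  set a₁' := algebraMap ℂ G a₁
  set a₂' := algebraMap ℂ G a₂
  set b₁' := algebraMap ℂ G b₁
  set b₂' := algebraMap ℂ G b₂
  have g1 : ∀ a b : ℂ, Generic T (x + algebraMap ℂ G a - algebraMap ℂ G b) :=
    fun a b => (hx.add_cst a).sub_cst b
  have g2 : ∀ a b c d : ℂ, Generic T (x + algebraMap ℂ G a - algebraMap ℂ G b +
      algebraMap ℂ G c - algebraMap ℂ G d) := fun a b c d => ((g1 a b).add_cst c).sub_cst d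
  have e := (g1 a₂ b₁).sub_two_mul m
  have d := ((g1 a₂ b₂).sub_two_mul m).sub_two_mul i
  cases σ
  · have key := congrArg (· / denom T (x + a₂' - b₁' - 2 * m) (x + a₂' - b₂' - 2 * m - 2 * i) i)
        (hT.coef_lowering_mm (z := z) (j := (j : G)) (a₁ := a₁') (hc.lower₁ i m) h2 (hn i)
        (e.sub_nat i).sub_one.ne_zero d.sub_one.ne_zero d.ne_zero e.ne_zero e.sub_one.ne_zero k0)
    simp only [add_div] at key
    linear_combination key
  · have key := congrArg (· / denom T (x + a₂' - b₁' - 2 * m) (x + a₂' - b₂' - 2 * m - 2 * i) i)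
        (hT.coef_lowering_pm (z := z) (j := (j : G)) (a₁ := a₁') (hc.lower₁ i m) h2 (hn i)
        (((((g2 a₁ b₁ a₂ b₂).sub_two_mul j).sub_two_mul i).sub_two_mul m).sub_one).ne_zero
        (e.sub_nat i).sub_one.ne_zero d.sub_one.ne_zero d.ne_zero e.ne_zero e.sub_one.ne_zero
        (((g1 a₂ a₁).add_nat j).sub_nat m).ne_zero)
    simp only [add_div] at key
    linear_combination key

end

end EllipticQG

end

/-! ### From constants to functions, and from coefficients to operators. -/

noncomputable section

namespace EllipticQG

open scoped UpperHalfPlane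

universe u v

theorem map_homCoef {G F G' F' : Type*} [CommRing G] [Field F] [CommRing G'] [Field F'] {T : G → F}
    {T' : G' → F'} {ρ : F →+* F'} {π : G →+* G'} (h : ∀ f, ρ (T f) = T' (π f)) (x d e : G)
    (c : ℕ → ℕ → F) (i m : ℕ) :
    ρ (homCoef T x d e c i m) = homCoef T' (π x) (π d) (π e) (fun i m => ρ (c i m)) i m := by
  simp [homCoef, denom, lowerProd, upperProd, map_prod, h, map_ofNat]

theorem ThetaMap.admissible_of_map {G R F : Type*} [CommRing G] [CommRing R] [Field F] {T : G → F}
    {t : G → R} (A : R →+* F) (hT : ∀ g, T g = A (t g)) {i p q : G} {v1 v2 v3 : R}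
    (h : ∀ y j, v1 * t i * t j * t (y - q) * t (y + p + q - j) - v2 * t y * t (j - q) *
      t (y + p - j) + v3 * t (y + p) * t (y - j) * t (j - p - q) = 0) :
    Admissible T i p q (A v1) (A v2) (A v3) := fun y j => by
  simpa only [hT, map_mul, map_sub, map_add, map_zero] using (congrArg A (h y j)).trans A.map_zero

section

variable {E F : Type*} [NormedAddCommGroup E] [NormedSpace ℂ E]
  [NormedAddCommGroup F] [NormedSpace ℂ F] (τ : ℍ) (ħ : ℂ)

/-- Constants as meromorphic functions. -/
def cstMer (c : ℂ) : Mer E := algebraMap (Entire E) (Mer E) (cst c)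

theorem cstMer_mul (a b : ℂ) : cstMer (E := E) (a * b) = cstMer a * cstMer b := by
  rw [cstMer, map_mul, map_mul]
  rfl

theorem merPull_cstMer (f : E → F) (hf : AnalyticOnNhd ℂ f Set.univ)
    (hs : Function.Surjective f) (c : ℂ) : merPull f hf hs (cstMer c) = cstMer c :=
  merPull_algebraMap f hf hs (cst c)

theorem thetaFn_cst (c : ℂ) : thetaFn (E := E) τ ħ (cst c) = cstMer (theta τ (ħ * c)) := rfl

variable {τ ħ}

/-- The relation is quantified over all arguments y and j, so for entire functions it can be checked
pointwise. The coefficients c(i, m) therefore need only be found over ℂ. -/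
theorem ThetaMap.Admissible.lift {i p q v1 v2 v3 : ℂ}
    (h : Admissible (fun u => theta τ (ħ * u)) i p q v1 v2 v3) :
    Admissible (thetaFn (E := E) τ ħ) (cst i) (cst p) (cst q) (cstMer v1) (cstMer v2)
      (cstMer v3) := fun y j => by
  refine admissible_of_map (G := Entire E) (R := Entire E) (F := Mer E)
    (T := thetaFn τ ħ) (t := fun f => ⟨fun p => theta τ (ħ * f.1 p), fun p _ =>
      (theta_analyticAt τ _).comp (f := fun p => ħ * f.1 p) (analyticAt_const.mul (f.2 p trivial))⟩)
    (algebraMap (Entire E) (Mer E)) (fun _ => rfl) (i := cst i) (p := cst p) (q := cst q) (v1 := cst v1)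
    (v2 := cst v2) (v3 := cst v3) (fun y j => Subtype.ext (funext fun v => ?_)) y j
  exact h (y.1 v) (j.1 v)

theorem Intertwining.lift {a₂ b₁ b₂ : ℂ} {c : ℕ → ℕ → ℂ}
    (hc : Intertwining (fun u => theta τ (ħ * u)) a₂ b₁ b₂ c) :
    Intertwining (thetaFn (E := E) τ ħ) (cst a₂) (cst b₁) (cst b₂) fun i m => cstMer (c i m) where
  raise i m := by
    have h := (hc.raise i m).lift (E := E)
    simpa only [cstMer_mul, ← thetaFn_cst, RingHom.map_add, RingHom.map_sub, map_natCast,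
      RingHom.map_one] using h
  lower₁ i m := by
    have h := congrArg (cstMer (E := E)) (hc.lower₁ i m)
    simpa only [cstMer_mul, ← thetaFn_cst, RingHom.map_add, RingHom.map_sub, map_natCast,
      RingHom.map_one] using h
  lower₂ i m := by
    have h := congrArg (cstMer (E := E)) (hc.lower₂ i m)
    simpa only [cstMer_mul, ← thetaFn_cst, RingHom.map_add, RingHom.map_sub, map_natCast,
      RingHom.map_one] using h
  lower₀ m := by
    have h := congrArg (cstMer (E := E)) (hc.lower₀ m)
    simpa only [cstMer_mul, ← thetaFn_cst, RingHom.map_add, RingHom.map_sub, map_natCast,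
      RingHom.map_one] using h

end

/-- The index of the basis vector with coefficient `coefA`. -/
def stepA : Sgn → Sgn → ℕ × ℕ → ℕ × ℕ
  | true, true, p => p
  | true, false, p => (p.1 + 1, p.2)
  | false, true, p => (p.1 - 1, p.2)
  | false, false, p => p

/-- The index of the basis vector with coefficient `coefB`. -/
def stepB : Sgn → Sgn → ℕ × ℕ → ℕ × ℕ
  | true, true, p => (p.1 + 1, p.2 - 1)
  | true, false, p => (p.1, p.2 + 1)
  | false, true, p => (p.1, p.2 - 1)
  | false, false, p => (p.1 - 1, p.2 + 1)

section

variable {G F : Type*} [CommRing G] [Field F] {T : G → F}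

theorem ThetaMap.coefA_zero (hT : ThetaMap T) (z x a₁ b₁ a₂ b₂ k : G) :
    coefA T z x a₁ b₁ a₂ b₂ 0 k false true = 0 := by simp [coefA, hT.map_zero]

theorem ThetaMap.coefB_zero_left (hT : ThetaMap T) (z x a₁ b₁ a₂ b₂ k : G) :
    coefB T z x a₁ b₁ a₂ b₂ 0 k false false = 0 := by simp [coefB, hT.map_zero]

theorem ThetaMap.coefB_zero_right (hT : ThetaMap T) (z x a₁ b₁ a₂ b₂ j : G) (σ : Sgn) :
    coefB T z x a₁ b₁ a₂ b₂ j 0 σ true = 0 := by cases σ <;> simp [coefB, hT.map_zero]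

end

section

variable {G F N : Type*} [CommRing G] [Algebra ℂ G] [Field F] [AddCommGroup N] [Module F N]
  {T : G → F} {x : G} (hT : ThetaMap T) (hx : Generic T x) (hx2 : Generic T (2 * x))
  (hn : ∀ n : ℕ, T (n + 1 : G) ≠ 0)
include hT hx hx2 hn

open Finset.HasAntidiagonal (antidiagonal)

omit hx2 in
theorem sum_raising {a₁ b₁ a₂ b₂ : ℂ} {c : ℕ → ℕ → F} (hc : Intertwining T (algebraMap ℂ G a₂)
    (algebraMap ℂ G b₁) (algebraMap ℂ G b₂) c) (z : G) (σ : Sgn) (j k : ℕ) (e : ℕ → ℕ → N) :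
    coefA T z x (algebraMap ℂ G a₁) (algebraMap ℂ G b₁) (algebraMap ℂ G a₂) (algebraMap ℂ G b₂)
      j k σ true • ∑ q ∈ antidiagonal k,
        homCoef T x (algebraMap ℂ G (a₂ - b₂)) (algebraMap ℂ G (a₂ - b₁)) c q.1 q.2 • e q.1 q.2 +
    coefB T z x (algebraMap ℂ G a₁) (algebraMap ℂ G b₁) (algebraMap ℂ G a₂) (algebraMap ℂ G b₂)
      j k σ true • ∑ q ∈ antidiagonal (k - 1),
        homCoef T x (algebraMap ℂ G (a₂ - b₂)) (algebraMap ℂ G (a₂ - b₁)) c q.1 q.2 •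
          e (q.1 + 1) q.2 =
    ∑ q ∈ antidiagonal k,
      homCoef T (x + 1) (algebraMap ℂ G (a₂ - b₂)) (algebraMap ℂ G (a₂ - b₁)) c q.1 q.2 •
      (coefA T z x (algebraMap ℂ G a₁) (algebraMap ℂ G b₂) (algebraMap ℂ G a₂)
        (algebraMap ℂ G b₁) (j + q.1 : ℕ) q.2 σ true • e q.1 q.2 +
      coefB T z x (algebraMap ℂ G a₁) (algebraMap ℂ G b₂) (algebraMap ℂ G a₂)
        (algebraMap ℂ G b₁) (j + q.1 : ℕ) q.2 σ true • e (q.1 + 1) (q.2 - 1)) := by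
  refine raising_sum (A := fun i m => coefA T z x (algebraMap ℂ G a₁) (algebraMap ℂ G b₂)
    (algebraMap ℂ G a₂) (algebraMap ℂ G b₁) (j + i : ℕ) m σ true) (B := fun i m => coefB T z x
    (algebraMap ℂ G a₁) (algebraMap ℂ G b₂) (algebraMap ℂ G a₂) (algebraMap ℂ G b₁)
    (j + i : ℕ) m σ true) e ?_ (fun i m h => ?_) ?_ fun h => ?_
  · rw [homCoef_zero, homCoef_zero, coefA_swap, mul_comm]; rfl
  · subst h
    have := homCoef_raising hT hx hn hc (a₁ := a₁) z σ i m j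
    simp only [Nat.cast_add, Nat.cast_one]
    rw [← add_assoc]
    exact this
  · rw [Nat.cast_zero, hT.coefB_zero_right]
  · rw [h, Nat.cast_zero, hT.coefB_zero_right]

theorem sum_lowering {a₁ b₁ a₂ b₂ : ℂ} {c : ℕ → ℕ → F} (hc : Intertwining T (algebraMap ℂ G a₂)
    (algebraMap ℂ G b₁) (algebraMap ℂ G b₂) c) (z : G) (σ : Sgn) (j k : ℕ) (f : ℕ → ℕ → N) :
    coefA T z x (algebraMap ℂ G a₁) (algebraMap ℂ G b₁) (algebraMap ℂ G a₂) (algebraMap ℂ G b₂)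
      j k σ false • ∑ q ∈ antidiagonal k,
        homCoef T x (algebraMap ℂ G (a₂ - b₂)) (algebraMap ℂ G (a₂ - b₁)) c q.1 q.2 •
          f (q.1 + 1) q.2 +
    coefB T z x (algebraMap ℂ G a₁) (algebraMap ℂ G b₁) (algebraMap ℂ G a₂) (algebraMap ℂ G b₂)
      j k σ false • ∑ q ∈ antidiagonal (k + 1),
        homCoef T x (algebraMap ℂ G (a₂ - b₂)) (algebraMap ℂ G (a₂ - b₁)) c q.1 q.2 • f q.1 q.2 =
    ∑ q ∈ antidiagonal k,
      homCoef T (x - 1) (algebraMap ℂ G (a₂ - b₂)) (algebraMap ℂ G (a₂ - b₁)) c q.1 q.2 •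
      (coefA T z x (algebraMap ℂ G a₁) (algebraMap ℂ G b₂) (algebraMap ℂ G a₂)
        (algebraMap ℂ G b₁) (j + q.1 : ℕ) q.2 σ false • f (q.1 + 1) q.2 +
      coefB T z x (algebraMap ℂ G a₁) (algebraMap ℂ G b₂) (algebraMap ℂ G a₂)
        (algebraMap ℂ G b₁) (j + q.1 : ℕ) q.2 σ false • f q.1 (q.2 + 1)) := by
  refine lowering_sum (A := fun i m => coefA T z x (algebraMap ℂ G a₁) (algebraMap ℂ G b₂)
    (algebraMap ℂ G a₂) (algebraMap ℂ G b₁) (j + i : ℕ) m σ false) (B := fun i m => coefB T z x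
    (algebraMap ℂ G a₁) (algebraMap ℂ G b₂) (algebraMap ℂ G a₂) (algebraMap ℂ G b₁)
    (j + i : ℕ) m σ false) f ?_ ?_ fun i m h => ?_
  · rw [homCoef_zero, homCoef_zero, coefB_swap T (hc.lower₀ k)]; rfl
  · have := homCoef_lowering hT hx hx2 hn hc (a₁ := a₁) z σ k 0 j 0
      (by rw [Nat.cast_zero, hT.map_zero]; ring)
    rw [zero_div, zero_div, zero_mul, add_zero, Nat.cast_zero, add_zero] at this
    simp only [Nat.cast_add, Nat.cast_zero]
    exact this
  · subst h
    have h2 := hc.lower₂ i m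
    have := homCoef_lowering hT hx hx2 hn hc (a₁ := a₁) z σ i (m + 1) j (c (i + 1) m) (by
      rw [Nat.cast_add, Nat.cast_one, ← h2]; congr 2; ring)
    have h3 := homCoef_sub_one_succ (T := T) x (a₂ - b₂) (a₂ - b₁) c i m
    rw [← h3] at this
    simp only [Nat.cast_add, Nat.cast_one] at this ⊢
    rw [add_sub_cancel_right] at this
    rw [add_assoc (i : G), ← add_assoc (j : G)]
    exact this

/-- This is commutation with L_{σρ} on the basis vector p: ρ = + leads to `sum_raising` and ρ = - to
`sum_lowering`. Truncated indices in `stepA` and `stepB` always come with the coefficient zero. -/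
theorem sum_step {a₁ b₁ a₂ b₂ : ℂ} {c : ℕ → ℕ → F} (hc : Intertwining T (algebraMap ℂ G a₂)
    (algebraMap ℂ G b₁) (algebraMap ℂ G b₂) c) (z : G) (σ ρ : Sgn) (p : ℕ × ℕ) :
    coefA T z x (algebraMap ℂ G a₁) (algebraMap ℂ G b₁) (algebraMap ℂ G a₂) (algebraMap ℂ G b₂)
      p.1 p.2 σ ρ • ∑ q ∈ antidiagonal (stepA σ ρ p).2,
        homCoef T x (algebraMap ℂ G (a₂ - b₂)) (algebraMap ℂ G (a₂ - b₁)) c q.1 q.2 •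
          Finsupp.single ((stepA σ ρ p).1 + q.1, q.2) (1 : F) +
    coefB T z x (algebraMap ℂ G a₁) (algebraMap ℂ G b₁) (algebraMap ℂ G a₂) (algebraMap ℂ G b₂)
      p.1 p.2 σ ρ • ∑ q ∈ antidiagonal (stepB σ ρ p).2,
        homCoef T x (algebraMap ℂ G (a₂ - b₂)) (algebraMap ℂ G (a₂ - b₁)) c q.1 q.2 •
          Finsupp.single ((stepB σ ρ p).1 + q.1, q.2) (1 : F) =
    ∑ q ∈ antidiagonal p.2, homCoef T (x + algebraMap ℂ G ρ.val) (algebraMap ℂ G (a₂ - b₂))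
        (algebraMap ℂ G (a₂ - b₁)) c q.1 q.2 •
      (coefA T z x (algebraMap ℂ G a₁) (algebraMap ℂ G b₂) (algebraMap ℂ G a₂)
        (algebraMap ℂ G b₁) (p.1 + q.1 : ℕ) q.2 σ ρ •
          Finsupp.single (stepA σ ρ (p.1 + q.1, q.2)) (1 : F) +
      coefB T z x (algebraMap ℂ G a₁) (algebraMap ℂ G b₂) (algebraMap ℂ G a₂)
        (algebraMap ℂ G b₁) (p.1 + q.1 : ℕ) q.2 σ ρ •
          Finsupp.single (stepB σ ρ (p.1 + q.1, q.2)) (1 : F)) := by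
  obtain ⟨j, k⟩ := p
  cases ρ
  · rw [show Sgn.val false = -1 from rfl, RingHom.map_neg, RingHom.map_one, ← sub_eq_add_neg]
    cases σ
    · have h := sum_lowering hT hx hx2 hn hc (a₁ := a₁) z false j k
        fun i m => Finsupp.single (j + i - 1, m) (1 : F)
      refine Eq.trans ?_ h
      congr 1
      cases j with
      | zero => simp only [Nat.cast_zero, hT.coefB_zero_left, zero_smul]
      | succ j =>
        simp only [stepB, Nat.add_sub_cancel, add_right_comm j 1]
    · have h := sum_lowering hT hx hx2 hn hc (a₁ := a₁) z true j k
        fun i m => Finsupp.single (j + i, m) (1 : F)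
      refine Eq.trans ?_ h
      simp only [stepA, stepB, add_assoc, add_comm 1]
  · rw [show Sgn.val true = 1 from rfl, RingHom.map_one]
    cases σ
    · have h := sum_raising hT hx hn hc (a₁ := a₁) z false j k
        fun i m => Finsupp.single (j + i - 1, m) (1 : F)
      refine Eq.trans ?_ h
      congr 1
      cases j with
      | zero => simp only [Nat.cast_zero, hT.coefA_zero, zero_smul]
      | succ j => simp only [stepA, Nat.add_sub_cancel, add_right_comm j 1]
    · have h := sum_raising hT hx hn hc (a₁ := a₁) z true j k
        fun i m => Finsupp.single (j + i, m) (1 : F)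
      refine Eq.trans ?_ h
      simp only [stepA, stepB, add_assoc, add_comm 1]

end

/-! ### The gauge form of a tensor product -/

/-- The tensor product of two asymptotic representations, in a rescaled basis. -/
abbrev gaugeRep (τ : ℍ) (ħ a₁ b₁ a₂ b₂ : ℂ) : LData.{0} where
  B := ℕ × ℕ
  wt p := a₁ - b₁ - 2 * p.1 + (a₂ - b₂ - 2 * p.2)
  L i j p :=
    Finsupp.single (stepA i j p) (coefA (thetaFn τ ħ) (z₂ ħ) (x₂ ħ) (cst a₁) (cst b₁) (cst a₂)
      (cst b₂) p.1 p.2 i j) +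
    Finsupp.single (stepB i j p) (coefB (thetaFn τ ħ) (z₂ ħ) (x₂ ħ) (cst a₁) (cst b₁) (cst a₂)
      (cst b₂) p.1 p.2 i j)

namespace LData

variable {X Y Z : LData.{u}} {ħ : ℂ}

theorem emb_sum {ι : Type*} (s : Finset ι) (f : ι → X.V) :
    X.emb (∑ i ∈ s, f i) = ∑ i ∈ s, X.emb (f i) :=
  map_sum (AddMonoidHom.mk' X.emb emb_add) f s

theorem act_sum {ι : Type*} (i j : Sgn) (s : Finset ι) (f : ι → X.V) :
    X.act ħ i j (∑ k ∈ s, f k) = ∑ k ∈ s, X.act ħ i j (f k) :=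
  map_sum (AddMonoidHom.mk' (X.act ħ i j) act_add) f s

theorem component_eq_self {α : ℂ} {v : X.V} (h : ∀ a, v a ≠ 0 → X.wt a = α) :
    X.component α v = v := by
  classical
  rw [component, Finsupp.filter_eq_self_iff]
  exact h

theorem component_eq_zero {α : ℂ} {v : X.V} (h : ∀ a, v a ≠ 0 → X.wt a ≠ α) :
    X.component α v = 0 := by
  classical
  rw [component, Finsupp.filter_eq_zero_iff]
  exact fun a ha => by_contra fun hv => h a hv ha

theorem isHomOn_of_single {φ : X.V →ₗ[M] Y.V}
    (hg : ∀ b a, φ (Finsupp.single b 1) a ≠ 0 → Y.wt a = X.wt b)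
    (hc : ∀ i j b, ext φ (X.L i j b) = Y.act ħ i j (φ (Finsupp.single b 1))) :
    IsHomOn ħ ⊤ φ where
  graded α v _ := by
    induction v using Finsupp.induction_linear with
    | zero => rw [component, component, Finsupp.filter_zero, map_zero, Finsupp.filter_zero]
    | add v w hv hw => rw [component_add, map_add, map_add, component_add, hv trivial, hw trivial]
    | single b g =>
      rw [show Finsupp.single b g = g • Finsupp.single b (1 : M) by
        rw [Finsupp.smul_single, smul_eq_mul, mul_one], component_smul, map_smul, map_smul,
        component_smul]
      congr 1
      have hb : ∀ a, Finsupp.single b (1 : M) a ≠ 0 → a = b := fun a ha => by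
        by_contra h
        exact ha (Finsupp.single_eq_of_ne h)
      by_cases h : X.wt b = α
      · rw [component_eq_self fun a ha => by rw [hb a ha, h],
          component_eq_self fun a ha => by rw [hg b a ha, h]]
      · rw [component_eq_zero fun a ha => by rwa [hb a ha],
          component_eq_zero fun a ha => by rwa [hg b a ha], map_zero]
  comm i j v _ := by
    induction v using Finsupp.induction_linear with
    | zero => rw [map_zero]; simp [act]
    | add v w hv hw => rw [act_add, map_add, map_add, act_add, hv trivial, hw trivial]
    | single b g =>
      rw [show Finsupp.single b g = g • Finsupp.single b (1 : M) by
        rw [Finsupp.smul_single, smul_eq_mul, mul_one], act_smul, map_smul, map_smul, act_smul,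
        act_single, map_one, one_smul, hc]

theorem IsHomOn.comp {φ : X.V →ₗ[M] Y.V} {ψ : Y.V →ₗ[M] Z.V} (hψ : IsHomOn ħ ⊤ ψ)
    (hφ : IsHomOn ħ ⊤ φ) : IsHomOn ħ ⊤ (ψ ∘ₗ φ) where
  graded α v _ := by
    rw [LinearMap.comp_apply, hφ.graded α v trivial, hψ.graded α _ trivial]; rfl
  comm i j v _ := by rw [ext_comp, hφ.comm i j v trivial, hψ.comm i j _ trivial]; rfl

theorem IsHomOn.symm {φ : X.V ≃ₗ[M] Y.V} (hφ : IsHomOn ħ ⊤ (φ : X.V →ₗ[M] Y.V)) :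
    IsHomOn ħ ⊤ (φ.symm : Y.V →ₗ[M] X.V) where
  graded α v _ := by
    have h := hφ.graded α (φ.symm v) trivial
    simp only [LinearEquiv.coe_coe, LinearEquiv.apply_symm_apply] at h
    rw [LinearEquiv.coe_coe, ← h, LinearEquiv.symm_apply_apply]
  comm i j v _ := by
    have h := hφ.comm i j (φ.symm v) trivial
    simp only [LinearEquiv.coe_coe, LinearEquiv.apply_symm_apply] at h
    rw [← h, ← ext_comp, LinearEquiv.coe_coe]
    rw [show (φ.symm : Y.V →ₗ[M] X.V) ∘ₗ (φ : X.V →ₗ[M] Y.V) = LinearMap.id from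
      LinearMap.ext fun v => φ.symm_apply_apply v, ext_id]

end LData

/-! ### Intertwining operators -/

/-- The linear map with coefficients `homCoef`. -/
def homMap (τ : ℍ) (ħ : ℂ) (d e : ℂ) (c : ℕ → ℕ → ℂ) : (ℕ × ℕ →₀ M) →ₗ[M] (ℕ × ℕ →₀ M) :=
  Finsupp.linearCombination M fun p : ℕ × ℕ =>
    ∑ q ∈ Finset.HasAntidiagonal.antidiagonal p.2, Finsupp.single (p.1 + q.1, q.2)
      (homCoef (thetaFn τ ħ) (x₁ ħ) (cst d) (cst e) (fun i m => cstMer (c i m)) q.1 q.2)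

section

variable {τ : ℍ} {ħ : ℂ}

theorem homMap_single (d e : ℂ) (c : ℕ → ℕ → ℂ) (p : ℕ × ℕ) :
    homMap τ ħ d e c (Finsupp.single p 1) =
      ∑ q ∈ Finset.HasAntidiagonal.antidiagonal p.2, Finsupp.single (p.1 + q.1, q.2)
        (homCoef (thetaFn τ ħ) (x₁ ħ) (cst d) (cst e) (fun i m => cstMer (c i m)) q.1 q.2) := by
  rw [homMap, Finsupp.linearCombination_single, one_smul]

theorem homMap_apply_ne_zero {d e : ℂ} {c : ℕ → ℕ → ℂ} {p a : ℕ × ℕ}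
    (h : homMap τ ħ d e c (Finsupp.single p 1) a ≠ 0) :
    ∃ q : ℕ × ℕ, q.1 + q.2 = p.2 ∧ a = (p.1 + q.1, q.2) := by
  rw [homMap_single, Finsupp.finsetSum_apply] at h
  obtain ⟨q, hq, h⟩ := Finset.exists_ne_zero_of_sum_ne_zero h
  exact ⟨q, Finset.HasAntidiagonal.mem_antidiagonal.1 hq, (Finsupp.single_apply_ne_zero.1 h).1⟩

variable (hħ : ħ ≠ 0)
include hħ

theorem xIn_homCoef (d e s : ℂ) (c : ℕ → ℕ → ℂ) (i m : ℕ) :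
    xIn (s * ħ) (homCoef (thetaFn τ ħ) (x₁ ħ) (cst d) (cst e) (fun i m => cstMer (c i m)) i m) =
      homCoef (thetaFn τ ħ) (x₂ ħ + cst s) (cst d) (cst e) (fun i m => cstMer (c i m)) i m := by
  obtain ⟨π, h, hx⟩ := xIn_thetaFn (τ := τ) hħ s
  rw [map_homCoef (T' := thetaFn τ ħ) (π := (π : Entire ℂ →+* Entire (ℂ × ℂ))) h]
  simp only [AlgHom.coe_toRingHom, hx, AlgHom.commutes]
  congr 1
  funext i m
  exact merPull_cstMer _ _ _ _

theorem emb_homMap {a₁ b₁ a₂ b₂ : ℂ} (d e : ℂ) (c : ℕ → ℕ → ℂ) (p : ℕ × ℕ) :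
    (gaugeRep τ ħ a₁ b₁ a₂ b₂).emb (homMap τ ħ d e c (Finsupp.single p 1)) =
      ∑ q ∈ Finset.HasAntidiagonal.antidiagonal p.2,
        homCoef (thetaFn τ ħ) (x₂ ħ) (cst d) (cst e) (fun i m => cstMer (c i m)) q.1 q.2 •
          Finsupp.single (p.1 + q.1, q.2) (1 : M2) := by
  rw [homMap_single, LData.emb_sum]
  refine Finset.sum_congr rfl fun q _ => ?_
  have h := xIn_homCoef (τ := τ) hħ d e 0 c q.1 q.2
  rw [zero_mul, RingHom.map_zero, add_zero] at h
  rw [LData.emb_single, h, Finsupp.smul_single, smul_eq_mul, mul_one]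

theorem act_homMap {a₁ b₁ a₂ b₂ : ℂ} (d e : ℂ) (c : ℕ → ℕ → ℂ) (p : ℕ × ℕ) (i j : Sgn) :
    (gaugeRep τ ħ a₁ b₁ a₂ b₂).act ħ i j (homMap τ ħ d e c (Finsupp.single p 1)) =
      ∑ q ∈ Finset.HasAntidiagonal.antidiagonal p.2,
        homCoef (thetaFn τ ħ) (x₂ ħ + cst j.val) (cst d) (cst e) (fun i m => cstMer (c i m))
          q.1 q.2 •
        (coefA (thetaFn τ ħ) (z₂ ħ) (x₂ ħ) (cst a₁) (cst b₁) (cst a₂) (cst b₂) (p.1 + q.1 : ℕ) q.2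
          i j • Finsupp.single (stepA i j (p.1 + q.1, q.2)) (1 : M2) +
        coefB (thetaFn τ ħ) (z₂ ħ) (x₂ ħ) (cst a₁) (cst b₁) (cst a₂) (cst b₂) (p.1 + q.1 : ℕ) q.2
          i j • Finsupp.single (stepB i j (p.1 + q.1, q.2)) (1 : M2)) := by
  rw [homMap_single, LData.act_sum]
  refine Finset.sum_congr rfl fun q _ => ?_
  rw [LData.act_single, xIn_homCoef hħ, Finsupp.smul_single, Finsupp.smul_single, smul_eq_mul,
    smul_eq_mul, mul_one, mul_one]

theorem ext_homMap {a₁ b₁ a₂ b₂ a₁' b₁' a₂' b₂' : ℂ} (d e : ℂ) (c : ℕ → ℕ → ℂ) (p : ℕ × ℕ)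
    (f : M2) : LData.ext (X := gaugeRep τ ħ a₁ b₁ a₂ b₂) (Y := gaugeRep τ ħ a₁' b₁' a₂' b₂')
      (homMap τ ħ d e c) (Finsupp.single p f) =
      f • ∑ q ∈ Finset.HasAntidiagonal.antidiagonal p.2,
        homCoef (thetaFn τ ħ) (x₂ ħ) (cst d) (cst e) (fun i m => cstMer (c i m)) q.1 q.2 •
          Finsupp.single (p.1 + q.1, q.2) (1 : M2) := by
  rw [← emb_homMap hħ (a₁ := a₁') (b₁ := b₁') (a₂ := a₂') (b₂ := b₂')]
  exact LData.ext_single ..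

variable (hgen : ∀ n : ℕ, theta τ (ħ * (n + 1)) ≠ 0)
include hgen

theorem isHomOn_homMap {a₁ b₁ a₂ b₂ : ℂ} {c : ℕ → ℕ → ℂ}
    (hc : Intertwining (fun u => theta τ (ħ * u)) a₂ b₁ b₂ c) :
    LData.IsHomOn (X := gaugeRep τ ħ a₁ b₁ a₂ b₂) (Y := gaugeRep τ ħ a₁ b₂ a₂ b₁) ħ ⊤
      (homMap τ ħ (a₂ - b₂) (a₂ - b₁) c) := by
  refine LData.isHomOn_of_single (fun p a ha => ?_) fun σ ρ p => ?_
  · obtain ⟨q, h2, h1⟩ := homMap_apply_ne_zero ha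
    change a₁ - b₂ - 2 * (a.1 : ℂ) + (a₂ - b₁ - 2 * (a.2 : ℂ)) =
      a₁ - b₁ - 2 * (p.1 : ℂ) + (a₂ - b₂ - 2 * (p.2 : ℂ))
    rw [h1, ← h2]
    push_cast
    ring
  · rw [act_homMap hħ]
    refine (map_add _ _ _).trans ?_
    rw [ext_homMap hħ, ext_homMap hħ]
    have hT := thetaMap_thetaFn (E := ℂ × ℂ) τ ħ
    have hn : ∀ n : ℕ, thetaFn (E := ℂ × ℂ) τ ħ (n + 1) ≠ 0 := fun n =>
      thetaFn_ne_zero τ ħ (p := 0) (hgen n)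
    have hx : Generic (thetaFn τ ħ) (x₂ ħ) := thetaFn_x₂_ne_zero hħ
    have hx2 : Generic (thetaFn τ ħ) (2 * x₂ ħ) := thetaFn_two_mul_x₂_ne_zero hħ
    have hc' := hc.lift (E := ℂ × ℂ)
    exact sum_step hT hx hx2 hn hc' (a₁ := a₁) (z₂ ħ) σ ρ p

end

end EllipticQG

end

/-! ### The rescaling factors that bring a tensor product to gauge form. -/

noncomputable section

namespace EllipticQG

open scoped UpperHalfPlane

universe u v

/-- The rescaling of the basis of a tensor product. -/
def gaugeCoef {G F : Type*} [CommRing G] [Field F] (T : G → F) (x d : G) (j k : ℕ) : F :=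
  lowerProd T (x + d - 2 * k) j / lowerProd T (x + d - k + 1) k

section

variable {G F : Type*} [CommRing G] [Algebra ℂ G] [Field F] {T : G → F} {x : G}

theorem Generic.lowerProd_ne_zero {u : G} (h : Generic T u) (i : ℕ) : lowerProd T u i ≠ 0 :=
  (h.prod_ne_zero i).1

theorem gaugeCoef_ne_zero (hx : Generic T x) (d : ℂ) (j k : ℕ) :
    gaugeCoef T x (algebraMap ℂ G d) j k ≠ 0 :=
  div_ne_zero (((hx.add_cst d).sub_two_mul k).lowerProd_ne_zero j)
    ((generic_add_one.2 ((hx.add_cst d).sub_nat k)).lowerProd_ne_zero k)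

variable (hx : Generic T x) (d : ℂ) (j k : ℕ)

omit [Algebra ℂ G] in
theorem gaugeCoef_succ (x d : G) (j k : ℕ) :
    gaugeCoef T x d (j + 1) k = gaugeCoef T x d j k * T (x + d - 2 * k - j - 1) := by
  rw [gaugeCoef, lowerProd_succ, gaugeCoef]; ring

omit [Algebra ℂ G] in
theorem gaugeCoef_add_one_succ_left (x d : G) (j k : ℕ) :
    gaugeCoef T (x + 1) d (j + 1) k = gaugeCoef T (x + 1) d j k * T (x + d - 2 * k - j) := by
  rw [gaugeCoef_succ]; congr 2; ring

omit [Algebra ℂ G] in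
theorem gaugeCoef_sub_one_succ_left (x d : G) (j k : ℕ) :
    gaugeCoef T (x - 1) d (j + 1) k = gaugeCoef T (x - 1) d j k * T (x + d - 2 * k - j - 2) := by
  rw [gaugeCoef_succ]; congr 2; ring

include hx

theorem gaugeCoef_add_one : gaugeCoef T (x + 1) (algebraMap ℂ G d) j k =
    gaugeCoef T x (algebraMap ℂ G d) j k * (T (x + algebraMap ℂ G d - 2 * k) *
      T (x + algebraMap ℂ G d - 2 * k + 1) /
      (T (x + algebraMap ℂ G d - 2 * k - j) * T (x + algebraMap ℂ G d - k + 1))) := by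
  have gy := (hx.add_cst d).sub_two_mul k
  have gw := generic_add_one.2 ((hx.add_cst d).sub_nat k)
  have h1 := lowerProd_sub_one T (x + algebraMap ℂ G d - 2 * k + 1) j
  have h2 := lowerProd_sub_one T (x + algebraMap ℂ G d - k + 1 + 1) k
  have n1 := gw.lowerProd_ne_zero k
  have n2 := (generic_add_one.2 gw).lowerProd_ne_zero k
  have n3 := gw.ne_zero
  have n4 := (gy.sub_nat j).ne_zero
  rw [add_sub_cancel_right, show x + algebraMap ℂ G d - 2 * k + 1 - j - 1 =
    x + algebraMap ℂ G d - 2 * k - j by ring] at h1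
  rw [add_sub_cancel_right, show x + algebraMap ℂ G d - k + 1 + 1 - k - 1 =
    x + algebraMap ℂ G d - 2 * k + 1 by ring] at h2
  rw [gaugeCoef, gaugeCoef, show x + 1 + algebraMap ℂ G d - 2 * k =
    x + algebraMap ℂ G d - 2 * k + 1 by ring, show x + 1 + algebraMap ℂ G d - k + 1 =
    x + algebraMap ℂ G d - k + 1 + 1 by ring]
  field_simp
  linear_combination lowerProd T (x + algebraMap ℂ G d - 2 * k + 1) j *
    T (x + algebraMap ℂ G d - 2 * k - j) * h2 - lowerProd T (x + algebraMap ℂ G d - k + 1 + 1) k *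
    T (x + algebraMap ℂ G d - 2 * k + 1) * h1

theorem gaugeCoef_sub_one : gaugeCoef T (x - 1) (algebraMap ℂ G d) j k =
    gaugeCoef T x (algebraMap ℂ G d) j k * (T (x + algebraMap ℂ G d - 2 * k - j - 1) *
      T (x + algebraMap ℂ G d - k) /
      (T (x + algebraMap ℂ G d - 2 * k - 1) * T (x + algebraMap ℂ G d - 2 * k))) := by
  have gy := (hx.add_cst d).sub_two_mul k
  have gw := (hx.add_cst d).sub_nat k
  have h1 := lowerProd_sub_one T (x + algebraMap ℂ G d - 2 * k) j
  have h2 := lowerProd_sub_one T (x + algebraMap ℂ G d - k + 1) k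
  have n1 := gw.lowerProd_ne_zero k
  have n2 := (generic_add_one.2 gw).lowerProd_ne_zero k
  have n3 := gy.sub_one.ne_zero
  have n4 := gy.ne_zero
  rw [add_sub_cancel_right, show x + algebraMap ℂ G d - k + 1 - k - 1 =
    x + algebraMap ℂ G d - 2 * k by ring] at h2
  rw [gaugeCoef, gaugeCoef, show x - 1 + algebraMap ℂ G d - 2 * k =
    x + algebraMap ℂ G d - 2 * k - 1 by ring, show x - 1 + algebraMap ℂ G d - k + 1 =
    x + algebraMap ℂ G d - k by ring]
  field_simp
  linear_combination lowerProd T (x + algebraMap ℂ G d - k + 1) k *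
    T (x + algebraMap ℂ G d - 2 * k) * h1 - lowerProd T (x + algebraMap ℂ G d - 2 * k) j *
    T (x + algebraMap ℂ G d - 2 * k - j - 1) * h2

theorem gaugeCoef_succ_right : gaugeCoef T x (algebraMap ℂ G d) j (k + 1) =
    gaugeCoef T (x - 1) (algebraMap ℂ G d) j k * (T (x + algebraMap ℂ G d - 2 * k - j - 2) /
      (T (x + algebraMap ℂ G d - 2 * k - 1) * T (x + algebraMap ℂ G d - 2 * k - 2))) := by
  have gy := (hx.add_cst d).sub_two_mul k
  have gw := (hx.add_cst d).sub_nat k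
  have h1 := lowerProd_sub_one T (x + algebraMap ℂ G d - 2 * k - 1) j
  have h2 := lowerProd_succ T (x + algebraMap ℂ G d - k) k
  have n1 := gw.lowerProd_ne_zero k
  have n3 := gy.sub_one.ne_zero
  have n4 := gy.sub_one.sub_one.ne_zero
  rw [show x + algebraMap ℂ G d - 2 * k - 1 - 1 = x + algebraMap ℂ G d - 2 * k - 2 by ring]
    at n4 h1
  rw [show x + algebraMap ℂ G d - 2 * k - 1 - j - 1 = x + algebraMap ℂ G d - 2 * k - j - 2 by ring]
    at h1
  rw [show x + algebraMap ℂ G d - k - k - 1 = x + algebraMap ℂ G d - 2 * k - 1 by ring] at h2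
  rw [gaugeCoef, gaugeCoef, show x + algebraMap ℂ G d - 2 * ((k + 1 : ℕ) : G) =
    x + algebraMap ℂ G d - 2 * k - 2 by push_cast; ring, show x - 1 + algebraMap ℂ G d - 2 * k =
    x + algebraMap ℂ G d - 2 * k - 1 by ring, show x - 1 + algebraMap ℂ G d - k + 1 =
    x + algebraMap ℂ G d - k by ring, show x + algebraMap ℂ G d - ((k + 1 : ℕ) : G) + 1 =
    x + algebraMap ℂ G d - k by push_cast; ring, h2]
  field_simp
  linear_combination h1

theorem gaugeCoef_add_one_succ_right : gaugeCoef T (x + 1) (algebraMap ℂ G d) j (k + 1) =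
    gaugeCoef T x (algebraMap ℂ G d) j k * (T (x + algebraMap ℂ G d - 2 * k - j - 1) /
      (T (x + algebraMap ℂ G d - 2 * k) * T (x + algebraMap ℂ G d - 2 * k - 1))) := by
  rw [gaugeCoef_succ_right (generic_add_one.2 hx), add_sub_cancel_right]
  congr 2
  · congr 1; ring
  · congr 2 <;> ring

end

section

variable {G F : Type*} [CommRing G] [Algebra ℂ G] [Field F] {T : G → F} {x : G}
  (hT : ThetaMap T) (hx : Generic T x) (a₁ b₁ a₂ b₂ : ℂ) (z : G)
include hT hx

/-- The inner sign k of the coproduct takes two values. The term with k = ρ, where the second factor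
acts diagonally, becomes `coefA` after the rescaling; the term with the other sign becomes `coefB`
(`wcoef_gauge_B`). -/
theorem wcoef_gauge_A (σ ρ : Sgn) (p : ℕ × ℕ) :
    wcoef T z (x + algebraMap ℂ G (a₂ - b₂) - 2 * ((stepA σ ρ p).2 : G)) (algebraMap ℂ G a₁)
        (algebraMap ℂ G b₁) p.1 σ ρ *
      wcoef T z x (algebraMap ℂ G a₂) (algebraMap ℂ G b₂) p.2 ρ ρ *
      gaugeCoef T (x + algebraMap ℂ G ρ.val) (algebraMap ℂ G (a₂ - b₂)) p.1 p.2 =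
    coefA T z x (algebraMap ℂ G a₁) (algebraMap ℂ G b₁) (algebraMap ℂ G a₂) (algebraMap ℂ G b₂)
      p.1 p.2 σ ρ *
      gaugeCoef T x (algebraMap ℂ G (a₂ - b₂)) (stepA σ ρ p).1 (stepA σ ρ p).2 := by
  have gx : ∀ k : ℕ, Generic T (x + algebraMap ℂ G a₂ - algebraMap ℂ G b₂ - 2 * k) := fun k =>
    ((hx.add_cst a₂).sub_cst b₂).sub_two_mul k
  have gx' : ∀ j k : ℕ, Generic T (x + algebraMap ℂ G a₂ - algebraMap ℂ G b₂ - 2 * k +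
    algebraMap ℂ G a₁ - algebraMap ℂ G b₁ - 2 * j) := fun j k =>
    (((gx k).add_cst a₁).sub_cst b₁).sub_two_mul j
  have n0 := hx.ne_zero
  have n1 := fun k => (gx k).ne_zero
  have n2 := fun k => (gx k).sub_one.ne_zero
  have n3 := fun k => (generic_add_one.2 (gx k)).ne_zero
  have n4 := fun k => (gx k).sub_one.sub_one.ne_zero
  have n5 := fun j k : ℕ => ((gx k).sub_nat j).ne_zero
  have n6 := fun j k : ℕ => ((gx k).sub_nat j).sub_one.ne_zero
  have n7 := fun j k : ℕ => ((gx k).sub_nat j).sub_one.sub_one.ne_zero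
  have n8 := fun k : ℕ => (generic_add_one.2 (((hx.add_cst a₂).sub_cst b₂).sub_nat k)).ne_zero
  have m1 := fun j k => (generic_add_one.2 (gx' j k)).ne_zero
  have m2 := fun j k => (gx' j k).sub_one.ne_zero
  obtain ⟨j, k⟩ := p
  cases ρ
  · rw [show Sgn.val false = -1 from rfl, RingHom.map_neg, RingHom.map_one, ← sub_eq_add_neg]
    cases σ
    · rw [gaugeCoef_sub_one hx]
      simp only [stepA]
      generalize gaugeCoef T x (algebraMap ℂ G (a₂ - b₂)) j k = g
      simp only [wcoef, coefA, map_sub]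
      ring_nf
    · rw [gaugeCoef_sub_one hx]
      simp only [stepA]
      rw [gaugeCoef_succ]
      generalize gaugeCoef T x (algebraMap ℂ G (a₂ - b₂)) j k = g
      simp only [wcoef, coefA, map_sub]
      ring_nf
  · rw [show Sgn.val true = 1 from rfl, RingHom.map_one]
    cases σ
    · cases j with
      | zero => simp only [Nat.cast_zero, hT.coefA_zero, hT.wcoef_zero, zero_mul]
      | succ j => ?_
      rw [gaugeCoef_add_one_succ_left, gaugeCoef_add_one hx]
      simp only [stepA, Nat.add_sub_cancel]
      generalize gaugeCoef T x (algebraMap ℂ G (a₂ - b₂)) j k = g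
      simp only [wcoef, coefA, map_sub, Nat.cast_add, Nat.cast_one]
      have h0 := n1 k
      have h1 := n3 k
      have h2 := n5 j k
      have h3 := n8 k
      have h4 := n0
      clear n0 n1 n2 n3 n4 n5 n6 n7 n8 m1 m2 gx gx'
      ring_nf at *
      field_simp
    · rw [gaugeCoef_add_one hx]
      simp only [stepA]
      generalize gaugeCoef T x (algebraMap ℂ G (a₂ - b₂)) j k = g
      simp only [wcoef, coefA, map_sub]
      have h0 := n1 k
      have h1 := n3 k
      have h2 := n5 j k
      have h3 := n8 k
      have h4 := n0
      have h5 := m1 j k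
      clear n0 n1 n2 n3 n4 n5 n6 n7 n8 m1 m2 gx gx'
      ring_nf at *
      field_simp

theorem wcoef_gauge_B (σ ρ : Sgn) (p : ℕ × ℕ) :
    wcoef T z (x + algebraMap ℂ G (a₂ - b₂) - 2 * ((stepB σ ρ p).2 : G)) (algebraMap ℂ G a₁)
        (algebraMap ℂ G b₁) p.1 σ (!ρ) *
      wcoef T z x (algebraMap ℂ G a₂) (algebraMap ℂ G b₂) p.2 (!ρ) ρ *
      gaugeCoef T (x + algebraMap ℂ G ρ.val) (algebraMap ℂ G (a₂ - b₂)) p.1 p.2 =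
    coefB T z x (algebraMap ℂ G a₁) (algebraMap ℂ G b₁) (algebraMap ℂ G a₂) (algebraMap ℂ G b₂)
      p.1 p.2 σ ρ *
      gaugeCoef T x (algebraMap ℂ G (a₂ - b₂)) (stepB σ ρ p).1 (stepB σ ρ p).2 := by
  have gx : ∀ k : ℕ, Generic T (x + algebraMap ℂ G a₂ - algebraMap ℂ G b₂ - 2 * k) := fun k =>
    ((hx.add_cst a₂).sub_cst b₂).sub_two_mul k
  have gx' : ∀ j k : ℕ, Generic T (x + algebraMap ℂ G a₂ - algebraMap ℂ G b₂ - 2 * k +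
    algebraMap ℂ G a₁ - algebraMap ℂ G b₁ - 2 * j) := fun j k =>
    (((gx k).add_cst a₁).sub_cst b₁).sub_two_mul j
  have n0 := hx.ne_zero
  have n1 := fun k => (gx k).ne_zero
  have n2 := fun k => (gx k).sub_one.ne_zero
  have n3 := fun k => (generic_add_one.2 (gx k)).ne_zero
  have n4 := fun k => (gx k).sub_one.sub_one.ne_zero
  have n5 := fun j k : ℕ => ((gx k).sub_nat j).ne_zero
  have n6 := fun j k : ℕ => ((gx k).sub_nat j).sub_one.ne_zero
  have n7 := fun j k : ℕ => ((gx k).sub_nat j).sub_one.sub_one.ne_zero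
  have n8 := fun k : ℕ => (generic_add_one.2 (((hx.add_cst a₂).sub_cst b₂).sub_nat k)).ne_zero
  have m1 := fun j k => (generic_add_one.2 (gx' j k)).ne_zero
  have m2 := fun j k => (gx' j k).sub_one.ne_zero
  obtain ⟨j, k⟩ := p
  cases ρ
  · rw [show Sgn.val false = -1 from rfl, RingHom.map_neg, RingHom.map_one, ← sub_eq_add_neg]
    cases σ
    · cases j with
      | zero => simp only [Bool.not_false, Nat.cast_zero, hT.coefB_zero_left, hT.wcoef_zero, zero_mul]
      | succ j => ?_
      rw [gaugeCoef_sub_one_succ_left]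
      simp only [stepB, Nat.add_sub_cancel, Bool.not_false]
      rw [gaugeCoef_succ_right hx]
      generalize gaugeCoef T (x - 1) (algebraMap ℂ G (a₂ - b₂)) j k = g
      simp only [wcoef, coefB, map_sub, Nat.cast_add, Nat.cast_one]
      ring_nf
    · simp only [stepB, Bool.not_false]
      rw [gaugeCoef_succ_right hx]
      generalize gaugeCoef T (x - 1) (algebraMap ℂ G (a₂ - b₂)) j k = g
      simp only [wcoef, coefB, map_sub, Nat.cast_add, Nat.cast_one]
      ring_nf
  · rw [show Sgn.val true = 1 from rfl, RingHom.map_one]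
    cases k with
    | zero =>
      simp only [Bool.not_true, Nat.cast_zero, hT.coefB_zero_right, hT.wcoef_zero, zero_mul,
        mul_zero]
    | succ k => ?_
    cases σ
    · rw [gaugeCoef_add_one_succ_right hx]
      simp only [stepB, Nat.add_sub_cancel, Bool.not_true]
      generalize gaugeCoef T x (algebraMap ℂ G (a₂ - b₂)) j k = g
      simp only [wcoef, coefB, map_sub, Nat.cast_add, Nat.cast_one]
      ring_nf
    · rw [gaugeCoef_add_one_succ_right hx]
      simp only [stepB, Nat.add_sub_cancel, Bool.not_true]
      rw [gaugeCoef_succ]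
      generalize gaugeCoef T x (algebraMap ℂ G (a₂ - b₂)) j k = g
      simp only [wcoef, coefB, map_sub, Nat.cast_add, Nat.cast_one]
      ring_nf

end

end EllipticQG

end

/-! ### The isomorphism between a tensor product and its gauge form. -/

noncomputable section

namespace EllipticQG

open scoped UpperHalfPlane

universe u v

theorem map_gaugeCoef {G F G' F' : Type*} [CommRing G] [Field F] [CommRing G'] [Field F'] {T : G → F}
    {T' : G' → F'} {ρ : F →+* F'} {π : G →+* G'} (h : ∀ f, ρ (T f) = T' (π f)) (x d : G)
    (j k : ℕ) : ρ (gaugeCoef T x d j k) = gaugeCoef T' (π x) (π d) j k := by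
  simp [gaugeCoef, lowerProd, map_prod, h, map_ofNat]

theorem smul_single_add_single {ι k : Type*} [CommRing k] (g : k) (p q : ι) (a b : k) :
    g • (Finsupp.single p a + Finsupp.single q b) =
      Finsupp.single p (a * g) + Finsupp.single q (b * g) := by
  rw [smul_add, Finsupp.smul_single, Finsupp.smul_single, smul_eq_mul, smul_eq_mul, mul_comm g,
    mul_comm g]

/-- A rescaling of a basis. -/
def rescale {ι k : Type*} [Field k] (g : ι → k) (hg : ∀ p, g p ≠ 0) : (ι →₀ k) ≃ₗ[k] (ι →₀ k) :=
  LinearEquiv.ofLinearMap (Finsupp.linearCombination k fun p => Finsupp.single p (g p))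
    (Finsupp.linearCombination k fun p => Finsupp.single p (g p)⁻¹)
    (Finsupp.lhom_ext fun p c => by
      simp only [LinearMap.comp_apply, Finsupp.linearCombination_single, Finsupp.smul_single,
        smul_eq_mul, LinearMap.id_apply, mul_assoc, inv_mul_cancel₀ (hg p), mul_one])
    (Finsupp.lhom_ext fun p c => by
      simp only [LinearMap.comp_apply, Finsupp.linearCombination_single, Finsupp.smul_single,
        smul_eq_mul, LinearMap.id_apply, mul_assoc, mul_inv_cancel₀ (hg p), mul_one])

theorem rescale_single {ι k : Type*} [Field k] (g : ι → k) (hg : ∀ p, g p ≠ 0) (p : ι) :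
    rescale g hg (Finsupp.single p 1) = Finsupp.single p (g p) := by
  simp [rescale]

section

variable {τ : ℍ} {ħ : ℂ} (hħ : ħ ≠ 0)
include hħ

theorem xIn_gaugeCoef (d s : ℂ) (j k : ℕ) :
    xIn (s * ħ) (gaugeCoef (thetaFn τ ħ) (x₁ ħ) (cst d) j k) =
      gaugeCoef (thetaFn τ ħ) (x₂ ħ + cst s) (cst d) j k := by
  obtain ⟨π, h, hx⟩ := xIn_thetaFn (τ := τ) hħ s
  rw [map_gaugeCoef (T' := thetaFn τ ħ) (π := (π : Entire ℂ →+* Entire (ℂ × ℂ))) h]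
  simp only [AlgHom.coe_toRingHom, hx, AlgHom.commutes]

theorem shift_wcoef (s : ℂ) (a b : ℂ) (n : ℕ) (i j : Sgn) :
    shift 0 (ħ * s) (wcoef (thetaFn τ ħ) (z₂ ħ) (x₂ ħ) (cst a) (cst b) n i j) =
      wcoef (thetaFn τ ħ) (z₂ ħ) (x₂ ħ + cst s) (cst a) (cst b) n i j := by
  obtain ⟨π, h, hz, hx⟩ := shift_thetaFn (τ := τ) hħ 0 s
  rw [zero_mul] at h
  rw [mul_comm, map_wcoef (T' := thetaFn τ ħ) (π := (π : Entire (ℂ × ℂ) →+* Entire (ℂ × ℂ))) h]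
  simp only [AlgHom.coe_toRingHom, hx, hz, AlgHom.commutes, map_zero, add_zero, map_natCast]

theorem tensor_asymptoticRep_L (ℓ₁ s₁ ℓ₂ s₂ : ℂ) (i j : Sgn) (p : ℕ × ℕ) :
    ((asymptoticRep τ ħ ℓ₁ s₁).tensor ħ (asymptoticRep τ ħ ℓ₂ s₂)).L i j p =
      Finsupp.single (stepA i j p)
        (wcoef (thetaFn τ ħ) (z₂ ħ) (x₂ ħ + cst ℓ₂ - 2 * ((stepA i j p).2 : Entire (ℂ × ℂ)))
            (cst (ℓ₁ + s₁)) (cst s₁) p.1 i j *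
          wcoef (thetaFn τ ħ) (z₂ ħ) (x₂ ħ) (cst (ℓ₂ + s₂)) (cst s₂) p.2 j j) +
      Finsupp.single (stepB i j p)
        (wcoef (thetaFn τ ħ) (z₂ ħ) (x₂ ħ + cst ℓ₂ - 2 * ((stepB i j p).2 : Entire (ℂ × ℂ)))
            (cst (ℓ₁ + s₁)) (cst s₁) p.1 i (!j) *
          wcoef (thetaFn τ ħ) (z₂ ħ) (x₂ ħ) (cst (ℓ₂ + s₂)) (cst s₂) p.2 (!j) j) := by
  have hs : ∀ (k : Sgn) (q : ℕ × ℕ),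
      q = (((p.1 : ℤ) + i.ind - k.ind).toNat, ((p.2 : ℤ) + k.ind - j.ind).toNat) →
      (((asymptoticRep τ ħ ℓ₁ s₁).L i k p.1).sum fun a f =>
        ((asymptoticRep τ ħ ℓ₂ s₂).L k j p.2).sum fun a' g =>
        Finsupp.single (a, a') (shift 0 (ħ * (asymptoticRep τ ħ ℓ₂ s₂).wt a') f * g)) =
      Finsupp.single q
        (wcoef (thetaFn τ ħ) (z₂ ħ) (x₂ ħ + cst ℓ₂ - 2 * (q.2 : Entire (ℂ × ℂ)))
            (cst (ℓ₁ + s₁)) (cst s₁) p.1 i k *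
          wcoef (thetaFn τ ħ) (z₂ ħ) (x₂ ħ) (cst (ℓ₂ + s₂)) (cst s₂) p.2 k j) := fun k q hq => by
    rw [asymptoticRep_L hħ, asymptoticRep_L hħ]
    refine (Finsupp.sum_single_index (by simp [Finsupp.sum])).trans ?_
    refine (Finsupp.sum_single_index (by simp)).trans ?_
    rw [Int.cast_natCast, Int.cast_natCast, asymptoticRep_wt, shift_wcoef hħ, hq]
    simp only [map_sub, map_mul, map_ofNat, map_natCast, add_sub_assoc]
    rfl
  have hA := hs j (stepA i j p) (by cases i <;> cases j <;> simp [stepA, Sgn.ind])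
  have hB := hs (!j) (stepB i j p) (by cases i <;> cases j <;> simp [stepB, Sgn.ind])
  change (∑ k : Sgn, ((asymptoticRep τ ħ ℓ₁ s₁).L i k p.1).sum fun a f =>
      ((asymptoticRep τ ħ ℓ₂ s₂).L k j p.2).sum fun a' g =>
      Finsupp.single (a, a') (shift 0 (ħ * (asymptoticRep τ ħ ℓ₂ s₂).wt a') f * g)) = _
  rw [Fintype.sum_bool]
  cases j
  · exact (congrArg₂ (· + ·) hB hA).trans (add_comm _ _)
  · exact congrArg₂ (· + ·) hA hB

/-- The isomorphism from the gauge form to the tensor product. -/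
def gaugeEquiv (d : ℂ) : (ℕ × ℕ →₀ M) ≃ₗ[M] (ℕ × ℕ →₀ M) :=
  rescale (fun p => gaugeCoef (thetaFn τ ħ) (x₁ ħ) (cst d) p.1 p.2)
    fun p => gaugeCoef_ne_zero (thetaFn_x₁_ne_zero hħ) d p.1 p.2

theorem isHomOn_gaugeEquiv (ℓ₁ s₁ ℓ₂ s₂ : ℂ) :
    LData.IsHomOn (X := gaugeRep τ ħ (ℓ₁ + s₁) s₁ (ℓ₂ + s₂) s₂)
      (Y := (asymptoticRep τ ħ ℓ₁ s₁).tensor ħ (asymptoticRep τ ħ ℓ₂ s₂)) ħ ⊤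
      (gaugeEquiv (τ := τ) hħ ℓ₂ : (ℕ × ℕ →₀ M) →ₗ[M] (ℕ × ℕ →₀ M)) := by
  have hφ : ∀ p : ℕ × ℕ, gaugeEquiv (τ := τ) hħ ℓ₂ (Finsupp.single p 1) =
      Finsupp.single p (gaugeCoef (thetaFn τ ħ) (x₁ ħ) (cst ℓ₂) p.1 p.2) := fun p =>
    rescale_single _ _ p
  have hemb : ∀ (p : ℕ × ℕ) (f : M2), LData.ext
      (X := gaugeRep τ ħ (ℓ₁ + s₁) s₁ (ℓ₂ + s₂) s₂)
      (Y := (asymptoticRep τ ħ ℓ₁ s₁).tensor ħ (asymptoticRep τ ħ ℓ₂ s₂))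
      (gaugeEquiv (τ := τ) hħ ℓ₂ : (ℕ × ℕ →₀ M) →ₗ[M] (ℕ × ℕ →₀ M)) (Finsupp.single p f) =
      Finsupp.single p (f * gaugeCoef (thetaFn τ ħ) (x₂ ħ) (cst ℓ₂) p.1 p.2) := fun p f => by
    refine (LData.ext_single ..).trans ?_
    have h := xIn_gaugeCoef (τ := τ) hħ ℓ₂ 0 p.1 p.2
    rw [zero_mul, RingHom.map_zero, add_zero] at h
    refine (congrArg (f • LData.emb _ ·) (hφ p)).trans ?_
    refine (congrArg (f • ·) (LData.emb_single ..)).trans ?_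
    rw [h]
    exact Finsupp.smul_single ..
  have hwt : ∀ a : ℕ × ℕ, ((asymptoticRep τ ħ ℓ₁ s₁).tensor ħ (asymptoticRep τ ħ ℓ₂ s₂)).wt a =
      (gaugeRep τ ħ (ℓ₁ + s₁) s₁ (ℓ₂ + s₂) s₂).wt a := fun a => by
    change ℓ₁ - 2 * (a.1 : ℂ) + (ℓ₂ - 2 * (a.2 : ℂ)) =
      ℓ₁ + s₁ - s₁ - 2 * (a.1 : ℂ) + (ℓ₂ + s₂ - s₂ - 2 * (a.2 : ℂ))
    ring
  refine LData.isHomOn_of_single (fun p a ha => ?_) fun i j p => ?_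
  · have h : a = p := by
      by_contra h
      refine ha ((DFunLike.congr_fun (hφ p) a).trans (Finsupp.single_eq_of_ne h))
    subst h
    exact hwt a
  · refine (map_add _ _ _).trans ?_
    rw [hemb, hemb]
    refine Eq.trans ?_ (congrArg (LData.act ħ _ i j) (hφ p)).symm
    refine Eq.trans ?_ (LData.act_single ..).symm
    rw [tensor_asymptoticRep_L hħ, xIn_gaugeCoef hħ]
    have hT := thetaMap_thetaFn (E := ℂ × ℂ) τ ħ
    have hx : Generic (thetaFn τ ħ) (x₂ ħ) := thetaFn_x₂_ne_zero hħ
    have hA := wcoef_gauge_A hT hx (ℓ₁ + s₁) s₁ (ℓ₂ + s₂) s₂ (z₂ ħ) i j p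
    have hB := wcoef_gauge_B hT hx (ℓ₁ + s₁) s₁ (ℓ₂ + s₂) s₂ (z₂ ħ) i j p
    rw [add_sub_cancel_right] at hA hB
    rw [← hA, ← hB]
    exact (smul_single_add_single ..).symm

end

end EllipticQG

end

noncomputable section

namespace EllipticQG

open scoped UpperHalfPlane

universe u v

/-! ### Coefficients of intertwining operators -/

section

variable {G F : Type*} [CommRing G] [Field F] (T : G → F)

/-- The conditions on the coefficients of an intertwining operator with indices `(i, m)`,
`(i + 1, m)` and `(i, m + 1)`. -/
structure IntertwiningAt (a₂ b₁ b₂ : G) (c : ℕ → ℕ → F) (i m : ℕ) : Prop where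
  raise : ThetaMap.Admissible T (i + 1) (b₁ - b₂ - i) (a₂ - b₁ - m) (c (i + 1) m)
    (c i m * T (i + m + 1)) (c i (m + 1) * T (m + 1))
  lower₁ : c (i + 1) m * T (i + 1) * T (a₂ - b₂ - i - m) = c i m * T (i + m + 1) * T (b₁ - b₂ - i)
  lower₂ : c (i + 1) m * T (i + 1) * T (a₂ - b₁ - m) = c i (m + 1) * T (m + 1) * T (b₁ - b₂ - i)

variable {T} {a₂ b₁ b₂ : G} {c : ℕ → ℕ → F}

theorem Intertwining.of_forall (h : ∀ i m, IntertwiningAt T a₂ b₁ b₂ c i m)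
    (h0 : ∀ m : ℕ, c 0 (m + 1) * T (a₂ - b₂ - m) = c 0 m * T (a₂ - b₁ - m)) :
    Intertwining T a₂ b₁ b₂ c :=
  ⟨fun i m => (h i m).raise, fun i m => (h i m).lower₁, fun i m => (h i m).lower₂, h0⟩

variable (hT : ThetaMap T)
include hT

theorem IntertwiningAt.of_generic {i m : ℕ} (t : F) (h1 : c (i + 1) m = t * T (b₁ - b₂ - i))
    (h0 : c i m * T (i + m + 1) = t * (T (i + 1) * T (a₂ - b₂ - i - m)))
    (h2 : c i (m + 1) * T (m + 1) = t * (T (i + 1) * T (a₂ - b₁ - m))) :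
    IntertwiningAt T a₂ b₁ b₂ c i m where
  raise := by
    have h := (hT.admissible_generic (i + 1) (b₁ - b₂ - i) (a₂ - b₁ - m)).mul t
    rw [show b₁ - b₂ - i + (a₂ - b₁ - m) = a₂ - b₂ - i - m by ring] at h
    rwa [h1, h0, h2]
  lower₁ := by rw [h1, h0]; ring
  lower₂ := by rw [h1, h2]; ring

variable (hn : ∀ n : ℕ, T (n + 1 : G) ≠ 0)
include hn

/-- Where T (a₂ - b₂ - i - m) is non-zero, c(i, m) determines its two neighbours, and together they
are a multiple of the generic triple. All conditions at (i, m) then follow. -/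
theorem IntertwiningAt.of_recursion {i m : ℕ} (hd : T (a₂ - b₂ - i - m) ≠ 0)
    (h1 : c (i + 1) m * T (i + 1) * T (a₂ - b₂ - i - m) = c i m * T (i + m + 1) * T (b₁ - b₂ - i))
    (h2 : c i (m + 1) * T (m + 1) * T (a₂ - b₂ - i - m) = c i m * T (i + m + 1) * T (a₂ - b₁ - m)) :
    IntertwiningAt T a₂ b₁ b₂ c i m := by
  have hi := hn i
  refine of_generic hT (c i m * T (i + m + 1) / (T (i + 1) * T (a₂ - b₂ - i - m))) ?_ ?_ ?_
  · field_simp; exact h1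
  · field_simp
  · field_simp; exact h2

omit hT hn

variable (T) in
/-- The theta factorial. -/
def thetaFact (k : ℕ) : F := upperProd T 0 k

theorem thetaFact_succ (k : ℕ) : thetaFact T (k + 1) = thetaFact T k * T (k + 1) := by
  rw [thetaFact, upperProd_succ, zero_add]; rfl

variable (T) in
/-- The generic form of the coefficient with index `(i, m + 1)`. -/
def genCoef (a₂ b₁ b₂ : G) (D : ℕ → F) (i m : ℕ) : F :=
  thetaFact T (i + m + 1) / (thetaFact T i * thetaFact T (m + 1)) *
    (lowerProd T (b₁ - b₂ + 1) i * lowerProd T (a₂ - b₁) m) / D (i + m)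

include hn

theorem thetaFact_ne_zero (k : ℕ) : thetaFact T k ≠ 0 := by
  induction k with
  | zero => exact one_ne_zero
  | succ k ih => rw [thetaFact_succ]; exact mul_ne_zero ih (hn k)

theorem genCoef_zero (D : ℕ → F) (m : ℕ) :
    genCoef T a₂ b₁ b₂ D 0 m = lowerProd T (a₂ - b₁) m / D m := by
  have h := thetaFact_ne_zero hn (m + 1)
  rw [genCoef, zero_add, lowerProd_zero, show thetaFact T 0 = 1 from rfl, one_mul, one_mul,
    div_self h, one_mul]

variable {D : ℕ → F}

/-- Only the growth of D by one factor matters for the recursion. D is left free because the two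
operators omit different vanishing factors from the product of the T (a₂ - b₂ - r). -/
theorem genCoef_succ_left {i m : ℕ} (hD : D (i + m) ≠ 0)
    (hD' : D (i + m + 1) = D (i + m) * T (a₂ - b₂ - i - (m + 1 : ℕ)))
    (hd : T (a₂ - b₂ - i - (m + 1 : ℕ)) ≠ 0) :
    genCoef T a₂ b₁ b₂ D (i + 1) m * T (i + 1) * T (a₂ - b₂ - i - (m + 1 : ℕ)) =
      genCoef T a₂ b₁ b₂ D i m * T (i + (m + 1 : ℕ) + 1) * T (b₁ - b₂ - i) := by
  have h1 := thetaFact_ne_zero hn i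
  have h2 := thetaFact_ne_zero hn (m + 1)
  have h3 := hn i
  have e : ((i + m + 1 : ℕ) : G) + 1 = i + (m + 1 : ℕ) + 1 := by push_cast; ring
  rw [genCoef, genCoef, add_right_comm i 1 m, hD', thetaFact_succ (i + m + 1), thetaFact_succ i,
    lowerProd_succ, e, show b₁ - b₂ + 1 - (i : G) - 1 = b₁ - b₂ - i by ring]
  field_simp

theorem genCoef_succ_right {i m : ℕ} (hD : D (i + m) ≠ 0)
    (hD' : D (i + m + 1) = D (i + m) * T (a₂ - b₂ - i - (m + 1 : ℕ)))
    (hd : T (a₂ - b₂ - i - (m + 1 : ℕ)) ≠ 0) :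
    genCoef T a₂ b₁ b₂ D i (m + 1) * T ((m + 1 : ℕ) + 1) * T (a₂ - b₂ - i - (m + 1 : ℕ)) =
      genCoef T a₂ b₁ b₂ D i m * T (i + (m + 1 : ℕ) + 1) * T (a₂ - b₁ - (m + 1 : ℕ)) := by
  have h1 := thetaFact_ne_zero hn i
  have h2 := thetaFact_ne_zero hn (m + 1)
  have h3 := hn (m + 1)
  have e : ((i + m + 1 : ℕ) : G) + 1 = i + (m + 1 : ℕ) + 1 := by push_cast; ring
  rw [genCoef, genCoef, ← add_assoc i m 1, hD', thetaFact_succ (i + m + 1), thetaFact_succ (m + 1),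
    lowerProd_succ, e, show a₂ - b₁ - (m : G) - 1 = a₂ - b₁ - (m + 1 : ℕ) by push_cast; ring]
  field_simp

omit hn

variable (T) in
/-- The coefficients of the first intertwining operator. -/
def coefPhi (s : G) : ℕ → ℕ → F
  | i, m + 1 => genCoef T s 0 s (lowerProd T 0) i m
  | 0, 0 => 0
  | i + 1, 0 => -(lowerProd T (-s) i / lowerProd T 0 i)

theorem coefPhi_zero (s : G) : coefPhi T s 0 0 = 0 := by rw [coefPhi]

theorem coefPhi_succ (s : G) (i m : ℕ) :
    coefPhi T s i (m + 1) = genCoef T s 0 s (lowerProd T 0) i m := by rw [coefPhi]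

include hT hn

theorem lowerProd_zero_ne_zero (i : ℕ) : lowerProd T 0 i ≠ 0 := by
  induction i with
  | zero => exact one_ne_zero
  | succ i ih =>
    rw [lowerProd_succ, hT.neg_of (show (0 : G) - i - 1 = -(i + 1) by ring)]
    exact mul_ne_zero ih (neg_ne_zero.2 (hn i))

/-- As a₂ = b₂, the denominators are T (-(i + m)) and vanish only at the origin. There the
coefficient is 0, and the values -1 and 1 at (1, 0) and (0, 1) satisfy the conditions as the
degenerate solution for p + q = 0. All other conditions follow from the recursion. -/
theorem coefPhi_intertwining (s : G) : Intertwining T s 0 s (coefPhi T s) := by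
  have hl : ∀ i : ℕ, lowerProd T 0 i ≠ 0 := lowerProd_zero_ne_zero hT hn
  have hd : ∀ i m : ℕ, T (s - s - i - (m + 1 : ℕ)) ≠ 0 := fun i m => by
    rw [hT.neg_of (show s - s - i - ((m + 1 : ℕ) : G) = -((i + m : ℕ) + 1) by push_cast; ring)]
    exact neg_ne_zero.2 (hn _)
  have hD : ∀ i m : ℕ, lowerProd T 0 (i + m + 1) =
      lowerProd T 0 (i + m) * T (s - s - i - (m + 1 : ℕ)) := fun i m => by
    rw [lowerProd_succ]; congr 2; push_cast; ring
  have e1 := fun i m => genCoef_succ_left (b₁ := 0) hn (hl (i + m)) (hD i m) (hd i m)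
  have e2 := fun i m => genCoef_succ_right (b₁ := 0) hn (hl (i + m)) (hD i m) (hd i m)
  have p0 : T (s - s - (0 : ℕ) - (0 : ℕ)) = 0 := by
    rw [← hT.map_zero]; congr 1; simp
  refine .of_forall (fun i m => ?_) fun m => ?_
  · cases m with
    | succ m =>
      refine .of_recursion hT hn (hd i m) ?_ ?_
      · rw [coefPhi_succ, coefPhi_succ]; exact e1 i m
      · rw [coefPhi_succ, coefPhi_succ]; exact e2 i m
    | zero =>
      cases i with
      | zero =>
        have h1 : coefPhi T s 1 0 = -1 := by
          rw [coefPhi, lowerProd_zero, lowerProd_zero, div_one]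
        have h2 : coefPhi T s 0 1 = 1 := by
          rw [coefPhi, genCoef_zero hn, lowerProd_zero, lowerProd_zero, div_one]
        have h3 : coefPhi T s 0 0 = 0 := by rw [coefPhi]
        refine ⟨?_, ?_, ?_⟩
        · have h := (ThetaMap.admissible_of_add_eq_zero (T := T) ((0 : ℕ) + 1) (0 - s - (0 : ℕ))
            (s - 0 - (0 : ℕ)) (by simp)).mul (-1)
          rw [h1, h2, h3]
          convert h using 1 <;> ring
        · rw [h3, p0]; ring
        · rw [h1, h2, hT.neg_of (show 0 - s - ((0 : ℕ) : G) = -(s - 0 - (0 : ℕ)) by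
            push_cast; ring)]
          ring
      | succ i =>
        have hd' : T (s - s - (i + 1 : ℕ) - (0 : ℕ)) ≠ 0 := by
          convert hd i 0 using 2; push_cast; ring
        have hD' : lowerProd T 0 (i + 1) = lowerProd T 0 i * T (s - s - (i + 1 : ℕ) - (0 : ℕ)) := by
          rw [lowerProd_succ]; congr 2; push_cast; ring
        have hl' := hl i
        refine .of_recursion hT hn hd' ?_ ?_
        · rw [coefPhi, coefPhi, lowerProd_succ, hD', show -s - (i : G) - 1 = 0 - s - (i + 1 : ℕ) by
            push_cast; ring, Nat.cast_zero, add_zero]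
          rw [Nat.cast_zero] at hd'
          field_simp
        · have h1 := thetaFact_ne_zero hn (i + 1)
          have h2 := hn 0
          have e : lowerProd T (0 - s + 1) (i + 1) = -(lowerProd T (-s) i * T s) := by
            rw [lowerProd_succ', zero_sub, hT.odd]; ring
          rw [coefPhi, coefPhi, genCoef, add_zero, hD', thetaFact_succ (i + 1), e,
            thetaFact_succ 0, lowerProd_zero, show thetaFact T 0 = 1 from rfl,
            show s - 0 - ((0 : ℕ) : G) = s by simp,
            show ((i + 1 : ℕ) : G) + (0 : ℕ) + 1 = (i + 1 : ℕ) + 1 by simp]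
          field_simp
  · cases m with
    | zero => simp [coefPhi_zero, hT.map_zero]
    | succ m =>
      have h := e2 0 m
      have h' := hn (m + 1)
      simp only [Nat.cast_zero, sub_zero, zero_add] at h h'
      rw [coefPhi, coefPhi]
      refine mul_right_cancel₀ h' ?_
      rw [sub_zero]
      linear_combination h

omit hn

/-- As a₂ = b₁, the parameter q is 0 on the line m = 0, so the degenerate solution (1, T (i + 1), 0)
allows constant coefficients on this line and zeros elsewhere, for every s. -/
theorem coefPi_intertwining (s : G) :
    Intertwining T s s 0 fun _ m => if m = 0 then 1 else 0 := by
  refine .of_forall (fun i m => ?_) fun m => ?_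
  · cases m with
    | succ m =>
      refine ⟨fun y j => ?_, ?_, ?_⟩ <;> simp
    | zero =>
      refine ⟨?_, ?_, ?_⟩
      · have h := ThetaMap.admissible_of_q_eq_zero (T := T) (i + 1) (s - 0 - i)
        simpa using h
      · simp [mul_comm]
      · simp [hT.map_zero]
  · cases m <;> simp [hT.map_zero]

variable (T) in
/-- The coefficients of a second intertwining operator, which exists if `T (s - n) = 0`. -/
def coefPsi (s : G) (K : F) (n : ℕ) (i : ℕ) : ℕ → F
  | 0 => if i ≤ n then 0 else -(lowerProd T (s + 1) n * K)
  | m + 1 => if i + m + 1 ≤ n then 0 else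
      genCoef T s s 0 (fun k => lowerProd T (s - n) (k - n)) i m

include hn

/-- The denominators T (s - i - m) vanish exactly in degree i + m = n. The coefficients up to this
degree may thus be 0, and in degree n + 1 a new solution starts: with m ≥ 1 in degree n the generic
triple has middle entry 0, and with m = 0 the triple is the one of
`ThetaMap.admissible_of_quasiperiod` for the quasi-period s - n. In higher degrees the recursion
applies. -/
theorem coefPsi_intertwining {s : G} {K : F} {n : ℕ} (hs : T (s - n) = 0)
    (hr : ∀ r : ℕ, r ≠ n → T (s - r) ≠ 0) {e : G → F} (he : ∀ a b, e (a + b) = e a * e b)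
    (hK : ∀ w, T (w + (s - n)) = K * e w * T w) : Intertwining T s s 0 (coefPsi T s K n) := by
  have hl : ∀ k : ℕ, lowerProd T (s - n) k ≠ 0 := fun k => by
    induction k with
    | zero => exact one_ne_zero
    | succ k ih =>
      rw [lowerProd_succ]
      refine mul_ne_zero ih ?_
      convert hr (n + k + 1) (by omega) using 2
      push_cast; ring
  have hd : ∀ i m : ℕ, n ≤ i + m → T (s - 0 - i - (m + 1 : ℕ)) ≠ 0 := fun i m h => by
    convert hr (i + m + 1) (by omega) using 2
    push_cast; ring
  have hD : ∀ i m : ℕ, n ≤ i + m → lowerProd T (s - n) (i + m + 1 - n) =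
      lowerProd T (s - n) (i + m - n) * T (s - 0 - i - (m + 1 : ℕ)) := fun i m h => by
    rw [Nat.sub_add_comm h, lowerProd_succ, Nat.cast_sub h]
    congr 2
    push_cast; ring
  have e1 := fun i m h => genCoef_succ_left (a₂ := s) (b₁ := s) (b₂ := 0) (i := i) (m := m)
    (D := fun k => lowerProd T (s - n) (k - n)) hn (hl _) (hD i m h) (hd i m h)
  have e2 := fun i m h => genCoef_succ_right (a₂ := s) (b₁ := s) (b₂ := 0) (i := i) (m := m)
    (D := fun k => lowerProd T (s - n) (k - n)) hn (hl _) (hD i m h) (hd i m h)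
  have h0 : ∀ i m : ℕ, i + m ≤ n → coefPsi T s K n i m = 0 := fun i m h => by
    cases m with
    | zero => exact if_pos h
    | succ m => exact if_pos h
  have hz : ∀ i : ℕ, n < i → coefPsi T s K n i 0 = -(lowerProd T (s + 1) n * K) := fun i h =>
    if_neg (by omega)
  have hg : ∀ i m : ℕ, n ≤ i + m → coefPsi T s K n i (m + 1) =
      genCoef T s s 0 (fun k => lowerProd T (s - n) (k - n)) i m := fun i m h => if_neg (by omega)
  refine .of_forall (fun i m => ?_) fun m => ?_
  · rcases lt_trichotomy (i + m) n with h | h | h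
    · refine .of_generic hT 0 ?_ ?_ ?_
      · rw [h0 _ _ (by omega), zero_mul]
      · rw [h0 _ _ (by omega), zero_mul, zero_mul]
      · rw [h0 _ _ (by omega), zero_mul, zero_mul]
    · cases m with
      | zero =>
        obtain rfl : i = n := h
        have h2 := thetaFact_ne_zero hn i
        have h3 := thetaFact_ne_zero hn 1
        have h1 : coefPsi T s K i i (0 + 1) * T ((0 : ℕ) + 1) = T (i + 1) * lowerProd T (s + 1) i := by
          rw [hg _ _ le_rfl, genCoef]
          simp only [add_zero, Nat.sub_self, lowerProd_zero, mul_one, div_one, zero_add, sub_zero]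
          rw [thetaFact_succ i, thetaFact_succ 0, show thetaFact T 0 = 1 from rfl]
          have h4 := hn 0
          field_simp
        refine ⟨?_, ?_, ?_⟩
        · have h := (hT.admissible_of_quasiperiod ((i : G) + 1) (s - i) he hK).mul
            (-lowerProd T (s + 1) i)
          rw [h1, hz _ (Nat.lt_succ_self _), h0 _ _ le_rfl, sub_zero, sub_self, Nat.cast_zero,
            sub_zero, zero_mul]
          convert h using 1 <;> ring
        · simp [hs]
        · simp [hs, hT.map_zero]
      | succ m =>
        have h1 := thetaFact_ne_zero hn i
        have h2 := thetaFact_ne_zero hn (m + 1)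
        have h3 := hn i
        have h4 := hn (m + 1)
        refine .of_generic hT (thetaFact T (n + 1) / (thetaFact T (i + 1) * thetaFact T (m + 1)) *
          (lowerProd T (s + 1) i * lowerProd T 0 m)) ?_ ?_ ?_
        · rw [hg _ _ (by omega), genCoef, show i + 1 + m = n by omega, lowerProd_succ]
          simp only [Nat.sub_self, lowerProd_zero, div_one, sub_zero, sub_self]
          rw [show s + 1 - (i : G) - 1 = s - i by ring]
          ring
        · rw [h0 _ _ h.le, zero_mul, sub_zero]
          rw [show s - (i : G) - ((m + 1 : ℕ) : G) = s - n by rw [← h]; push_cast; ring, hs]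
          ring
        · rw [hg _ _ (by omega), genCoef, show i + (m + 1) = n by omega, lowerProd_succ,
            thetaFact_succ (m + 1), thetaFact_succ i]
          simp only [Nat.sub_self, lowerProd_zero, div_one, sub_zero, sub_self]
          rw [show 0 - (m : G) - 1 = 0 - (m + 1 : ℕ) by push_cast; ring]
          field_simp
    · cases m with
      | zero =>
        have hd' : T (s - 0 - i - (0 : ℕ)) ≠ 0 := by
          convert hr i (by omega) using 2; simp
        refine .of_recursion hT hn hd' ?_ ?_
        · rw [hz _ (by omega), hz _ (by omega)]; simp
        · have hP : lowerProd T (s + 1) i = 0 :=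
            Finset.prod_eq_zero (Finset.mem_range.2 h) (by rw [add_sub_cancel_right, hs])
          rw [hg _ _ (by omega), genCoef, sub_zero, hP]
          simp [hT.map_zero]
      | succ m =>
        refine .of_recursion hT hn (hd i m (by omega)) ?_ ?_
        · rw [hg _ _ (by omega), hg _ _ (by omega)]; exact e1 i m (by omega)
        · rw [hg _ _ (by omega), hg _ _ (by omega)]; exact e2 i m (by omega)
  · rcases lt_trichotomy m n with h | h | h
    · rw [h0 _ _ (by omega), h0 _ _ (by omega), zero_mul, zero_mul]
    · rw [h0 0 m (by omega), h, sub_zero, hs, mul_zero, zero_mul]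
    · cases m with
      | zero => omega
      | succ m =>
        have h := e2 0 m (by omega)
        have h' := hn (m + 1)
        rw [hg _ _ (by omega), hg _ _ (by omega)]
        simp only [Nat.cast_zero, sub_zero, zero_add] at h h' ⊢
        refine mul_right_cancel₀ h' ?_
        linear_combination h

/-- There are two intertwining operators with complementary diagonal coefficients. -/
theorem exists_intertwining (s : G) (hr : ∀ n r : ℕ, T (s - n) = 0 → T (s - r) = 0 → r = n)
    (hq : ∀ w, T w = 0 → ∃ K : F, ∃ e : G → F, (∀ a b, e (a + b) = e a * e b) ∧
      ∀ u, T (u + w) = K * e u * T u) :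
    ∃ c c' : ℕ → ℕ → F, Intertwining T s 0 s c ∧ Intertwining T s s 0 c' ∧
      ∀ k, c 0 k = 0 ↔ c' 0 k ≠ 0 := by
  -- The diagonal of the first operator vanishes at k = 0 and, if T (s - n) = 0 for some n ≥ 1, for
  -- all k > n. The operator of `coefPi` has diagonal 1 at k = 0 and 0 elsewhere; that of `coefPsi`
  -- is non-zero on the diagonal exactly for k > n. Their sum, or `coefPi` alone if no such n
  -- exists, is therefore complementary.
  have hφ : ∀ k, coefPhi T s 0 (k + 1) = 0 ↔ ∃ r, 1 ≤ r ∧ r ≤ k ∧ T (s - r) = 0 := fun k => by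
    rw [coefPhi_succ, genCoef_zero hn, div_eq_zero_iff, or_iff_left (lowerProd_zero_ne_zero hT hn k),
      lowerProd, Finset.prod_eq_zero_iff]
    constructor
    · rintro ⟨r, h, h'⟩
      refine ⟨r + 1, by omega, Finset.mem_range.1 h, ?_⟩
      rw [← h']; congr 1; push_cast; ring
    · rintro ⟨r, h1, h2, h⟩
      refine ⟨r - 1, Finset.mem_range.2 (by omega), ?_⟩
      rw [← h, Nat.cast_sub h1]; congr 1; push_cast; ring
  by_cases h : ∃ n : ℕ, 1 ≤ n ∧ T (s - n) = 0
  · obtain ⟨n, h1, hs⟩ := h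
    obtain ⟨K, e, he, hK⟩ := hq _ hs
    have hr' : ∀ r : ℕ, r ≠ n → T (s - r) ≠ 0 := fun r h h' => h (hr n r hs h')
    refine ⟨_, _, coefPhi_intertwining hT hn s,
      (coefPi_intertwining hT s).add (coefPsi_intertwining hT hn hs hr' he hK), fun k => ?_⟩
    rw [Pi.add_apply, Pi.add_apply]
    cases k with
    | zero => simp [coefPhi_zero, coefPsi]
    | succ k =>
      rw [hφ, if_neg (Nat.succ_ne_zero k), zero_add, coefPsi, zero_add]
      split_ifs with hk
      · refine iff_of_false ?_ (not_not.2 rfl)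
        rintro ⟨r, h2, h3, h4⟩
        exact hr' r (by omega) h4
      · refine iff_of_true ⟨n, h1, by omega, hs⟩ ?_
        rw [genCoef_zero hn, sub_self]
        refine div_ne_zero (lowerProd_zero_ne_zero hT hn k) (Finset.prod_ne_zero_iff.2 fun r _ => ?_)
        convert hr' (n + r + 1) (by omega) using 2
        push_cast; ring
  · refine ⟨_, _, coefPhi_intertwining hT hn s, coefPi_intertwining hT s, fun k => ?_⟩
    cases k with
    | zero => simp [coefPhi_zero]
    | succ k =>
      rw [hφ, if_neg (Nat.succ_ne_zero k)]
      exact iff_of_false (fun ⟨r, h1, _, h2⟩ => h ⟨r, h1, h2⟩) (not_not.2 rfl)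

end

section

variable {τ : ℍ} {ħ : ℂ} (hħ : ħ ≠ 0)
  (hgen : ∀ a b n : ℤ, (n : ℂ) * ħ = a + b * (τ : ℂ) → n = 0)
include hgen

theorem eq_zero_of_theta_int_eq_zero {n : ℤ} (h : theta τ (ħ * n) = 0) : n = 0 := by
  obtain ⟨-, a, b, h⟩ := theta_eq_zero _ h
  exact hgen a b n (by rw [← h, mul_comm])

theorem theta_add_one_ne_zero (n : ℕ) : theta τ (ħ * (n + 1)) ≠ 0 := fun h => by
  have := eq_zero_of_theta_int_eq_zero hgen (n := n + 1) (by push_cast; exact h)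
  omega

theorem exists_theta_intertwining (s : ℂ) : ∃ c c' : ℕ → ℕ → ℂ,
    Intertwining (fun u => theta τ (ħ * u)) s 0 s c ∧
    Intertwining (fun u => theta τ (ħ * u)) s s 0 c' ∧ ∀ k, c 0 k = 0 ↔ c' 0 k ≠ 0 := by
  refine exists_intertwining (thetaMap_theta τ ħ) (theta_add_one_ne_zero hgen) s
    (fun n r h h' => ?_) fun w h => ?_
  · obtain ⟨-, a, b, h⟩ := theta_eq_zero _ h
    obtain ⟨-, a', b', h'⟩ := theta_eq_zero _ h'
    -- If both s - n and s - r give zeros, the difference (n - r)ħ lies in the lattice, so n = r.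
    have := hgen (a' - a) (b' - b) (n - r) (by push_cast; linear_combination h' - h)
    omega
  · obtain ⟨⟨K, ν, -, h⟩, -⟩ := theta_eq_zero _ h
    refine ⟨K, fun u => Complex.exp (ν * (ħ * u)), fun a b => ?_, fun u => ?_⟩
    · change Complex.exp (ν * (ħ * (a + b))) = Complex.exp (ν * (ħ * a)) * Complex.exp (ν * (ħ * b))
      rw [mul_add, mul_add, Complex.exp_add]
    · rw [← h, mul_add]

end

end EllipticQG

end

noncomputable section

namespace EllipticQG

open scoped UpperHalfPlane

universe u v

/-! ### Triangular operators -/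

section

variable {k : Type*} [Field k]

theorem exists_of_map_apply_ne_zero {ι κ : Type*} {f : (ι →₀ k) →ₗ[k] (κ →₀ k)} {u : ι →₀ k} {a : κ}
    (h : f u a ≠ 0) : ∃ p, u p ≠ 0 ∧ f (Finsupp.single p 1) a ≠ 0 := by
  by_contra! hc
  refine h ?_
  rw [← Finsupp.sum_single u, Finsupp.sum, map_sum, Finsupp.finsetSum_apply]
  refine Finset.sum_eq_zero fun p hp => ?_
  rw [← mul_one (u p), ← smul_eq_mul, ← Finsupp.smul_single, map_smul, Finsupp.smul_apply,
    hc p (Finsupp.mem_support_iff.1 hp), smul_zero]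

/-- A linear operator is triangular with respect to the second index. -/
def Triangular (f : (ℕ × ℕ →₀ k) →ₗ[k] (ℕ × ℕ →₀ k)) (α : ℕ → k) : Prop :=
  ∀ p a, p.2 ≤ a.2 → f (Finsupp.single p 1) a = α p.2 * Finsupp.single p 1 a

namespace Triangular

variable {f g : (ℕ × ℕ →₀ k) →ₗ[k] (ℕ × ℕ →₀ k)} {α γ : ℕ → k}

theorem apply (hf : Triangular f α) {u : ℕ × ℕ →₀ k} {a : ℕ × ℕ} (hu : ∀ p, u p ≠ 0 → p.2 ≤ a.2) :
    f u a = α a.2 * u a := by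
  have h : f u a = ∑ p ∈ u.support, u p * f (Finsupp.single p 1) a := by
    conv_lhs => rw [← Finsupp.sum_single u, Finsupp.sum, map_sum, Finsupp.finsetSum_apply]
    refine Finset.sum_congr rfl fun p _ => ?_
    rw [← mul_one (u p), ← smul_eq_mul, ← Finsupp.smul_single, map_smul, Finsupp.smul_apply,
      smul_eq_mul, smul_eq_mul, mul_one]
  rw [h, Finset.sum_eq_single a]
  · rw [hf a a le_rfl, Finsupp.single_eq_same]; ring
  · intro p hp hpa
    rw [hf p a (hu p (Finsupp.mem_support_iff.1 hp)), Finsupp.single_eq_of_ne hpa.symm, mul_zero,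
      mul_zero]
  · intro ha
    rw [Finsupp.notMem_support_iff.1 ha, zero_mul]

theorem le_of_ne_zero (hf : Triangular f α) {p a : ℕ × ℕ} (h : f (Finsupp.single p 1) a ≠ 0) :
    a.2 ≤ p.2 := by
  by_contra! hc
  refine h ?_
  rw [hf p a hc.le, Finsupp.single_eq_of_ne, mul_zero]
  rintro rfl
  exact hc.ne rfl

theorem comp_apply_eq_zero (hf : Triangular f α) (hg : Triangular g γ)
    (h : ∀ i, α i = 0 ↔ γ i ≠ 0) {p a : ℕ × ℕ} (hpa : p.2 ≤ a.2) :
    g (f (Finsupp.single p 1)) a = 0 := by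
  rw [hg.apply fun b hb => (hf.le_of_ne_zero hb).trans hpa, hf p a hpa]
  by_cases ha : a = p
  · subst ha
    rcases eq_or_ne (γ a.2) 0 with h' | h'
    · rw [h', zero_mul]
    · rw [(h _).2 h', zero_mul, mul_zero]
  · rw [Finsupp.single_eq_of_ne ha, mul_zero, mul_zero]

/-- A vector u in the kernel of f is reduced by induction on the largest second index K in its
support. If α K ≠ 0, then f u = 0 already forces the top coefficients of u to vanish. If α K = 0,
then γ K ≠ 0 and subtracting (γ K)⁻¹ g u removes them without leaving the kernel, since f ∘ g = 0.
-/
theorem ker_eq_range (hf : Triangular f α) (hg : Triangular g γ) (h : ∀ i, α i = 0 ↔ γ i ≠ 0)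
    (hfg : f ∘ₗ g = 0) : LinearMap.ker f = LinearMap.range g := by
  have key : ∀ K (u : ℕ × ℕ →₀ k), (∀ p, u p ≠ 0 → p.2 < K) → f u = 0 →
      u ∈ LinearMap.range g := by
    intro K
    induction K with
    | zero =>
      intro u hu _
      rw [show u = 0 from Finsupp.ext fun p => by_contra fun hp => absurd (hu p hp) (by omega)]
      exact zero_mem _
    | succ K ih =>
      intro u hu hfu
      by_cases hK : α K = 0
      · have hγ := (h K).1 hK
        have : u - (γ K)⁻¹ • g u ∈ LinearMap.range g := by
          refine ih _ (fun p hp => ?_) ?_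
          · by_contra! hpK
            refine hp ?_
            rw [Finsupp.sub_apply, Finsupp.smul_apply, hg.apply fun q hq => by
              have := hu q hq; omega]
            rcases hpK.eq_or_lt with e | e
            · rw [← e, smul_eq_mul, inv_mul_cancel_left₀ hγ, sub_self]
            · rw [show u p = 0 from by_contra fun h0 => by have := hu p h0; omega, mul_zero,
                smul_zero, sub_zero]
          · rw [map_sub, map_smul, hfu, show f (g u) = 0 from LinearMap.congr_fun hfg u, smul_zero,
              sub_zero]
        have h2 := add_mem this (Submodule.smul_mem _ (γ K)⁻¹ (LinearMap.mem_range_self g u))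
        rwa [sub_add_cancel] at h2
      · refine ih u (fun p hp => ?_) hfu
        by_contra! hpK
        have hpK' : p.2 = K := by have := hu p hp; omega
        have h2 := hf.apply (u := u) (a := p) fun q hq => by have := hu q hq; omega
        rw [hfu, hpK'] at h2
        exact mul_ne_zero hK hp h2.symm
  refine le_antisymm (fun u hu => ?_) ?_
  · refine key (u.support.sup Prod.snd + 1) u (fun p hp => ?_) hu
    exact Nat.lt_succ_of_le (Finset.le_sup (f := Prod.snd) (Finsupp.mem_support_iff.2 hp))
  · rintro _ ⟨u, rfl⟩
    exact LinearMap.congr_fun hfg u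

end Triangular

theorem ker_conj_eq_range {A B A' B' : Type*} [AddCommGroup A] [AddCommGroup B] [AddCommGroup A']
    [AddCommGroup B'] [Module k A] [Module k B] [Module k A'] [Module k B'] {f : A →ₗ[k] B}
    {g : B →ₗ[k] A} (h : LinearMap.ker f = LinearMap.range g) (e : A ≃ₗ[k] A') (e' : B ≃ₗ[k] B') :
    LinearMap.ker ((e' : B →ₗ[k] B') ∘ₗ f ∘ₗ (e.symm : A' →ₗ[k] A)) =
      LinearMap.range ((e : A →ₗ[k] A') ∘ₗ g ∘ₗ (e'.symm : B' →ₗ[k] B)) := by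
  ext v
  have h1 : f (e.symm v) = 0 ↔ ∃ u, g u = e.symm v := SetLike.ext_iff.1 h (e.symm v)
  simp only [LinearMap.mem_ker, LinearMap.mem_range, LinearMap.comp_apply, LinearEquiv.coe_coe,
    LinearEquiv.map_eq_zero_iff, h1]
  constructor
  · rintro ⟨u, hu⟩
    exact ⟨e' u, by rw [LinearEquiv.symm_apply_apply, hu, LinearEquiv.apply_symm_apply]⟩
  · rintro ⟨u, rfl⟩
    exact ⟨e'.symm u, (LinearEquiv.symm_apply_apply _ _).symm⟩

end

/-! ### Exactness -/

section

variable {τ : ℍ} {ħ : ℂ}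

theorem cstMer_ne_zero {E : Type*} [NormedAddCommGroup E] [NormedSpace ℂ E] {c : ℂ} (hc : c ≠ 0) :
    cstMer (E := E) c ≠ 0 := fun h => by
  have := (IsFractionRing.injective (Entire E) (Mer E)) (h.trans (map_zero _).symm)
  exact hc (congrFun (congrArg Subtype.val this) 0)

theorem cstMer_zero {E : Type*} [NormedAddCommGroup E] [NormedSpace ℂ E] :
    cstMer (E := E) 0 = 0 := by
  rw [cstMer, RingHom.map_zero]; exact RingHom.map_zero _

theorem homMap_triangular (d e : ℂ) (c : ℕ → ℕ → ℂ) :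
    Triangular (homMap τ ħ d e c) fun k => cstMer (c 0 k) := fun p a hpa => by
  by_cases h : a = p
  · subst h
    rw [homMap_single, Finsupp.finsetSum_apply, Finsupp.single_eq_same, mul_one,
      Finset.sum_eq_single (0, a.2)]
    · refine Finsupp.single_eq_same.trans ?_
      rw [homCoef_zero]
    · intro q hq hq'
      refine Finsupp.single_eq_of_ne fun h => hq' ?_
      have h1 := congrArg Prod.fst h
      have h2 := congrArg Prod.snd h
      exact Prod.ext (by dsimp at h1 ⊢; omega) h2.symm
    · intro h
      exact absurd (Finset.HasAntidiagonal.mem_antidiagonal.2 (zero_add _)) h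
  · rw [Finsupp.single_eq_of_ne h, mul_zero]
    by_contra h'
    obtain ⟨q, h1, h2⟩ := homMap_apply_ne_zero h'
    subst h2
    exact h (Prod.ext (by dsimp at hpa ⊢; omega) (by dsimp at hpa ⊢; omega))

variable (hħ : ħ ≠ 0)
include hħ

theorem thetaFn_z₂_sub_x₂_ne_zero (c : ℂ) : thetaFn τ ħ (z₂ ħ - x₂ ħ + cst c) ≠ 0 :=
  thetaFn_ne_zero_of_surjective τ ħ hħ fun u => ⟨((u - c) * ħ, 0), by
    change (u - c) * ħ / ħ - 0 / ħ + c = u; field_simp; ring⟩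

variable (hgen : ∀ n : ℕ, theta τ (ħ * (n + 1)) ≠ 0)
include hgen

theorem coefA_lowering_ne_zero (a₁ b₁ a₂ b₂ : ℂ) (j k : ℕ) :
    coefA (thetaFn τ ħ) (z₂ ħ) (x₂ ħ) (cst a₁) (cst b₁) (cst a₂) (cst b₂) (j + 1 : ℕ) k
      false true ≠ 0 := by
  have hz : Generic (thetaFn τ ħ) (z₂ ħ) := thetaFn_z₂_ne_zero hħ
  have hx : Generic (thetaFn τ ħ) (x₂ ħ) := thetaFn_x₂_ne_zero hħ
  have hzx : Generic (thetaFn τ ħ) (z₂ ħ - x₂ ħ) := thetaFn_z₂_sub_x₂_ne_zero hħ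
  have hj : thetaFn (E := ℂ × ℂ) τ ħ (j + 1 : ℕ) ≠ 0 := by
    rw [Nat.cast_add, Nat.cast_one]; exact thetaFn_ne_zero τ ħ (p := 0) (hgen j)
  have h1 := ((((hzx.sub_cst a₂).add_cst b₂).add_nat (2 * k)).add_cst b₁).add_nat (j + 1)
  rw [Nat.cast_mul 2, Nat.cast_ofNat] at h1
  have h2 := generic_add_one.2 ((hz.add_cst a₂).sub_nat k)
  exact neg_ne_zero.2 (div_ne_zero (mul_ne_zero (mul_ne_zero (mul_ne_zero h1.ne_zero h2.ne_zero) hj)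
    (hx.sub_nat k).ne_zero) hx.ne_zero)

/-- A vector of a tensor product that is annihilated by `L_{-+}(z)` is determined by its
coefficients along the basis vectors with first index zero. -/
theorem eq_zero_of_act_lowering_eq_zero {a₁ b₁ a₂ b₂ : ℂ} {u : ℕ × ℕ →₀ M} {N : ℕ}
    (hu : ∀ p, u p ≠ 0 → p.1 + p.2 = N ∧ 1 ≤ p.1)
    (h : (gaugeRep τ ħ a₁ b₁ a₂ b₂).act ħ false true u = 0) : u = 0 := by
  by_contra hu0
  -- For a with maximal second index, the coefficient of L_{-+}(z) u at (a.1 - 1, a.2) comes from a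
  -- alone: the other kind of step lowers the second index and would have to start from a larger
  -- one.
  obtain ⟨a, ha, hmax⟩ := Finset.exists_max_image u.support Prod.snd (Finsupp.support_nonempty_iff.2 hu0)
  have ha' := Finsupp.mem_support_iff.1 ha
  obtain ⟨j, hj⟩ : ∃ j, a.1 = j + 1 := ⟨a.1 - 1, by have := hu a ha'; omega⟩
  have h1 := DFunLike.congr_fun h (j, a.2)
  rw [LData.act, Finsupp.sum, Finsupp.finsetSum_apply, Finset.sum_eq_single a] at h1
  · rw [Finsupp.smul_apply, Finsupp.add_apply, show stepA false true a = (j, a.2) by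
      rw [stepA, hj, Nat.add_sub_cancel], Finsupp.single_eq_same, Finsupp.single_eq_of_ne, add_zero,
      hj] at h1
    · exact mul_ne_zero ((map_ne_zero _).2 ha') (coefA_lowering_ne_zero hħ hgen a₁ b₁ a₂ b₂ j a.2) h1
    · intro h2
      have := congrArg Prod.fst h2
      dsimp [stepB] at this
      omega
  · intro b hb hba
    have h2 := hu b (Finsupp.mem_support_iff.1 hb)
    have h3 := hu a ha'
    have h4 := hmax b hb
    rw [Finsupp.smul_apply, Finsupp.add_apply, Finsupp.single_eq_of_ne, Finsupp.single_eq_of_ne,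
      add_zero, smul_zero]
    · intro h5
      have e1 := congrArg Prod.fst h5
      have e2 := congrArg Prod.snd h5
      dsimp [stepB] at e1 e2
      omega
    · intro h5
      have e1 := congrArg Prod.fst h5
      have e2 := congrArg Prod.snd h5
      dsimp [stepA] at e1 e2
      exact hba (Prod.ext (by omega) (by omega))
  · exact fun h2 => absurd ha h2

/-- Induction on p.1 + p.2, which L_{-+}(z) lowers: f kills L_{-+}(z) p, hence L_{-+}(z) kills f p.
Strict triangularity leaves in f p only basis vectors with positive first index, so that
`eq_zero_of_act_lowering_eq_zero` applies. -/
theorem eq_zero_of_isHomOn {a₁ b₁ a₂ b₂ : ℂ} {f : (ℕ × ℕ →₀ M) →ₗ[M] (ℕ × ℕ →₀ M)}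
    (hf : LData.IsHomOn (X := gaugeRep τ ħ a₁ b₁ a₂ b₂) (Y := gaugeRep τ ħ a₁ b₁ a₂ b₂) ħ ⊤ f)
    (hs : ∀ p a, f (Finsupp.single p 1) a ≠ 0 → a.1 + a.2 = p.1 + p.2 ∧ a.2 < p.2) : f = 0 := by
  have key : ∀ N p, p.1 + p.2 = N → f (Finsupp.single p 1) = 0 := by
    intro N
    induction N with
    | zero =>
      intro p hp
      exact Finsupp.ext fun a => by_contra fun ha => by have := hs p a ha; omega
    | succ N ih =>
      intro p hp
      refine eq_zero_of_act_lowering_eq_zero hħ hgen (N := N + 1) (a₁ := a₁) (b₁ := b₁) (a₂ := a₂)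
        (b₂ := b₂) (fun a ha => by have := hs p a ha; omega) ?_
      refine (hf.comm false true (Finsupp.single p 1) trivial).symm.trans ?_
      have hT := thetaMap_thetaFn (E := ℂ × ℂ) τ ħ
      have h0 : (gaugeRep τ ħ a₁ b₁ a₂ b₂).emb 0 = 0 := Finsupp.mapRange_zero
      rw [LData.act_single, map_one, one_smul]
      refine (map_add _ _ _).trans ?_
      rw [LData.ext_single, LData.ext_single]
      have hA : coefA (thetaFn τ ħ) (z₂ ħ) (x₂ ħ) (cst a₁) (cst b₁) (cst a₂) (cst b₂) p.1 p.2
          false true • (gaugeRep τ ħ a₁ b₁ a₂ b₂).emb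
            (f (Finsupp.single (stepA false true p) 1)) = 0 := by
        rcases Nat.eq_zero_or_pos p.1 with h | h
        · rw [h, Nat.cast_zero, hT.coefA_zero, zero_smul]
        · rw [ih _ (by dsimp [stepA]; omega), h0, smul_zero]
      have hB : coefB (thetaFn τ ħ) (z₂ ħ) (x₂ ħ) (cst a₁) (cst b₁) (cst a₂) (cst b₂) p.1 p.2
          false true • (gaugeRep τ ħ a₁ b₁ a₂ b₂).emb
            (f (Finsupp.single (stepB false true p) 1)) = 0 := by
        rcases Nat.eq_zero_or_pos p.2 with h | h
        · rw [h, Nat.cast_zero, hT.coefB_zero_right, zero_smul]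
        · rw [ih _ (by dsimp [stepB]; omega), h0, smul_zero]
      exact (congrArg₂ (· + ·) hA hB).trans (add_zero 0)
  exact Finsupp.lhom_ext' fun p => LinearMap.ext_ring (key _ p rfl)

/-- The intertwining operators with complementary diagonal coefficients form an exact sequence. -/
theorem ker_homMap_eq_range {a₁ b₁ a₂ b₂ : ℂ} {c c' : ℕ → ℕ → ℂ}
    (hc : Intertwining (fun u => theta τ (ħ * u)) a₂ b₁ b₂ c)
    (hc' : Intertwining (fun u => theta τ (ħ * u)) a₂ b₂ b₁ c') (h : ∀ k, c 0 k = 0 ↔ c' 0 k ≠ 0) :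
    LinearMap.ker (homMap τ ħ (a₂ - b₂) (a₂ - b₁) c) =
      LinearMap.range (homMap τ ħ (a₂ - b₁) (a₂ - b₂) c') := by
  have h' : ∀ k, cstMer (E := ℂ) (c 0 k) = 0 ↔ cstMer (E := ℂ) (c' 0 k) ≠ 0 := fun k => by
    by_cases h0 : c 0 k = 0
    · rw [h0, cstMer_zero]; exact iff_of_true rfl (cstMer_ne_zero ((h k).1 h0))
    · rw [not_ne_iff.1 (mt (h k).2 h0), cstMer_zero]
      exact iff_of_false (cstMer_ne_zero h0) (not_not.2 rfl)
  refine (homMap_triangular _ _ c).ker_eq_range (homMap_triangular _ _ c') h' ?_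
  -- The composite is an endomorphism of the representation, and it is strictly triangular because
  -- the products of corresponding diagonal entries are zero.
  refine eq_zero_of_isHomOn hħ hgen (a₁ := a₁) (b₁ := b₂) (a₂ := a₂) (b₂ := b₁)
    ((isHomOn_homMap hħ hgen hc).comp (isHomOn_homMap hħ hgen hc')) fun p a ha => ⟨?_, ?_⟩
  · obtain ⟨b, h1, h2⟩ := exists_of_map_apply_ne_zero
      (f := homMap τ ħ (a₂ - b₂) (a₂ - b₁) c) ha
    obtain ⟨q, h3, rfl⟩ := homMap_apply_ne_zero h1
    obtain ⟨q', h4, rfl⟩ := homMap_apply_ne_zero h2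
    dsimp at *
    omega
  · by_contra! hpa
    refine ha ((homMap_triangular _ _ c').comp_apply_eq_zero (homMap_triangular _ _ c)
      (fun i => ?_) hpa)
    rw [Ne, h', not_not]

omit hgen in
theorem isHomOn_gaugeEquiv' {ℓ₁ s₁ ℓ₂ s₂ a₁ a₂ : ℂ} (h₁ : ℓ₁ + s₁ = a₁) (h₂ : ℓ₂ + s₂ = a₂) :
    LData.IsHomOn (X := gaugeRep τ ħ a₁ s₁ a₂ s₂)
      (Y := (asymptoticRep τ ħ ℓ₁ s₁).tensor ħ (asymptoticRep τ ħ ℓ₂ s₂)) ħ ⊤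
      (gaugeEquiv (τ := τ) hħ ℓ₂ : (ℕ × ℕ →₀ M) →ₗ[M] (ℕ × ℕ →₀ M)) := by
  subst h₁ h₂
  exact isHomOn_gaugeEquiv hħ ..

end

section

variable {τ : ℍ} {ħ : ℂ}

theorem classOf_eq_of_exact {X Y X' Y' : LData.{0}} {f : X.V →ₗ[M] Y.V} {g : Y.V →ₗ[M] X.V}
    (hf : LData.IsHomOn ħ ⊤ f) (hg : LData.IsHomOn ħ ⊤ g)
    (h1 : LinearMap.ker f = LinearMap.range g) (h2 : LinearMap.ker g = LinearMap.range f)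
    {e : X.V ≃ₗ[M] X'.V} {e' : Y.V ≃ₗ[M] Y'.V} (he : LData.IsHomOn ħ ⊤ (e : X.V →ₗ[M] X'.V))
    (he' : LData.IsHomOn ħ ⊤ (e' : Y.V →ₗ[M] Y'.V)) : classOf τ ħ X' = classOf τ ħ Y' :=
  classOf_eq_of_hom (he'.comp (hf.comp he.symm)) (he.comp (hg.comp he'.symm))
    (ker_conj_eq_range h1 e e') (ker_conj_eq_range h2 e' e)

/-- In gauge form the two sides share a₁ = ℓ and a₂ = s, while (b₁, b₂) is (0, s) for one and (s, 0)
for the other. The two operators of `exists_theta_intertwining` thus go in opposite directions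
between them. -/
theorem classOf_tensor_eq (hħ : ħ ≠ 0)
    (hgen : ∀ a b n : ℤ, (n : ℂ) * ħ = a + b * (τ : ℂ) → n = 0) (ℓ s : ℂ) :
    classOf τ ħ ((asymptoticRep τ ħ ℓ 0).tensor ħ (asymptoticRep τ ħ 0 s)) =
      classOf τ ħ ((asymptoticRep τ ħ (ℓ - s) s).tensor ħ (asymptoticRep τ ħ s 0)) := by
  obtain ⟨c, c', hc, hc', h⟩ := exists_theta_intertwining hgen s
  have hn := theta_add_one_ne_zero hgen
  exact classOf_eq_of_exact (X := gaugeRep τ ħ ℓ 0 s s) (Y := gaugeRep τ ħ ℓ s s 0)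
    (isHomOn_homMap hħ hn hc) (isHomOn_homMap hħ hn hc')
    (ker_homMap_eq_range hħ hn (a₁ := ℓ) hc hc' h)
    (ker_homMap_eq_range hħ hn (a₁ := ℓ) hc' hc fun k => by rw [Ne, h, not_not])
    (isHomOn_gaugeEquiv' hħ (add_zero ℓ) (zero_add s))
    (isHomOn_gaugeEquiv' hħ (sub_add_cancel ℓ s) (add_zero s))

end

end EllipticQG

end

theorem mainTheorem1 (τ : UpperHalfPlane) (ħ : ℂ) (hħ : ħ ≠ 0)
    (hgen : ∀ a b n : ℤ, (n : ℂ) * ħ = a + b * (τ : ℂ) → n = 0) (ℓ s : ℂ) :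
    let W := EllipticQG.asymptoticRep τ ħ
    let X := (W ℓ 0).tensor ħ (W 0 s)
    let Y := (W (ℓ - s) s).tensor ħ (W s 0)
    -- the representations are in the category `O`
    ((W ℓ s).InO τ ħ ∧ X.InO τ ħ ∧ Y.InO τ ħ) ∧
    -- the multiplicities that define their classes are finite
    (∀ c : EllipticQG.SimpleClass τ ħ, EllipticQG.LData.multiplicity ħ c.rep X ≠ ⊤ ∧
      EllipticQG.LData.multiplicity ħ c.rep Y ≠ ⊤) ∧
    -- their classes lie in `K₀(O)` and coincide
    EllipticQG.classOf τ ħ X ∈ EllipticQG.K0 τ ħ ∧ EllipticQG.classOf τ ħ Y ∈ EllipticQG.K0 τ ħ ∧ EllipticQG.classOf τ ħ X = EllipticQG.classOf τ ħ Y := by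
  dsimp only
  have h := EllipticQG.classOf_tensor_eq hħ hgen ℓ s
  have hW := EllipticQG.asymptoticRep_inO (τ := τ) hħ ℓ s
  have hX := EllipticQG.tensor_asymptoticRep_inO (τ := τ) hħ ℓ 0 0 s
  have hY := EllipticQG.tensor_asymptoticRep_inO (τ := τ) hħ (ℓ - s) s s 0
  exact ⟨⟨hW, hX, hY⟩, fun c => ⟨EllipticQG.multiplicity_ne_top hX c,
    EllipticQG.multiplicity_ne_top hY c⟩, EllipticQG.classOf_mem_K0 hX,
    EllipticQG.classOf_mem_K0 hY, h⟩
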